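/- **Setting.** Let $p$ be a prime, $S$ a finite $p$-group and $\mathcal F$ a saturated fusion system on $S$. Let $\mathcal R$ be a complete local principal ideal domain in which every prime number other than $p$ is invertible. For subgroups $A,B\le S$ write $A=_{\mathcal F}B$ if $A$ and $B$ are isomorphic in $\mathcal F$, and $A\le_{\mathcal F}B$ if $A=_{\mathcal F}J$ for some $J\le B$. A subgroup $K$ is *fully $\mathcal F$-normalized* if $|N_S(K)|\ge|N_S(L)|$ for all $L=_{\mathcal F}K$, and *$\mathcal F$-centric* if $C_S(L)\le L$ for all $L=_{\mathcal F}K$. Saturated means that $\mathrm{Aut}_S(S)$ is a Sylow $p$-subgroup of $\mathrm{Aut}_{\mathcal F}(S)$ and that every $\varphi\in\mathrm{Hom}_{\mathcal F}(A,S)$ with $\varphi(A)$ fully $\mathcal F$-normalized extends in $\mathcal F$ to $N_\varphi=\{x\in N_S(A):\exists z\in N_S(\varphi(A)),\ \varphi(xax^{-1})=z\varphi(a)z^{-1}\ \forall a\in A\}$. *Mackey functors.* Let $\mathcal E$ be a fusion system on a subgroup $Q\le S$. The isomorphism classes of finite $(B,A)$-bisets, with $A,B\le S$, generate a semiring: the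 sum of two $(B,A)$-bisets is their disjoint union, the product of a $(C,B)$-biset $X$ and a $(B',A)$-biset $Y$ is $X\times_BY$ if $B=B'$ and $0$ otherwise, and empty bisets are $0$. Take the subsemiring generated by the classes $I_A^B=\overline{(B\times A)/\Delta(A)}$ and $R_A^B=\overline{(A\times B)/\Delta(A)}$ for $A\le B\le Q$ and $c_\varphi=\overline{(\varphi(A)\times A)/\{(\varphi(a),a):a\in A\}}$ for the isomorphisms $\varphi\colon A\to\varphi(A)$ of $\mathcal E$. The Mackey algebra $\mu_{\mathcal R}(\mathcal E)$ is $\mathcal R\otimes_{\mathbb Z}G$, where $G$ is the Grothendieck ring of this subsemiring; its unit is $\sum_{K\le Q}I_K^K$. A *Mackey functor* over $\mathcal E$ is a finitely generated left $\mu_{\mathcal R}(\mathcal E)$-module. If $\mathcal E\subseteq\mathcal F$, it is *$\mathcal F$-centric* if $I_K^KM=0$ for all $K\le Q$ that are not $\mathcal F$-centric; a *centric* Mackey functor over $\mathcal F$ is an $\mathcal F$-centric one over $\mathcal F$. An inclusion $\mathcal D\subseteq\mathcal E$ of fusion systems on subgroups of $S$ induces a (possibly non-unital) ring homomorphism $\mu_{\mathcal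 R}(\mathcal D)\to\mu_{\mathcal R}(\mathcal E)$, through which one defines $$M{\downarrow}^{\mathcal E}_{\mathcal D}=1_{\mu_{\mathcal R}(\mathcal D)}M,\qquad N{\uparrow}^{\mathcal E}_{\mathcal D}=\mu_{\mathcal R}(\mathcal E)\,1_{\mu_{\mathcal R}(\mathcal D)}\otimes_{\mu_{\mathcal R}(\mathcal D)}N .$$ *Vertices.* Let $M$ be a Mackey functor over $\mathcal E$. For $K\le Q$ let $\mathcal F_K(K)$ be the fusion system of $K$ on itself, and put $M_K=M{\downarrow}^{\mathcal E}_{\mathcal F_K(K)}{\uparrow}^{\mathcal E}_{\mathcal F_K(K)}$ and $\theta_K\colon M_K\to M$, $y\otimes x\mapsto yx$. For a family $\mathcal Z$ of $\mathcal E$-centric subgroups of $Q$, $M$ is *$\mathcal Z$-projective* if $\sum_{K\in\mathcal Z}\theta_K\colon\bigoplus_{K\in\mathcal Z}M_K\to M$ is split surjective. A *defect set* of $M$ is a minimal family of $\mathcal E$-centric subgroups, closed under $\le_{\mathcal E}$ (among $\mathcal E$-centric subgroups), relative to which $M$ is projective. If the elements of a defect set that are maximal for $\le_{\mathcal E}$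 form a single $\mathcal E$-isomorphism class, then $M$ *admits a vertex*, and its *vertices* are the fully $\mathcal E$-normalized members of that class. *Normalizer.* Let $H\le S$ be fully $\mathcal F$-normalized and $\mathcal F$-centric. Let $N_{\mathcal F}=N_{\mathcal F}(H)$ be the fusion system on $N_S(H)$ whose morphisms $A\to B$ are the $\varphi\in\mathrm{Hom}_{\mathcal F}(A,B)$ that extend to some $\hat\varphi\in\mathrm{Hom}_{\mathcal F}(AH,BH)$ with $\hat\varphi(H)=H$. Put $$\mathcal Y=\{K\ \mathcal F\text{-centric}:K\le_{\mathcal F}H,\ K\le N_S(H),\ K\neq H\},\qquad \mathcal X=\{K\ \mathcal F\text{-centric}:K\le_{\mathcal F}H,\ K\neq_{\mathcal F}H\}.$$ **Theorem (Green correspondence).** Let $M$ be an indecomposable centric Mackey functor over $\mathcal F$ with vertex $H$, and let $N$ be an indecomposable $\mathcal F$-centric Mackey functor over $N_{\mathcal F}$ with vertex $H$ (as a functor over $N_{\mathcal F}$). Then: 1. $M{\downarrow}^{\mathcal F}_{N_{\mathcal F}}$ is an $\mathcal F$-centric Mackey functor over $N_{\mathcal F}$. It has a decomposition as a finite direct sum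 of indecomposable Mackey functors, unique up to permutation and isomorphism of the summands. In every such decomposition exactly one summand has vertex $H$ (the Green correspondent $M_{N_{\mathcal F}}$ of $M$), and each of the other summands admits a vertex and has all its vertices in $\mathcal Y$. 2. $N{\uparrow}^{\mathcal F}_{N_{\mathcal F}}$ is a centric Mackey functor over $\mathcal F$. It has a decomposition as a finite direct sum of indecomposable Mackey functors, unique up to permutation and isomorphism of the summands. In every such decomposition exactly one summand has vertex $H$ (the Green correspondent $N^{\mathcal F}$ of $N$), and each of the other summands admits a vertex and has all its vertices in $\mathcal X$. 3. $(M_{N_{\mathcal F}})^{\mathcal F}\cong M$ and $(N^{\mathcal F})_{N_{\mathcal F}}\cong N$. -/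

import Mathlib

open scoped TensorProduct DirectSum

universe u v w x

namespace CentricMackey

/-! ## Fusion systems -/

section Fusion

variable {S : Type u} [Group S]

/-- A (not necessarily saturated) fusion system on the subgroup `P` of `S`.  Its objects are the
subgroups of `P`; these are regarded as subgroups of `S`, so that fusion systems on different
subgroups of `S` can be compared. `Hom A B` is empty unless `A` and `B` are subgroups of `P`. -/
structure FusionSystem (P : Subgroup S) where
  /-- the morphisms from `A` to `B` -/
  Hom : (A B : Subgroup S) → Set (A →* B)
  le_of_mem : ∀ {A B : Subgroup S} {φ : A →* B}, φ ∈ Hom A B → A ≤ P ∧ B ≤ P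
  injective : ∀ {A B : Subgroup S} {φ : A →* B}, φ ∈ Hom A B → Function.Injective φ
  comp_mem : ∀ {A B C : Subgroup S} {φ : A →* B} {ψ : B →* C},
    φ ∈ Hom A B → ψ ∈ Hom B C → ψ.comp φ ∈ Hom A C
  /-- conjugation by an element of `P` followed by inclusion is a morphism -/
  conj_mem : ∀ {A B : Subgroup S}, A ≤ P → B ≤ P → ∀ g ∈ P, ∀ φ : A →* B,
    (∀ a : A, (φ a : S) = g * a * g⁻¹) → φ ∈ Hom A B
  /-- a morphism, seen as an isomorphism `e` onto its image `C`, is an isomorphism of the system -/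
  iso_mem : ∀ {A B C : Subgroup S} {φ : A →* B}, φ ∈ Hom A B → ∀ e : A ≃* C,
    (∀ a : A, (e a : S) = φ a) → e.toMonoidHom ∈ Hom A C ∧ e.symm.toMonoidHom ∈ Hom C A

/-- The normalizer `N_P(K)`. -/
def normalizerIn (P K : Subgroup S) : Subgroup S := P ⊓ Subgroup.normalizer (K : Set S)

/-- The image of a homomorphism between subgroups of `S`, as a subgroup of `S`. -/
def image {A B : Subgroup S} (φ : A →* B) : Subgroup S := (B.subtype.comp φ).range

namespace FusionSystem

variable {P Q : Subgroup S}

/-- Inclusion of fusion systems. -/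
def IsSubsystem (E : FusionSystem Q) (F : FusionSystem P) : Prop :=
  ∀ A B : Subgroup S, E.Hom A B ⊆ F.Hom A B

variable (F : FusionSystem P)

/-- `e` is an isomorphism of `F` -/
def IsIso {A B : Subgroup S} (e : A ≃* B) : Prop := e.toMonoidHom ∈ F.Hom A B

/-- `A =_F B` -/
def Conj (A B : Subgroup S) : Prop := ∃ e : A ≃* B, F.IsIso e

/-- `A ≤_F B` -/
def Subconj (A B : Subgroup S) : Prop := B ≤ P ∧ ∃ J ≤ B, F.Conj A J

/-- `H` is fully `F`-normalized. -/
def FullyNormalized (H : Subgroup S) : Prop :=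
  H ≤ P ∧ ∀ K, F.Conj K H → Nat.card (normalizerIn P K) ≤ Nat.card (normalizerIn P H)

/-- `H` is `F`-centric. -/
def Centric (H : Subgroup S) : Prop :=
  H ≤ P ∧ ∀ K, F.Conj K H → P ⊓ Subgroup.centralizer (K : Set S) ≤ K

/-- The `φ`-normalizer `N_φ`: the elements `x ∈ N_P(A)` for which there is `z ∈ N_P(φ(A))` with
`φ(x h x⁻¹) = z φ(h) z⁻¹` for all `h ∈ A`. -/
def homNormalizer (P : Subgroup S) {A B : Subgroup S} (φ : A →* B) : Subgroup S where
  carrier := {x | x ∈ normalizerIn P A ∧ ∃ z ∈ normalizerIn P (image φ),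
    ∀ h h' : A, (h' : S) = x * h * x⁻¹ → (φ h' : S) = z * φ h * z⁻¹}
  one_mem' := ⟨one_mem _, 1, one_mem _, fun h h' e => by
    have : h' = h := Subtype.ext (by simpa using e)
    simp [this]⟩
  mul_mem' := by
    rintro x y ⟨hx, z, hz, h1⟩ ⟨hy, w, hw, h2⟩
    refine ⟨mul_mem hx hy, z * w, mul_mem hz hw, fun h h' e => ?_⟩
    have hy' : y * h * y⁻¹ ∈ A := (Subgroup.mem_normalizer_iff.1 hy.2 h).1 h.2
    rw [h1 ⟨_, hy'⟩ h' (by rw [e]; group), h2 h ⟨_, hy'⟩ rfl]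
    group
  inv_mem' := by
    rintro x ⟨hx, z, hz, h1⟩
    refine ⟨inv_mem hx, z⁻¹, inv_mem hz, fun h h' e => ?_⟩
    rw [h1 h' h (by rw [e]; group)]
    group

/-- `Aut_F(A)` as a subgroup of the automorphism group of `A`. -/
def aut (A : Subgroup S) (hA : A ≤ P) : Subgroup (MulAut A) where
  carrier := {e | F.IsIso e}
  one_mem' := F.conj_mem hA hA 1 (one_mem _) _ (fun a => by simp)
  mul_mem' {a b} ha hb := F.comp_mem (φ := MulEquiv.toMonoidHom b) (ψ := MulEquiv.toMonoidHom a)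
    hb ha
  inv_mem' {a} ha := (F.iso_mem (φ := MulEquiv.toMonoidHom a) ha a (fun _ => rfl)).2

/-- `F` is saturated: `Aut_P(P)` is a Sylow `p`-subgroup of `Aut_F(P)`, and every morphism
`φ : A → P` with fully `F`-normalized image extends to the `φ`-normalizer `N_φ`. -/
def Saturated (p : ℕ) : Prop :=
  (∃ T : Sylow p (F.aut P le_rfl),
    (T : Subgroup (F.aut P le_rfl)).map (F.aut P le_rfl).subtype = (MulAut.conj (G := P)).range) ∧
  ∀ (A : Subgroup S) (φ : A →* P), φ ∈ F.Hom A P → F.FullyNormalized (image φ) →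
    ∃ ψ ∈ F.Hom (homNormalizer P φ) P,
      ∀ (a : A) (x : homNormalizer P φ), (x : S) = a → ψ x = φ a

end FusionSystem

/-- The fusion system `F_Q(Q)` of a subgroup `Q`: the morphisms are given by conjugation with
elements of `Q`. -/
def inner (Q : Subgroup S) : FusionSystem Q where
  Hom A B := {φ | A ≤ Q ∧ B ≤ Q ∧ ∃ g ∈ Q, ∀ a : A, (φ a : S) = g * a * g⁻¹}
  le_of_mem h := ⟨h.1, h.2.1⟩
  injective := by
    rintro A B φ ⟨-, -, g, -, h⟩ a b hab
    have : g * (a : S) * g⁻¹ = g * b * g⁻¹ := by rw [← h, ← h, hab]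
    exact Subtype.ext (by simpa using this)
  comp_mem := by
    rintro A B C φ ψ ⟨hA, hB, g, hg, h⟩ ⟨-, hC, k, hk, h'⟩
    refine ⟨hA, hC, k * g, mul_mem hk hg, fun a => ?_⟩
    rw [MonoidHom.comp_apply, h', h]
    group
  conj_mem hA hB g hg φ h := ⟨hA, hB, g, hg, h⟩
  iso_mem := by
    rintro A B C φ ⟨hA, hB, g, hg, h⟩ e he
    have hC : C ≤ Q := by
      intro c hc
      obtain ⟨a, ha⟩ := e.surjective ⟨c, hc⟩
      have : c = φ a := by rw [← he a, ha]
      rw [this]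
      exact hB (φ a).2
    refine ⟨⟨hA, hC, g, hg, fun a => (he a).trans (h a)⟩, hC, hA, g⁻¹, inv_mem hg, fun c => ?_⟩
    obtain ⟨a, rfl⟩ := e.surjective c
    change ((e.symm (e a) : A) : S) = _
    rw [e.symm_apply_apply, he, h]
    group

theorem inner_isSubsystem {P Q : Subgroup S} (F : FusionSystem P) (h : Q ≤ P) :
    (inner Q).IsSubsystem F := by
  rintro A B φ ⟨hA, hB, g, hg, hφ⟩
  exact F.conj_mem (hA.trans h) (hB.trans h) g (h hg) φ hφ

theorem exists_sup_equiv {P : Subgroup S} (F : FusionSystem P) {A B C H : Subgroup S}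
    {φ : A →* B} (e : A ≃* C) (he : ∀ a : A, (e a : S) = φ a)
    {ψ : (A ⊔ H : Subgroup S) →* (B ⊔ H : Subgroup S)} (hψ : ψ ∈ F.Hom (A ⊔ H) (B ⊔ H))
    (hext : ∀ (a : A) (x : (A ⊔ H : Subgroup S)), (x : S) = a → (ψ x : S) = φ a)
    (him : (fun x => (ψ x : S)) '' {x | (x : S) ∈ H} = (H : Set S)) :
    ∃ e' : (A ⊔ H : Subgroup S) ≃* (C ⊔ H : Subgroup S), ∀ x, (e' x : S) = ψ x := by
  have hr : image ψ = C ⊔ H := by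
    have h1 : image ψ = (A.subgroupOf (A ⊔ H) ⊔ H.subgroupOf (A ⊔ H)).map
        ((B ⊔ H).subtype.comp ψ) := by
      rw [← Subgroup.subgroupOf_sup le_sup_left le_sup_right, Subgroup.subgroupOf_self,
        ← MonoidHom.range_eq_map]
      rfl
    rw [h1, Subgroup.map_sup]
    congr 1
    · ext s
      constructor
      · rintro ⟨x, hx, rfl⟩
        have := hext ⟨x, hx⟩ x rfl
        change (ψ x : S) ∈ C
        rw [this, ← he]
        exact (e _).2
      · intro hs
        obtain ⟨a, ha⟩ := e.surjective ⟨s, hs⟩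
        refine ⟨⟨a, (le_sup_left : A ≤ A ⊔ H) a.2⟩, a.2, ?_⟩
        change (ψ _ : S) = s
        rw [hext a _ rfl, ← he, ha]
    · apply SetLike.coe_injective
      rw [← him]
      rfl
  let f : (A ⊔ H : Subgroup S) ≃* image ψ :=
    MonoidHom.ofInjective (f := (B ⊔ H).subtype.comp ψ)
      ((Subgroup.subtype_injective _).comp (F.injective hψ))
  exact ⟨f.trans (MulEquiv.subgroupCongr hr), fun x => rfl⟩

/-- The fusion system `N_F(H)` on `N_P(H)`: a morphism `φ : A → B` of `F` between subgroups of
`N_P(H)` belongs to it if it extends to a morphism `ψ : A H → B H` of `F` with `ψ(H) = H`.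
Since `A` and `B` normalize `H`, the products `A H` and `B H` are the joins `A ⊔ H` and `B ⊔ H`. -/
def normalizerSystem {P : Subgroup S} (F : FusionSystem P) (H : Subgroup S) (hH : H ≤ P) :
    FusionSystem (normalizerIn P H) where
  Hom A B := {φ | A ≤ normalizerIn P H ∧ B ≤ normalizerIn P H ∧ φ ∈ F.Hom A B ∧
    ∃ ψ ∈ F.Hom (A ⊔ H) (B ⊔ H),
      (∀ (a : A) (x : (A ⊔ H : Subgroup S)), (x : S) = a → (ψ x : S) = φ a) ∧
      (fun x => (ψ x : S)) '' {x | (x : S) ∈ H} = (H : Set S)}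
  le_of_mem h := ⟨h.1, h.2.1⟩
  injective h := F.injective h.2.2.1
  comp_mem := by
    rintro A B C φ φ' ⟨hA, hB, hφ, ψ, hψ, h1, h2⟩ ⟨-, hC, hφ', ψ', hψ', h1', h2'⟩
    refine ⟨hA, hC, F.comp_mem hφ hφ', ψ'.comp ψ, F.comp_mem hψ hψ', fun a x hx => ?_, ?_⟩
    · exact h1' (φ a) (ψ x) (h1 a x hx)
    · rw [← h2']
      ext s
      constructor
      · rintro ⟨x, hx, rfl⟩
        refine ⟨ψ x, ?_, rfl⟩
        change (ψ x : S) ∈ (H : Set S)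
        rw [← h2]
        exact ⟨x, hx, rfl⟩
      · rintro ⟨y, hy, rfl⟩
        have hy' : (y : S) ∈ (H : Set S) := hy
        rw [← h2] at hy'
        obtain ⟨x, hx, hxy⟩ := hy'
        refine ⟨x, hx, ?_⟩
        have : ψ x = y := Subtype.ext hxy
        simp [this]
  conj_mem := by
    intro A B hA hB g hg φ h
    have hgH := Subgroup.mem_normalizer_iff.1 hg.2
    have hle : A ⊔ H ≤ (B ⊔ H).comap (MulAut.conj g).toMonoidHom := by
      refine sup_le (fun a ha => ?_) (fun x hx => ?_)
      · have := h ⟨a, ha⟩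
        change g * a * g⁻¹ ∈ (B ⊔ H : Subgroup S)
        rw [← this]
        exact (le_sup_left : B ≤ B ⊔ H) (φ _).2
      · exact (le_sup_right : H ≤ B ⊔ H) ((hgH x).1 hx)
    let ψ : (A ⊔ H : Subgroup S) →* (B ⊔ H : Subgroup S) :=
      ((MulAut.conj g).toMonoidHom.comp (A ⊔ H).subtype).codRestrict (B ⊔ H)
        (fun x => hle x.2)
    have hψ : ∀ x, (ψ x : S) = g * x * g⁻¹ := fun x => rfl
    refine ⟨hA, hB, F.conj_mem (hA.trans inf_le_left) (hB.trans inf_le_left) g hg.1 φ h, ψ,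
      F.conj_mem (sup_le (hA.trans inf_le_left) hH) (sup_le (hB.trans inf_le_left) hH) g hg.1 ψ hψ,
      fun a x hx => by rw [hψ, h, hx], ?_⟩
    ext s
    constructor
    · rintro ⟨x, hx, rfl⟩
      exact (hgH x).1 hx
    · intro hs
      have : g⁻¹ * s * g ∈ H := (hgH _).2 (by simpa [mul_assoc] using hs)
      refine ⟨⟨_, (le_sup_right : H ≤ A ⊔ H) this⟩, this, ?_⟩
      simp only [hψ]
      group
  iso_mem := by
    rintro A B C φ ⟨hA, hB, hφ, ψ, hψ, h1, h2⟩ e he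
    obtain ⟨e', he'⟩ := exists_sup_equiv F e he hψ h1 h2
    have hC : C ≤ normalizerIn P H := by
      intro c hc
      obtain ⟨a, ha⟩ := e.surjective ⟨c, hc⟩
      have : c = φ a := by rw [← he a, ha]
      rw [this]
      exact hB (φ a).2
    have hm := F.iso_mem hφ e he
    have hm' := F.iso_mem hψ e' he'
    refine ⟨⟨hA, hC, hm.1, e'.toMonoidHom, hm'.1, fun a x hx => ?_, ?_⟩,
      ⟨hC, hA, hm.2, e'.symm.toMonoidHom, hm'.2, fun c y hy => ?_, ?_⟩⟩
    · exact (he' x).trans ((h1 a x hx).trans (he a).symm)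
    · rw [← h2]
      exact congrArg (fun f => f '' {x : (A ⊔ H : Subgroup S) | (x : S) ∈ H}) (funext he')
    · obtain ⟨a, rfl⟩ := e.surjective c
      let x : (A ⊔ H : Subgroup S) := ⟨a, (le_sup_left : A ≤ A ⊔ H) a.2⟩
      have hx : e' x = y := Subtype.ext (by rw [he', h1 a x rfl, hy, he])
      rw [← hx]
      change ((e'.symm (e' x) : (A ⊔ H : Subgroup S)) : S) = ((e.symm (e a) : A) : S)
      rw [e'.symm_apply_apply, e.symm_apply_apply]
    · ext s
      constructor
      · rintro ⟨y, hy, rfl⟩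
        have hy' : (y : S) ∈ (H : Set S) := hy
        rw [← h2] at hy'
        obtain ⟨x, hx, hxy⟩ := hy'
        have : e' x = y := Subtype.ext ((he' x).trans hxy)
        rw [← this]
        change ((e'.symm (e' x) : (A ⊔ H : Subgroup S)) : S) ∈ H
        rw [e'.symm_apply_apply]
        exact hx
      · intro hs
        let x : (A ⊔ H : Subgroup S) := ⟨s, (le_sup_right : H ≤ A ⊔ H) hs⟩
        refine ⟨e' x, ?_, ?_⟩
        · change (e' x : S) ∈ (H : Set S)
          rw [he', ← h2]
          exact ⟨x, hs, rfl⟩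
        · change ((e'.symm (e' x) : (A ⊔ H : Subgroup S)) : S) = s
          rw [e'.symm_apply_apply]

theorem normalizerSystem_isSubsystem {P : Subgroup S} (F : FusionSystem P) (H : Subgroup S)
    (hH : H ≤ P) : (normalizerSystem F H hH).IsSubsystem F :=
  fun _ _ _ h => h.2.2.1

end Fusion

/-! ## Bisets -/

/-- A finite `(H, K)`-biset, encoded as a finite left `H × K`-set. The left action of `h ∈ H` is
that of `(h, 1)`, the right action of `k ∈ K` is that of `(1, k⁻¹)`. -/
structure Biset (H K : Type u) [Group H] [Group K] where
  carrier : Type u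
  [finite : Finite carrier]
  [action : MulAction (H × K) carrier]

attribute [instance] Biset.finite Biset.action

namespace Biset

section

variable {H J K L : Type u} [Group H] [Group J] [Group K] [Group L]

/-- Isomorphism of bisets. -/
def Iso (X Y : Biset H K) : Prop :=
  ∃ f : X.carrier ≃ Y.carrier, ∀ (g : H × K) (x : X.carrier), f (g • x) = g • f x

/-- The setoid of isomorphism of bisets. -/
instance setoid (H K : Type u) [Group H] [Group K] : Setoid (Biset H K) where
  r := Iso
  iseqv :=
    { refl := fun _ => ⟨Equiv.refl _, fun _ _ => rfl⟩
      symm := by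
        rintro X Y ⟨f, hf⟩
        refine ⟨f.symm, fun g y => ?_⟩
        rw [Equiv.symm_apply_eq, hf, f.apply_symm_apply]
      trans := by
        rintro X Y Z ⟨f, hf⟩ ⟨f', hf'⟩
        exact ⟨f.trans f', fun g x => by simp [hf, hf']⟩ }

/-- The empty biset. -/
def empty (H K : Type u) [Group H] [Group K] : Biset H K where
  carrier := PEmpty.{u + 1}
  action := { smul := fun _ x => x.elim, one_smul := fun x => x.elim, mul_smul := fun _ _ x => x.elim }

/-- The disjoint union of two bisets. -/
def disjUnion (X Y : Biset H K) : Biset H K where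
  carrier := X.carrier ⊕ Y.carrier

/-- The equivalence relation on `X × Y` generated by `(x · j, y) ∼ (x, j · y)`; since `J` is a
group, the pairs equivalent to `(x, y)` are the pairs `(x · j⁻¹, j · y)`. -/
def compSetoid (X : Biset H J) (Y : Biset J K) : Setoid (X.carrier × Y.carrier) where
  r a b := ∃ j : J, b.1 = ((1, j) : H × J) • a.1 ∧ b.2 = ((j, 1) : J × K) • a.2
  iseqv :=
    { refl := fun a => ⟨1, (one_smul (H × J) a.1).symm, (one_smul (J × K) a.2).symm⟩
      symm := by
        rintro a b ⟨j, h1, h2⟩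
        refine ⟨j⁻¹, ?_, ?_⟩
        · rw [h1, smul_smul]
          simp [← Prod.one_eq_mk]
        · rw [h2, smul_smul]
          simp [← Prod.one_eq_mk]
      trans := by
        rintro a b c ⟨j, h1, h2⟩ ⟨k, h3, h4⟩
        refine ⟨k * j, ?_, ?_⟩
        · rw [h3, h1, smul_smul]
          simp
        · rw [h4, h2, smul_smul]
          simp }

/-- The action of `H × K` on `X ×_J Y`. -/
instance compAction (X : Biset H J) (Y : Biset J K) :
    MulAction (H × K) (Quotient (compSetoid X Y)) where
  smul g := Quotient.map (fun a => (((g.1, 1) : H × J) • a.1, ((1, g.2) : J × K) • a.2)) (by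
    rintro a b ⟨j, h1, h2⟩
    refine ⟨j, ?_, ?_⟩
    · simp [h1, smul_smul]
    · simp [h2, smul_smul])
  one_smul := by
    rintro ⟨a⟩
    exact congrArg (Quotient.mk _) (Prod.ext (one_smul (H × J) _) (one_smul (J × K) _))
  mul_smul := by
    rintro g g' ⟨a⟩
    refine congrArg (Quotient.mk _) (Prod.ext ?_ ?_)
    · simp [smul_smul]
    · simp [smul_smul]

/-- The product `X ×_J Y` of an `(H, J)`-biset and a `(J, K)`-biset. -/
def comp (X : Biset H J) (Y : Biset J K) : Biset H K where
  carrier := Quotient (compSetoid X Y)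

theorem comp_iso {X X' : Biset H J} {Y Y' : Biset J K} (hX : Iso X X') (hY : Iso Y Y') :
    Iso (comp X Y) (comp X' Y') := by
  obtain ⟨f, hf⟩ := hX
  obtain ⟨f', hf'⟩ := hY
  refine ⟨Quotient.congr (f.prodCongr f') ?_, ?_⟩
  · intro a b
    constructor
    · rintro ⟨j, h1, h2⟩
      exact ⟨j, by simp [h1, hf], by simp [h2, hf']⟩
    · rintro ⟨j, h1, h2⟩
      refine ⟨j, f.injective ?_, f'.injective ?_⟩
      · rw [hf]; exact h1
      · rw [hf']; exact h2
  · rintro g ⟨a⟩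
    exact congrArg (Quotient.mk _) (Prod.ext (hf _ _) (hf' _ _))

theorem disjUnion_iso {X X' Y Y' : Biset H K} (hX : Iso X X') (hY : Iso Y Y') :
    Iso (disjUnion X Y) (disjUnion X' Y') := by
  obtain ⟨f, hf⟩ := hX
  obtain ⟨f', hf'⟩ := hY
  refine ⟨f.sumCongr f', ?_⟩
  rintro g (x | y)
  · exact congrArg Sum.inl (hf g x)
  · exact congrArg Sum.inr (hf' g y)

theorem disjUnion_assoc (X Y Z : Biset H K) :
    Iso (disjUnion (disjUnion X Y) Z) (disjUnion X (disjUnion Y Z)) := by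
  refine ⟨Equiv.sumAssoc _ _ _, ?_⟩
  rintro g ((x | x) | x) <;> rfl

theorem disjUnion_comm (X Y : Biset H K) : Iso (disjUnion X Y) (disjUnion Y X) := by
  refine ⟨Equiv.sumComm _ _, ?_⟩
  rintro g (x | x) <;> rfl

theorem empty_disjUnion (X : Biset H K) : Iso (disjUnion (empty H K) X) X := by
  refine ⟨Equiv.emptySum PEmpty _, ?_⟩
  rintro g (x | x)
  · exact x.elim
  · rfl

theorem comp_empty (X : Biset H J) : Iso (comp X (empty J K)) (empty H K) := by
  have : IsEmpty (comp X (empty J K)).carrier := ⟨by rintro ⟨a⟩; exact PEmpty.elim a.2⟩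
  exact ⟨Equiv.equivOfIsEmpty _ PEmpty, fun g x => isEmptyElim x⟩

theorem empty_comp (X : Biset J K) : Iso (comp (empty H J) X) (empty H K) := by
  have : IsEmpty (comp (empty H J) X).carrier := ⟨by rintro ⟨a⟩; exact PEmpty.elim a.1⟩
  exact ⟨Equiv.equivOfIsEmpty _ PEmpty, fun g x => isEmptyElim x⟩

theorem comp_disjUnion (X : Biset H J) (Y Z : Biset J K) :
    Iso (comp X (disjUnion Y Z)) (disjUnion (comp X Y) (comp X Z)) := by
  refine ⟨
    { toFun := Quotient.lift (fun a : X.carrier × (Y.carrier ⊕ Z.carrier) =>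
        (Sum.elim (fun y => Sum.inl (Quotient.mk (compSetoid X Y) (a.1, y)))
          (fun z => Sum.inr (Quotient.mk (compSetoid X Z) (a.1, z))) a.2 :
            Quotient (compSetoid X Y) ⊕ Quotient (compSetoid X Z))) ?_
      invFun := Sum.elim
        (Quotient.map (fun a => (a.1, Sum.inl a.2)) ?_)
        (Quotient.map (fun a => (a.1, Sum.inr a.2)) ?_)
      left_inv := ?_
      right_inv := ?_ }, ?_⟩
  · rintro ⟨x, y | y⟩ ⟨x', y' | y'⟩ ⟨j, h1, h2⟩
    · exact congrArg Sum.inl (Quotient.sound ⟨j, h1, Sum.inl_injective h2⟩)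
    · cases h2
    · cases h2
    · exact congrArg Sum.inr (Quotient.sound ⟨j, h1, Sum.inr_injective h2⟩)
  · rintro a b ⟨j, h1, h2⟩
    exact ⟨j, h1, congrArg Sum.inl h2⟩
  · rintro a b ⟨j, h1, h2⟩
    exact ⟨j, h1, congrArg Sum.inr h2⟩
  · rintro ⟨x, y | y⟩ <;> rfl
  · rintro (⟨x, y⟩ | ⟨x, y⟩) <;> rfl
  · rintro g ⟨x, y | y⟩ <;> rfl

theorem disjUnion_comp (X Y : Biset H J) (Z : Biset J K) :
    Iso (comp (disjUnion X Y) Z) (disjUnion (comp X Z) (comp Y Z)) := by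
  refine ⟨
    { toFun := Quotient.lift (fun a : (X.carrier ⊕ Y.carrier) × Z.carrier =>
        (Sum.elim (fun x => Sum.inl (Quotient.mk (compSetoid X Z) (x, a.2)))
          (fun y => Sum.inr (Quotient.mk (compSetoid Y Z) (y, a.2))) a.1 :
            Quotient (compSetoid X Z) ⊕ Quotient (compSetoid Y Z))) ?_
      invFun := Sum.elim
        (Quotient.map (fun a => (Sum.inl a.1, a.2)) ?_)
        (Quotient.map (fun a => (Sum.inr a.1, a.2)) ?_)
      left_inv := ?_
      right_inv := ?_ }, ?_⟩
  · rintro ⟨y | y, x⟩ ⟨y' | y', x'⟩ ⟨j, h1, h2⟩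
    · exact congrArg Sum.inl (Quotient.sound ⟨j, Sum.inl_injective h1, h2⟩)
    · cases h1
    · cases h1
    · exact congrArg Sum.inr (Quotient.sound ⟨j, Sum.inr_injective h1, h2⟩)
  · rintro a b ⟨j, h1, h2⟩
    exact ⟨j, congrArg Sum.inl h1, h2⟩
  · rintro a b ⟨j, h1, h2⟩
    exact ⟨j, congrArg Sum.inr h1, h2⟩
  · rintro ⟨y | y, x⟩ <;> rfl
  · rintro (⟨x, y⟩ | ⟨x, y⟩) <;> rfl
  · rintro g ⟨y | y, x⟩ <;> rfl

theorem comp_assoc (X : Biset H J) (Y : Biset J K) (Z : Biset K L) :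
    Iso (comp (comp X Y) Z) (comp X (comp Y Z)) := by
  have key1 : ∀ (z z' : Z.carrier) (k : K), z' = ((k, 1) : K × L) • z → ∀ (x x' : X.carrier)
      (y y' : Y.carrier) (j : J), x' = ((1, j) : H × J) • x →
      y' = ((j, k) : J × K) • y →
      (Quotient.mk (compSetoid X (comp Y Z)) (x, Quotient.mk (compSetoid Y Z) (y, z)) =
        Quotient.mk (compSetoid X (comp Y Z)) (x', Quotient.mk (compSetoid Y Z) (y', z'))) := by
    rintro z _ k rfl x _ y _ j rfl rfl
    refine Quotient.sound ⟨j, rfl, ?_⟩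
    refine Quotient.sound ⟨k⁻¹, ?_, ?_⟩
    · simp [smul_smul]
    · simp [smul_smul]
  have key2 : ∀ (z z' : Z.carrier) (k : K), z' = ((k, 1) : K × L) • z → ∀ (x x' : X.carrier)
      (y y' : Y.carrier) (j : J), x' = ((1, j) : H × J) • x →
      y' = ((j, k) : J × K) • y →
      (Quotient.mk (compSetoid (comp X Y) Z) (Quotient.mk (compSetoid X Y) (x, y), z) =
        Quotient.mk (compSetoid (comp X Y) Z) (Quotient.mk (compSetoid X Y) (x', y'), z')) := by
    rintro z _ k rfl x _ y _ j rfl rfl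
    refine Quotient.sound ⟨k, ?_, rfl⟩
    refine Quotient.sound ⟨j⁻¹, ?_, ?_⟩
    · simp [smul_smul]
    · simp [smul_smul]
  refine ⟨
    { toFun := Quotient.lift (fun a : Quotient (compSetoid X Y) × Z.carrier =>
        Quotient.lift (fun b : X.carrier × Y.carrier =>
          Quotient.mk (compSetoid X (comp Y Z)) (b.1, Quotient.mk (compSetoid Y Z) (b.2, a.2)))
          ?_ a.1) ?_
      invFun := Quotient.lift (fun a : X.carrier × Quotient (compSetoid Y Z) =>
        Quotient.lift (fun b : Y.carrier × Z.carrier =>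
          Quotient.mk (compSetoid (comp X Y) Z) (Quotient.mk (compSetoid X Y) (a.1, b.1), b.2))
          ?_ a.2) ?_
      left_inv := ?_
      right_inv := ?_ }, ?_⟩
  · rintro ⟨x, y⟩ ⟨x', y'⟩ ⟨j, h1, h2⟩
    exact key1 _ _ 1 (one_smul (K × L) _).symm _ _ _ _ j h1 h2
  · rintro ⟨⟨x, y⟩, z⟩ ⟨⟨x', y'⟩, z'⟩ ⟨k, h1, h2⟩
    obtain ⟨j, h3, h4⟩ := Quotient.exact h1.symm
    refine key1 z z' k h2 x x' y y' j (h3.trans ?_) (h4.trans ?_)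
    · simp [smul_smul]
    · simp [smul_smul]
  · rintro ⟨y, z⟩ ⟨y', z'⟩ ⟨k, h1, h2⟩
    exact key2 _ _ k h2 _ _ _ _ 1 (one_smul (H × J) _).symm h1
  · rintro ⟨x, ⟨y, z⟩⟩ ⟨x', ⟨y', z'⟩⟩ ⟨k, h1, h2⟩
    obtain ⟨j, h3, h4⟩ := Quotient.exact h2.symm
    refine key2 z z' j (h4.trans ?_) x x' y y' k h1 (h3.trans ?_)
    · simp [smul_smul]
    · simp [smul_smul]
  · rintro ⟨⟨⟨x, y⟩⟩, z⟩
    rfl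
  · rintro ⟨x, ⟨⟨y, z⟩⟩⟩
    rfl
  · rintro g ⟨⟨⟨x, y⟩⟩, z⟩
    rfl

/-- The transitive biset `(H × K) / D`. -/
def quot [Finite H] [Finite K] (D : Subgroup (H × K)) : Biset H K where
  carrier := (H × K) ⧸ D

end

end Biset

namespace Biset

section

variable {H J K : Type u} [Group H] [Group J] [Group K]

/-- The diagonal of `J`. -/
def diag (J : Type u) [Group J] : Subgroup (J × J) :=
  ((MonoidHom.id J).prod (MonoidHom.id J)).range

theorem diag_comp [Finite J] (X : Biset J K) : Iso (comp (quot (diag J)) X) X := by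
  have hact : ∀ (a b : J) (c d : K) (x : X.carrier), ((a, c) : J × K) • ((b, d) : J × K) • x =
      ((a * b, c * d) : J × K) • x := fun a b c d x => smul_smul _ _ _
  refine ⟨
    { toFun := Quotient.lift (fun a : ((J × J) ⧸ diag J) × X.carrier =>
        Quotient.lift (fun g : J × J => ((g.1 * g.2⁻¹, 1) : J × K) • a.2) ?_ a.1) ?_
      invFun := fun x => Quotient.mk (compSetoid (quot (diag J)) X)
        (((1 : J × J) : (J × J) ⧸ diag J), x)
      left_inv := ?_
      right_inv := ?_ }, ?_⟩
  · intro g g' h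
    obtain ⟨d, hd⟩ := QuotientGroup.leftRel_apply.1 h
    have h1 : g' = g * (d, d) := by rw [← mul_inv_cancel_left g g', ← hd]; rfl
    subst h1
    simp
  · rintro ⟨⟨⟨x, y⟩⟩, z⟩ ⟨q', z'⟩ ⟨j, h1, h2⟩
    dsimp only at h1 h2
    subst h1 h2
    change ((x * y⁻¹, 1) : J × K) • z =
      ((1 * x * (j * y)⁻¹, 1) : J × K) • ((j, 1) : J × K) • z
    rw [hact]
    simp [mul_assoc]
  · rintro ⟨⟨⟨x, y⟩⟩, z⟩
    refine Quotient.sound ?_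
    refine ⟨(x * y⁻¹)⁻¹, ?_, ?_⟩
    · refine Quotient.sound (QuotientGroup.leftRel_apply.2 ⟨x⁻¹, ?_⟩)
      ext <;> simp
    · change z = (((x * y⁻¹)⁻¹, 1) : J × K) • ((x * y⁻¹, 1) : J × K) • z
      rw [hact]
      simp [← Prod.one_eq_mk]
  · intro x
    change ((1 * 1⁻¹, 1) : J × K) • x = x
    simp [← Prod.one_eq_mk]
  · rintro ⟨a, c⟩ ⟨⟨⟨x, y⟩⟩, z⟩
    change ((a * x * (1 * y)⁻¹, 1) : J × K) • ((1, c) : J × K) • z =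
      ((a, c) : J × K) • ((x * y⁻¹, 1) : J × K) • z
    rw [hact, hact]
    simp [mul_assoc]

theorem comp_diag [Finite J] (X : Biset H J) : Iso (comp X (quot (diag J))) X := by
  have hact : ∀ (a b : H) (c d : J) (x : X.carrier), ((a, c) : H × J) • ((b, d) : H × J) • x =
      ((a * b, c * d) : H × J) • x := fun a b c d x => smul_smul _ _ _
  refine ⟨
    { toFun := Quotient.lift (fun a : X.carrier × ((J × J) ⧸ diag J) =>
        Quotient.lift (fun g : J × J => ((1, g.2 * g.1⁻¹) : H × J) • a.1) ?_ a.2) ?_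
      invFun := fun x => Quotient.mk (compSetoid X (quot (diag J)))
        (x, ((1 : J × J) : (J × J) ⧸ diag J))
      left_inv := ?_
      right_inv := ?_ }, ?_⟩
  · intro g g' h
    obtain ⟨d, hd⟩ := QuotientGroup.leftRel_apply.1 h
    have h1 : g' = g * (d, d) := by rw [← mul_inv_cancel_left g g', ← hd]; rfl
    subst h1
    simp
  · rintro ⟨z, ⟨⟨x, y⟩⟩⟩ ⟨z', q'⟩ ⟨j, h1, h2⟩
    dsimp only at h1 h2
    subst h1 h2
    change ((1, y * x⁻¹) : H × J) • z =
      ((1, 1 * y * (j * x)⁻¹) : H × J) • ((1, j) : H × J) • z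
    rw [hact]
    simp [mul_assoc]
  · rintro ⟨z, ⟨⟨x, y⟩⟩⟩
    refine Quotient.sound ?_
    refine ⟨(y * x⁻¹)⁻¹, ?_, ?_⟩
    · change z = ((1, (y * x⁻¹)⁻¹) : H × J) • ((1, y * x⁻¹) : H × J) • z
      rw [hact]
      simp [← Prod.one_eq_mk]
    · refine Quotient.sound (QuotientGroup.leftRel_apply.2 ⟨y⁻¹, ?_⟩)
      ext <;> simp
  · intro x
    change ((1, 1 * 1⁻¹) : H × J) • x = x
    simp [← Prod.one_eq_mk]
  · rintro ⟨a, c⟩ ⟨z, ⟨⟨x, y⟩⟩⟩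
    change ((1, c * y * (1 * x)⁻¹) : H × J) • ((a, 1) : H × J) • z =
      ((a, c) : H × J) • ((1, y * x⁻¹) : H × J) • z
    rw [hact, hact]
    simp [mul_assoc]

end

end Biset

/-- Isomorphism classes of finite `(H, K)`-bisets. -/
def BisetClass (H K : Type u) [Group H] [Group K] : Type (u + 1) := Quotient (Biset.setoid H K)

namespace BisetClass

section

variable {H J K L : Type u} [Group H] [Group J] [Group K] [Group L]

/-- The isomorphism class of a biset. -/
def mk (X : Biset H K) : BisetClass H K := Quotient.mk (Biset.setoid H K) X

theorem sound {X Y : Biset H K} (h : Biset.Iso X Y) : mk X = mk Y :=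
  Quotient.sound (s := Biset.setoid H K) h

/-- The zero element is the class of the empty biset. -/
instance : Zero (BisetClass H K) := ⟨mk (Biset.empty H K)⟩

/-- Addition of isomorphism classes is induced by the disjoint union. -/
instance : Add (BisetClass H K) :=
  ⟨Quotient.map₂ Biset.disjUnion (fun _ _ h _ _ h' => Biset.disjUnion_iso h h')⟩

instance : AddCommMonoid (BisetClass H K) where
  add_assoc := by
    rintro ⟨X⟩ ⟨Y⟩ ⟨Z⟩
    exact sound (Biset.disjUnion_assoc X Y Z)
  zero_add := by
    rintro ⟨X⟩
    exact sound (Biset.empty_disjUnion X)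
  add_zero := by
    rintro ⟨X⟩
    exact sound ((Biset.setoid H K).trans (Biset.disjUnion_comm X _) (Biset.empty_disjUnion X))
  add_comm := by
    rintro ⟨X⟩ ⟨Y⟩
    exact sound (Biset.disjUnion_comm X Y)
  nsmul := nsmulRec

/-- The product of isomorphism classes induced by `X ×_J Y`. -/
def comp : BisetClass H J → BisetClass J K → BisetClass H K :=
  Quotient.map₂ Biset.comp (fun _ _ h _ _ h' => Biset.comp_iso h h')

theorem comp_assoc (x : BisetClass H J) (y : BisetClass J K) (z : BisetClass K L) :
    comp (comp x y) z = comp x (comp y z) := by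
  obtain ⟨X⟩ := x
  obtain ⟨Y⟩ := y
  obtain ⟨Z⟩ := z
  exact sound (Biset.comp_assoc X Y Z)

theorem comp_add (x : BisetClass H J) (y z : BisetClass J K) :
    comp x (y + z) = comp x y + comp x z := by
  obtain ⟨X⟩ := x
  obtain ⟨Y⟩ := y
  obtain ⟨Z⟩ := z
  exact sound (Biset.comp_disjUnion X Y Z)

theorem add_comp (x y : BisetClass H J) (z : BisetClass J K) :
    comp (x + y) z = comp x z + comp y z := by
  obtain ⟨X⟩ := x
  obtain ⟨Y⟩ := y
  obtain ⟨Z⟩ := z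
  exact sound (Biset.disjUnion_comp X Y Z)

theorem comp_zero (x : BisetClass H J) : comp x (0 : BisetClass J K) = 0 := by
  obtain ⟨X⟩ := x
  exact sound (Biset.comp_empty X)

theorem zero_comp (x : BisetClass J K) : comp (0 : BisetClass H J) x = 0 := by
  obtain ⟨X⟩ := x
  exact sound (Biset.empty_comp X)

theorem comp_sum {ι : Type*} (s : Finset ι) (x : BisetClass H J) (f : ι → BisetClass J K) :
    comp x (∑ i ∈ s, f i) = ∑ i ∈ s, comp x (f i) :=
  map_sum (⟨⟨comp x, comp_zero x⟩, comp_add x⟩ : BisetClass J K →+ BisetClass H K) f s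

theorem sum_comp {ι : Type*} (s : Finset ι) (f : ι → BisetClass H J) (x : BisetClass J K) :
    comp (∑ i ∈ s, f i) x = ∑ i ∈ s, comp (f i) x :=
  map_sum (⟨⟨fun y => comp y x, zero_comp x⟩, fun y z => add_comp y z x⟩ :
    BisetClass H J →+ BisetClass H K) f s

end

end BisetClass

/-! ## The Mackey algebra of a fusion system -/

section Mackey

variable (S : Type u) [Group S]

/-- The semiring of formal sums of isomorphism classes of finite `(B, A)`-bisets, where `A` and `B`
run over the subgroups of `S`: an element has one component for every pair `(B, A)`. The product
of bisets is `X ×_J Y` whenever this makes sense and `0` otherwise. -/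
def BisetSemiring : Type (u + 1) := ∀ B A : Subgroup S, BisetClass B A

variable {S}

namespace BisetSemiring

instance : AddCommMonoid (BisetSemiring S) :=
  inferInstanceAs (AddCommMonoid (∀ B A : Subgroup S, BisetClass B A))

open Classical in
/-- The isomorphism class of a `(B, A)`-biset as an element of the semiring. -/
noncomputable def single (B A : Subgroup S) (x : BisetClass B A) : BisetSemiring S :=
  Pi.single B (Pi.single A x)

theorem single_apply_self (B A : Subgroup S) (x : BisetClass B A) : single B A x B A = x := by
  simp [single]

theorem single_apply_of_ne_left {B B' : Subgroup S} (A A' : Subgroup S) (x : BisetClass B A)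
    (h : B' ≠ B) : single B A x B' A' = 0 := by
  simp [single, h]

theorem single_apply_of_ne_right (B B' : Subgroup S) {A A' : Subgroup S} (x : BisetClass B A)
    (h : A' ≠ A) : single B A x B' A' = 0 := by
  by_cases hB : B' = B
  · subst hB
    simp [single, h]
  · exact single_apply_of_ne_left A A' x hB

theorem entry_sum {ι : Type*} (s : Finset ι) (f : ι → BisetSemiring S) (B A : Subgroup S) :
    (∑ i ∈ s, f i) B A = ∑ i ∈ s, f i B A :=
  map_sum (⟨⟨fun x => x B A, rfl⟩, fun _ _ => rfl⟩ : BisetSemiring S →+ BisetClass B A) f s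

variable [Finite S]

attribute [local instance] Fintype.ofFinite

noncomputable instance : NonUnitalSemiring (BisetSemiring S) where
  mul x y := fun B A => ∑ C, (x B C).comp (y C A)
  left_distrib x y z := by
    funext B A
    change ∑ C, (x B C).comp (y C A + z C A) = _
    simp only [BisetClass.comp_add, Finset.sum_add_distrib]
    rfl
  right_distrib x y z := by
    funext B A
    change ∑ C, (x B C + y B C).comp (z C A) = _
    simp only [BisetClass.add_comp, Finset.sum_add_distrib]
    rfl
  zero_mul x := by
    funext B A
    exact Finset.sum_eq_zero (fun C _ => BisetClass.zero_comp _)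
  mul_zero x := by
    funext B A
    exact Finset.sum_eq_zero (fun C _ => BisetClass.comp_zero _)
  mul_assoc x y z := by
    funext B A
    change ∑ C, (∑ D, (x B D).comp (y D C)).comp (z C A) =
      ∑ D, (x B D).comp (∑ C, (y D C).comp (z C A))
    simp only [BisetClass.comp_sum, BisetClass.sum_comp, BisetClass.comp_assoc]
    exact Finset.sum_comm

theorem entry_mul (x y : BisetSemiring S) (B A : Subgroup S) :
    (x * y) B A = ∑ C, (x B C).comp (y C A) := rfl

theorem entry_add (x y : BisetSemiring S) (B A : Subgroup S) :
    (x + y) B A = x B A + y B A := rfl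

theorem entry_zero (B A : Subgroup S) : (0 : BisetSemiring S) B A = 0 := rfl

/-- Restriction `R_H^K`: the class of the `(H, K)`-biset `(H × K) / Δ(H, id)`. -/
noncomputable def res {H K : Subgroup S} (h : H ≤ K) : BisetSemiring S :=
  single H K (.mk (.quot ((MonoidHom.id H).prod (Subgroup.inclusion h)).range))

/-- Induction `I_H^K`: the class of the `(K, H)`-biset `(K × H) / Δ(H, id)`. -/
noncomputable def ind {H K : Subgroup S} (h : H ≤ K) : BisetSemiring S :=
  single K H (.mk (.quot ((Subgroup.inclusion h).prod (MonoidHom.id H)).range))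

/-- Conjugation `c_φ` for an isomorphism `φ : H → H'`: the class of the `(H', H)`-biset
`(H' × H) / Δ(H, φ)`, where `Δ(H, φ)` consists of the pairs `(φ(x), x)`. -/
noncomputable def conj {H H' : Subgroup S} (φ : H ≃* H') : BisetSemiring S :=
  single H' H (.mk (.quot (φ.toMonoidHom.prod (MonoidHom.id H)).range))

theorem ind_refl_eq (K : Subgroup S) :
    ind (le_refl K) = single K K (.mk (.quot (Biset.diag K))) := by
  have : Subgroup.inclusion (le_refl K) = MonoidHom.id K := rfl
  rw [ind, this, Biset.diag]

open Classical in
/-- The element `∑_{K ≤ P} I_K^K`. -/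
noncomputable def unit (P : Subgroup S) : BisetSemiring S :=
  ∑ K : Subgroup S, if K ≤ P then ind (le_refl K) else 0

theorem unit_apply_ne (P : Subgroup S) {B A : Subgroup S} (h : B ≠ A) : unit P B A = 0 := by
  rw [unit, entry_sum]
  refine Finset.sum_eq_zero (fun K _ => ?_)
  split_ifs
  · rw [ind_refl_eq]
    by_cases hB : B = K
    · subst hB
      exact single_apply_of_ne_right _ _ _ (Ne.symm h)
    · exact single_apply_of_ne_left _ _ _ hB
  · rfl

theorem unit_apply_self {P A : Subgroup S} (h : A ≤ P) :
    unit P A A = .mk (.quot (Biset.diag A)) := by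
  rw [unit, entry_sum, Finset.sum_eq_single A]
  · rw [if_pos h, ind_refl_eq, single_apply_self]
  · intro K _ hK
    split_ifs
    · rw [ind_refl_eq]
      exact single_apply_of_ne_left _ _ _ (Ne.symm hK)
    · rfl
  · intro hA
    exact absurd (Finset.mem_univ A) hA

theorem unit_mul {P : Subgroup S} {x : BisetSemiring S}
    (hx : ∀ B A, ¬ (B ≤ P ∧ A ≤ P) → x B A = 0) : unit P * x = x := by
  funext B A
  rw [entry_mul, Finset.sum_eq_single B]
  · by_cases h : B ≤ P ∧ A ≤ P
    · rw [unit_apply_self h.1]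
      obtain ⟨X, hX⟩ := Quotient.exists_rep (x B A)
      rw [← hX]
      exact BisetClass.sound (Biset.diag_comp X)
    · rw [hx B A h, BisetClass.comp_zero]
  · intro C _ hC
    rw [unit_apply_ne P (Ne.symm hC), BisetClass.zero_comp]
  · intro hA
    exact absurd (Finset.mem_univ B) hA

theorem mul_unit {P : Subgroup S} {x : BisetSemiring S}
    (hx : ∀ B A, ¬ (B ≤ P ∧ A ≤ P) → x B A = 0) : x * unit P = x := by
  funext B A
  rw [entry_mul, Finset.sum_eq_single A]
  · by_cases h : B ≤ P ∧ A ≤ P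
    · rw [unit_apply_self h.2]
      obtain ⟨X, hX⟩ := Quotient.exists_rep (x B A)
      rw [← hX]
      exact BisetClass.sound (Biset.comp_diag X)
    · rw [hx B A h, BisetClass.zero_comp]
  · intro C _ hC
    rw [unit_apply_ne P hC, BisetClass.comp_zero]
  · intro hA
    exact absurd (Finset.mem_univ A) hA

end BisetSemiring

open BisetSemiring

variable [Finite S] {P Q : Subgroup S}

/-- The generators `I_H^K`, `R_H^K` (for `H ≤ K ≤ P`) and `c_φ` (for isomorphisms `φ` of `F`) of
the Mackey semiring of a fusion system `F` on `P`. -/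
inductive IsGenerator (F : FusionSystem P) : BisetSemiring S → Prop
  | ind {H K : Subgroup S} (h : H ≤ K) (hK : K ≤ P) : IsGenerator F (ind h)
  | res {H K : Subgroup S} (h : H ≤ K) (hK : K ≤ P) : IsGenerator F (res h)
  | conj {H K : Subgroup S} (φ : H ≃* K) (hφ : F.IsIso φ) : IsGenerator F (conj φ)

theorem IsGenerator.mono {E : FusionSystem Q} {F : FusionSystem P} (hQP : Q ≤ P)
    (h : E.IsSubsystem F) {x : BisetSemiring S} (hx : IsGenerator E x) : IsGenerator F x := by
  cases hx with
  | ind h' hK => exact .ind h' (hK.trans hQP)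
  | res h' hK => exact .res h' (hK.trans hQP)
  | conj φ hφ => exact .conj φ (h _ _ hφ)

/-- The subsemiring generated by the bisets `I_H^K`, `R_H^K` and `c_φ`. -/
noncomputable def mackeySubsemiring (F : FusionSystem P) : NonUnitalSubsemiring (BisetSemiring S) :=
  NonUnitalSubsemiring.closure {x | IsGenerator F x}

theorem mackeySubsemiring_mono {E : FusionSystem Q} {F : FusionSystem P} (hQP : Q ≤ P)
    (h : E.IsSubsystem F) : mackeySubsemiring E ≤ mackeySubsemiring F :=
  NonUnitalSubsemiring.closure_mono (fun _ hx => IsGenerator.mono hQP h hx)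

theorem apply_eq_zero_of_mem (F : FusionSystem P) {x : BisetSemiring S}
    (hx : x ∈ mackeySubsemiring F) : ∀ B A, ¬ (B ≤ P ∧ A ≤ P) → x B A = 0 := by
  have aux : ∀ (B' A' : Subgroup S) (y : BisetClass B' A'), B' ≤ P → A' ≤ P →
      ∀ B A, ¬ (B ≤ P ∧ A ≤ P) → single B' A' y B A = 0 := by
    intro B' A' y hB' hA' B A h
    by_cases hB : B = B'
    · by_cases hA : A = A'
      · subst hB hA
        exact absurd ⟨hB', hA'⟩ h
      · exact single_apply_of_ne_right _ _ _ hA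
    · exact single_apply_of_ne_left _ _ _ hB
  induction hx using NonUnitalSubsemiring.closure_induction with
  | mem x hx =>
    cases hx with
    | ind h' hK => exact aux _ _ _ hK (h'.trans hK)
    | res h' hK => exact aux _ _ _ (h'.trans hK) hK
    | conj φ hφ => exact aux _ _ _ (F.le_of_mem hφ).2 (F.le_of_mem hφ).1
  | zero => intros; rfl
  | add x y _ _ ihx ihy =>
    intro B A h
    rw [entry_add, ihx B A h, ihy B A h, add_zero]
  | mul x y _ _ ihx ihy =>
    intro B A h
    rw [entry_mul]
    refine Finset.sum_eq_zero (fun C _ => ?_)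
    by_cases hB : B ≤ P
    · rw [ihy C A (fun h' => h ⟨hB, h'.2⟩), BisetClass.comp_zero]
    · rw [ihx B C (fun h' => hB h'.1), BisetClass.zero_comp]

theorem unit_mem (F : FusionSystem P) : BisetSemiring.unit P ∈ mackeySubsemiring F := by
  refine sum_mem (fun K _ => ?_)
  split_ifs with h
  · exact NonUnitalSubsemiring.subset_closure (.ind (le_refl K) h)
  · exact zero_mem _

/-- The Mackey semiring of `F`, whose unit is `∑_{K ≤ P} I_K^K`. -/
def MackeySemiring (F : FusionSystem P) : Type (u + 1) := mackeySubsemiring F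

noncomputable instance (F : FusionSystem P) : NonUnitalSemiring (MackeySemiring F) :=
  inferInstanceAs (NonUnitalSemiring (mackeySubsemiring F))

noncomputable instance (F : FusionSystem P) : Semiring (MackeySemiring F) where
  one := ⟨BisetSemiring.unit P, unit_mem F⟩
  one_mul x := Subtype.ext (BisetSemiring.unit_mul (apply_eq_zero_of_mem F x.2))
  mul_one x := Subtype.ext (BisetSemiring.mul_unit (apply_eq_zero_of_mem F x.2))

/-- The Grothendieck ring of a semiring `T`: the Grothendieck group of its additive monoid, with
the multiplication extended biadditively. -/
def GrothendieckRing (T : Type v) [Semiring T] : Type v := Algebra.GrothendieckAddGroup T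

namespace GrothendieckRing

variable {T : Type v} [Semiring T]

noncomputable instance : AddCommGroup (GrothendieckRing T) :=
  inferInstanceAs (AddCommGroup (Algebra.GrothendieckAddGroup T))

/-- The canonical map from a semiring to its Grothendieck ring. -/
noncomputable def of : T →+ GrothendieckRing T := Algebra.GrothendieckAddGroup.of

/-- The universal property of the Grothendieck group. -/
noncomputable def lift {G : Type w} [AddCommGroup G] (f : T →+ G) : GrothendieckRing T →+ G :=
  Algebra.GrothendieckAddGroup.lift f

theorem lift_of {G : Type w} [AddCommGroup G] (f : T →+ G) (t : T) : lift f (of t) = f t :=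
  DFunLike.congr_fun (Algebra.GrothendieckAddGroup.lift.symm_apply_apply f) t

theorem exists_eq_sub (x : GrothendieckRing T) : ∃ a b : T, x = of a - of b := by
  obtain ⟨⟨a, b⟩, h⟩ := (AddLocalization.addMonoidOf (⊤ : AddSubmonoid T)).surj x
  exact ⟨a, b, eq_sub_of_add_eq h⟩

/-- The multiplication of the Grothendieck ring. -/
noncomputable def mulHom : GrothendieckRing T →+ GrothendieckRing T →+ GrothendieckRing T :=
  lift (AddMonoidHom.flip (lift (AddMonoidHom.flip
    ((AddMonoidHom.compHom (of (T := T))).comp AddMonoidHom.mul))))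

noncomputable instance : Mul (GrothendieckRing T) := ⟨fun x y => mulHom x y⟩

theorem of_mul_of (a b : T) : of a * of b = of (a * b) := by
  change mulHom (of a) (of b) = _
  simp [mulHom, lift_of]

theorem mul_def (x y : GrothendieckRing T) : x * y = mulHom x y := rfl

noncomputable instance : NonUnitalNonAssocRing (GrothendieckRing T) where
  left_distrib x y z := (mulHom x).map_add y z
  right_distrib x y z := by simp [mul_def]
  zero_mul x := by simp [mul_def]
  mul_zero x := (mulHom x).map_zero

noncomputable instance : Ring (GrothendieckRing T) where
  mul_assoc x y z := by
    obtain ⟨a, b, rfl⟩ := exists_eq_sub x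
    obtain ⟨c, d, rfl⟩ := exists_eq_sub y
    obtain ⟨e, f, rfl⟩ := exists_eq_sub z
    simp only [mul_sub, sub_mul, of_mul_of, mul_assoc]
  one := of 1
  one_mul x := by
    obtain ⟨a, b, rfl⟩ := exists_eq_sub x
    change of 1 * _ = _
    simp only [mul_sub, of_mul_of, one_mul]
  mul_one x := by
    obtain ⟨a, b, rfl⟩ := exists_eq_sub x
    change _ * of 1 = _
    simp only [sub_mul, of_mul_of, mul_one]

/-- The map induced on Grothendieck rings by a (not necessarily unital) homomorphism. -/
noncomputable def map {T' : Type w} [Semiring T'] (f : T →ₙ+* T') :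
    GrothendieckRing T →ₙ+* GrothendieckRing T' where
  __ := lift ((of (T := T')).comp (f : T →+ T'))
  map_mul' x y := by
    obtain ⟨a, b, rfl⟩ := exists_eq_sub x
    obtain ⟨c, d, rfl⟩ := exists_eq_sub y
    change lift _ _ = lift _ _ * lift _ _
    simp [mul_sub, sub_mul, of_mul_of, lift_of]

end GrothendieckRing

/-- The Mackey algebra `μ_R(F)` of a fusion system `F` on `P`: the base change to `R` of the
Grothendieck ring of the Mackey semiring. -/
def MackeyAlgebra (R : Type v) [CommRing R] (F : FusionSystem P) : Type (max v (u + 1)) :=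
  R ⊗[ℤ] GrothendieckRing (MackeySemiring F)

section

variable (R : Type v) [CommRing R] (F : FusionSystem P)

noncomputable instance : Ring (MackeyAlgebra R F) :=
  inferInstanceAs (Ring (R ⊗[ℤ] GrothendieckRing (MackeySemiring F)))

noncomputable instance : Algebra R (MackeyAlgebra R F) :=
  inferInstanceAs (Algebra R (R ⊗[ℤ] GrothendieckRing (MackeySemiring F)))

/-- The element of the Mackey algebra given by an element of the Mackey semiring. -/
noncomputable def mackeyOf (x : BisetSemiring S) (hx : x ∈ mackeySubsemiring F) :
    MackeyAlgebra R F :=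
  (1 : R) ⊗ₜ[ℤ] GrothendieckRing.of (T := MackeySemiring F) ⟨x, hx⟩

/-- The idempotent `I_K^K` of the Mackey algebra, for `K ≤ P`. -/
noncomputable def idem (K : Subgroup S) (hK : K ≤ P) : MackeyAlgebra R F :=
  mackeyOf R F (ind (le_refl K)) (NonUnitalSubsemiring.subset_closure (.ind (le_refl K) hK))

end

/-- The (in general not unital) inclusion of Mackey algebras `μ_R(E) → μ_R(F)` for a fusion system
`E` on `Q ≤ P` contained in `F`. -/
noncomputable def mackeyInclusion (R : Type v) [CommRing R] {E : FusionSystem Q}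
    {F : FusionSystem P} (hQP : Q ≤ P) (h : E.IsSubsystem F) :
    MackeyAlgebra R E →ₙ+* MackeyAlgebra R F where
  __ := (LinearMap.lTensor R (GrothendieckRing.map (T := MackeySemiring E)
      (T' := MackeySemiring F) (NonUnitalSubsemiring.inclusion
        (mackeySubsemiring_mono hQP h)) :
        GrothendieckRing (MackeySemiring E) →+ GrothendieckRing (MackeySemiring F)).toIntLinearMap).toAddMonoidHom
  map_mul' x y := by
    set f : GrothendieckRing (MackeySemiring E) →ₙ+* GrothendieckRing (MackeySemiring F) :=
      GrothendieckRing.map (T := MackeySemiring E) (T' := MackeySemiring F)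
        (NonUnitalSubsemiring.inclusion (mackeySubsemiring_mono hQP h)) with hf
    change R ⊗[ℤ] GrothendieckRing (MackeySemiring E) at x
    change R ⊗[ℤ] GrothendieckRing (MackeySemiring E) at y
    let g := LinearMap.lTensor R (f : GrothendieckRing (MackeySemiring E) →+
      GrothendieckRing (MackeySemiring F)).toIntLinearMap
    change g (x * y) = (g x * g y : R ⊗[ℤ] GrothendieckRing (MackeySemiring F))
    induction x using TensorProduct.induction_on with
    | zero => simp
    | add x x' hx hx' => rw [add_mul, map_add, hx, hx', map_add, add_mul]
    | tmul r t =>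
      induction y using TensorProduct.induction_on with
      | zero => simp
      | add y y' hy hy' => rw [mul_add, map_add, hy, hy', map_add, mul_add]
      | tmul r' t' =>
        rw [Algebra.TensorProduct.tmul_mul_tmul]
        change _ ⊗ₜ[ℤ] f (t * t') = (r ⊗ₜ[ℤ] f t) * (r' ⊗ₜ[ℤ] f t')
        rw [Algebra.TensorProduct.tmul_mul_tmul, map_mul f]
        rfl

end Mackey

/-! ## Restriction and induction of modules -/

section Functors

variable {A : Type v} {B : Type w} [Ring A] [Ring B]

/-- Restriction along a not necessarily unital ring homomorphism `ι : A → B`: the `A`-module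
`1_A M`, where `1_A` acts on `M` as `ι 1`. -/
def Res (ι : A →ₙ+* B) (M : Type*) [AddCommGroup M] [Module B M] : Type _ :=
  (DistribSMul.toAddMonoidHom M (ι 1)).range

namespace Res

variable (ι : A →ₙ+* B) (M : Type*) [AddCommGroup M] [Module B M]

instance : AddCommGroup (Res ι M) :=
  inferInstanceAs (AddCommGroup (DistribSMul.toAddMonoidHom M (ι 1)).range)

variable {ι M}

/-- The inclusion of `1_A M` in `M`. -/
def val : Res ι M →+ M := (DistribSMul.toAddMonoidHom M (ι 1)).range.subtype

theorem val_injective : Function.Injective (val : Res ι M →+ M) := Subtype.val_injective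

theorem map_smul_mem (a : A) (m : M) :
    ι a • m ∈ (DistribSMul.toAddMonoidHom M (ι 1)).range :=
  ⟨ι a • m, by
    change ι 1 • ι a • m = ι a • m
    rw [← mul_smul, ← map_mul, one_mul]⟩

theorem one_smul_val (m : Res ι M) : ι 1 • val m = val m := by
  obtain ⟨_, x, rfl⟩ := m
  change ι 1 • ι 1 • x = ι 1 • x
  rw [← mul_smul, ← map_mul, one_mul]

instance : SMul A (Res ι M) := ⟨fun a m => ⟨ι a • val m, map_smul_mem a _⟩⟩

theorem val_smul (a : A) (m : Res ι M) : val (a • m) = ι a • val m := rfl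

instance : Module A (Res ι M) where
  one_smul m := val_injective (one_smul_val m)
  mul_smul a b m := val_injective (by simp only [val_smul, map_mul, mul_smul])
  smul_zero a := val_injective (by simp only [val_smul, map_zero, smul_zero])
  smul_add a m n := val_injective (by simp only [val_smul, map_add, smul_add])
  add_smul a b m := val_injective (by simp only [val_smul, map_add, add_smul])
  zero_smul m := val_injective (by simp only [val_smul, map_zero, zero_smul])

end Res

/-- The left ideal `B 1_A` of `B`. -/
abbrev leftIdeal (ι : A →ₙ+* B) : Submodule B B := Submodule.span B {ι 1}

/-- The right action of `A` on `B 1_A`. -/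
def rightMul (ι : A →ₙ+* B) (y : leftIdeal ι) (a : A) : leftIdeal ι :=
  ⟨y * ι a, Submodule.mem_span_singleton.2 ⟨y * ι a, by
    rw [smul_eq_mul, mul_assoc, ← map_mul, mul_one]⟩⟩

section

variable (ι : A →ₙ+* B) (N : Type*) [AddCommGroup N] [Module A N]

/-- The relations `y a ⊗ n = y ⊗ a n` of the tensor product `(B 1_A) ⊗_A N`. -/
def indRelations : Submodule B (leftIdeal ι ⊗[ℤ] N) :=
  Submodule.span B {z | ∃ (y : leftIdeal ι) (a : A) (n : N),
    z = rightMul ι y a ⊗ₜ[ℤ] n - y ⊗ₜ[ℤ] (a • n)}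

/-- Induction along a not necessarily unital ring homomorphism `ι : A → B`: the `B`-module
`(B 1_A) ⊗_A N`, constructed as a quotient of the tensor product over the integers. -/
def Ind : Type _ := (leftIdeal ι ⊗[ℤ] N) ⧸ indRelations ι N

instance : AddCommGroup (Ind ι N) :=
  inferInstanceAs (AddCommGroup ((leftIdeal ι ⊗[ℤ] N) ⧸ indRelations ι N))

instance : Module B (Ind ι N) :=
  inferInstanceAs (Module B ((leftIdeal ι ⊗[ℤ] N) ⧸ indRelations ι N))

end

section

variable (ι : A →ₙ+* B) (M : Type*) [AddCommGroup M] [Module B M]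

/-- The bilinear map `(y, x) ↦ y x`. -/
def thetaAux : leftIdeal ι →ₗ[B] Res ι M →ₗ[ℤ] M where
  toFun y := AddMonoidHom.toIntLinearMap
    { toFun := fun x => (y : B) • Res.val x
      map_zero' := by simp
      map_add' := by simp }
  map_add' y y' := by
    ext x
    exact add_smul (y : B) (y' : B) (Res.val x)
  map_smul' b y := by
    ext x
    exact mul_smul b (y : B) (Res.val x)

/-- The map `(B 1_A) ⊗_A (1_A M) → M`, `y ⊗ x ↦ y x`. -/
def theta : Ind ι (Res ι M) →ₗ[B] M :=
  (indRelations ι (Res ι M)).liftQ (TensorProduct.AlgebraTensorModule.lift (thetaAux ι M)) (by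
    refine Submodule.span_le.2 ?_
    rintro _ ⟨y, a, x, rfl⟩
    change TensorProduct.AlgebraTensorModule.lift (thetaAux ι M) _ = 0
    rw [map_sub, TensorProduct.AlgebraTensorModule.lift_tmul,
      TensorProduct.AlgebraTensorModule.lift_tmul, sub_eq_zero]
    change ((y : B) * ι a) • Res.val x = (y : B) • ι a • Res.val x
    exact mul_smul _ _ _)

end

end Functors

/-! ## Mackey functors, relative projectivity and vertices -/

section MackeyFunctors

variable {S : Type u} [Group S] [Finite S] {P Q : Subgroup S} (R : Type v) [CommRing R]

/-- A `μ_R(E)`-module `M` is `F`-centric, for a fusion system `E` contained in `F`, if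
`I_K^K M = 0` for all objects `K` of `E` that are not `F`-centric. -/
def IsCentric (F : FusionSystem P) (E : FusionSystem Q) (M : Type w) [AddCommGroup M]
    [Module (MackeyAlgebra R E) M] : Prop :=
  ∀ (K : Subgroup S) (hK : K ≤ Q), ¬ F.Centric K → ∀ m : M, idem R E K hK • m = 0

variable (F : FusionSystem P)

/-- The inclusion `μ_R(F_K(K)) → μ_R(F)` for a subgroup `K ≤ P`. -/
noncomputable def innerInclusion {K : Subgroup S} (hK : K ≤ P) :
    MackeyAlgebra R (inner K) →ₙ+* MackeyAlgebra R F :=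
  mackeyInclusion R hK (inner_isSubsystem F hK)

section

variable (M : Type w) [AddCommGroup M] [Module (MackeyAlgebra R F) M]

/-- The functor `M_K`, the induction to `F` of the restriction of `M` to `F_K(K)`. -/
abbrev ResInd {K : Subgroup S} (hK : K ≤ P) : Type _ :=
  Ind (innerInclusion R F hK) (Res (innerInclusion R F hK) M)

open Classical in
/-- The map `θ_X : ⨁_{K ∈ X} M_K → M` for a family `X` of subgroups of `P`. -/
noncomputable def thetaFamily (X : Set (Subgroup S)) :
    (⨁ K : {K : Subgroup S // K ∈ X ∧ K ≤ P}, ResInd R F M K.2.2) →ₗ[MackeyAlgebra R F] M :=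
  DirectSum.toModule (MackeyAlgebra R F) _ M (fun K => theta (innerInclusion R F K.2.2) M)

/-- `M` is projective relative to the family `X`: the map `θ_X` is split surjective. -/
def IsRelProjective (X : Set (Subgroup S)) : Prop :=
  ∃ s : M →ₗ[MackeyAlgebra R F]
      (⨁ K : {K : Subgroup S // K ∈ X ∧ K ≤ P}, ResInd R F M K.2.2),
    thetaFamily R F M X ∘ₗ s = LinearMap.id

/-- The families of `F`-centric subgroups, closed under `F`-subconjugacy, relative to which `M` is
projective. -/
def IsProjectiveFamily (X : Set (Subgroup S)) : Prop :=
  (∀ K ∈ X, F.Centric K) ∧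
  (∀ K ∈ X, ∀ L, F.Centric L → F.Subconj L K → L ∈ X) ∧
  IsRelProjective R F M X

/-- `X` is the defect set of `M`: a minimal one of these families. -/
def IsDefectSet (X : Set (Subgroup S)) : Prop := Minimal (IsProjectiveFamily R F M) X

/-- `K` is a maximal element of `X` with respect to the preorder `≤_F`. -/
def IsMaximalIn (X : Set (Subgroup S)) (K : Subgroup S) : Prop :=
  K ∈ X ∧ ∀ L ∈ X, F.Subconj K L → F.Subconj L K

/-- `M` admits a vertex and `V` is a vertex of `M`: the maximal elements of the defect set are
unique up to isomorphism in `F`, and `V` is a fully `F`-normalized one of them. -/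
def IsVertex (V : Subgroup S) : Prop :=
  ∃ X, IsDefectSet R F M X ∧ IsMaximalIn F X V ∧
    (∀ K, IsMaximalIn F X K → F.Conj K V) ∧ F.FullyNormalized V

end

/-- A module is indecomposable if it is nonzero and not the direct sum of two nonzero
submodules. -/
def IsIndecomposable (B : Type*) [Ring B] (M : Type*) [AddCommGroup M] [Module B M] : Prop :=
  Nontrivial M ∧ ∀ p q : Submodule B M, IsCompl p q → p = ⊥ ∨ q = ⊥

/-- `D` is a decomposition of `M` as a finite direct sum of indecomposable submodules. -/
def IsDecomposition {B : Type*} [Ring B] {M : Type*} [AddCommGroup M] [Module B M] {n : ℕ}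
    (D : Fin n → Submodule B M) : Prop :=
  DirectSum.IsInternal D ∧ ∀ i, IsIndecomposable B (D i)

/-- The Krull–Schmidt property: `M` is a finite direct sum of indecomposable modules, and any two
such decompositions agree up to permutation and isomorphism of the summands. -/
def HasKrullSchmidtDecomposition (B : Type*) [Ring B] (M : Type*) [AddCommGroup M] [Module B M] :
    Prop :=
  (∃ (n : ℕ) (D : Fin n → Submodule B M), IsDecomposition D) ∧
  ∀ (n m : ℕ) (D : Fin n → Submodule B M) (D' : Fin m → Submodule B M),
    IsDecomposition D → IsDecomposition D' →
    ∃ σ : Fin n ≃ Fin m, ∀ i, Nonempty (D i ≃ₗ[B] D' (σ i))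

/-- `L` is a Mackey functor over `E` (that is, finitely generated) with a unique decomposition
into indecomposable Mackey functors. In any decomposition exactly one summand has vertex `H`, and
every other summand has a vertex, which lies in `𝒵`. -/
def HasGreenDecomposition (E : FusionSystem Q) (H : Subgroup S) (𝒵 : Set (Subgroup S))
    (L : Type w) [AddCommGroup L] [Module (MackeyAlgebra R E) L] : Prop :=
  Module.Finite (MackeyAlgebra R E) L ∧
  HasKrullSchmidtDecomposition (MackeyAlgebra R E) L ∧
  ∀ (n : ℕ) (D : Fin n → Submodule (MackeyAlgebra R E) L), IsDecomposition D →
    (∃! i, IsVertex R E (D i) H) ∧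
    ∀ j, ¬ IsVertex R E (D j) H →
      (∃ V, IsVertex R E (D j) V) ∧ ∀ V, IsVertex R E (D j) V → V ∈ 𝒵

/-- `C` is a summand with vertex `H` in a decomposition of `L` into indecomposable functors. -/
def IsGreenCorrespondent (E : FusionSystem Q) (H : Subgroup S) {L : Type w} [AddCommGroup L]
    [Module (MackeyAlgebra R E) L] (C : Submodule (MackeyAlgebra R E) L) : Prop :=
  IsVertex R E C H ∧
  ∃ (n : ℕ) (D : Fin n → Submodule (MackeyAlgebra R E) L) (i : Fin n), IsDecomposition D ∧ D i = C

variable {F}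

/-- The inclusion `μ_R(N_F(H)) → μ_R(F)`. -/
noncomputable def normalizerInclusion (F : FusionSystem P) (H : Subgroup S) (hH : H ≤ P) :
    MackeyAlgebra R (normalizerSystem F H hH) →ₙ+* MackeyAlgebra R F :=
  mackeyInclusion R inf_le_left (normalizerSystem_isSubsystem F H hH)

/-- The normalizer system `N_F(H)` of a subgroup `H` of `S`, for a fusion system `F` on `S`. -/
abbrev normalizerFusion (F : FusionSystem (⊤ : Subgroup S)) (H : Subgroup S) :
    FusionSystem (normalizerIn ⊤ H) :=
  normalizerSystem F H le_top

/-- The restriction `M↓` of a functor `M` over `F` to `N_F(H)`. -/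
abbrev ResNormalizer (F : FusionSystem (⊤ : Subgroup S)) (H : Subgroup S) (M : Type w)
    [AddCommGroup M] [Module (MackeyAlgebra R F) M] : Type w :=
  Res (normalizerInclusion R F H le_top) M

/-- The induction `N↑` of a functor `N` over `N_F(H)` to `F`. -/
abbrev IndNormalizer (F : FusionSystem (⊤ : Subgroup S)) (H : Subgroup S) (N : Type w)
    [AddCommGroup N] [Module (MackeyAlgebra R (normalizerFusion F H)) N] :
    Type (max v (u + 1) w) :=
  Ind (normalizerInclusion R F H le_top) N

/-- The set `𝒳` of the `F`-centric subgroups `K` with `K <_F H`. -/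
def greenX (F : FusionSystem P) (H : Subgroup S) : Set (Subgroup S) :=
  {K | F.Centric K ∧ F.Subconj K H ∧ ¬ F.Conj K H}

/-- The set `𝒴` of the `F`-centric subgroups `K ≤ N_P(H)` with `K ≤_F H` and `K ≠ H`. -/
def greenY (F : FusionSystem P) (H : Subgroup S) : Set (Subgroup S) :=
  {K | F.Centric K ∧ F.Subconj K H ∧ K ≤ normalizerIn P H ∧ K ≠ H}

end MackeyFunctors

end CentricMackey

open CentricMackey

set_option linter.unusedSectionVars false

namespace CentricMackey

/-! ## Morphisms of fusion systems as subgroups of `S × S` -/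

section Graph

variable {S : Type u} [Group S]

/-- The domain of a relation `Γ ≤ S × S`, read from right to left. -/
def dom (Γ : Subgroup (S × S)) : Subgroup S := Γ.map (MonoidHom.snd S S)

/-- The image of a relation `Γ ≤ S × S`, read from right to left. -/
def im (Γ : Subgroup (S × S)) : Subgroup S := Γ.map (MonoidHom.fst S S)

theorem mem_dom {Γ : Subgroup (S × S)} {a : S} : a ∈ dom Γ ↔ ∃ b, (b, a) ∈ Γ := by
  simp [dom]

theorem mem_im {Γ : Subgroup (S × S)} {b : S} : b ∈ im Γ ↔ ∃ a, (b, a) ∈ Γ := by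
  simp [im]

theorem mem_dom_of {Γ : Subgroup (S × S)} {a b : S} (h : (b, a) ∈ Γ) : a ∈ dom Γ :=
  mem_dom.2 ⟨b, h⟩

theorem mem_im_of {Γ : Subgroup (S × S)} {a b : S} (h : (b, a) ∈ Γ) : b ∈ im Γ :=
  mem_im.2 ⟨a, h⟩

theorem dom_mono {Γ Δ : Subgroup (S × S)} (h : Γ ≤ Δ) : dom Γ ≤ dom Δ := Subgroup.map_mono h

theorem im_mono {Γ Δ : Subgroup (S × S)} (h : Γ ≤ Δ) : im Γ ≤ im Δ := Subgroup.map_mono h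

/-- Composition of relations. -/
def rcomp (Γ Δ : Subgroup (S × S)) : Subgroup (S × S) where
  carrier := {x | ∃ b, (x.1, b) ∈ Γ ∧ (b, x.2) ∈ Δ}
  one_mem' := ⟨1, Γ.one_mem, Δ.one_mem⟩
  mul_mem' := by
    rintro x y ⟨b, h1, h2⟩ ⟨c, h3, h4⟩
    exact ⟨b * c, Γ.mul_mem h1 h3, Δ.mul_mem h2 h4⟩
  inv_mem' := by
    rintro x ⟨b, h1, h2⟩
    exact ⟨b⁻¹, Γ.inv_mem h1, Δ.inv_mem h2⟩

theorem mem_rcomp {Γ Δ : Subgroup (S × S)} {a c : S} :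
    (c, a) ∈ rcomp Γ Δ ↔ ∃ b, (c, b) ∈ Γ ∧ (b, a) ∈ Δ := Iff.rfl

theorem rcomp_assoc (Γ Δ Θ : Subgroup (S × S)) :
    rcomp (rcomp Γ Δ) Θ = rcomp Γ (rcomp Δ Θ) := by
  ext ⟨a, b⟩
  simp only [mem_rcomp]
  constructor
  · rintro ⟨c, ⟨d, h1, h2⟩, h3⟩
    exact ⟨d, h1, c, h2, h3⟩
  · rintro ⟨d, h1, c, h2, h3⟩
    exact ⟨c, ⟨d, h1, h2⟩, h3⟩

theorem dom_rcomp_le (Γ Δ : Subgroup (S × S)) : dom (rcomp Γ Δ) ≤ dom Δ := by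
  intro a ha
  obtain ⟨b, c, -, h⟩ := mem_dom.1 ha
  exact mem_dom_of h

theorem im_rcomp_le (Γ Δ : Subgroup (S × S)) : im (rcomp Γ Δ) ≤ im Γ := by
  intro a ha
  obtain ⟨b, c, h, -⟩ := mem_im.1 ha
  exact mem_im_of h

theorem dom_rcomp {Γ Δ : Subgroup (S × S)} (h : im Δ ≤ dom Γ) : dom (rcomp Γ Δ) = dom Δ := by
  refine le_antisymm (dom_rcomp_le _ _) (fun a ha => ?_)
  obtain ⟨b, hb⟩ := mem_dom.1 ha
  obtain ⟨c, hc⟩ := mem_dom.1 (h (mem_im_of hb))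
  exact mem_dom_of (b := c) ⟨b, hc, hb⟩

theorem im_rcomp {Γ Δ : Subgroup (S × S)} (h : dom Γ ≤ im Δ) : im (rcomp Γ Δ) = im Γ := by
  refine le_antisymm (im_rcomp_le _ _) (fun a ha => ?_)
  obtain ⟨b, hb⟩ := mem_im.1 ha
  obtain ⟨c, hc⟩ := mem_im.1 (h (mem_dom_of hb))
  exact mem_im_of (a := c) ⟨b, hb, hc⟩

/-- The inverse relation. -/
def rinv (Γ : Subgroup (S × S)) : Subgroup (S × S) :=
  Γ.comap (MulEquiv.prodComm : S × S ≃* S × S).toMonoidHom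

theorem mem_rinv {Γ : Subgroup (S × S)} {a b : S} : (a, b) ∈ rinv Γ ↔ (b, a) ∈ Γ := Iff.rfl

theorem dom_rinv (Γ : Subgroup (S × S)) : dom (rinv Γ) = im Γ := by
  ext a; simp only [mem_dom, mem_im, mem_rinv]

theorem im_rinv (Γ : Subgroup (S × S)) : im (rinv Γ) = dom Γ := by
  ext a; simp only [mem_dom, mem_im, mem_rinv]

/-- The restriction of conjugation by `g` to `D`. -/
def cgr (g : S) (D : Subgroup S) : Subgroup (S × S) :=
  D.map ((MulAut.conj g).toMonoidHom.prod (MonoidHom.id S))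

theorem mem_cgr {g a b : S} {D : Subgroup S} : (b, a) ∈ cgr g D ↔ a ∈ D ∧ b = g * a * g⁻¹ := by
  simp only [cgr, Subgroup.mem_map, MonoidHom.prod_apply, Prod.mk.injEq]
  constructor
  · rintro ⟨c, hc, rfl, rfl⟩
    exact ⟨hc, rfl⟩
  · rintro ⟨h, rfl⟩
    exact ⟨a, h, rfl, rfl⟩

theorem dom_cgr (g : S) (D : Subgroup S) : dom (cgr g D) = D := by
  ext a
  simp [mem_dom, mem_cgr]

theorem cgr_mono (g : S) {D D' : Subgroup S} (h : D ≤ D') : cgr g D ≤ cgr g D' :=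
  Subgroup.map_mono h

theorem im_cgr_one (D : Subgroup S) : im (cgr 1 D) = D := by
  ext a
  simp [mem_im, mem_cgr]

theorem rcomp_one_right {Γ : Subgroup (S × S)} {D : Subgroup S} (h : dom Γ ≤ D) :
    rcomp Γ (cgr 1 D) = Γ := by
  ext ⟨b, a⟩
  simp only [mem_rcomp, mem_cgr]
  constructor
  · rintro ⟨c, h1, h2, rfl⟩
    simpa using h1
  · intro h1
    exact ⟨a, h1, h (mem_dom_of h1), by simp⟩

theorem rcomp_one_left {Γ : Subgroup (S × S)} {D : Subgroup S} (h : im Γ ≤ D) :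
    rcomp (cgr 1 D) Γ = Γ := by
  ext ⟨b, a⟩
  simp only [mem_rcomp, mem_cgr]
  constructor
  · rintro ⟨c, ⟨h1, rfl⟩, h2⟩
    simpa using h2
  · intro h1
    exact ⟨b, ⟨h (mem_im_of h1), by simp⟩, h1⟩

/-- The conjugate of a relation by the pair `(x, y)`. -/
def cj (x y : S) (Γ : Subgroup (S × S)) : Subgroup (S × S) :=
  Γ.map (MulAut.conj (x, y)).toMonoidHom

theorem mem_cj {x y a b : S} {Γ : Subgroup (S × S)} :
    (b, a) ∈ cj x y Γ ↔ (x⁻¹ * b * x, y⁻¹ * a * y) ∈ Γ := by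
  simp only [cj, Subgroup.mem_map]
  constructor
  · rintro ⟨⟨c, d⟩, h, h'⟩
    simp only [MulEquiv.coe_toMonoidHom, MulAut.conj_apply, Prod.mk_mul_mk, Prod.inv_mk,
      Prod.mk.injEq] at h'
    obtain ⟨rfl, rfl⟩ := h'
    simpa [mul_assoc] using h
  · intro h
    exact ⟨_, h, by simp [mul_assoc]⟩

theorem cj_mono (x y : S) {Γ Δ : Subgroup (S × S)} (h : Γ ≤ Δ) : cj x y Γ ≤ cj x y Δ :=
  Subgroup.map_mono h

theorem cj_cj (x y x' y' : S) (Γ : Subgroup (S × S)) :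
    cj x y (cj x' y' Γ) = cj (x * x') (y * y') Γ := by
  ext ⟨a, b⟩
  simp [mem_cj, mul_assoc]

theorem cj_one (Γ : Subgroup (S × S)) : cj 1 1 Γ = Γ := by
  ext ⟨a, b⟩
  simp [mem_cj]

theorem mem_normalizer_iff_cj {x y : S} {Γ : Subgroup (S × S)} :
    (x, y) ∈ Subgroup.normalizer (Γ : Set (S × S)) ↔ cj x y Γ = Γ := by
  rw [← inv_mem_iff, Subgroup.mem_normalizer_iff]
  constructor
  · intro h
    ext ⟨b, a⟩
    rw [mem_cj, h (b, a)]
    simp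
  · rintro h ⟨b, a⟩
    conv_lhs => rw [← h, mem_cj]
    simp

theorem dom_cj (x y : S) (Γ : Subgroup (S × S)) :
    dom (cj x y Γ) = (dom Γ).map (MulAut.conj y).toMonoidHom := by
  simp only [dom, cj, Subgroup.map_map]
  rfl

theorem im_cj (x y : S) (Γ : Subgroup (S × S)) :
    im (cj x y Γ) = (im Γ).map (MulAut.conj x).toMonoidHom := by
  simp only [im, cj, Subgroup.map_map]
  rfl

/-- The restriction of a relation to a smaller domain. -/
def rres (Γ : Subgroup (S × S)) (D : Subgroup S) : Subgroup (S × S) :=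
  Γ ⊓ D.comap (MonoidHom.snd S S)

theorem mem_rres {Γ : Subgroup (S × S)} {D : Subgroup S} {a b : S} :
    (b, a) ∈ rres Γ D ↔ (b, a) ∈ Γ ∧ a ∈ D := Iff.rfl

theorem rres_le (Γ : Subgroup (S × S)) (D : Subgroup S) : rres Γ D ≤ Γ := inf_le_left

theorem dom_rres {Γ : Subgroup (S × S)} {D : Subgroup S} (h : D ≤ dom Γ) :
    dom (rres Γ D) = D := by
  ext a
  simp only [mem_dom, mem_rres]
  constructor
  · rintro ⟨b, -, h⟩
    exact h
  · intro ha
    obtain ⟨b, hb⟩ := mem_dom.1 (h ha)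
    exact ⟨b, hb, ha⟩

namespace FusionSystem

variable {P Q : Subgroup S} (E : FusionSystem Q)

/-- `Γ` is the graph of an isomorphism of `E`. -/
def Gr (Γ : Subgroup (S × S)) : Prop :=
  ∃ (A B : Subgroup S) (φ : A →* B), φ ∈ E.Hom A B ∧
    ∀ b a : S, (b, a) ∈ Γ ↔ ∃ h : a ∈ A, (φ ⟨a, h⟩ : S) = b

variable {E}

theorem Gr.functional {Γ : Subgroup (S × S)} (h : E.Gr Γ) {a b b' : S} (h1 : (b, a) ∈ Γ)
    (h2 : (b', a) ∈ Γ) : b = b' := by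
  obtain ⟨A, B, φ, -, hφ⟩ := h
  obtain ⟨_, h1⟩ := (hφ _ _).1 h1
  obtain ⟨_, h2⟩ := (hφ _ _).1 h2
  exact h1.symm.trans h2

theorem Gr.injective {Γ : Subgroup (S × S)} (h : E.Gr Γ) {a a' b : S} (h1 : (b, a) ∈ Γ)
    (h2 : (b, a') ∈ Γ) : a = a' := by
  obtain ⟨A, B, φ, hm, hφ⟩ := h
  obtain ⟨_, h1⟩ := (hφ _ _).1 h1
  obtain ⟨_, h2⟩ := (hφ _ _).1 h2
  exact congrArg Subtype.val (E.injective hm (Subtype.ext (h1.trans h2.symm)))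

theorem Gr.dom_le {Γ : Subgroup (S × S)} (h : E.Gr Γ) : dom Γ ≤ Q := by
  intro a ha
  obtain ⟨b, hb⟩ := mem_dom.1 ha
  obtain ⟨A, B, φ, hm, hφ⟩ := h
  obtain ⟨h1, -⟩ := (hφ _ _).1 hb
  exact (E.le_of_mem hm).1 h1

theorem Gr.im_le {Γ : Subgroup (S × S)} (h : E.Gr Γ) : im Γ ≤ Q := by
  intro b hb
  obtain ⟨a, hb⟩ := mem_im.1 hb
  obtain ⟨A, B, φ, hm, hφ⟩ := h
  obtain ⟨h1, rfl⟩ := (hφ _ _).1 hb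
  exact (E.le_of_mem hm).2 (φ _).2

theorem Gr.mono {Γ Δ : Subgroup (S × S)} (h : E.Gr Δ) (hle : Γ ≤ Δ) : E.Gr Γ := by
  have hdom := h.dom_le
  have hfun := fun {a b b' : S} => h.functional (a := a) (b := b) (b' := b')
  obtain ⟨A, B, φ, hm, hφ⟩ := h
  have hA : dom Γ ≤ A := by
    intro a ha
    obtain ⟨b, hb⟩ := mem_dom.1 ha
    exact ((hφ _ _).1 (hle hb)).1
  refine ⟨dom Γ, B, φ.comp (Subgroup.inclusion hA), E.comp_mem (E.conj_mem (hA.trans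
    (E.le_of_mem hm).1) (E.le_of_mem hm).1 1 (one_mem _) _ (fun a => by simp)) hm,
    fun b a => ⟨fun hab => ⟨mem_dom_of hab, ((hφ _ _).1 (hle hab)).2⟩, ?_⟩⟩
  rintro ⟨ha, h⟩
  obtain ⟨c, hc⟩ := mem_dom.1 ha
  have : b = c := hfun ((hφ _ _).2 ⟨hA ha, h⟩) (hle hc)
  rwa [this]

/-- The graph of an isomorphism. -/
theorem gr_of_hom {A B : Subgroup S} {φ : A →* B} (hm : φ ∈ E.Hom A B) :
    E.Gr ((B.subtype.comp φ).prod A.subtype).range := by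
  refine ⟨A, B, φ, hm, fun b a => ?_⟩
  simp only [MonoidHom.mem_range, MonoidHom.prod_apply, Prod.mk.injEq]
  constructor
  · rintro ⟨x, h1, rfl⟩
    exact ⟨x.2, h1⟩
  · rintro ⟨h, rfl⟩
    exact ⟨⟨a, h⟩, rfl, rfl⟩

theorem Gr.exists_equiv {Γ : Subgroup (S × S)} (h : E.Gr Γ) :
    ∃ e : dom Γ ≃* im Γ, E.IsIso e ∧ ∀ a : dom Γ, ((e a : S), (a : S)) ∈ Γ := by
  have hinj := fun {a a' b : S} => h.injective (a := a) (a' := a') (b := b)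
  obtain ⟨A, B, φ, hm, hφ⟩ := h
  have hA : dom Γ = A := by
    ext a
    simp [mem_dom, hφ]
  subst hA
  have hmem : ∀ a : dom Γ, ((φ a : S), (a : S)) ∈ Γ := fun a => (hφ _ _).2 ⟨a.2, rfl⟩
  let e : dom Γ ≃* im Γ := MulEquiv.ofBijective
    ((B.subtype.comp φ).codRestrict (im Γ) (fun a => mem_im_of (hmem a)))
    ⟨fun a b hab => E.injective hm (Subtype.ext (congrArg (fun z : im Γ => (z : S)) hab :)), by
      rintro ⟨b, hb⟩
      obtain ⟨a, ha⟩ := mem_im.1 hb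
      obtain ⟨h1, h2⟩ := (hφ _ _).1 ha
      exact ⟨⟨a, h1⟩, Subtype.ext h2⟩⟩
  exact ⟨e, (E.iso_mem hm e (fun _ => rfl)).1, hmem⟩

theorem Gr.of_equiv {Γ : Subgroup (S × S)} {A B : Subgroup S} (e : A ≃* B) (he : E.IsIso e)
    (h : ∀ b a : S, (b, a) ∈ Γ ↔ ∃ h : a ∈ A, (e ⟨a, h⟩ : S) = b) : E.Gr Γ :=
  ⟨A, B, e.toMonoidHom, he, h⟩

theorem Gr.mem_iff_of_equiv {Γ : Subgroup (S × S)} (h : E.Gr Γ) {e : dom Γ ≃* im Γ}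
    (he : ∀ a : dom Γ, ((e a : S), (a : S)) ∈ Γ) (b a : S) :
    (b, a) ∈ Γ ↔ ∃ h : a ∈ dom Γ, (e ⟨a, h⟩ : S) = b := by
  constructor
  · intro hab
    exact ⟨mem_dom_of hab, h.functional (he ⟨a, mem_dom_of hab⟩) hab⟩
  · rintro ⟨h, rfl⟩
    exact he _

theorem Gr.rinv {Γ : Subgroup (S × S)} (h : E.Gr Γ) : E.Gr (rinv Γ) := by
  obtain ⟨e, he, hm⟩ := h.exists_equiv
  refine Gr.of_equiv e.symm (E.iso_mem (φ := e.toMonoidHom) he e (fun _ => rfl)).2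
    (fun b a => ?_)
  rw [mem_rinv, h.mem_iff_of_equiv hm]
  constructor
  · rintro ⟨hb, rfl⟩
    exact ⟨(e _).2, by simp⟩
  · rintro ⟨ha, rfl⟩
    exact ⟨(e.symm _).2, by simp⟩

theorem Gr.rcomp {Γ Δ : Subgroup (S × S)} (h : E.Gr Γ) (h' : E.Gr Δ) : E.Gr (rcomp Γ Δ) := by
  set D := dom (CentricMackey.rcomp Γ Δ) with hD
  have hD' : D ≤ dom Δ := dom_rcomp_le _ _
  have h1 : E.Gr (rres Δ D) := h'.mono (rres_le _ _)
  have him : im (rres Δ D) ≤ dom Γ := by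
    intro b hb
    obtain ⟨a, hb, ha⟩ := mem_im.1 hb
    obtain ⟨c, d, hc, hd⟩ := mem_dom.1 ha
    rw [h'.functional hb hd]
    exact mem_dom_of hc
  obtain ⟨e, he, hm⟩ := h1.exists_equiv
  obtain ⟨f, hf, hm'⟩ := h.exists_equiv
  refine ⟨dom (rres Δ D), im Γ, (f.toMonoidHom.comp (Subgroup.inclusion him)).comp e.toMonoidHom,
    E.comp_mem he (E.comp_mem (E.conj_mem h1.im_le h.dom_le 1 (one_mem _) _
      (fun a => by simp)) hf), fun b a => ?_⟩
  constructor
  · rintro ⟨c, hc, hd⟩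
    have ha : (c, a) ∈ rres Δ D := ⟨hd, mem_dom_of (b := b) ⟨c, hc, hd⟩⟩
    refine ⟨mem_dom_of ha, h.functional (hm' _) ?_⟩
    convert hc using 1
    exact congrArg (Prod.mk b) (h1.functional (hm _) ha)
  · rintro ⟨ha, rfl⟩
    exact ⟨_, hm' _, (hm ⟨a, ha⟩).1⟩

theorem gr_cgr {g : S} (hg : g ∈ Q) {D : Subgroup S} (hD : D ≤ Q) : E.Gr (cgr g D) := by
  refine ⟨D, Q, ((MulAut.conj g).toMonoidHom.comp D.subtype).codRestrict Q (fun a =>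
    Q.mul_mem (Q.mul_mem hg (hD a.2)) (Q.inv_mem hg)), E.conj_mem hD le_rfl g hg _ (fun a => rfl),
    fun b a => ?_⟩
  rw [mem_cgr]
  constructor
  · rintro ⟨h, rfl⟩
    exact ⟨h, rfl⟩
  · rintro ⟨h, rfl⟩
    exact ⟨h, rfl⟩

theorem Gr.cj_eq {Γ : Subgroup (S × S)} (x y : S) :
    cj x y Γ = CentricMackey.rcomp (cgr x (im Γ)) (CentricMackey.rcomp Γ
      (CentricMackey.rinv (cgr y (dom Γ)))) := by
  ext ⟨b, a⟩
  simp only [mem_cj, mem_rcomp, mem_cgr, mem_rinv]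
  constructor
  · intro h
    exact ⟨_, ⟨mem_im_of h, by simp [mul_assoc]⟩, _, h, mem_dom_of h, by simp [mul_assoc]⟩
  · rintro ⟨c, ⟨h1, rfl⟩, d, h2, h3, rfl⟩
    simpa [mul_assoc] using h2

theorem Gr.cj {Γ : Subgroup (S × S)} (h : E.Gr Γ) {x y : S} (hx : x ∈ Q) (hy : y ∈ Q) :
    E.Gr (cj x y Γ) := by
  rw [Gr.cj_eq]
  exact (gr_cgr hx h.im_le).rcomp (h.rcomp (gr_cgr hy h.dom_le).rinv)

theorem Gr.of_isSubsystem {F : FusionSystem P} (hEF : E.IsSubsystem F) {Γ : Subgroup (S × S)}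
    (h : E.Gr Γ) : F.Gr Γ := by
  obtain ⟨A, B, φ, hm, hφ⟩ := h
  exact ⟨A, B, φ, hEF _ _ hm, hφ⟩

theorem conj_iff_gr {A B : Subgroup S} : E.Conj A B ↔ ∃ Γ, E.Gr Γ ∧ dom Γ = A ∧ im Γ = B := by
  constructor
  · rintro ⟨e, he⟩
    refine ⟨((B.subtype.comp e.toMonoidHom).prod A.subtype).range, gr_of_hom he, ?_, ?_⟩
    · ext a
      simp [mem_dom]
    · ext b
      simp only [mem_im, MonoidHom.mem_range, MonoidHom.prod_apply, Prod.mk.injEq]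
      constructor
      · rintro ⟨a, x, rfl, rfl⟩
        exact (e x).2
      · intro hb
        exact ⟨_, e.symm ⟨b, hb⟩, by simp, rfl⟩
  · rintro ⟨Γ, h, rfl, rfl⟩
    obtain ⟨e, he, -⟩ := h.exists_equiv
    exact ⟨e, he⟩

theorem Gr.conj {Γ : Subgroup (S × S)} (h : E.Gr Γ) : E.Conj (dom Γ) (im Γ) :=
  conj_iff_gr.2 ⟨Γ, h, rfl, rfl⟩

theorem Conj.symm {A B : Subgroup S} (h : E.Conj A B) : E.Conj B A := by
  obtain ⟨Γ, hΓ, rfl, rfl⟩ := conj_iff_gr.1 h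
  have := hΓ.rinv.conj
  rwa [dom_rinv, im_rinv] at this

theorem Conj.trans {A B C : Subgroup S} (h : E.Conj A B) (h' : E.Conj B C) : E.Conj A C := by
  obtain ⟨Γ, hΓ, rfl, h1⟩ := conj_iff_gr.1 h
  obtain ⟨Δ, hΔ, h2, rfl⟩ := conj_iff_gr.1 h'
  rw [← dom_rcomp (h1.trans h2.symm).le, ← im_rcomp (h2.trans h1.symm).le]
  exact (hΔ.rcomp hΓ).conj

theorem Conj.le {A B : Subgroup S} (h : E.Conj A B) : A ≤ Q ∧ B ≤ Q := by
  obtain ⟨e, he⟩ := h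
  exact E.le_of_mem he

theorem conj_refl {A : Subgroup S} (h : A ≤ Q) : E.Conj A A := by
  have := (gr_cgr (E := E) (one_mem Q) h).conj
  rwa [dom_cgr, im_cgr_one] at this

theorem Conj.card_eq {A B : Subgroup S} (h : E.Conj A B) : Nat.card A = Nat.card B := by
  obtain ⟨e, -⟩ := h
  exact Nat.card_congr e.toEquiv

theorem Gr.card_eq {Γ : Subgroup (S × S)} (h : E.Gr Γ) : Nat.card (dom Γ) = Nat.card (im Γ) :=
  h.conj.card_eq

theorem Subconj.exists_gr {A B : Subgroup S} (h : E.Subconj A B) :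
    ∃ Γ, E.Gr Γ ∧ dom Γ = A ∧ im Γ ≤ B := by
  obtain ⟨-, J, hJ, h⟩ := h
  obtain ⟨Γ, hΓ, h1, rfl⟩ := conj_iff_gr.1 h
  exact ⟨Γ, hΓ, h1, hJ⟩

theorem Gr.subconj {Γ : Subgroup (S × S)} (h : E.Gr Γ) {B : Subgroup S} (hB : B ≤ Q)
    (h' : im Γ ≤ B) : E.Subconj (dom Γ) B := ⟨hB, _, h', h.conj⟩

theorem Subconj.le {A B : Subgroup S} (h : E.Subconj A B) : A ≤ Q := by
  obtain ⟨Γ, hΓ, rfl, -⟩ := h.exists_gr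
  exact hΓ.dom_le

theorem Subconj.trans {A B C : Subgroup S} (h : E.Subconj A B) (h' : E.Subconj B C) :
    E.Subconj A C := by
  obtain ⟨Γ, hΓ, rfl, h1⟩ := h.exists_gr
  obtain ⟨Δ, hΔ, rfl, h2⟩ := h'.exists_gr
  rw [← dom_rcomp h1]
  exact (hΔ.rcomp hΓ).subconj h'.1 ((im_rcomp_le _ _).trans h2)

theorem subconj_of_le {A B : Subgroup S} (hB : B ≤ Q) (h : A ≤ B) : E.Subconj A B :=
  ⟨hB, A, h, conj_refl (h.trans hB)⟩

theorem Conj.subconj {A B : Subgroup S} (h : E.Conj A B) : E.Subconj A B :=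
  ⟨h.le.2, B, le_rfl, h⟩

theorem Subconj.card_le [Finite S] {A B : Subgroup S} (h : E.Subconj A B) :
    Nat.card A ≤ Nat.card B := by
  obtain ⟨-, J, hJ, h⟩ := h
  rw [h.card_eq]
  exact Subgroup.card_le_of_le hJ

theorem Subconj.conj_of_card_le [Finite S] {A B : Subgroup S} (h : E.Subconj A B)
    (hc : Nat.card B ≤ Nat.card A) : E.Conj A B := by
  obtain ⟨-, J, hJ, h⟩ := h
  rwa [← Subgroup.eq_of_le_of_card_ge hJ (by rwa [← h.card_eq])]

theorem Conj.of_isSubsystem {F : FusionSystem P} (hEF : E.IsSubsystem F) {A B : Subgroup S}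
    (h : E.Conj A B) : F.Conj A B := by
  obtain ⟨e, he⟩ := h
  exact ⟨e, hEF _ _ he⟩

theorem Centric.conj {A B : Subgroup S} (hA : E.Centric A) (h : E.Conj A B) : E.Centric B :=
  ⟨h.le.2, fun K hK => hA.2 K (hK.trans h.symm)⟩

theorem Centric.mono {A B : Subgroup S} (hA : E.Centric A) (h : A ≤ B) (hB : B ≤ Q) :
    E.Centric B := by
  refine ⟨hB, fun K hK => ?_⟩
  obtain ⟨Γ, hΓ, h1, rfl⟩ := conj_iff_gr.1 hK.symm
  have h2 : dom (rres Γ A) = A := dom_rres (by rw [h1]; exact h)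
  have h3 := hA.2 (im (rres Γ A)) (by
    have := (hΓ.mono (rres_le Γ A)).conj.symm
    rwa [h2] at this)
  have h4 : im (rres Γ A) ≤ im Γ := im_mono (rres_le _ _)
  exact (inf_le_inf_left _ (Subgroup.centralizer_le h4)).trans (h3.trans h4)

theorem Gr.centric_im {Γ : Subgroup (S × S)} (h : E.Gr Γ) (hc : E.Centric (dom Γ)) :
    E.Centric (im Γ) := hc.conj h.conj

theorem Gr.centric_dom {Γ : Subgroup (S × S)} (h : E.Gr Γ) (hc : E.Centric (im Γ)) :
    E.Centric (dom Γ) := hc.conj h.conj.symm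

theorem Gr.eq_of_le_of_dom_le {Γ Δ : Subgroup (S × S)} (h : E.Gr Δ) (hle : Γ ≤ Δ)
    (hd : dom Δ ≤ dom Γ) : Γ = Δ := by
  refine le_antisymm hle ?_
  rintro ⟨b, a⟩ hab
  obtain ⟨c, hc⟩ := mem_dom.1 (hd (mem_dom_of hab))
  rwa [h.functional hab (hle hc)]

theorem Gr.rcomp_rinv_self {Γ : Subgroup (S × S)} (h : E.Gr Γ) :
    CentricMackey.rcomp Γ (CentricMackey.rinv Γ) = cgr 1 (im Γ) := by
  ext ⟨b, a⟩
  simp only [mem_rcomp, mem_rinv, mem_cgr, mem_im]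
  constructor
  · rintro ⟨c, h1, h2⟩
    exact ⟨⟨c, h2⟩, by simpa using h.functional h1 h2⟩
  · rintro ⟨⟨c, h2⟩, rfl⟩
    exact ⟨c, by simpa using h2, h2⟩

theorem Gr.rinv_rcomp_self {Γ : Subgroup (S × S)} (h : E.Gr Γ) :
    CentricMackey.rcomp (CentricMackey.rinv Γ) Γ = cgr 1 (dom Γ) := by
  ext ⟨b, a⟩
  simp only [mem_rcomp, mem_rinv, mem_cgr, mem_dom]
  constructor
  · rintro ⟨c, h1, h2⟩
    exact ⟨⟨c, h2⟩, by simpa using h.injective h1 h2⟩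
  · rintro ⟨⟨c, h2⟩, rfl⟩
    exact ⟨c, by simpa using h2, h2⟩

theorem Gr.rres_eq_of_le {Γ Δ : Subgroup (S × S)} (h : E.Gr Δ) (hle : Γ ≤ Δ) :
    rres Δ (dom Γ) = Γ :=
  ((h.mono (rres_le _ _)).eq_of_le_of_dom_le (fun ⟨_, _⟩ hx => mem_rres.2 ⟨hle hx, mem_dom_of hx⟩)
    (dom_rres (dom_mono hle)).le).symm

theorem gr_inner_iff {K : Subgroup S} {Γ : Subgroup (S × S)} :
    (inner K).Gr Γ ↔ dom Γ ≤ K ∧ ∃ k ∈ K, Γ = cgr k (dom Γ) := by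
  constructor
  · intro h
    refine ⟨h.dom_le, ?_⟩
    obtain ⟨e, ⟨-, -, k, hk, he⟩, hm⟩ := h.exists_equiv
    refine ⟨k, hk, ?_⟩
    ext ⟨b, a⟩
    rw [mem_cgr]
    constructor
    · intro hab
      exact ⟨mem_dom_of hab,
        (h.functional hab (hm ⟨a, mem_dom_of hab⟩)).trans (he ⟨a, mem_dom_of hab⟩)⟩
    · rintro ⟨ha, rfl⟩
      have := hm ⟨a, ha⟩
      have h2 : ((e ⟨a, ha⟩ : im Γ) : S) = k * a * k⁻¹ := he ⟨a, ha⟩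
      rwa [h2] at this
  · rintro ⟨h, k, hk, h'⟩
    rw [h']
    exact gr_cgr hk h

end FusionSystem

end Graph

end CentricMackey

namespace CentricMackey

/-! ## Saturated fusion systems -/

section Saturation

variable {S : Type u} [Group S]

theorem normalizer_dom_im {Γ : Subgroup (S × S)} {z x : S}
    (h : (z, x) ∈ Subgroup.normalizer (Γ : Set (S × S))) :
    z ∈ Subgroup.normalizer (im Γ : Set S) ∧ x ∈ Subgroup.normalizer (dom Γ : Set S) :=
  ⟨Subgroup.le_normalizer_map (MonoidHom.fst S S) (Subgroup.mem_map_of_mem _ h),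
    Subgroup.le_normalizer_map (MonoidHom.snd S S) (Subgroup.mem_map_of_mem _ h)⟩

theorem mem_normalizer_of_forall {G : Type*} [Group G] [Finite G] {H : Subgroup G} {g : G}
    (h : ∀ x ∈ H, g * x * g⁻¹ ∈ H) : g ∈ Subgroup.normalizer (H : Set G) := by
  have h1 : H.map (MulAut.conj g).toMonoidHom = H := by
    refine Subgroup.eq_of_le_of_card_ge ?_ ?_
    · rintro _ ⟨x, hx, rfl⟩
      exact h x hx
    · rw [Subgroup.card_map_of_injective (MulAut.conj g).injective]
  rw [Subgroup.mem_normalizer_iff]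
  refine fun x => ⟨h x, fun hx => ?_⟩
  rw [← h1] at hx
  obtain ⟨y, hy, hxy⟩ := hx
  have : y = x := (MulAut.conj g).injective hxy
  rwa [← this]

theorem mem_normalizer_graph [Finite S] {Γ : Subgroup (S × S)} {z x : S}
    (h : ∀ b a, (b, a) ∈ Γ → (z * b * z⁻¹, x * a * x⁻¹) ∈ Γ) :
    (z, x) ∈ Subgroup.normalizer (Γ : Set (S × S)) :=
  mem_normalizer_of_forall (fun y hy => h y.1 y.2 hy)

theorem conj_mem_of_normalizer {G : Type*} [Group G] {H : Subgroup G} {g x : G}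
    (h : g ∈ Subgroup.normalizer (H : Set G)) (hx : x ∈ H) : g * x * g⁻¹ ∈ H :=
  (Subgroup.mem_normalizer_iff.1 h x).1 hx

/-- The graph of an isomorphism between two subgroups. -/
def egr {A B : Subgroup S} (e : A ≃* B) : Subgroup (S × S) :=
  ((B.subtype.comp e.toMonoidHom).prod A.subtype).range

theorem mem_egr {A B : Subgroup S} {e : A ≃* B} {a b : S} :
    (b, a) ∈ egr e ↔ ∃ h : a ∈ A, (e ⟨a, h⟩ : S) = b := by
  simp only [egr, MonoidHom.mem_range, MonoidHom.prod_apply, Prod.mk.injEq]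
  constructor
  · rintro ⟨x, h1, rfl⟩
    exact ⟨x.2, h1⟩
  · rintro ⟨h, rfl⟩
    exact ⟨⟨a, h⟩, rfl, rfl⟩

theorem dom_egr {A B : Subgroup S} (e : A ≃* B) : dom (egr e) = A := by
  ext a
  simp [mem_dom, mem_egr]

theorem im_egr {A B : Subgroup S} (e : A ≃* B) : im (egr e) = B := by
  ext b
  simp only [mem_im, mem_egr]
  constructor
  · rintro ⟨a, h, rfl⟩
    exact (e _).2
  · intro hb
    exact ⟨e.symm ⟨b, hb⟩, (e.symm ⟨b, hb⟩).2, by simp⟩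

/-- The automorphisms of `K` that are given by conjugation with an element of `S`. -/
def autIn (K : Subgroup S) : Subgroup (MulAut K) where
  carrier := {e | ∃ s : S, ∀ a : K, (e a : S) = s * a * s⁻¹}
  one_mem' := ⟨1, by simp⟩
  mul_mem' := by
    rintro e f ⟨s, hs⟩ ⟨t, ht⟩
    exact ⟨s * t, fun a => by rw [MulAut.mul_apply, hs, ht]; group⟩
  inv_mem' := by
    rintro e ⟨s, hs⟩
    refine ⟨s⁻¹, fun a => ?_⟩
    obtain ⟨b, rfl⟩ := e.surjective a
    rw [MulAut.inv_apply_self, hs]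
    group

/-- Conjugation by an element of the normalizer as an automorphism. -/
theorem exists_autIn [Finite S] {K : Subgroup S} {x : S}
    (hx : x ∈ Subgroup.normalizer (K : Set S)) :
    ∃ e ∈ autIn K, ∀ a : K, (e a : S) = x * a * x⁻¹ := by
  let f : K →* K := ((MulAut.conj x).toMonoidHom.comp K.subtype).codRestrict K
    (fun a => conj_mem_of_normalizer hx a.2)
  have hf : Function.Injective f := fun a b h =>
    Subtype.ext ((MulAut.conj x).injective (congrArg (fun z : K => (z : S)) h :))
  exact ⟨MulEquiv.ofBijective f (Finite.injective_iff_bijective.1 hf), ⟨x, fun _ => rfl⟩,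
    fun _ => rfl⟩

namespace FusionSystem

theorem gr_egr {Q : Subgroup S} {E : FusionSystem Q} {A B : Subgroup S} {e : A ≃* B}
    (h : E.IsIso e) : E.Gr (egr e) := gr_of_hom h

theorem Gr.exists_equiv_of_eq {Q : Subgroup S} {E : FusionSystem Q} {A B : Subgroup S}
    {Γ : Subgroup (S × S)} (h : E.Gr Γ) (hA : dom Γ = A) (hB : im Γ = B) :
    ∃ e : A ≃* B, E.IsIso e ∧ egr e = Γ := by
  subst hA hB
  obtain ⟨e, he, hm⟩ := h.exists_equiv
  refine ⟨e, he, ?_⟩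
  ext ⟨b, a⟩
  rw [mem_egr, h.mem_iff_of_equiv hm]

variable {F : FusionSystem (⊤ : Subgroup S)} {p : ℕ}

theorem Saturated.exists_extension [Finite S] (hF : F.Saturated p) {Γ : Subgroup (S × S)}
    (h : F.Gr Γ) (hn : F.FullyNormalized (im Γ)) :
    ∃ Δ, F.Gr Δ ∧ Γ ≤ Δ ∧ ∀ z x, (z, x) ∈ Subgroup.normalizer (Γ : Set (S × S)) → x ∈ dom Δ := by
  obtain ⟨e, he, hm⟩ := h.exists_equiv
  let φ : dom Γ →* (⊤ : Subgroup S) := (Subgroup.inclusion le_top).comp e.toMonoidHom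
  have hφ : φ ∈ F.Hom (dom Γ) ⊤ :=
    F.comp_mem he (F.conj_mem le_top le_rfl 1 (one_mem _) _ (fun a => by simp))
  have hφe : ∀ a, (φ a : S) = e a := fun _ => rfl
  have him : image φ = im Γ := by
    ext b
    constructor
    · rintro ⟨a, rfl⟩
      exact (e a).2
    · intro hb
      exact ⟨e.symm ⟨b, hb⟩, by simp [φ]⟩
  obtain ⟨ψ, hψ, hext⟩ := hF.2 (dom Γ) φ hφ (by rwa [him])
  refine ⟨_, gr_of_hom hψ, ?_, fun z x hzx => ?_⟩
  · rintro ⟨b, a⟩ hab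
    have ha := mem_dom_of hab
    have ha' : a ∈ homNormalizer ⊤ φ := by
      refine ⟨⟨trivial, Subgroup.le_normalizer ha⟩, φ ⟨a, ha⟩, ⟨trivial, ?_⟩, fun h h' hh => ?_⟩
      · rw [him]
        exact Subgroup.le_normalizer (e ⟨a, ha⟩).2
      · have : h' = ⟨a, ha⟩ * h * ⟨a, ha⟩⁻¹ := Subtype.ext hh
        rw [this]
        simp
    refine ⟨⟨a, ha'⟩, Prod.ext ?_ rfl⟩
    change (ψ ⟨a, ha'⟩ : S) = b
    rw [hext ⟨a, ha⟩ ⟨a, ha'⟩ rfl, hφe]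
    exact h.functional (hm _) hab
  · obtain ⟨hz, hx⟩ := normalizer_dom_im hzx
    have hx' : x ∈ homNormalizer ⊤ φ := by
      refine ⟨⟨trivial, hx⟩, z, ⟨trivial, by rwa [him]⟩, fun a a' haa' => ?_⟩
      rw [hφe, hφe]
      refine h.functional (hm a') ?_
      rw [haa']
      exact conj_mem_of_normalizer hzx (hm a)
    exact mem_dom_of (b := (ψ ⟨x, hx'⟩ : S)) ⟨⟨x, hx'⟩, rfl⟩

theorem exists_fullyNormalized [Finite S] {Q : Subgroup S} {E : FusionSystem Q} {K : Subgroup S}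
    (hK : K ≤ Q) : ∃ L, E.Conj K L ∧ E.FullyNormalized L := by
  obtain ⟨L, hL, hmax⟩ := Set.exists_max_image {L | E.Conj K L}
    (fun L => Nat.card (normalizerIn Q L)) (Set.toFinite _) ⟨K, conj_refl hK⟩
  exact ⟨L, hL, hL.le.2, fun J hJ => hmax J (hL.trans hJ.symm)⟩

/-- Every `p`-group of automorphisms of `D` in `F` is realized by conjugation in `S` on any fully
normalized subgroup that is isomorphic to `D`. -/
def LiftsAut (F : FusionSystem (⊤ : Subgroup S)) (p : ℕ) (D : Subgroup S) : Prop :=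
  ∀ K, F.Conj D K → F.FullyNormalized K →
    ∀ A : Subgroup (MulAut D), A ≤ F.aut D le_top → IsPGroup p A →
    ∃ Γ, F.Gr Γ ∧ dom Γ = D ∧ im Γ = K ∧
      ∀ e ∈ A, ∃ s : S, ∀ (b a : S) (h : a ∈ D), (b, a) ∈ Γ → (s * b * s⁻¹, (e ⟨a, h⟩ : S)) ∈ Γ

/-- The automorphisms of `K` induced by `S` form a Sylow `p`-subgroup of `Aut_F(K)`. -/
def FullyAutomized (F : FusionSystem (⊤ : Subgroup S)) (p : ℕ) (K : Subgroup S) : Prop :=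
  ∀ A : Subgroup (MulAut K), A ≤ F.aut K le_top → IsPGroup p A → autIn K ≤ A → A ≤ autIn K

theorem autIn_le_aut (K : Subgroup S) : autIn K ≤ F.aut K le_top := by
  rintro e ⟨s, hs⟩
  exact F.conj_mem le_top le_top s trivial _ hs

theorem isPGroup_autIn [Finite S] (hS : IsPGroup p S) (K : Subgroup S) :
    IsPGroup p (autIn K) := by
  rintro ⟨e, s, hs⟩
  obtain ⟨k, hk⟩ := hS s
  refine ⟨k, Subtype.ext ?_⟩
  have h : ∀ n : ℕ, ∀ a : K, ((e ^ n) a : S) = s ^ n * a * (s ^ n)⁻¹ := by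
    intro n
    induction n with
    | zero => simp
    | succ n ih =>
      intro a
      rw [pow_succ', MulAut.mul_apply, hs, ih, pow_succ']
      group
  change e ^ p ^ k = 1
  ext a
  rw [h, hk]
  simp

theorem liftsAut_of_fullyAutomized [Finite S] [Fact p.Prime] (hS : IsPGroup p S) {D : Subgroup S}
    (ha : ∀ K, F.Conj D K → F.FullyNormalized K → FullyAutomized F p K) :
    LiftsAut F p D := by
  intro K hDK hK A hA hAp
  replace ha := ha K hDK hK
  obtain ⟨e₀, he₀⟩ := hDK
  have he₀' : F.IsIso e₀.symm := (F.iso_mem (φ := e₀.toMonoidHom) he₀ e₀ (fun _ => rfl)).2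
  let c : MulAut D →* MulAut K := (MulAut.congr e₀).toMonoidHom
  have hc : ∀ e a, c e (e₀ a) = e₀ (e a) := fun e a => by simp [c, MulAut.congr]
  have hcA : A.map c ≤ F.aut K le_top := by
    rintro _ ⟨e, he, rfl⟩
    have h1 := F.comp_mem he₀' (F.comp_mem (hA he) he₀)
    exact h1
  let T : Sylow p (F.aut K le_top) :=
    { toSubgroup := (autIn K).subgroupOf _
      isPGroup' := (isPGroup_autIn hS K).comap_of_injective _ (Subgroup.subtype_injective _)
      is_maximal' := by
        intro B hB hle
        refine le_antisymm (fun b hb => ?_) hle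
        refine ha (B.map (Subgroup.subtype _)) ?_ (hB.map _) ?_ (Subgroup.mem_map_of_mem _ hb)
        · rintro _ ⟨x, -, rfl⟩
          exact x.2
        · intro x hx
          exact ⟨⟨x, autIn_le_aut K hx⟩, hle hx, rfl⟩ }
  have hp : IsPGroup p ((A.map c).subgroupOf (F.aut K le_top)) :=
    (hAp.map c).comap_of_injective _ (Subgroup.subtype_injective _)
  obtain ⟨T', hT'⟩ := hp.exists_le_sylow
  obtain ⟨g, rfl⟩ := MulAction.exists_smul_eq (F.aut K le_top) T T'
  let χ : MulAut K := (g⁻¹ : F.aut K le_top)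
  have hχ : F.IsIso χ := (g⁻¹).2
  have hf : F.IsIso (e₀.trans χ) := F.comp_mem he₀ hχ
  refine ⟨egr (e₀.trans χ), gr_egr hf, dom_egr _, im_egr _, fun e he => ?_⟩
  have h1 := hT' (show (⟨c e, hcA (Subgroup.mem_map_of_mem c he)⟩ : F.aut K le_top) ∈ _ from
    Subgroup.mem_map_of_mem c he)
  obtain ⟨t, ⟨s, hs⟩, ht⟩ := h1
  have ht' : c e * (g : MulAut K) = (g : MulAut K) * (t : MulAut K) := by
    have := congrArg Subtype.val ht
    change (g : MulAut K) * t * (g : MulAut K)⁻¹ = c e at this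
    rw [← this]
    simp
  refine ⟨s, fun b a h hab => ?_⟩
  obtain ⟨_, rfl⟩ := mem_egr.1 hab
  refine mem_egr.2 ⟨(e _).2, ?_⟩
  have h3 : χ (e₀ (e ⟨a, h⟩)) = (t : MulAut K) (χ (e₀ ⟨a, h⟩)) := by
    rw [← hc]
    have h4 : χ * c e = t * χ := by
      change (g : MulAut K)⁻¹ * c e = t * (g : MulAut K)⁻¹
      rw [inv_mul_eq_iff_eq_mul, ← mul_assoc, ← ht']
      simp
    exact DFunLike.congr_fun h4 _
  have h5 := hs (χ (e₀ ⟨a, h⟩))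
  change ((χ (e₀ (e ⟨a, h⟩)) : K) : S) = _
  rw [h3]
  exact h5

theorem fullyAutomized_top (hF : F.Saturated p) : FullyAutomized F p (⊤ : Subgroup S) := by
  intro A hA hAp hle
  obtain ⟨T, hT⟩ := hF.1
  have hT' : (T : Subgroup (F.aut ⊤ le_rfl)).map (Subgroup.subtype _) = autIn ⊤ := by
    rw [hT]
    ext e
    constructor
    · rintro ⟨s, rfl⟩
      exact ⟨s, fun a => rfl⟩
    · rintro ⟨s, hs⟩
      exact ⟨⟨s, trivial⟩, MulEquiv.ext (fun a => Subtype.ext (hs a).symm)⟩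
  have h1 := T.is_maximal' (Q := A.subgroupOf _)
    (hAp.comap_of_injective _ (Subgroup.subtype_injective _)) (by
      intro x hx
      exact hle (hT' ▸ Subgroup.mem_map_of_mem _ hx))
  intro e he
  have h2 : (⟨e, hA he⟩ : F.aut ⊤ le_rfl) ∈ A.subgroupOf (F.aut ⊤ le_rfl) := he
  rw [h1] at h2
  rw [← hT']
  exact Subgroup.mem_map_of_mem (Subgroup.subtype _) h2

theorem fullyAutomized_of_lt [Finite S] [Fact p.Prime] (hS : IsPGroup p S) (hF : F.Saturated p)
    {K : Subgroup S} (hK : F.FullyNormalized K)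
    (ih : ∀ N : Subgroup S, Nat.card K < Nat.card N → LiftsAut F p N) (hKt : K ≠ ⊤) :
    FullyAutomized F p K := by
  intro A hA hAp hle
  by_contra hnot
  -- an automorphism normalizing the inner ones
  obtain ⟨φ, hφA, hφn, hφ⟩ : ∃ φ ∈ A, (∀ e ∈ autIn K, φ * e * φ⁻¹ ∈ autIn K) ∧ φ ∉ autIn K := by
    have := hAp.isNilpotent
    have h1 := Group.normalizerCondition_of_isNilpotent (G := A) ((autIn K).subgroupOf A) (by
      rw [lt_top_iff_ne_top, ne_eq, Subgroup.subgroupOf_eq_top]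
      exact hnot)
    obtain ⟨φ, h2, h3⟩ := SetLike.exists_of_lt h1
    refine ⟨φ, φ.2, fun e he => ?_, h3⟩
    exact conj_mem_of_normalizer (x := (⟨e, hle he⟩ : A)) h2 he
  have hgr : F.Gr (egr φ) := gr_egr (hA hφA)
  set N := Subgroup.normalizer (K : Set S) with hN
  have hKN : K ≤ N := Subgroup.le_normalizer
  obtain ⟨Δ, hΔ, hle', hdom⟩ := hF.exists_extension hgr (by rwa [im_egr])
  have hND : N ≤ dom Δ := by
    intro x hx
    obtain ⟨e, he, hex⟩ := exists_autIn hx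
    obtain ⟨z, hz⟩ := hφn e he
    refine hdom z x (mem_normalizer_graph fun b a hab => ?_)
    obtain ⟨h, rfl⟩ := mem_egr.1 hab
    refine mem_egr.2 ⟨conj_mem_of_normalizer hx h, ?_⟩
    rw [← hz]
    have : (⟨x * a * x⁻¹, conj_mem_of_normalizer hx h⟩ : K) = e ⟨a, h⟩ := Subtype.ext (hex ⟨a, h⟩).symm
    rw [this]
    simp
  have hd : dom (rres Δ N) = N := dom_rres hND
  have hΔ' : F.Gr (rres Δ N) := hΔ.mono (rres_le _ _)
  have hi : im (rres Δ N) = N := by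
    refine Subgroup.eq_of_le_of_card_ge (fun z hz => ?_) ?_
    · obtain ⟨x, hzx, hx⟩ := mem_im.1 hz
      refine mem_normalizer_of_forall fun k hk => ?_
      obtain ⟨k', hk'⟩ := φ.surjective ⟨k, hk⟩
      have h1 : (k, (k' : S)) ∈ Δ := hle' (mem_egr.2 ⟨k'.2, by simp [hk']⟩)
      have h2 : (z * k * z⁻¹, x * k' * x⁻¹) ∈ Δ := Δ.mul_mem (Δ.mul_mem hzx h1) (Δ.inv_mem hzx)
      have h3 : x * k' * x⁻¹ ∈ K := conj_mem_of_normalizer hx k'.2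
      rw [hΔ.functional h2 (hle' (mem_egr.2 ⟨h3, rfl⟩))]
      exact (φ _).2
    · rw [← hΔ'.card_eq, hd]
  obtain ⟨ψ, hψ, hψe⟩ := hΔ'.exists_equiv_of_eq hd hi
  let ψ' : MulAut N := ψ
  have hψφ : ∀ k : K, ∀ n : ℕ, ((ψ' ^ n) ⟨k, hKN k.2⟩ : S) = (φ ^ n) k := by
    intro k n
    induction n with
    | zero => simp
    | succ n ih =>
      rw [pow_succ', pow_succ', MulAut.mul_apply, MulAut.mul_apply]
      have h1 : (ψ' ^ n) ⟨k, hKN k.2⟩ = ⟨(φ ^ n) k, hKN ((φ ^ n) k).2⟩ := Subtype.ext ih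
      rw [h1]
      have h2 : ((φ ((φ ^ n) k) : S), ((φ ^ n) k : S)) ∈ rres Δ N :=
        ⟨hle' (mem_egr.2 ⟨((φ ^ n) k).2, rfl⟩), hKN ((φ ^ n) k).2⟩
      rw [← hψe] at h2
      exact (mem_egr.1 h2).2
  obtain ⟨e, m, hm, hem⟩ := Nat.exists_eq_pow_mul_and_not_dvd (orderOf_pos ψ').ne' p
    (Fact.out : p.Prime).ne_one
  have hφm : φ ^ m ∉ autIn K := by
    intro h
    obtain ⟨k, hk⟩ := IsPGroup.iff_orderOf.1 hAp ⟨φ, hφA⟩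
    rw [Subgroup.orderOf_mk] at hk
    have hc : m.Coprime (orderOf φ) := by
      rw [hk]
      exact (((Fact.out : p.Prime).coprime_iff_not_dvd.2 hm).pow_left k).symm
    obtain ⟨j, hj⟩ := exists_pow_eq_self_of_coprime hc
    exact hφ (hj ▸ (autIn K).pow_mem h j)
  have hlt : Nat.card K < Nat.card N := by
    have := hS.isNilpotent
    have h1 := Group.normalizerCondition_of_isNilpotent (G := S) K (lt_top_iff_ne_top.2 hKt)
    refine lt_of_le_of_ne (Subgroup.card_le_of_le hKN) (fun h => h1.ne ?_)
    exact Subgroup.eq_of_le_of_card_ge hKN h.ge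
  obtain ⟨L, hNL, hL⟩ := exists_fullyNormalized (E := F) (le_top : N ≤ ⊤)
  obtain ⟨Γ, hΓ, hΓd, -, hΓs⟩ := ih N hlt L hNL hL (Subgroup.zpowers (ψ' ^ m))
    ((Subgroup.zpowers_le).2 (Subgroup.pow_mem _ hψ m)) (by
      intro g
      refine ⟨e, Subtype.ext ?_⟩
      obtain ⟨g, j, rfl⟩ := g
      change ((ψ' ^ m) ^ j) ^ p ^ e = 1
      rw [← zpow_natCast, ← zpow_mul, mul_comm, zpow_mul, zpow_natCast, ← pow_mul, mul_comm m,
        ← hem, pow_orderOf_eq_one, one_zpow])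
  obtain ⟨s, hs⟩ := hΓs _ (Subgroup.mem_zpowers _)
  set K₂ := im (rres Γ K) with hK₂
  have hdK : dom (rres Γ K) = K := dom_rres (by rw [hΓd]; exact hKN)
  have hconj : F.Conj K₂ K := by
    have := (hΓ.mono (rres_le Γ K)).conj.symm
    rwa [hdK] at this
  have hle₂ : im Γ ≤ Subgroup.normalizer (K₂ : Set S) := by
    intro b hb
    obtain ⟨a, hab⟩ := mem_im.1 hb
    refine mem_normalizer_of_forall fun k hk => ?_
    obtain ⟨k', hk', hkK⟩ := mem_im.1 hk
    refine mem_im.2 ⟨a * k' * a⁻¹, Γ.mul_mem (Γ.mul_mem hab hk') (Γ.inv_mem hab), ?_⟩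
    exact conj_mem_of_normalizer (hΓd.le (mem_dom_of hab) : a ∈ N) hkK
  have heq : im Γ = Subgroup.normalizer (K₂ : Set S) := by
    refine Subgroup.eq_of_le_of_card_ge hle₂ ?_
    have := hK.2 K₂ hconj
    simp only [normalizerIn, top_inf_eq] at this
    rwa [← hΓ.card_eq, hΓd]
  have hψK : ∀ k (hk : k ∈ K), (((ψ' ^ m) ⟨k, hKN hk⟩ : N) : S) ∈ K := by
    intro k hk
    have := hψφ ⟨k, hk⟩ m
    rw [this]
    exact ((φ ^ m) _).2
  have hsN : s ∈ im Γ := by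
    rw [heq]
    refine mem_normalizer_of_forall fun k hk => ?_
    obtain ⟨k', hk', hkK⟩ := mem_im.1 hk
    exact mem_im.2 ⟨_, hs _ _ (hKN hkK) hk', hψK k' hkK⟩
  obtain ⟨y, hy⟩ := mem_im.1 hsN
  refine hφm ⟨y, fun k => ?_⟩
  rw [← hψφ k m]
  obtain ⟨b, hb⟩ := mem_dom.1 (hΓd.symm ▸ hKN k.2 : (k : S) ∈ dom Γ)
  exact hΓ.injective (hs _ _ (hKN k.2) hb) (Γ.mul_mem (Γ.mul_mem hy hb) (Γ.inv_mem hy))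

theorem Saturated.liftsAut [Finite S] [Fact p.Prime] (hS : IsPGroup p S) (hF : F.Saturated p)
    (D : Subgroup S) : LiftsAut F p D := by
  induction hn : Nat.card S - Nat.card D using Nat.strong_induction_on generalizing D with
  | _ n ih =>
    refine liftsAut_of_fullyAutomized hS (fun K hDK hK => ?_)
    by_cases hKt : K = ⊤
    · subst hKt
      exact fullyAutomized_top hF
    · refine fullyAutomized_of_lt hS hF hK (fun N hN => ih _ ?_ N rfl) hKt
      have h1 : Nat.card N ≤ Nat.card S := Subgroup.card_le_card_group N
      rw [← hDK.card_eq] at hN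
      omega

end FusionSystem

end Saturation

end CentricMackey

namespace CentricMackey

section CentricExtension

variable {S : Type u} [Group S] [Finite S] {p : ℕ} [Fact p.Prime]

theorem isPGroup_prod (hS : IsPGroup p S) : IsPGroup p (S × S) := by
  rintro ⟨x, y⟩
  obtain ⟨k, hk⟩ := hS x
  obtain ⟨l, hl⟩ := hS y
  refine ⟨k + l, Prod.ext ?_ ?_⟩
  · change x ^ p ^ (k + l) = 1
    rw [pow_add, pow_mul, hk, one_pow]
  · change y ^ p ^ (k + l) = 1
    rw [add_comm, pow_add, pow_mul, hl, one_pow]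

theorem lt_inf_normalizer {G : Type*} [Group G] [Finite G] (hG : IsPGroup p G) {H K : Subgroup G}
    (h : H < K) : H < K ⊓ Subgroup.normalizer (H : Set G) := by
  refine lt_of_le_of_ne (le_inf h.le Subgroup.le_normalizer) (fun heq => ?_)
  have := (hG.to_subgroup K).isNilpotent
  have h1 := Group.normalizerCondition_of_isNilpotent (G := K) (H.subgroupOf K) (by
    rw [lt_top_iff_ne_top, ne_eq, Subgroup.subgroupOf_eq_top]
    exact h.not_ge)
  obtain ⟨x, hx, hx'⟩ := SetLike.exists_of_lt h1
  refine hx' ?_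
  rw [Subgroup.mem_subgroupOf, heq]
  refine ⟨x.2, mem_normalizer_of_forall fun y hy => ?_⟩
  exact conj_mem_of_normalizer (x := (⟨y, h.le hy⟩ : K)) hx hy

theorem conj_pair_mem {Γ : Subgroup (S × S)} {y x b a : S} (h : (y, x) ∈ Γ) (h' : (b, a) ∈ Γ) :
    (y * b * y⁻¹, x * a * x⁻¹) ∈ Γ :=
  Γ.mul_mem (Γ.mul_mem h h') (Γ.inv_mem h)

theorem im_rcomp_eq (Γ Δ : Subgroup (S × S)) : im (rcomp Γ Δ) = im (rres Γ (im Δ)) := by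
  ext b
  simp only [mem_im, mem_rcomp, mem_rres]
  constructor
  · rintro ⟨a, c, h1, h2⟩
    exact ⟨c, h1, a, h2⟩
  · rintro ⟨c, h1, a, h2⟩
    exact ⟨a, c, h1, h2⟩

namespace FusionSystem

variable {F : FusionSystem (⊤ : Subgroup S)}

theorem Centric.mem_of_commute {D : Subgroup S} (h : F.Centric D) {s : S}
    (hs : ∀ d ∈ D, s * d * s⁻¹ = d) : s ∈ D := by
  refine h.2 D (conj_refl le_top) ⟨trivial, Subgroup.mem_centralizer_iff.2 fun d hd => ?_⟩
  have := hs d hd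
  exact (mul_inv_eq_iff_eq_mul.1 this).symm

theorem Saturated.exists_gr_normalizer (hS : IsPGroup p S) (hF : F.Saturated p) {K H : Subgroup S}
    (hKH : F.Conj K H) (hH : F.FullyNormalized H) :
    ∃ Γ, F.Gr Γ ∧ dom Γ = Subgroup.normalizer (K : Set S) ∧ im (rres Γ K) = H := by
  obtain ⟨Γ, hΓ, rfl, rfl, hs⟩ := hF.liftsAut hS K H hKH hH (autIn K) (autIn_le_aut K)
    (isPGroup_autIn hS K)
  obtain ⟨Δ, hΔ, hle, hd⟩ := hF.exists_extension hΓ hH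
  have hN : Subgroup.normalizer (dom Γ : Set S) ≤ dom Δ := by
    intro x hx
    obtain ⟨e, he, hex⟩ := exists_autIn hx
    obtain ⟨s, hs⟩ := hs e he
    refine hd s x (mem_normalizer_graph fun b a hab => ?_)
    have := hs b a (mem_dom_of hab) hab
    rwa [hex] at this
  have hle' : Γ ≤ rres Δ (Subgroup.normalizer (dom Γ : Set S)) := fun ⟨b, a⟩ h =>
    ⟨hle h, Subgroup.le_normalizer (mem_dom_of h)⟩
  exact ⟨_, hΔ.mono (rres_le _ _), dom_rres hN,
    by rw [(hΔ.mono (rres_le _ _)).rres_eq_of_le hle']⟩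

/-- Morphisms between centric subgroups extend as far as possible. -/
theorem Saturated.exists_extension_of_centric (hS : IsPGroup p S) (hF : F.Saturated p)
    {Γ : Subgroup (S × S)} (h : F.Gr Γ) (hc : F.Centric (dom Γ)) :
    ∃ Δ, F.Gr Δ ∧ Γ ≤ Δ ∧ ∀ z x, (z, x) ∈ Subgroup.normalizer (Γ : Set (S × S)) →
      ∃ c ∈ im Γ, (z * c, x) ∈ Δ := by
  obtain ⟨H, hconj, hH⟩ := exists_fullyNormalized (E := F) (le_top : im Γ ≤ ⊤)
  obtain ⟨κ, hκ, hκd, hκi⟩ := hF.exists_gr_normalizer hS hconj hH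
  have hΓ' := hκ.rcomp h
  have him : im (rcomp κ Γ) = H := by rw [im_rcomp_eq, hκi]
  have hle : im Γ ≤ dom κ := by
    rw [hκd]
    exact Subgroup.le_normalizer
  have hdom : dom (rcomp κ Γ) = dom Γ := dom_rcomp hle
  obtain ⟨Δ, hΔ, hΓΔ, hd⟩ := hF.exists_extension hΓ' (by rwa [him])
  refine ⟨rcomp (rinv κ) Δ, hκ.rinv.rcomp hΔ, ?_, fun z x hzx => ?_⟩
  · rintro ⟨b, a⟩ hab
    obtain ⟨c, hc⟩ := mem_dom.1 (hle (mem_im_of hab))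
    exact ⟨c, hc, hΓΔ ⟨b, hc, hab⟩⟩
  · obtain ⟨z', hz'⟩ := mem_dom.1 (hκd.ge (normalizer_dom_im hzx).1 : z ∈ dom κ)
    have hkey : ∀ b a, (b, a) ∈ rcomp κ Γ → (z' * b * z'⁻¹, x * a * x⁻¹) ∈ rcomp κ Γ := by
      rintro b a ⟨c, h1, h2⟩
      exact ⟨z * c * z⁻¹, κ.mul_mem (κ.mul_mem hz' h1) (κ.inv_mem hz'),
        conj_mem_of_normalizer hzx h2⟩
    obtain ⟨x', hx'⟩ := mem_dom.1 (hd z' x (mem_normalizer_graph hkey))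
    have hmem : z'⁻¹ * x' ∈ im (rcomp κ Γ) := by
      refine (hΓ'.centric_im (by rwa [hdom])).mem_of_commute fun b hb => ?_
      obtain ⟨a, hab⟩ := mem_im.1 hb
      have := hΔ.functional (hΓΔ (hkey b a hab))
        (conj_pair_mem hx' (hΓΔ hab))
      calc z'⁻¹ * x' * b * (z'⁻¹ * x')⁻¹ = z'⁻¹ * (x' * b * x'⁻¹) * z' := by group
        _ = z'⁻¹ * (z' * b * z'⁻¹) * z' := by rw [this]
        _ = b := by group
    obtain ⟨a, c, h1, h2⟩ := mem_im.1 hmem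
    refine ⟨c, mem_im_of h2, x', ?_, hx'⟩
    have := κ.mul_mem hz' h1
    simpa [mem_rinv] using this

theorem Saturated.exists_conj_of_normal (hS : IsPGroup p S) (hF : F.Saturated p)
    {Γ Γ₁ Γ₂ : Subgroup (S × S)} (h₁ : F.Gr Γ₁) (h₂ : F.Gr Γ₂) (hle₁ : Γ ≤ Γ₁) (hle₂ : Γ ≤ Γ₂)
    (hd : dom Γ₁ = dom Γ₂) (hc : F.Centric (dom Γ))
    (hn : Γ₁ ≤ Subgroup.normalizer (Γ : Set (S × S))) :
    ∃ z ∈ im Γ, (∀ b ∈ im Γ, z * b * z⁻¹ = b) ∧ cj z 1 Γ₁ = Γ₂ := by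
  have hΓ : F.Gr Γ := h₁.mono hle₁
  have hci := hΓ.centric_im hc
  set Δ := rcomp Γ₂ (rinv Γ₁) with hΔdef
  have hΔ : F.Gr Δ := h₂.rcomp h₁.rinv
  have hdΔ : dom Δ = im Γ₁ := by
    rw [hΔdef, dom_rcomp (by rw [im_rinv, hd]), dom_rinv]
  have hfix : ∀ b ∈ im Γ, (b, b) ∈ Δ := by
    intro b hb
    obtain ⟨a, ha⟩ := mem_im.1 hb
    exact ⟨a, hle₂ ha, hle₁ ha⟩
  have hζ : ∀ y x, (y, x) ∈ Δ → x⁻¹ * y ∈ im Γ := by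
    rintro y x ⟨a, h1, h2⟩
    replace h2 : (x, a) ∈ Γ₁ := h2
    replace h1 : (y, a) ∈ Γ₂ := h1
    refine hci.mem_of_commute fun b hb => ?_
    obtain ⟨c, hc⟩ := mem_im.1 hb
    have e1 : (x * b * x⁻¹, a * c * a⁻¹) ∈ Γ₂ := hle₂ (conj_mem_of_normalizer (hn h2) hc)
    have := h₂.functional e1 (conj_pair_mem h1 (hle₂ hc))
    calc x⁻¹ * y * b * (x⁻¹ * y)⁻¹ = x⁻¹ * (y * b * y⁻¹) * x := by group
      _ = x⁻¹ * (x * b * x⁻¹) * x := by rw [this]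
      _ = b := by group
  have hiΔ : im Δ = im Γ₁ := by
    refine Subgroup.eq_of_le_of_card_ge (fun y hy => ?_) ?_
    · obtain ⟨x, hx⟩ := mem_im.1 hy
      have h1 : x ∈ im Γ₁ := hdΔ ▸ mem_dom_of hx
      have := (im Γ₁).mul_mem h1 (im_mono hle₁ (hζ y x hx))
      simpa using this
    · rw [← hΔ.card_eq, hdΔ]
  obtain ⟨e, he, hee⟩ := hΔ.exists_equiv_of_eq hdΔ hiΔ
  let e' : MulAut (im Γ₁) := e
  have hme : ∀ x : im Γ₁, ((e' x : S), (x : S)) ∈ Δ := fun x => by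
    rw [← hee]; exact mem_egr.2 ⟨x.2, rfl⟩
  have hefix : ∀ x : im Γ₁, (x : S) ∈ im Γ → e' x = x := fun x hx =>
    Subtype.ext (hΔ.functional (hme x) (hfix x hx))
  have hpow : ∀ (n : ℕ) (x : im Γ₁), ((e' ^ n) x : S) = x * ((x : S)⁻¹ * e' x) ^ n := by
    intro n x
    induction n with
    | zero => simp
    | succ n ih =>
      have hz := hζ _ _ (hme x)
      set ζ : im Γ₁ := x⁻¹ * e' x with hζdef
      have h1 : (e' ^ n) x = x * ζ ^ n := Subtype.ext ih
      have h2 : e' ζ = ζ := hefix ζ hz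
      rw [pow_succ', MulAut.mul_apply, h1, map_mul, map_pow, h2]
      have h3 : e' x = x * ζ := by simp [hζdef]
      rw [h3]
      simp [pow_succ', mul_assoc]
  obtain ⟨k, hk⟩ := IsPGroup.iff_card.1 hS
  have hek : e' ^ p ^ k = 1 := by
    ext x
    rw [hpow, ← hk, pow_card_eq_one']
    simp
  obtain ⟨L, hL, hLn⟩ := exists_fullyNormalized (E := F) (le_top : im Γ₁ ≤ ⊤)
  obtain ⟨Θ, hΘ, hΘd, -, hΘs⟩ := hF.liftsAut hS _ L hL hLn (Subgroup.zpowers e')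
    ((Subgroup.zpowers_le).2 he) (by
      rintro ⟨g, j, rfl⟩
      refine ⟨k, Subtype.ext ?_⟩
      change (e' ^ j) ^ p ^ k = 1
      rw [← zpow_natCast, ← zpow_mul, mul_comm, zpow_mul, zpow_natCast, hek, one_zpow])
  obtain ⟨s, hs⟩ := hΘs _ (Subgroup.mem_zpowers _)
  have hdr : dom (rres Θ (im Γ)) = im Γ := dom_rres (by rw [hΘd]; exact im_mono hle₁)
  have hsmem : s ∈ im (rres Θ (im Γ)) := by
    refine ((hΘ.mono (rres_le _ _)).centric_im (by rwa [hdr])).mem_of_commute fun c hc => ?_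
    obtain ⟨b, hb, hbΓ⟩ := mem_im.1 hc
    have h1 := hs c b (im_mono hle₁ hbΓ) hb
    rw [hefix ⟨b, im_mono hle₁ hbΓ⟩ hbΓ] at h1
    exact hΘ.functional h1 hb
  obtain ⟨z, hsz, hz⟩ := mem_im.1 hsmem
  have hez : ∀ x : im Γ₁, (e' x : S) = z * x * z⁻¹ := by
    intro x
    obtain ⟨c, hc⟩ := mem_dom.1 (hΘd.ge x.2)
    exact hΘ.injective (hs c x x.2 hc) (conj_pair_mem hsz hc)
  refine ⟨z, hz, fun b hb => ?_, ?_⟩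
  · rw [← hez ⟨b, im_mono hle₁ hb⟩, hefix _ hb]
  · refine h₂.eq_of_le_of_dom_le ?_ ?_
    · rintro ⟨b, a⟩ hab
      rw [mem_cj] at hab
      have h1 : (z⁻¹ * b * z, a) ∈ Γ₁ := by simpa using hab
      have h2 := hme ⟨_, mem_im_of h1⟩
      rw [hez] at h2
      obtain ⟨a', h3, h4⟩ := h2
      have h5 : a' = a := h₁.injective h4 h1
      rw [h5] at h3
      simpa [mul_assoc] using h3
    · rw [← hd]
      intro a ha
      obtain ⟨b, hb⟩ := mem_dom.1 ha
      exact mem_dom_of (b := z * b * z⁻¹) (mem_cj.2 (by simpa [mul_assoc] using hb))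

/-- Two extensions of a morphism from a centric subgroup differ by conjugation with an element of
its center. -/
theorem Saturated.exists_conj_of_le (hS : IsPGroup p S) (hF : F.Saturated p)
    {Γ Γ₁ Γ₂ : Subgroup (S × S)} (h₁ : F.Gr Γ₁) (h₂ : F.Gr Γ₂) (hle₁ : Γ ≤ Γ₁) (hle₂ : Γ ≤ Γ₂)
    (hd : dom Γ₁ = dom Γ₂) (hc : F.Centric (dom Γ)) :
    ∃ z ∈ im Γ, (∀ b ∈ im Γ, z * b * z⁻¹ = b) ∧ cj z 1 Γ₁ = Γ₂ := by
  induction hn : Nat.card (S × S) - Nat.card Γ using Nat.strong_induction_on generalizing Γ Γ₁ with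
  | _ n ih =>
    rcases hle₁.eq_or_lt with rfl | hlt
    · refine ⟨1, one_mem _, by simp, ?_⟩
      rw [cj_one, h₂.eq_of_le_of_dom_le hle₂ hd.ge]
    · set M := Γ₁ ⊓ Subgroup.normalizer (Γ : Set (S × S)) with hM
      have hΓM : Γ < M := lt_inf_normalizer (isPGroup_prod hS) hlt
      have hMd : dom M ≤ dom Γ₂ := (dom_mono inf_le_left).trans hd.le
      have hΓ₂ : Γ ≤ rres Γ₂ (dom M) := fun ⟨b, a⟩ h =>
        ⟨hle₂ h, mem_dom_of (hΓM.le h)⟩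
      obtain ⟨z, hz, hzc, hzM⟩ := hF.exists_conj_of_normal hS (h₁.mono inf_le_left)
        (h₂.mono (rres_le Γ₂ (dom M))) hΓM.le hΓ₂ (dom_rres hMd).symm hc inf_le_right
      have hle' : rres Γ₂ (dom M) ≤ cj z 1 Γ₁ := by
        rw [← hzM]
        exact cj_mono _ _ inf_le_left
      have hcard : Nat.card M = Nat.card (rres Γ₂ (dom M)) := by
        rw [← hzM]
        exact (Subgroup.card_map_of_injective (MulAut.conj (z, (1 : S))).injective).symm
      have hdz : dom (cj z 1 Γ₁) = dom Γ₁ := by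
        rw [dom_cj]
        ext a
        simp
      have hlt' : Nat.card Γ < Nat.card M :=
        lt_of_le_of_ne (Subgroup.card_le_of_le hΓM.le)
          (fun h => hΓM.ne (Subgroup.eq_of_le_of_card_ge hΓM.le h.ge))
      have hMle : Nat.card M ≤ Nat.card (S × S) := Subgroup.card_le_card_group M
      obtain ⟨z', hz', hzc', hzz⟩ := ih (Nat.card (S × S) - Nat.card M) (by omega)
        (h₁.cj trivial trivial) hle' (rres_le _ _) (hdz.trans hd)
        (hc.mono (dom_mono hΓ₂) le_top) (by rw [hcard])
      have hcomm : ∀ b ∈ im Γ, z' * b * z'⁻¹ = b := fun b hb => hzc' b (im_mono hΓ₂ hb)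
      have hz'Γ : z' ∈ im Γ :=
        ((h₁.mono hle₁).centric_im hc).mem_of_commute hcomm
      refine ⟨z' * z, mul_mem hz'Γ hz, fun b hb => ?_, ?_⟩
      · calc z' * z * b * (z' * z)⁻¹ = z' * (z * b * z⁻¹) * z'⁻¹ := by group
          _ = b := by rw [hzc b hb, hcomm b hb]
      · rw [← hzz, cj_cj, one_mul]

end FusionSystem

end CentricExtension

end CentricMackey

namespace CentricMackey

section CentricallySaturated

variable {S : Type u} [Group S]

/-- The properties of a subsystem `E` of `F` that are needed for the Mackey formula: `E` contains
all extensions in `F` of its morphisms between `F`-centric subgroups, and `p`-groups of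
automorphisms in `E` of an `F`-centric subgroup are realized by conjugation in `Q` on an isomorphic
subgroup. -/
structure IsCentricallySaturated (p : ℕ) (F : FusionSystem (⊤ : Subgroup S)) {Q : Subgroup S}
    (E : FusionSystem Q) : Prop where
  le : E.IsSubsystem F
  full : ∀ {Γ Δ : Subgroup (S × S)}, E.Gr Γ → F.Centric (dom Γ) → Γ ≤ Δ → F.Gr Δ → dom Δ ≤ Q →
    im Δ ≤ Q → E.Gr Δ
  lift : ∀ {D : Subgroup S}, D ≤ Q → F.Centric D → ∀ A : Subgroup (MulAut D),
    (∀ e ∈ A, E.IsIso e) → IsPGroup p A → ∃ τ, E.Gr τ ∧ dom τ = D ∧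
      ∀ e ∈ A, ∃ s ∈ Q, ∀ (b a : S) (h : a ∈ D), (b, a) ∈ τ → (s * b * s⁻¹, (e ⟨a, h⟩ : S)) ∈ τ

open FusionSystem

variable [Finite S] {p : ℕ} [Fact p.Prime] {F : FusionSystem (⊤ : Subgroup S)}

theorem dom_cj_one (z : S) (Γ : Subgroup (S × S)) : dom (cj z 1 Γ) = dom Γ := by
  rw [dom_cj]
  ext a
  simp

theorem isCentricallySaturated_self (hS : IsPGroup p S) (hF : F.Saturated p) :
    IsCentricallySaturated p F F where
  le _ _ := subset_rfl
  full _ _ _ h _ _ := h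
  lift {D} _ _ A hA hAp := by
    obtain ⟨L, hL, hLn⟩ := exists_fullyNormalized (E := F) (le_top : D ≤ ⊤)
    obtain ⟨Γ, hΓ, hd, -, hs⟩ := hF.liftsAut hS D L hL hLn A hA hAp
    refine ⟨Γ, hΓ, hd, fun e he => ?_⟩
    obtain ⟨s, hs⟩ := hs e he
    exact ⟨s, trivial, hs⟩

theorem isCentricallySaturated_inner (hS : IsPGroup p S) (hF : F.Saturated p) (J : Subgroup S) :
    IsCentricallySaturated p F (inner J) where
  le := inner_isSubsystem F le_top
  full {Γ Δ} h hc hle hΔ hd hi := by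
    obtain ⟨-, j, hj, hΓ⟩ := gr_inner_iff.1 h
    have h1 : (inner J).Gr (cgr j (dom Δ)) := gr_cgr hj hd
    obtain ⟨z, hz, -, hzΔ⟩ := hF.exists_conj_of_le hS
      (h1.of_isSubsystem (inner_isSubsystem F le_top)) hΔ
      (by conv_lhs => rw [hΓ]
          exact cgr_mono _ (dom_mono hle)) hle (dom_cgr _ _) hc
    rw [← hzΔ]
    exact h1.cj (h.im_le hz) (one_mem _)
  lift {D} hD hc A hA _ := by
    refine ⟨cgr 1 D, gr_cgr (one_mem _) hD, dom_cgr _ _, fun e he => ?_⟩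
    obtain ⟨-, -, j, hj, hej⟩ := hA e he
    refine ⟨j, hj, fun b a h hab => ?_⟩
    obtain ⟨-, rfl⟩ := mem_cgr.1 hab
    refine mem_cgr.2 ⟨(e _).2, ?_⟩
    have : (e ⟨a, h⟩ : S) = j * a * j⁻¹ := hej ⟨a, h⟩
    rw [this]
    simp

theorem FusionSystem.Gr.im_rres_eq_of_maps {X : Subgroup (S × S)} (hX : F.Gr X) {H : Subgroup S}
    (hH : H ≤ dom X) (hm : ∀ b a, (b, a) ∈ X → a ∈ H → b ∈ H) : im (rres X H) = H := by
  refine Subgroup.eq_of_le_of_card_ge ?_ ?_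
  · intro b hb
    obtain ⟨a, hab, ha⟩ := mem_im.1 hb
    exact hm b a hab ha
  · rw [← (hX.mono (rres_le _ _)).card_eq, dom_rres hH]

theorem FusionSystem.Gr.mem_of_maps {X : Subgroup (S × S)} (hX : F.Gr X) {H : Subgroup S}
    (hH : H ≤ dom X) (hm : ∀ b a, (b, a) ∈ X → a ∈ H → b ∈ H) {b a : S} (hab : (b, a) ∈ X)
    (hb : b ∈ H) : a ∈ H := by
  rw [← hX.im_rres_eq_of_maps hH hm] at hb
  obtain ⟨a', h1, h2⟩ := mem_im.1 hb
  rwa [hX.injective hab h1]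

theorem FusionSystem.Gr.exists_hom {Q : Subgroup S} {E : FusionSystem Q} {Γ : Subgroup (S × S)}
    (h : E.Gr Γ) {A B : Subgroup S} (hA : dom Γ = A) (hB : im Γ ≤ B) (hBQ : B ≤ Q) :
    ∃ φ ∈ E.Hom A B, ∀ a : A, ((φ a : S), (a : S)) ∈ Γ := by
  subst hA
  obtain ⟨e, he, hm⟩ := h.exists_equiv
  exact ⟨(Subgroup.inclusion hB).comp e.toMonoidHom,
    E.comp_mem he (E.conj_mem h.im_le hBQ 1 (one_mem _) _ (fun a => by simp)), hm⟩

theorem FusionSystem.Gr.im_rres_sup_le {X : Subgroup (S × S)} (hX : F.Gr X) {A B H : Subgroup S}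
    (hA : A ≤ dom X) (hH : H ≤ dom X) (hm : ∀ b a, (b, a) ∈ X → a ∈ H → b ∈ H)
    (hm' : ∀ b a, (b, a) ∈ X → a ∈ A → b ∈ B) : im (rres X (A ⊔ H)) ≤ B ⊔ H := by
  obtain ⟨e, -, he⟩ := hX.exists_equiv
  have h3 : A ⊔ H ≤ ((B ⊔ H).comap ((im X).subtype.comp e.toMonoidHom)).map (dom X).subtype := by
    refine sup_le (fun a ha => ?_) (fun a ha => ?_)
    · exact ⟨⟨a, hA ha⟩, (le_sup_left : B ≤ B ⊔ H) (hm' _ _ (he ⟨a, hA ha⟩) ha), rfl⟩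
    · exact ⟨⟨a, hH ha⟩, (le_sup_right : H ≤ B ⊔ H) (hm _ _ (he ⟨a, hH ha⟩) ha), rfl⟩
  intro b hb
  obtain ⟨a, hab, ha⟩ := mem_im.1 hb
  obtain ⟨x, hx, rfl⟩ := h3 ha
  rw [hX.functional hab (he x)]
  exact hx

/-- The isomorphisms of `N_F(H)` are those of `F` between subgroups of the normalizer that extend
to a morphism mapping `H` to itself. -/
theorem gr_normalizerSystem_iff {H : Subgroup S} {Γ : Subgroup (S × S)} :
    (normalizerFusion F H).Gr Γ ↔ dom Γ ≤ normalizerIn ⊤ H ∧ im Γ ≤ normalizerIn ⊤ H ∧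
      ∃ X, F.Gr X ∧ Γ ≤ X ∧ H ≤ dom X ∧ ∀ b a, (b, a) ∈ X → a ∈ H → b ∈ H := by
  constructor
  · intro h
    refine ⟨h.dom_le, h.im_le, ?_⟩
    obtain ⟨A, B, φ, ⟨hA, hB, hφ, ψ, hψ, h1, h2⟩, hΓ⟩ := h
    refine ⟨_, gr_of_hom hψ, ?_, ?_, ?_⟩
    · rintro ⟨b, a⟩ hab
      obtain ⟨ha, rfl⟩ := (hΓ _ _).1 hab
      exact ⟨⟨a, (le_sup_left : A ≤ A ⊔ H) ha⟩, Prod.ext (h1 ⟨a, ha⟩ _ rfl) rfl⟩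
    · intro a ha
      exact mem_dom_of (b := (ψ ⟨a, (le_sup_right : H ≤ A ⊔ H) ha⟩ : S)) ⟨_, rfl⟩
    · rintro b a ⟨x, hx⟩ ha
      obtain ⟨rfl, rfl⟩ := Prod.ext_iff.1 hx
      change _ ∈ (H : Set S)
      rw [← h2]
      exact ⟨x, ha, rfl⟩
  · rintro ⟨hd, hi, X, hX, hle, hH, hm⟩
    obtain ⟨φ, hφ, hφm⟩ := (hX.mono hle).exists_hom rfl le_rfl le_top
    have hle' : dom Γ ⊔ H ≤ dom X := sup_le (dom_mono hle) hH
    have hdr := dom_rres hle'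
    have hir : im (rres X (dom Γ ⊔ H)) ≤ im Γ ⊔ H := by
      refine hX.im_rres_sup_le (dom_mono hle) hH hm (fun b a hab ha => ?_)
      obtain ⟨b', hb'⟩ := mem_dom.1 ha
      rw [hX.functional hab (hle hb')]
      exact mem_im_of hb'
    obtain ⟨ψ, hψ, hψm⟩ := (hX.mono (rres_le X (dom Γ ⊔ H))).exists_hom hdr hir le_top
    refine ⟨dom Γ, im Γ, φ, ⟨hd, hi, hφ, ψ, hψ, ?_, ?_⟩, fun b a => ⟨fun hab => ?_, ?_⟩⟩
    · rintro a x hx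
      refine hX.functional (rres_le _ _ (hψm x)) ?_
      rw [hx]
      exact hle (hφm a)
    · ext b
      constructor
      · rintro ⟨x, hx, rfl⟩
        exact hm _ _ (rres_le _ _ (hψm x)) hx
      · intro hb
        have hb' : b ∈ H := hb
        rw [← hX.im_rres_eq_of_maps hH hm] at hb'
        obtain ⟨a, hab, ha⟩ := mem_im.1 hb'
        exact ⟨⟨a, (le_sup_right : H ≤ dom Γ ⊔ H) ha⟩, ha,
          hX.functional (rres_le _ _ (hψm ⟨a, (le_sup_right : H ≤ dom Γ ⊔ H) ha⟩)) hab⟩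
    · exact ⟨mem_dom_of hab, (hX.mono hle).functional (hφm ⟨a, mem_dom_of hab⟩) hab⟩
    · rintro ⟨ha, rfl⟩
      exact hφm _

variable {H : Subgroup S}

theorem mem_normalizerIn_top {x : S} :
    x ∈ normalizerIn ⊤ H ↔ x ∈ Subgroup.normalizer (H : Set S) := by
  simp [normalizerIn]

theorem normalizer_full_of_normal (hS : IsPGroup p S) (hF : F.Saturated p)
    {Γ Δ : Subgroup (S × S)} (hΓ : (normalizerFusion F H).Gr Γ) (hc : F.Centric (dom Γ))
    (hle : Γ ≤ Δ) (hΔ : F.Gr Δ) (hd : dom Δ ≤ normalizerIn ⊤ H) (hi : im Δ ≤ normalizerIn ⊤ H)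
    (hn : Δ ≤ Subgroup.normalizer (Γ : Set (S × S))) : (normalizerFusion F H).Gr Δ := by
  obtain ⟨-, hiΓ, X', hX', hΓX', hHX', hmX'⟩ := gr_normalizerSystem_iff.1 hΓ
  -- shrink the domain of the extension
  set X := rres X' (dom Γ ⊔ H) with hXdef
  have hXd : dom X = dom Γ ⊔ H := dom_rres (sup_le (dom_mono hΓX') hHX')
  have hX : F.Gr X := hX'.mono (rres_le _ _)
  have hΓX : Γ ≤ X := fun ⟨b, a⟩ h =>
    ⟨hΓX' h, (le_sup_left : dom Γ ≤ dom Γ ⊔ H) (mem_dom_of h)⟩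
  have hHX : H ≤ dom X := by rw [hXd]; exact le_sup_right
  have hmX : ∀ b a, (b, a) ∈ X → a ∈ H → b ∈ H := fun b a h => hmX' b a (rres_le _ _ h)
  obtain ⟨Y, hY, hXY, hYe⟩ := hF.exists_extension_of_centric hS hX
    (hc.mono (dom_mono hΓX) le_top)
  have hdY : dom Δ ≤ dom Y := by
    intro x hx
    obtain ⟨y, hy⟩ := mem_dom.1 hx
    have hyx := hn hy
    have hdx : dom (cj y x X) = dom X := by
      rw [dom_cj, hXd, Subgroup.map_sup]
      congr 1
      · rw [← dom_cj y x, mem_normalizer_iff_cj.1 hyx]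
      · refine Subgroup.eq_of_le_of_card_ge ?_
          (by rw [Subgroup.card_map_of_injective (MulAut.conj x).injective])
        rintro _ ⟨h, hh, rfl⟩
        exact conj_mem_of_normalizer (mem_normalizerIn_top.1 (hd hx)) hh
    obtain ⟨z, hz, -, hzX⟩ := hF.exists_conj_of_le hS hX (hX.cj trivial trivial) hΓX
      (by conv_lhs => rw [← mem_normalizer_iff_cj.1 hyx]
          exact cj_mono y x hΓX) hdx.symm hc
    have hnX : (z⁻¹ * y, x) ∈ Subgroup.normalizer (X : Set (S × S)) := by
      rw [mem_normalizer_iff_cj]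
      have := congrArg (cj z⁻¹ 1) hzX
      rw [cj_cj, cj_cj] at this
      simpa [cj_one] using this.symm
    obtain ⟨c, -, hc⟩ := hYe _ _ hnX
    exact mem_dom_of hc
  have hHY : H ≤ dom Y := hHX.trans (dom_mono hXY)
  have hmY : ∀ b a, (b, a) ∈ Y → a ∈ H → b ∈ H := by
    intro b a hab ha
    obtain ⟨b', hb'⟩ := mem_dom.1 (hHX ha)
    rw [hY.functional hab (hXY hb')]
    exact hmX _ _ hb' ha
  obtain ⟨z, hz, -, hzΔ⟩ := hF.exists_conj_of_le hS (hY.mono (rres_le Y (dom Δ))) hΔ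
    (fun ⟨b, a⟩ h => ⟨hXY (hΓX h), mem_dom_of (hle h)⟩) hle (dom_rres hdY) hc
  refine gr_normalizerSystem_iff.2 ⟨hd, hi, cj z 1 Y, hY.cj trivial trivial, ?_, ?_, ?_⟩
  · rw [← hzΔ]
    exact cj_mono _ _ (rres_le _ _)
  · rwa [dom_cj_one]
  · intro b a hab ha
    rw [mem_cj] at hab
    have h1 := hmY _ _ hab (by simpa using ha)
    have := conj_mem_of_normalizer (mem_normalizerIn_top.1 (hiΓ hz)) h1
    simpa [mul_assoc] using this

theorem normalizer_full (hS : IsPGroup p S) (hF : F.Saturated p)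
    {Γ Δ : Subgroup (S × S)} (hΓ : (normalizerFusion F H).Gr Γ) (hc : F.Centric (dom Γ))
    (hle : Γ ≤ Δ) (hΔ : F.Gr Δ) (hd : dom Δ ≤ normalizerIn ⊤ H) (hi : im Δ ≤ normalizerIn ⊤ H) :
    (normalizerFusion F H).Gr Δ := by
  induction hn : Nat.card (S × S) - Nat.card Γ using Nat.strong_induction_on generalizing Γ with
  | _ n ih =>
    rcases hle.eq_or_lt with rfl | hlt
    · exact hΓ
    · have hlt' := lt_inf_normalizer (isPGroup_prod hS) hlt
      set M := Δ ⊓ Subgroup.normalizer (Γ : Set (S × S)) with hM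
      have hMΔ : M ≤ Δ := inf_le_left
      have hMg : (normalizerFusion F H).Gr M := normalizer_full_of_normal hS hF hΓ hc hlt'.le
        (hΔ.mono hMΔ) ((dom_mono hMΔ).trans hd) ((im_mono hMΔ).trans hi) inf_le_right
      have h1 : Nat.card Γ < Nat.card M :=
        lt_of_le_of_ne (Subgroup.card_le_of_le hlt'.le)
          (fun h => hlt'.ne (Subgroup.eq_of_le_of_card_ge hlt'.le h.ge))
      have h2 : Nat.card M ≤ Nat.card (S × S) := Subgroup.card_le_card_group M
      exact ih _ (by omega) hMg (hc.mono (dom_mono hlt'.le) le_top) hMΔ rfl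

theorem normalizer_lift (hS : IsPGroup p S) (hF : F.Saturated p) (hH : F.FullyNormalized H)
    {D : Subgroup S} (hD : D ≤ normalizerIn ⊤ H) (hc : F.Centric D) (A : Subgroup (MulAut D))
    (hA : ∀ e ∈ A, (normalizerFusion F H).IsIso e) (hAp : IsPGroup p A) :
    ∃ τ, (normalizerFusion F H).Gr τ ∧ dom τ = D ∧ ∀ e ∈ A, ∃ s ∈ normalizerIn ⊤ H,
      ∀ (b a : S) (h : a ∈ D), (b, a) ∈ τ → (s * b * s⁻¹, (e ⟨a, h⟩ : S)) ∈ τ := by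
  have hDC : D ≤ D ⊔ H := le_sup_left
  have hHC : H ≤ D ⊔ H := le_sup_right
  have hCN : D ⊔ H ≤ Subgroup.normalizer (H : Set S) :=
    sup_le (fun x hx => mem_normalizerIn_top.1 (hD hx)) Subgroup.le_normalizer
  have hext : ∀ e ∈ A, ∃ f : MulAut (D ⊔ H : Subgroup S), F.IsIso f ∧
      (∀ a, (f a : S) ∈ H ↔ (a : S) ∈ H) ∧ ∀ a : D, (f ⟨a, hDC a.2⟩ : S) = e a := by
    intro e he
    obtain ⟨-, -, X, hX, hle, hHX, hm⟩ := gr_normalizerSystem_iff.1 (gr_egr (hA e he))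
    have hDX : D ≤ dom X := by
      have := dom_mono hle
      rwa [dom_egr] at this
    have hm' : ∀ (b a : S) (ha : a ∈ D), (b, a) ∈ X → b = e ⟨a, ha⟩ := fun b a ha hab =>
      hX.functional hab (hle (mem_egr.2 ⟨ha, rfl⟩))
    have hd : dom (rres X (D ⊔ H)) = D ⊔ H := dom_rres (sup_le hDX hHX)
    have hi : im (rres X (D ⊔ H)) = D ⊔ H := by
      refine Subgroup.eq_of_le_of_card_ge (hX.im_rres_sup_le hDX hHX hm fun b a hab ha => ?_) ?_
      · rw [hm' b a ha hab]
        exact (e _).2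
      · rw [← (hX.mono (rres_le _ _)).card_eq, hd]
    obtain ⟨f, hf, hfe⟩ := (hX.mono (rres_le X (D ⊔ H))).exists_equiv_of_eq hd hi
    have hfX : ∀ a, ((f a : S), (a : S)) ∈ X := fun a => by
      have : ((f a : S), (a : S)) ∈ egr f := mem_egr.2 ⟨a.2, rfl⟩
      rw [hfe] at this
      exact this.1
    exact ⟨f, hf, fun a => ⟨hX.mem_of_maps hHX hm (hfX a), hm _ _ (hfX a)⟩,
      fun a => hm' _ _ a.2 (hfX ⟨a, hDC a.2⟩)⟩
  let A' : Subgroup (MulAut (D ⊔ H : Subgroup S)) :=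
    { carrier := {f | F.IsIso f ∧ (∀ a, (f a : S) ∈ H ↔ (a : S) ∈ H) ∧
        ∃ e ∈ A, ∀ a : D, (f ⟨a, hDC a.2⟩ : S) = e a}
      one_mem' := ⟨(F.aut _ le_top).one_mem, fun a => Iff.rfl, 1, one_mem _, fun a => rfl⟩
      mul_mem' := by
        rintro f g ⟨hf, hf1, e, he, hf2⟩ ⟨hg, hg1, e', he', hg2⟩
        refine ⟨(F.aut _ le_top).mul_mem hf hg, fun a => (hf1 _).trans (hg1 a), e * e',
          mul_mem he he', fun a => ?_⟩
        rw [MulAut.mul_apply, MulAut.mul_apply, ← hf2]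
        exact congrArg (fun x => (f x : S)) (Subtype.ext (hg2 a))
      inv_mem' := by
        rintro f ⟨hf, hf1, e, he, hf2⟩
        refine ⟨(F.aut _ le_top).inv_mem hf, fun a => ?_, e⁻¹, inv_mem he, fun a => ?_⟩
        · rw [← hf1, MulAut.apply_inv_self]
        · obtain ⟨b, rfl⟩ := e.surjective a
          have : (⟨e b, hDC (e b).2⟩ : (D ⊔ H : Subgroup S)) = f ⟨b, hDC b.2⟩ :=
            Subtype.ext (hf2 b).symm
          rw [this, MulAut.inv_apply_self, MulAut.inv_apply_self] }
  have hA'p : IsPGroup p A' := by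
    rintro ⟨f, hf⟩
    obtain ⟨hfi, -, e, he, hfe⟩ := hf
    obtain ⟨k, hk⟩ := hAp ⟨e, he⟩
    have hk : e ^ p ^ k = 1 := congrArg Subtype.val hk
    have hpow : ∀ (n : ℕ) (a : D), ((f ^ n) ⟨a, hDC a.2⟩ : S) = (e ^ n) a := by
      intro n a
      induction n with
      | zero => rfl
      | succ n ih =>
        rw [pow_succ', pow_succ', MulAut.mul_apply, MulAut.mul_apply, ← hfe]
        exact congrArg (fun x => (f x : S)) (Subtype.ext ih)
    have hg : F.IsIso (f ^ p ^ k : MulAut (D ⊔ H : Subgroup S)) :=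
      (F.aut _ le_top).pow_mem hfi _
    obtain ⟨z, hz, -, hzf⟩ := hF.exists_conj_of_le hS (Γ := cgr 1 D)
      (gr_cgr (E := F) (g := 1) trivial (le_top : D ⊔ H ≤ ⊤)) (gr_egr hg) (cgr_mono _ hDC) (by
        rintro ⟨b, a⟩ hab
        obtain ⟨ha, rfl⟩ := mem_cgr.1 hab
        refine mem_egr.2 ⟨hDC ha, ?_⟩
        rw [hpow _ ⟨a, ha⟩, hk]
        simp) (by rw [dom_cgr, dom_egr]) (by rwa [dom_cgr])
    have hin : f ^ p ^ k ∈ autIn (D ⊔ H) := by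
      refine ⟨z, fun a => ?_⟩
      have h1 : (((f ^ p ^ k) a : S), (a : S)) ∈ cj z 1 (cgr 1 (D ⊔ H)) := by
        rw [hzf]
        exact mem_egr.2 ⟨a.2, rfl⟩
      rw [mem_cj, mem_cgr] at h1
      have h2 := h1.2
      simp only [inv_one, one_mul, mul_one] at h2
      rw [← h2]
      group
    obtain ⟨l, hl⟩ := isPGroup_autIn hS (D ⊔ H) ⟨_, hin⟩
    refine ⟨k + l, Subtype.ext ?_⟩
    change f ^ p ^ (k + l) = 1
    rw [pow_add, pow_mul]
    exact congrArg Subtype.val hl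
  obtain ⟨L, hL, hLn⟩ := exists_fullyNormalized (E := F) (le_top : D ⊔ H ≤ ⊤)
  obtain ⟨Γ, hΓ, hΓd, -, hΓs⟩ := hF.liftsAut hS _ L hL hLn A' (fun f hf => hf.1) hA'p
  -- move the image of `H` back to `H`
  have hHΓ : dom (rres Γ H) = H := dom_rres (by rw [hΓd]; exact hHC)
  have hconj : F.Conj (im (rres Γ H)) H := by
    have := (hΓ.mono (rres_le Γ H)).conj.symm
    rwa [hHΓ] at this
  obtain ⟨σ, hσ, hσd, hσi⟩ := hF.exists_gr_normalizer hS hconj hH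
  have hΓN : im Γ ≤ dom σ := by
    rw [hσd]
    intro b hb
    obtain ⟨a, hab⟩ := mem_im.1 hb
    refine mem_normalizer_of_forall fun k hk => ?_
    obtain ⟨k', hk', hkH⟩ := mem_im.1 hk
    exact mem_im.2 ⟨a * k' * a⁻¹, conj_pair_mem hab hk',
      conj_mem_of_normalizer (hCN (hΓd.le (mem_dom_of hab))) hkH⟩
  set X := rcomp σ Γ with hX
  have hXg : F.Gr X := hσ.rcomp hΓ
  have hXd : dom X = D ⊔ H := by rw [hX, dom_rcomp hΓN, hΓd]
  have hXm : ∀ b a, (b, a) ∈ X → a ∈ H → b ∈ H := by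
    rintro b a ⟨c, h1, h2⟩ ha
    rw [← hσi]
    exact mem_im.2 ⟨c, h1, mem_im.2 ⟨a, h2, ha⟩⟩
  have hXi : im X ≤ normalizerIn ⊤ H := by
    intro b hb
    obtain ⟨a, hab⟩ := mem_im.1 hb
    rw [mem_normalizerIn_top]
    refine mem_normalizer_of_forall fun h hh => ?_
    have hh' := hh
    rw [← hXg.im_rres_eq_of_maps (by rw [hXd]; exact hHC) hXm] at hh'
    obtain ⟨a', h1, h2⟩ := mem_im.1 hh'
    exact hXm _ _ (conj_pair_mem hab h1)
      (conj_mem_of_normalizer (hCN (hXd.le (mem_dom_of hab))) h2)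
  have hXD : dom (rres X D) = D := dom_rres (by rw [hXd]; exact hDC)
  refine ⟨rres X D, gr_normalizerSystem_iff.2 ⟨by rwa [hXD], (im_mono (rres_le _ _)).trans hXi, X,
    hXg, rres_le _ _, by rw [hXd]; exact hHC, hXm⟩, hXD, fun e he => ?_⟩
  obtain ⟨f, hf, hfH, hfe⟩ := hext e he
  obtain ⟨s₀, hs₀⟩ := hΓs f ⟨hf, hfH, e, he, hfe⟩
  have hs₀N : ∀ b ∈ im (rres Γ H), s₀ * b * s₀⁻¹ ∈ im (rres Γ H) := by
    intro b hb
    obtain ⟨a, hab, ha⟩ := mem_im.1 hb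
    exact mem_im.2 ⟨_, hs₀ b a (hHC ha) hab, (hfH _).2 ha⟩
  obtain ⟨s, hs⟩ := mem_dom.1 (hσd.ge (mem_normalizer_of_forall hs₀N))
  refine ⟨s, mem_normalizerIn_top.2 (mem_normalizer_of_forall fun h hh => ?_), ?_⟩
  · rw [← hσi] at hh ⊢
    obtain ⟨b, hb, hbH⟩ := mem_im.1 hh
    exact mem_im.2 ⟨_, conj_pair_mem hs hb, hs₀N b hbH⟩
  · rintro b a ha ⟨⟨c, h1, h2⟩, -⟩
    refine ⟨⟨_, conj_pair_mem hs h1, ?_⟩, (e _).2⟩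
    have := hs₀ c a (hDC ha) h2
    rwa [hfe ⟨a, ha⟩] at this

theorem isCentricallySaturated_normalizer (hS : IsPGroup p S) (hF : F.Saturated p)
    (hH : F.FullyNormalized H) : IsCentricallySaturated p F (normalizerFusion F H) where
  le := normalizerSystem_isSubsystem F H le_top
  full h hc hle hΔ hd hi := normalizer_full hS hF h hc hle hΔ hd hi
  lift hD hc A hA hAp := normalizer_lift hS hF hH hD hc A hA hAp

end CentricallySaturated

end CentricMackey

namespace CentricMackey

/-! ## Maximal morphisms -/

section Pairs

open FusionSystem

variable {S : Type u} [Group S]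

/-- The setting of the Mackey formula for the restriction to `E₁` of a functor induced from a
subgroup `K` to `E`. -/
structure MackeySetting (p : ℕ) (F : FusionSystem (⊤ : Subgroup S)) {Q Q₁ : Subgroup S}
    (E : FusionSystem Q) (E₁ : FusionSystem Q₁) (K : Subgroup S) : Prop where
  isPGroup : IsPGroup p S
  saturated : F.Saturated p
  big : IsCentricallySaturated p F E
  small : IsCentricallySaturated p F E₁
  sub : E₁.IsSubsystem E
  le : Q₁ ≤ Q
  le' : K ≤ Q

/-- `Γ` is a morphism of `E` from an `F`-centric subgroup of `K` to `Q₁`. -/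
structure IsPair (F : FusionSystem (⊤ : Subgroup S)) {Q : Subgroup S} (E : FusionSystem Q)
    (Q₁ K : Subgroup S) (Γ : Subgroup (S × S)) : Prop where
  gr : E.Gr Γ
  centric : F.Centric (dom Γ)
  dom_le : dom Γ ≤ K
  im_le : im Γ ≤ Q₁

/-- `τ ∘ Γ` is a restriction of `Γ' ∘ c_k`. -/
def Via (τ : Subgroup (S × S)) (k : S) (Γ Γ' : Subgroup (S × S)) : Prop :=
  ∀ b a, (b, a) ∈ Γ → ∃ c, (c, b) ∈ τ ∧ (c, k * a * k⁻¹) ∈ Γ'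

theorem Via.trans {τ τ' : Subgroup (S × S)} {k k' : S} {Γ Γ' Γ'' : Subgroup (S × S)}
    (h : Via τ k Γ Γ') (h' : Via τ' k' Γ' Γ'') : Via (rcomp τ' τ) (k' * k) Γ Γ'' := by
  intro b a hab
  obtain ⟨c, h1, h2⟩ := h b a hab
  obtain ⟨d, h3, h4⟩ := h' _ _ h2
  refine ⟨d, ⟨c, h3, h1⟩, ?_⟩
  convert h4 using 2
  group

theorem via_of_le {τ Γ Γ' : Subgroup (S × S)} (hτ : cgr 1 (im Γ) ≤ τ) (h : Γ ≤ Γ') :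
    Via τ 1 Γ Γ' := fun b a hab =>
  ⟨b, hτ (mem_cgr.2 ⟨mem_im_of hab, by simp⟩), by simpa using h hab⟩

theorem Via.conj_dom_le {τ : Subgroup (S × S)} {k : S} {Γ Γ' : Subgroup (S × S)}
    (h : Via τ k Γ Γ') {a : S} (ha : a ∈ dom Γ) : k * a * k⁻¹ ∈ dom Γ' := by
  obtain ⟨b, hb⟩ := mem_dom.1 ha
  obtain ⟨c, -, hc⟩ := h b a hb
  exact mem_dom_of hc

theorem Via.dom_le {τ : Subgroup (S × S)} {Γ Γ' : Subgroup (S × S)} (h : Via τ 1 Γ Γ') :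
    dom Γ ≤ dom Γ' := fun a ha => by simpa using h.conj_dom_le ha

theorem Via.map_dom_le {τ : Subgroup (S × S)} {k : S} {Γ Γ' : Subgroup (S × S)}
    (h : Via τ k Γ Γ') : (dom Γ).map (MulAut.conj k).toMonoidHom ≤ dom Γ' := by
  rintro _ ⟨a, ha, rfl⟩
  exact h.conj_dom_le ha

theorem card_map_conj (k : S) (D : Subgroup S) :
    Nat.card (D.map (MulAut.conj k).toMonoidHom) = Nat.card D :=
  Subgroup.card_map_of_injective (MulAut.conj k).injective

variable [Finite S]

theorem Via.card_le {τ : Subgroup (S × S)} {k : S} {Γ Γ' : Subgroup (S × S)}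
    (h : Via τ k Γ Γ') : Nat.card (dom Γ) ≤ Nat.card (dom Γ') := by
  rw [← card_map_conj k]
  exact Subgroup.card_le_of_le h.map_dom_le

variable {p : ℕ} [Fact p.Prime] {F : FusionSystem (⊤ : Subgroup S)} {Q Q₁ : Subgroup S}
  {E : FusionSystem Q} {E₁ : FusionSystem Q₁} {K : Subgroup S}

theorem Via.symm {τ : Subgroup (S × S)} {k : S} {Γ Γ' : Subgroup (S × S)}
    (h : Via τ k Γ Γ') (hΓ' : E.Gr Γ') (hc : Nat.card (dom Γ') ≤ Nat.card (dom Γ)) :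
    Via (rinv τ) k⁻¹ Γ' Γ := by
  have heq : (dom Γ).map (MulAut.conj k).toMonoidHom = dom Γ' :=
    Subgroup.eq_of_le_of_card_ge h.map_dom_le (by rwa [card_map_conj])
  intro c a' hca
  have ha' := mem_dom_of hca
  rw [← heq] at ha'
  obtain ⟨a, ha, rfl⟩ := ha'
  obtain ⟨b, hb⟩ := mem_dom.1 ha
  obtain ⟨c', h1, h2⟩ := h b a hb
  rw [hΓ'.functional hca h2]
  exact ⟨b, h1, by simpa [mul_assoc] using hb⟩

theorem IsPair.mono {Γ Γ' : Subgroup (S × S)} (h : IsPair F E Q₁ K Γ') (hle : Γ ≤ Γ')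
    (hc : F.Centric (dom Γ)) : IsPair F E Q₁ K Γ :=
  ⟨h.gr.mono hle, hc, (dom_mono hle).trans h.dom_le, (im_mono hle).trans h.im_le⟩

theorem IsPair.cj {Γ : Subgroup (S × S)} (hs : MackeySetting p F E E₁ K)
    (h : IsPair F E Q₁ K Γ) {j k : S} (hj : j ∈ Q₁) (hk : k ∈ K) :
    IsPair F E Q₁ K (cj j k Γ) := by
  have hg := h.gr.cj (hs.le hj) (hs.le' hk)
  refine ⟨hg, ?_, ?_, ?_⟩
  · rw [dom_cj]
    refine h.centric.conj ?_
    have := (gr_cgr (E := F) (g := k) trivial (le_top : dom Γ ≤ ⊤)).conj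
    rw [dom_cgr] at this
    convert this
    ext a
    simp only [Subgroup.mem_map, mem_im, mem_cgr]
    constructor
    · rintro ⟨b, hb, rfl⟩
      exact ⟨b, hb, rfl⟩
    · rintro ⟨b, hb, rfl⟩
      exact ⟨b, hb, rfl⟩
  · rw [dom_cj]
    rintro _ ⟨a, ha, rfl⟩
    exact K.mul_mem (K.mul_mem hk (h.dom_le ha)) (K.inv_mem hk)
  · rw [im_cj]
    rintro _ ⟨a, ha, rfl⟩
    exact Q₁.mul_mem (Q₁.mul_mem hj (h.im_le ha)) (Q₁.inv_mem hj)

/-- The automorphism `e` of the image of `Γ` corresponds to conjugation with `k`. -/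
def Covers (Γ : Subgroup (S × S)) (k : S) (e : MulAut (im Γ)) : Prop :=
  ∀ (b a : S) (h : (b, a) ∈ Γ), ((e ⟨b, mem_im_of h⟩ : S), k * a * k⁻¹) ∈ Γ

theorem Covers.mul {Γ : Subgroup (S × S)} {k k' : S} {e e' : MulAut (im Γ)}
    (h : Covers Γ k e) (h' : Covers Γ k' e') : Covers Γ (k * k') (e * e') := by
  intro b a hab
  have h1 := h _ _ (h' b a hab)
  have h3 : k * k' * a * (k * k')⁻¹ = k * (k' * a * k'⁻¹) * k⁻¹ := by group
  rw [h3]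
  exact h1

theorem Covers.inv {Γ : Subgroup (S × S)} {k : S} {e : MulAut (im Γ)} (hΓ : E.Gr Γ)
    (h : Covers Γ k e) : Covers Γ k⁻¹ e⁻¹ := by
  intro b a hab
  obtain ⟨a', ha'⟩ := mem_im.1 (e⁻¹ ⟨b, mem_im_of hab⟩).2
  have h1 := h _ _ ha'
  have h2 : e ⟨_, mem_im_of ha'⟩ = ⟨b, mem_im_of hab⟩ := MulAut.apply_inv_self _ e _
  rw [h2] at h1
  have h3 := hΓ.injective hab h1
  have h4 : k⁻¹ * a * k⁻¹⁻¹ = a' := by rw [h3]; group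
  rw [h4]
  exact ha'

theorem covers_one (Γ : Subgroup (S × S)) : Covers Γ 1 1 := fun b a h => by simpa using h

theorem exists_extension_pair (hs : MackeySetting p F E E₁ K) {Γ : Subgroup (S × S)}
    (hΓ : IsPair F E Q₁ K Γ) :
    ∃ ρ, IsPair F E Q₁ K ρ ∧ (∃ τ, E₁.Gr τ ∧ Via τ 1 Γ ρ) ∧
      ∀ k ∈ K, ∀ e : MulAut (im Γ), E₁.IsIso e → Covers Γ k e → k ∈ dom ρ := by
  have hFg : F.Gr Γ := hΓ.gr.of_isSubsystem hs.big.le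
  let T : Subgroup S :=
    { carrier := {k | k ∈ K ∧ ∃ e : MulAut (im Γ), E₁.IsIso e ∧ Covers Γ k e}
      one_mem' := ⟨one_mem _, 1, (E₁.aut _ hΓ.im_le).one_mem, covers_one Γ⟩
      mul_mem' := by
        rintro k k' ⟨hk, e, he, h⟩ ⟨hk', e', he', h'⟩
        exact ⟨mul_mem hk hk', e * e', (E₁.aut _ hΓ.im_le).mul_mem he he', h.mul h'⟩
      inv_mem' := by
        rintro k ⟨hk, e, he, h⟩
        exact ⟨inv_mem hk, e⁻¹, (E₁.aut _ hΓ.im_le).inv_mem he, h.inv hΓ.gr⟩ }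
  let A : Subgroup (MulAut (im Γ)) :=
    { carrier := {e | E₁.IsIso e ∧ ∃ k ∈ K, Covers Γ k e}
      one_mem' := ⟨(E₁.aut _ hΓ.im_le).one_mem, 1, one_mem _, covers_one Γ⟩
      mul_mem' := by
        rintro e e' ⟨he, k, hk, h⟩ ⟨he', k', hk', h'⟩
        exact ⟨(E₁.aut _ hΓ.im_le).mul_mem he he', k * k', mul_mem hk hk', h.mul h'⟩
      inv_mem' := by
        rintro e ⟨he, k, hk, h⟩
        exact ⟨(E₁.aut _ hΓ.im_le).inv_mem he, k⁻¹, inv_mem hk, h.inv hΓ.gr⟩ }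
  have hA : IsPGroup p A := by
    rintro ⟨e, he, k, hk, h⟩
    obtain ⟨n, hn⟩ := hs.isPGroup k
    refine ⟨n, Subtype.ext ?_⟩
    change e ^ p ^ n = 1
    have hpow : ∀ m : ℕ, Covers Γ (k ^ m) (e ^ m) := by
      intro m
      induction m with
      | zero => simpa using covers_one Γ
      | succ m ih =>
        rw [pow_succ, pow_succ]
        exact ih.mul h
    ext ⟨b, hb⟩
    obtain ⟨a, hab⟩ := mem_im.1 hb
    have h1 := hpow (p ^ n) b a hab
    rw [hn] at h1
    exact hΓ.gr.functional h1 (by simpa using hab)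
  obtain ⟨τ, hτ, hτd, hτs⟩ := hs.small.lift hΓ.im_le (hFg.centric_im hΓ.centric) A
    (fun e he => he.1) hA
  have hτE : E.Gr τ := hτ.of_isSubsystem hs.sub
  have h1E := hτE.rcomp hΓ.gr
  have h1d : dom (rcomp τ Γ) = dom Γ := dom_rcomp hτd.ge
  obtain ⟨Δ, hΔ, hle, hext⟩ := hs.saturated.exists_extension_of_centric hs.isPGroup
    (h1E.of_isSubsystem hs.big.le) (by rw [h1d]; exact hΓ.centric)
  have hΓT : dom Γ ≤ T := by
    intro a ha
    obtain ⟨b, hb⟩ := mem_dom.1 ha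
    obtain ⟨e, -, he⟩ := exists_autIn (Subgroup.le_normalizer (mem_im_of hb))
    refine ⟨hΓ.dom_le ha, e, E₁.conj_mem hΓ.im_le hΓ.im_le b (hΓ.im_le (mem_im_of hb)) _ he, ?_⟩
    intro c d hcd
    rw [he]
    exact conj_pair_mem hb hcd
  have hT : ∀ k ∈ T, ∃ y ∈ Q₁, (y, k) ∈ Δ := by
    rintro k ⟨hk, e, he, h⟩
    obtain ⟨s, hsQ, hs'⟩ := hτs e ⟨he, k, hk, h⟩
    have hn : (s, k) ∈ Subgroup.normalizer (rcomp τ Γ : Set (S × S)) := by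
      refine mem_normalizer_graph ?_
      rintro b a ⟨c, h1, h2⟩
      exact ⟨_, hs' b c (mem_im_of h2) h1, h c a h2⟩
    obtain ⟨c, hc, h3⟩ := hext s k hn
    exact ⟨s * c, mul_mem hsQ (hτ.im_le (im_rcomp_le _ _ hc)), h3⟩
  have hdT : dom (rres Δ T) = T := dom_rres (fun k hk => by
    obtain ⟨y, -, hy⟩ := hT k hk
    exact mem_dom_of hy)
  have hle' : rcomp τ Γ ≤ rres Δ T := fun ⟨b, a⟩ h =>
    ⟨hle h, hΓT (h1d.le (mem_dom_of h))⟩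
  have hTK : dom (rres Δ T) ≤ K := by
    rw [hdT]
    exact fun k hk => hk.1
  have hiQ : im (rres Δ T) ≤ Q₁ := by
    intro y hy
    obtain ⟨k, hk, hkT⟩ := mem_im.1 hy
    obtain ⟨y', hy', hk'⟩ := hT k hkT
    rwa [hΔ.functional hk hk']
  refine ⟨rres Δ T, ⟨?_, ?_, hTK, hiQ⟩, ⟨τ, hτ, ?_⟩, fun k hk e he h => ?_⟩
  · exact hs.big.full h1E (by rw [h1d]; exact hΓ.centric) hle' (hΔ.mono (rres_le _ _))
      (hTK.trans hs.le') (hiQ.trans hs.le)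
  · rw [hdT]
    exact hΓ.centric.mono hΓT le_top
  · intro b a hab
    obtain ⟨c, hc⟩ := mem_dom.1 (hτd.ge (mem_im_of hab))
    refine ⟨c, hc, hle' ⟨b, hc, ?_⟩⟩
    simpa using hab
  · rw [hdT]
    exact ⟨hk, e, he, h⟩

theorem via_extension (hs : MackeySetting p F E E₁ K) {Γ Γ' ρ τ τ' : Subgroup (S × S)}
    (hΓ : IsPair F E Q₁ K Γ) (hΓ' : IsPair F E Q₁ K Γ') (hρ : IsPair F E Q₁ K ρ)
    (hτ : E₁.Gr τ) (h : Via τ 1 Γ ρ) (hτ' : E₁.Gr τ') (h' : Via τ' 1 Γ Γ')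
    (hext : ∀ k ∈ K, ∀ e : MulAut (im Γ), E₁.IsIso e → Covers Γ k e → k ∈ dom ρ) :
    ∃ σ, E₁.Gr σ ∧ Via σ 1 (rres Γ' (dom Γ' ⊓ Subgroup.normalizer (dom Γ : Set S))) ρ := by
  set N := dom Γ' ⊓ Subgroup.normalizer (dom Γ : Set S) with hN
  have key : ∀ {x b a : S}, (x, b) ∈ τ' → (b, a) ∈ Γ → (x, a) ∈ Γ' := by
    intro x b a h1 h2
    obtain ⟨c, h3, h4⟩ := h' b a h2
    rw [hτ'.functional h1 h3]
    simpa using h4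
  have key' : ∀ {x a : S}, (x, a) ∈ Γ' → a ∈ dom Γ → ∃ b, (x, b) ∈ τ' ∧ (b, a) ∈ Γ := by
    intro x a h1 h2
    obtain ⟨b, hb⟩ := mem_dom.1 h2
    obtain ⟨c, h3, h4⟩ := h' b a hb
    rw [hΓ'.gr.functional h1 (by simpa using h4)]
    exact ⟨b, h3, hb⟩
  have hNρ : N ≤ dom ρ := by
    rintro t ⟨ht, htn⟩
    obtain ⟨s, hst⟩ := mem_dom.1 ht
    set χ := rcomp (rinv τ') (rcomp (cgr s Q₁) (rcomp τ' (cgr 1 (im Γ)))) with hχ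
    have hsQ : s ∈ Q₁ := hΓ'.im_le (mem_im_of hst)
    have hχg : E₁.Gr χ := hτ'.rinv.rcomp ((gr_cgr hsQ le_rfl).rcomp
      (hτ'.rcomp (gr_cgr (one_mem _) hΓ.im_le)))
    have hmem : ∀ b a, (b, a) ∈ Γ → ∃ b', (b', b) ∈ χ ∧ (b', t * a * t⁻¹) ∈ Γ := by
      intro b a hab
      obtain ⟨c, h1, h2⟩ := h' b a hab
      have h3 := conj_pair_mem hst (key h1 hab)
      obtain ⟨b', h4, h5⟩ := key' h3 (conj_mem_of_normalizer htn (mem_dom_of hab))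
      exact ⟨b', ⟨_, h4, c, mem_cgr.2 ⟨hτ'.im_le (mem_im_of h1), rfl⟩, b, h1,
        mem_cgr.2 ⟨mem_im_of hab, by simp⟩⟩, h5⟩
    have hχd : dom χ = im Γ := by
      refine le_antisymm ?_ ?_
      · have := (dom_rcomp_le (rinv τ') (rcomp (cgr s Q₁) (rcomp τ' (cgr 1 (im Γ))))).trans
          ((dom_rcomp_le _ _).trans (dom_rcomp_le _ _))
        rwa [dom_cgr] at this
      · intro b hb
        obtain ⟨a, hab⟩ := mem_im.1 hb
        obtain ⟨b', h1, -⟩ := hmem b a hab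
        exact mem_dom_of h1
    have hχi : im χ = im Γ := by
      refine Subgroup.eq_of_le_of_card_ge (fun b' hb' => ?_) ?_
      · obtain ⟨b, hb⟩ := mem_im.1 hb'
        obtain ⟨a, hab⟩ := mem_im.1 (hχd.le (mem_dom_of hb))
        obtain ⟨b'', h1, h2⟩ := hmem b a hab
        rw [hχg.functional hb h1]
        exact mem_im_of h2
      · rw [← hχg.card_eq, hχd]
    obtain ⟨e, he, hee⟩ := hχg.exists_equiv_of_eq hχd hχi
    refine hext t (hΓ'.dom_le ht) e he fun b a hab => ?_
    obtain ⟨b', h1, h2⟩ := hmem b a hab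
    rw [← hee] at h1
    obtain ⟨h3, h4⟩ := mem_egr.1 h1
    have h5 : ((e : im Γ ≃* im Γ) ⟨b, mem_im_of hab⟩ : S) = b' := h4
    change (((e : im Γ ≃* im Γ) ⟨b, mem_im_of hab⟩ : S), _) ∈ Γ
    rwa [h5]
  have hNd : dom (rres Γ' N) = N := dom_rres inf_le_left
  have hΓN : dom Γ ≤ N := le_inf h'.dom_le Subgroup.le_normalizer
  set σ := rcomp ρ (rinv (rres Γ' N)) with hσ
  have h0 : ∀ x y, (x, y) ∈ rcomp (rcomp τ (cgr 1 (im Γ))) (rinv τ') → (x, y) ∈ σ := by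
    rintro x y ⟨b, ⟨b', h1, h2⟩, h3⟩
    obtain ⟨hb, rfl⟩ := mem_cgr.1 h2
    obtain ⟨a, hab⟩ := mem_im.1 hb
    obtain ⟨c, h4, h5⟩ := h b a hab
    refine ⟨a, ?_, key h3 hab, hΓN (mem_dom_of hab)⟩
    have h6 : x = c := hτ.functional h1 (by simpa using h4)
    rw [h6]
    simpa using h5
  have hFg : F.Gr Γ := hΓ.gr.of_isSubsystem hs.big.le
  have h0g : E₁.Gr (rcomp (rcomp τ (cgr 1 (im Γ))) (rinv τ')) :=
    (hτ.rcomp (gr_cgr (one_mem _) hΓ.im_le)).rcomp hτ'.rinv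
  have h0d : dom (rcomp (rcomp τ (cgr 1 (im Γ))) (rinv τ')) = dom (rinv (rcomp τ' (cgr 1 (im Γ)))) := by
    ext y
    rw [dom_rinv]
    simp only [mem_dom, mem_im]
    constructor
    · rintro ⟨x, b, ⟨b', h1, h2⟩, h3⟩
      have hb := (mem_cgr.1 h2).1
      exact ⟨b, b, h3, mem_cgr.2 ⟨hb, by simp⟩⟩
    · rintro ⟨b', b, h3, h2⟩
      obtain ⟨hb, rfl⟩ := mem_cgr.1 h2
      obtain ⟨a, hab⟩ := mem_im.1 hb
      obtain ⟨c, h4, h5⟩ := h b' a hab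
      exact ⟨c, b', ⟨b', h4, mem_cgr.2 ⟨hb, by simp⟩⟩, by simpa [mem_rinv] using h3⟩
  have hσF : F.Gr σ := (hρ.gr.of_isSubsystem hs.big.le).rcomp
    ((hΓ'.gr.mono (rres_le _ _)).of_isSubsystem hs.big.le).rinv
  have hτ'1 : E₁.Gr (rcomp τ' (cgr 1 (im Γ))) := hτ'.rcomp (gr_cgr (one_mem _) hΓ.im_le)
  have hdτ' : dom (rcomp τ' (cgr 1 (im Γ))) = im Γ := by
    rw [dom_rcomp, dom_cgr]
    rw [im_cgr_one]
    intro b hb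
    obtain ⟨a, hab⟩ := mem_im.1 hb
    obtain ⟨c, h1, -⟩ := h' b a hab
    exact mem_dom_of h1
  refine ⟨σ, hs.small.full h0g ?_ (fun ⟨x, y⟩ h => h0 x y h) hσF ?_ ?_, ?_⟩
  · rw [h0d, dom_rinv]
    refine (hτ'1.of_isSubsystem hs.small.le).centric_im ?_
    rw [hdτ']
    exact hFg.centric_im hΓ.centric
  · refine (dom_rcomp_le _ _).trans ?_
    rw [dom_rinv]
    exact (im_mono (rres_le _ _)).trans hΓ'.im_le
  · exact (im_rcomp_le _ _).trans hρ.im_le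
  · intro b a hab
    obtain ⟨c, hc⟩ := mem_dom.1 (hNρ (hNd.le (mem_dom_of hab)))
    exact ⟨c, ⟨a, hc, hab⟩, by simpa using hc⟩

/-- Two morphisms lying above the same morphism have a common upper bound. -/
theorem exists_upper_bound (hs : MackeySetting p F E E₁ K) {Γ Γ₁ Γ₂ τ₁ τ₂ : Subgroup (S × S)}
    (hΓ : IsPair F E Q₁ K Γ) (hΓ₁ : IsPair F E Q₁ K Γ₁) (hΓ₂ : IsPair F E Q₁ K Γ₂)
    (hτ₁ : E₁.Gr τ₁) (h₁ : Via τ₁ 1 Γ Γ₁) (hτ₂ : E₁.Gr τ₂) (h₂ : Via τ₂ 1 Γ Γ₂) :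
    ∃ Γ₃, IsPair F E Q₁ K Γ₃ ∧ (∃ τ, E₁.Gr τ ∧ Via τ 1 Γ₁ Γ₃) ∧ ∃ τ, E₁.Gr τ ∧ Via τ 1 Γ₂ Γ₃ := by
  have hid : ∀ {Θ : Subgroup (S × S)}, IsPair F E Q₁ K Θ → ∃ τ, E₁.Gr τ ∧ Via τ 1 Θ Θ := fun hΘ =>
    ⟨cgr 1 (im _), gr_cgr (one_mem _) hΘ.im_le, via_of_le le_rfl le_rfl⟩
  induction hn : Nat.card S - Nat.card (dom Γ) using Nat.strong_induction_on
    generalizing Γ Γ₁ Γ₂ τ₁ τ₂ with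
  | _ n ih =>
    by_cases hd₁ : Nat.card (dom Γ₁) ≤ Nat.card (dom Γ)
    · refine ⟨Γ₂, hΓ₂, ⟨_, hτ₂.rcomp hτ₁.rinv, ?_⟩, hid hΓ₂⟩
      simpa using (h₁.symm hΓ₁.gr hd₁).trans h₂
    by_cases hd₂ : Nat.card (dom Γ₂) ≤ Nat.card (dom Γ)
    · refine ⟨Γ₁, hΓ₁, hid hΓ₁, ⟨_, hτ₁.rcomp hτ₂.rinv, ?_⟩⟩
      simpa using (h₂.symm hΓ₂.gr hd₂).trans h₁
    obtain ⟨ρ, hρ, ⟨τ, hτ, hτρ⟩, hext⟩ := exists_extension_pair hs hΓ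
    have aux : ∀ {Θ τ' : Subgroup (S × S)}, IsPair F E Q₁ K Θ → E₁.Gr τ' → Via τ' 1 Γ Θ →
        ¬ Nat.card (dom Θ) ≤ Nat.card (dom Γ) →
        Nat.card (dom Γ) < Nat.card (dom ρ) ∧
        ∃ Γ₃, IsPair F E Q₁ K Γ₃ ∧ (∃ τ, E₁.Gr τ ∧ Via τ 1 Θ Γ₃) ∧
          ∃ τ, E₁.Gr τ ∧ Via τ 1 ρ Γ₃ := by
      intro Θ τ' hΘ hτ' hΓΘ hcard
      obtain ⟨σ, hσ, hvia⟩ := via_extension hs hΓ hΘ hρ hτ hτρ hτ' hΓΘ hext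
      have hlt : dom Γ < dom Θ := lt_of_le_of_ne hΓΘ.dom_le (fun h => hcard (by rw [h]))
      have hlt' := lt_inf_normalizer hs.isPGroup hlt
      set N := dom Θ ⊓ Subgroup.normalizer (dom Γ : Set S) with hN
      have hNd : dom (rres Θ N) = N := dom_rres inf_le_left
      have hNp : IsPair F E Q₁ K (rres Θ N) := hΘ.mono (rres_le _ _) (by
        rw [hNd]
        exact hΓ.centric.mono hlt'.le le_top)
      have hc1 : Nat.card (dom Γ) < Nat.card N :=
        lt_of_le_of_ne (Subgroup.card_le_of_le hlt'.le)
          (fun h => hlt'.ne (Subgroup.eq_of_le_of_card_ge hlt'.le h.ge))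
      have hc2 : Nat.card N ≤ Nat.card S := Subgroup.card_le_card_group N
      refine ⟨?_, ih (Nat.card S - Nat.card N) (by omega) hNp hΘ hρ
        (gr_cgr (one_mem _) hNp.im_le) (via_of_le le_rfl (rres_le _ _)) hσ hvia (by rw [hNd])⟩
      have := hvia.card_le
      rw [hNd] at this
      omega
    obtain ⟨hlt, Z₁, hZ₁, ⟨a₁, ha₁, hv₁⟩, ⟨b₁, hb₁, hw₁⟩⟩ := aux hΓ₁ hτ₁ h₁ hd₁
    obtain ⟨-, Z₂, hZ₂, ⟨a₂, ha₂, hv₂⟩, ⟨b₂, hb₂, hw₂⟩⟩ := aux hΓ₂ hτ₂ h₂ hd₂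
    have hc2 : Nat.card (dom ρ) ≤ Nat.card S := Subgroup.card_le_card_group _
    obtain ⟨Z, hZ, ⟨c₁, hc₁, hx₁⟩, ⟨c₂, hc₂, hx₂⟩⟩ := ih _ (by omega) hρ hZ₁ hZ₂ hb₁ hw₁ hb₂ hw₂ rfl
    exact ⟨Z, hZ, ⟨_, hc₁.rcomp ha₁, by simpa using hv₁.trans hx₁⟩,
      ⟨_, hc₂.rcomp ha₂, by simpa using hv₂.trans hx₂⟩⟩

/-- A morphism that cannot be extended, even after composition with a morphism of `E₁`. -/
structure IsMaxPair (F : FusionSystem (⊤ : Subgroup S)) {Q Q₁ : Subgroup S} (E : FusionSystem Q)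
    (E₁ : FusionSystem Q₁) (K : Subgroup S) (G : Subgroup (S × S)) : Prop where
  pair : IsPair F E Q₁ K G
  card_le : ∀ Γ τ, IsPair F E Q₁ K Γ → E₁.Gr τ → Via τ 1 G Γ →
    Nat.card (dom Γ) ≤ Nat.card (dom G)

theorem via_cj_right {τ : Subgroup (S × S)} {k l : S} {Γ Γ' : Subgroup (S × S)} :
    Via τ k Γ (cj 1 l Γ') ↔ Via τ (l⁻¹ * k) Γ Γ' := by
  simp [Via, mem_cj, mul_assoc]

theorem IsPair.exists_max {Γ : Subgroup (S × S)}
    (hΓ : IsPair F E Q₁ K Γ) : ∃ G, IsMaxPair F E E₁ K G ∧ ∃ τ, E₁.Gr τ ∧ Via τ 1 Γ G := by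
  obtain ⟨G, ⟨hG, τ, hτ, hv⟩, hmax⟩ := Set.exists_max_image
    {G | IsPair F E Q₁ K G ∧ ∃ τ, E₁.Gr τ ∧ Via τ 1 Γ G} (fun G => Nat.card (dom G))
    (Set.toFinite _) ⟨Γ, hΓ, cgr 1 (im Γ), gr_cgr (one_mem _) hΓ.im_le, via_of_le le_rfl le_rfl⟩
  refine ⟨G, ⟨hG, fun Θ σ hΘ hσ hvia => hmax Θ ⟨hΘ, _, hσ.rcomp hτ, ?_⟩⟩, τ, hτ, hv⟩
  simpa using hv.trans hvia

/-- An element of `K` that relates two restrictions of a maximal morphism lies in its domain. -/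
theorem IsMaxPair.mem_dom_of_via (hs : MackeySetting p F E E₁ K) {G Γ τ τ' : Subgroup (S × S)}
    (hG : IsMaxPair F E E₁ K G) (hΓ : IsPair F E Q₁ K Γ) (hτ : E₁.Gr τ) (h : Via τ 1 Γ G)
    (hτ' : E₁.Gr τ') {k : S} (hk : k ∈ K) (h' : Via τ' k Γ G) : k ∈ dom G := by
  have hGk : IsPair F E Q₁ K (cj 1 k⁻¹ G) := hG.pair.cj hs (one_mem _) (inv_mem hk)
  obtain ⟨Z, hZ, ⟨σ, hσ, hv⟩, ⟨σ', hσ', hv'⟩⟩ := exists_upper_bound hs hΓ hG.pair hGk hτ h hτ'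
    (via_cj_right.2 (by simpa using h'))
  have hcZ := hG.card_le Z σ hZ hσ hv
  have hw := hv.symm hZ.gr hcZ
  have hcov : Via (rcomp (rinv σ) σ') k⁻¹ G G := by
    have h1 := hv'.trans hw
    intro b a hab
    obtain ⟨c, hc, hc'⟩ := h1 b (k⁻¹ * a * k) (mem_cj.2 (by simpa [mul_assoc] using hab))
    exact ⟨c, hc, by simpa using hc'⟩
  obtain ⟨ρ, hρ, ⟨π, hπ, hvπ⟩, hext⟩ := exists_extension_pair hs hG.pair
  -- turn the relation into an automorphism of the image
  set χ := rcomp (rcomp (rinv σ) σ') (cgr 1 (im G)) with hχ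
  have hχg : E₁.Gr χ := (hσ.rinv.rcomp hσ').rcomp (gr_cgr (one_mem _) hG.pair.im_le)
  have hmem : ∀ b a, (b, a) ∈ G → ∃ c, (c, b) ∈ χ ∧ (c, k⁻¹ * a * k⁻¹⁻¹) ∈ G := by
    intro b a hab
    obtain ⟨c, hc, hc'⟩ := hcov b a hab
    exact ⟨c, ⟨b, hc, mem_cgr.2 ⟨mem_im_of hab, by simp⟩⟩, hc'⟩
  have hχd : dom χ = im G := by
    refine le_antisymm ?_ (fun b hb => ?_)
    · have := dom_rcomp_le (rcomp (rinv σ) σ') (cgr 1 (im G))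
      rwa [dom_cgr] at this
    · obtain ⟨a, hab⟩ := mem_im.1 hb
      obtain ⟨c, hc, -⟩ := hmem b a hab
      exact mem_dom_of hc
  have hχi : im χ = im G := by
    refine Subgroup.eq_of_le_of_card_ge (fun c hc => ?_) ?_
    · obtain ⟨b, hb⟩ := mem_im.1 hc
      obtain ⟨a, hab⟩ := mem_im.1 (hχd.le (mem_dom_of hb))
      obtain ⟨c', h1, h2⟩ := hmem b a hab
      rw [hχg.functional hb h1]
      exact mem_im_of h2
    · rw [← hχg.card_eq, hχd]
  obtain ⟨e, he, hee⟩ := hχg.exists_equiv_of_eq hχd hχi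
  have hkρ : k⁻¹ ∈ dom ρ := by
    refine hext k⁻¹ (inv_mem hk) e he fun b a hab => ?_
    obtain ⟨c, h1, h2⟩ := hmem b a hab
    rw [← hee] at h1
    obtain ⟨h3, h4⟩ := mem_egr.1 h1
    have h5 : ((e : im G ≃* im G) ⟨b, mem_im_of hab⟩ : S) = c := h4
    change (((e : im G ≃* im G) ⟨b, mem_im_of hab⟩ : S), _) ∈ G
    rwa [h5]
  have := Subgroup.eq_of_le_of_card_ge hvπ.dom_le (hG.card_le ρ π hρ hπ hvπ)
  rw [← this] at hkρ
  simpa using inv_mem hkρ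

/-- `Γ` is a restriction of `Γ'`, up to conjugation in `K` and composition with a morphism of
`E₁`. -/
def PairLE (E₁ : FusionSystem Q₁) (K : Subgroup S) (Γ Γ' : Subgroup (S × S)) : Prop :=
  ∃ k ∈ K, ∃ τ, E₁.Gr τ ∧ Via τ k Γ Γ'

theorem PairLE.trans {Γ Γ' Γ'' : Subgroup (S × S)} (h : PairLE E₁ K Γ Γ')
    (h' : PairLE E₁ K Γ' Γ'') : PairLE E₁ K Γ Γ'' := by
  obtain ⟨k, hk, τ, hτ, hv⟩ := h
  obtain ⟨k', hk', τ', hτ', hv'⟩ := h'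
  exact ⟨_, mul_mem hk' hk, _, hτ'.rcomp hτ, hv.trans hv'⟩

theorem IsPair.pairLE_refl {Γ : Subgroup (S × S)} (h : IsPair F E Q₁ K Γ) : PairLE E₁ K Γ Γ :=
  ⟨1, one_mem _, cgr 1 (im Γ), gr_cgr (one_mem _) h.im_le, via_of_le le_rfl le_rfl⟩

theorem pairLE_upper_bound (hs : MackeySetting p F E E₁ K) {Γ Γ₁ Γ₂ : Subgroup (S × S)}
    (hΓ : IsPair F E Q₁ K Γ) (hΓ₁ : IsPair F E Q₁ K Γ₁) (hΓ₂ : IsPair F E Q₁ K Γ₂)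
    (h₁ : PairLE E₁ K Γ Γ₁) (h₂ : PairLE E₁ K Γ Γ₂) :
    ∃ Γ₃, IsPair F E Q₁ K Γ₃ ∧ PairLE E₁ K Γ₁ Γ₃ ∧ PairLE E₁ K Γ₂ Γ₃ := by
  obtain ⟨k, hk, τ, hτ, hv⟩ := h₁
  obtain ⟨k', hk', τ', hτ', hv'⟩ := h₂
  obtain ⟨Z, hZ, ⟨σ, hσ, hw⟩, ⟨σ', hσ', hw'⟩⟩ := exists_upper_bound hs hΓ
    (hΓ₁.cj hs (one_mem _) (inv_mem hk)) (hΓ₂.cj hs (one_mem _) (inv_mem hk')) hτ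
    (via_cj_right.2 (by simpa using hv)) hτ' (via_cj_right.2 (by simpa using hv'))
  refine ⟨Z, hZ, ⟨k⁻¹, inv_mem hk, σ, hσ, ?_⟩, ⟨k'⁻¹, inv_mem hk', σ', hσ', ?_⟩⟩
  · intro b a hab
    obtain ⟨c, h1, h2⟩ := hw b (k⁻¹ * a * k) (mem_cj.2 (by simpa [mul_assoc] using hab))
    exact ⟨c, h1, by simpa using h2⟩
  · intro b a hab
    obtain ⟨c, h1, h2⟩ := hw' b (k'⁻¹ * a * k') (mem_cj.2 (by simpa [mul_assoc] using hab))
    exact ⟨c, h1, by simpa using h2⟩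

theorem IsMaxPair.pairLE_symm (hs : MackeySetting p F E E₁ K) {G Γ : Subgroup (S × S)}
    (hG : IsMaxPair F E E₁ K G) (hΓ : IsPair F E Q₁ K Γ) (h : PairLE E₁ K G Γ) :
    PairLE E₁ K Γ G := by
  obtain ⟨k, hk, τ, hτ, hv⟩ := h
  refine ⟨k⁻¹, inv_mem hk, rinv τ, hτ.rinv, hv.symm hΓ.gr ?_⟩
  have := hG.card_le (cj 1 k⁻¹ Γ) τ (hΓ.cj hs (one_mem _) (inv_mem hk)) hτ
    (via_cj_right.2 (by simpa using hv))
  rwa [dom_cj, card_map_conj] at this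

/-- There is a set of maximal morphisms such that every morphism lies below exactly one of them. -/
theorem exists_transversal (hs : MackeySetting p F E E₁ K) :
    ∃ T : Set (Subgroup (S × S)), (∀ G ∈ T, IsMaxPair F E E₁ K G) ∧
      ∀ Γ, IsPair F E Q₁ K Γ → ∃! G, G ∈ T ∧ PairLE E₁ K Γ G := by
  let M := {G : Subgroup (S × S) // IsMaxPair F E E₁ K G}
  let r : Setoid M :=
    { r := fun G G' => PairLE E₁ K G.1 G'.1
      iseqv :=
        { refl := fun G => G.2.pair.pairLE_refl
          symm := fun {G G'} h => G.2.pairLE_symm hs G'.2.pair h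
          trans := fun h h' => h.trans h' } }
  refine ⟨Set.range (fun c : Quotient r => c.out.1), ?_, fun Γ hΓ => ?_⟩
  · rintro _ ⟨c, rfl⟩
    exact c.out.2
  · obtain ⟨G, hG, τ, hτ, hv⟩ := hΓ.exists_max
    have h1 : PairLE E₁ K Γ G := ⟨1, one_mem _, τ, hτ, hv⟩
    have h2 : PairLE E₁ K G (Quotient.mk r ⟨G, hG⟩).out.1 :=
      r.symm (Quotient.mk_out (s := r) (⟨G, hG⟩ : M))
    refine ⟨_, ⟨⟨Quotient.mk r ⟨G, hG⟩, rfl⟩, h1.trans h2⟩, ?_⟩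
    rintro _ ⟨⟨c, rfl⟩, hc⟩
    obtain ⟨Z, hZ, h3, h4⟩ := pairLE_upper_bound hs hΓ hG.pair c.out.2.pair h1 hc
    have h5 : PairLE E₁ K c.out.1 G := h4.trans (hG.pairLE_symm hs hZ h3)
    have h6 : c = Quotient.mk r ⟨G, hG⟩ := by
      rw [← Quotient.out_eq c]
      exact Quotient.sound h5
    simp only [h6]

end Pairs

end CentricMackey

namespace CentricMackey

section Bisets

variable {S : Type u} [Group S]

/-- The stabilizer of a point of a biset, as a subgroup of `S × S`. -/
def stabS {J L : Subgroup S} (X : Biset J L) (x : X.carrier) : Subgroup (S × S) :=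
  (MulAction.stabilizer (J × L) x).map (J.subtype.prodMap L.subtype)

theorem mem_stabS {J L : Subgroup S} {X : Biset J L} {x : X.carrier} {b a : S} :
    (b, a) ∈ stabS X x ↔ ∃ (hb : b ∈ J) (ha : a ∈ L),
      ((⟨b, hb⟩, ⟨a, ha⟩) : J × L) • x = x := by
  constructor
  · rintro ⟨⟨⟨b', hb⟩, ⟨a', ha⟩⟩, h, e⟩
    obtain ⟨rfl, rfl⟩ := Prod.mk.inj e
    exact ⟨hb, ha, h⟩
  · rintro ⟨hb, ha, h⟩
    exact ⟨(⟨b, hb⟩, ⟨a, ha⟩), h, rfl⟩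

theorem prodMap_subtype_injective (J L : Subgroup S) :
    Function.Injective (J.subtype.prodMap L.subtype) :=
  Function.Injective.prodMap J.subtype_injective L.subtype_injective

theorem comap_stabS {J L : Subgroup S} (X : Biset J L) (x : X.carrier) :
    (stabS X x).comap (J.subtype.prodMap L.subtype) = MulAction.stabilizer (J × L) x :=
  Subgroup.comap_map_eq_self_of_injective (prodMap_subtype_injective J L) _

theorem dom_stabS_le {J L : Subgroup S} (X : Biset J L) (x : X.carrier) : dom (stabS X x) ≤ L := by
  intro a ha
  obtain ⟨b, h⟩ := mem_dom.1 ha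
  exact (mem_stabS.1 h).2.1

theorem im_stabS_le {J L : Subgroup S} (X : Biset J L) (x : X.carrier) : im (stabS X x) ≤ J := by
  intro a ha
  obtain ⟨b, h⟩ := mem_im.1 ha
  exact (mem_stabS.1 h).1

theorem stabS_smul {J L : Subgroup S} (X : Biset J L) (j : J) (l : L) (x : X.carrier) :
    stabS X (((j, l) : J × L) • x) = cj (j : S) (l : S) (stabS X x) := by
  ext ⟨b, a⟩
  rw [mem_cj, mem_stabS, mem_stabS]
  constructor
  · rintro ⟨hb, ha, h⟩
    refine ⟨J.mul_mem (J.mul_mem (J.inv_mem j.2) hb) j.2,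
      L.mul_mem (L.mul_mem (L.inv_mem l.2) ha) l.2, ?_⟩
    have := congrArg (fun y => ((j, l) : J × L)⁻¹ • y) h
    simp only [smul_smul, inv_mul_cancel, one_smul] at this
    rw [← mul_assoc] at this
    exact this
  · rintro ⟨hb, ha, h⟩
    have hb' : b ∈ J := by
      have := J.mul_mem (J.mul_mem j.2 hb) (J.inv_mem j.2)
      simpa [mul_assoc] using this
    have ha' : a ∈ L := by
      have := L.mul_mem (L.mul_mem l.2 ha) (L.inv_mem l.2)
      simpa [mul_assoc] using this
    refine ⟨hb', ha', ?_⟩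
    have h2 := congrArg (fun y => ((j, l) : J × L) • y) h
    simp only [smul_smul] at h2
    rw [smul_smul, ← h2]
    congr 1
    ext <;> simp [mul_assoc]

/-- The point of `X ×_M Y` given by two points. -/
def compMk {J M L : Subgroup S} (X : Biset J M) (Y : Biset M L) (x : X.carrier) (y : Y.carrier) :
    (Biset.comp X Y).carrier :=
  Quotient.mk (Biset.compSetoid X Y) (x, y)

theorem compMk_eq {J M L : Subgroup S} {X : Biset J M} {Y : Biset M L} {x x' : X.carrier}
    {y y' : Y.carrier} : compMk X Y x y = compMk X Y x' y' ↔
      ∃ m : M, x' = ((1, m) : J × M) • x ∧ y' = ((m, 1) : M × L) • y :=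
  ⟨fun h => Quotient.exact h, fun h => Quotient.sound h⟩

theorem smul_compMk {J M L : Subgroup S} {X : Biset J M} {Y : Biset M L} (x : X.carrier)
    (y : Y.carrier) (j : J) (l : L) : ((j, l) : J × L) • compMk X Y x y =
      compMk X Y (((j, 1) : J × M) • x) (((1, l) : M × L) • y) := rfl

theorem exists_compMk {J M L : Subgroup S} {X : Biset J M} {Y : Biset M L}
    (z : (Biset.comp X Y).carrier) : ∃ x y, z = compMk X Y x y := by
  obtain ⟨x, y⟩ := z
  exact ⟨x, y, rfl⟩

theorem stabS_comp {J M L : Subgroup S} (X : Biset J M) (Y : Biset M L) (x : X.carrier)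
    (y : Y.carrier) :
    stabS (Biset.comp X Y) (compMk X Y x y) = rcomp (stabS X x) (stabS Y y) := by
  ext ⟨c, a⟩
  rw [mem_rcomp, mem_stabS]
  constructor
  · rintro ⟨hc, ha, h⟩
    rw [smul_compMk] at h
    obtain ⟨m, h1, h2⟩ := compMk_eq.1 h
    rw [smul_smul] at h1 h2
    refine ⟨m, mem_stabS.2 ⟨hc, m.2, ?_⟩, mem_stabS.2 ⟨m.2, ha, ?_⟩⟩
    · simpa using h1.symm
    · simpa using h2.symm
  · rintro ⟨m, h1, h2⟩
    obtain ⟨hc, hm, h1⟩ := mem_stabS.1 h1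
    obtain ⟨hm', ha, h2⟩ := mem_stabS.1 h2
    refine ⟨hc, ha, ?_⟩
    rw [smul_compMk, compMk_eq]
    refine ⟨⟨m, hm⟩, ?_, ?_⟩
    · rw [smul_smul]
      simpa using h1.symm
    · rw [smul_smul]
      simpa using h2.symm

variable [Finite S]

/-- The class of the transitive biset with stabilizer `Γ`. -/
def bquot (J L : Subgroup S) (Γ : Subgroup (S × S)) : BisetClass J L :=
  .mk (.quot (Γ.comap (J.subtype.prodMap L.subtype)))

theorem mk_eq_bquot {J L : Subgroup S} (X : Biset J L) (x : X.carrier)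
    (h : ∀ y, ∃ g : J × L, g • x = y) : BisetClass.mk X = bquot J L (stabS X x) := by
  rw [bquot, comap_stabS]
  refine (BisetClass.sound ?_).symm
  refine ⟨Equiv.ofBijective (MulAction.ofQuotientStabilizer (J × L) x) ⟨
    MulAction.injective_ofQuotientStabilizer _ _, fun y => ?_⟩, fun g q => ?_⟩
  · obtain ⟨g, rfl⟩ := h y
    exact ⟨(g : (J × L) ⧸ MulAction.stabilizer (J × L) x), rfl⟩
  · exact MulAction.ofQuotientStabilizer_smul _ _ g q

/-- A subset stable under the action, as a biset. -/
def subBiset {J L : Subgroup S} (X : Biset J L) (s : Set X.carrier)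
    (hs : ∀ (g : J × L) (x : X.carrier), x ∈ s → g • x ∈ s) : Biset J L where
  carrier := s
  action :=
    { smul := fun g x => ⟨g • x.1, hs g x.1 x.2⟩
      one_smul := fun x => Subtype.ext (one_smul (J × L) x.1)
      mul_smul := fun g h x => Subtype.ext (mul_smul g h x.1) }

theorem stabS_eq_of_equivariant {J L : Subgroup S} {X Y : Biset J L}
    (g : X.carrier → Y.carrier) (hi : Function.Injective g)
    (hg : ∀ (a : J × L) x, g (a • x) = a • g x) (x : X.carrier) :
    stabS Y (g x) = stabS X x := by
  ext ⟨b, a⟩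
  rw [mem_stabS, mem_stabS]
  refine exists_congr fun _ => exists_congr fun _ => ?_
  rw [← hg]
  exact hi.eq_iff

/-- The inclusion of a stable subset. -/
def subBisetVal {J L : Subgroup S} (X : Biset J L) (s : Set X.carrier)
    (hs : ∀ (g : J × L) (x : X.carrier), x ∈ s → g • x ∈ s) (x : (subBiset X s hs).carrier) :
    X.carrier := (show s from x).1

theorem stabS_subBiset {J L : Subgroup S} (X : Biset J L) (s : Set X.carrier)
    (hs : ∀ (g : J × L) (x : X.carrier), x ∈ s → g • x ∈ s) (x : (subBiset X s hs).carrier) :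
    stabS (subBiset X s hs) x = stabS X (subBisetVal X s hs x) :=
  (stabS_eq_of_equivariant (subBisetVal X s hs) Subtype.val_injective (fun _ _ => rfl) x).symm

theorem mk_mem_closure {J L : Subgroup S} (X : Biset J L) :
    BisetClass.mk X ∈ AddSubmonoid.closure {y | ∃ x, y = bquot J L (stabS X x)} := by
  induction hn : Nat.card X.carrier using Nat.strong_induction_on generalizing X with
  | _ n ih =>
    rcases isEmpty_or_nonempty X.carrier with he | ⟨⟨x⟩⟩
    · have : BisetClass.mk X = 0 :=
        BisetClass.sound ⟨Equiv.equivOfIsEmpty _ PEmpty, fun g x => isEmptyElim x⟩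
      rw [this]
      exact zero_mem _
    · let s : Set X.carrier := MulAction.orbit (J × L) x
      have hs : ∀ (g : J × L) (x : X.carrier), x ∈ s → g • x ∈ s := fun g y hy => by
        obtain ⟨h, rfl⟩ := hy
        exact ⟨g * h, mul_smul g h x⟩
      have hs' : ∀ (g : J × L) (x : X.carrier), x ∈ sᶜ → g • x ∈ sᶜ := fun g y hy hy' => by
        refine hy ?_
        have := hs g⁻¹ _ hy'
        rwa [inv_smul_smul] at this
      have e : BisetClass.mk X =
          BisetClass.mk (subBiset X s hs) + BisetClass.mk (subBiset X sᶜ hs') := by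
        classical
        refine (BisetClass.sound ⟨Equiv.Set.sumCompl s, ?_⟩).symm
        rintro g (y | y) <;> rfl
      rw [e]
      refine add_mem ?_ ?_
      · let x₀ : (subBiset X s hs).carrier :=
          (⟨x, MulAction.mem_orbit_self x⟩ : MulAction.orbit (J × L) x)
        have := mk_eq_bquot (subBiset X s hs) x₀ (by
          rintro ⟨_, g, rfl⟩
          exact ⟨g, rfl⟩)
        rw [this, stabS_subBiset]
        exact AddSubmonoid.subset_closure ⟨x, rfl⟩
      · have hlt : Nat.card (subBiset X sᶜ hs').carrier < n := by
          rw [← hn]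
          change Nat.card (sᶜ : Set X.carrier) < _
          rw [Nat.card_coe_set_eq, ← Set.ncard_univ]
          refine Set.ncard_lt_ncard ⟨Set.subset_univ _, fun h => ?_⟩ (Set.toFinite _)
          exact h (Set.mem_univ x) (MulAction.mem_orbit_self x)
        have := ih _ hlt (subBiset X sᶜ hs') rfl
        refine AddSubmonoid.closure_mono ?_ this
        rintro _ ⟨y, rfl⟩
        exact ⟨subBisetVal X _ _ y, by rw [stabS_subBiset]⟩

/-- The base point of a transitive biset. -/
def basePt {J L : Subgroup S} (D : Subgroup (J × L)) : (Biset.quot D).carrier :=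
  ((1 : J × L) : (J × L) ⧸ D)

theorem exists_smul_basePt {J L : Subgroup S} (D : Subgroup (J × L))
    (y : (Biset.quot D).carrier) : ∃ g : J × L, g • basePt D = y := by
  obtain ⟨g, hg⟩ := QuotientGroup.mk_surjective (s := D) y
  refine ⟨g, Eq.trans ?_ hg⟩
  change ((g * 1 : J × L) : (J × L) ⧸ D) = _
  rw [mul_one]

/-- The standard transitive biset with stabilizer `Γ`. -/
abbrev tquot (J L : Subgroup S) (Γ : Subgroup (S × S)) : Biset J L :=
  Biset.quot (Γ.comap (J.subtype.prodMap L.subtype))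

theorem stabS_basePt {J L : Subgroup S} {Γ : Subgroup (S × S)} (hi : im Γ ≤ J) (hd : dom Γ ≤ L) :
    stabS (tquot J L Γ) (basePt _) = Γ := by
  unfold stabS
  have : MulAction.stabilizer (J × L) (basePt (Γ.comap (J.subtype.prodMap L.subtype))) =
      Γ.comap (J.subtype.prodMap L.subtype) := MulAction.stabilizer_quotient _
  rw [this]
  refine Subgroup.map_comap_eq_self ?_
  rintro ⟨b, a⟩ h
  exact ⟨(⟨b, hi (mem_im_of h)⟩, ⟨a, hd (mem_dom_of h)⟩), rfl⟩

theorem bquot_cj {J L : Subgroup S} {Γ : Subgroup (S × S)} (hi : im Γ ≤ J) (hd : dom Γ ≤ L)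
    {j l : S} (hj : j ∈ J) (hl : l ∈ L) : bquot J L (cj j l Γ) = bquot J L Γ := by
  have h := mk_eq_bquot (tquot J L Γ) (((⟨j, hj⟩, ⟨l, hl⟩) : J × L) • basePt _) (fun y => by
      obtain ⟨g, rfl⟩ := exists_smul_basePt _ y
      refine ⟨g * (((⟨j, hj⟩, ⟨l, hl⟩) : J × L))⁻¹, ?_⟩
      rw [mul_smul, inv_smul_smul])
  rw [stabS_smul, stabS_basePt hi hd] at h
  exact h.symm

theorem comp_bquot {J M L : Subgroup S} {Γ Δ : Subgroup (S × S)} (h1 : im Γ ≤ J)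
    (h2 : dom Γ ≤ M) (h3 : im Δ ≤ M) (h4 : dom Δ ≤ L) (h : M ≤ dom Γ ∨ M ≤ im Δ) :
    (bquot J M Γ).comp (bquot M L Δ) = bquot J L (rcomp Γ Δ) := by
  let X := tquot J M Γ
  let Y := tquot M L Δ
  let x : X.carrier := basePt _
  let y : Y.carrier := basePt _
  have hx : stabS X x = Γ := stabS_basePt h1 h2
  have hy : stabS Y y = Δ := stabS_basePt h3 h4
  have key := mk_eq_bquot (Biset.comp X Y) (compMk X Y x y) (by
    intro z
    obtain ⟨x', y', rfl⟩ := exists_compMk z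
    obtain ⟨⟨j, m⟩, rfl⟩ := exists_smul_basePt _ x'
    obtain ⟨⟨n, l⟩, rfl⟩ := exists_smul_basePt _ y'
    change ∃ g : J × L, g • compMk X Y x y =
      compMk X Y (((j, m) : J × M) • x) (((n, l) : M × L) • y)
    rcases h with h | h
    · obtain ⟨b, hb⟩ := mem_dom.1 (h (n⁻¹ * m).2)
      rw [← hx] at hb
      obtain ⟨hbJ, _, hb⟩ := mem_stabS.1 hb
      refine ⟨(j * ⟨b, hbJ⟩⁻¹, l), ?_⟩
      rw [smul_compMk, compMk_eq]
      refine ⟨n, ?_, ?_⟩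
      · rw [smul_smul]
        conv_rhs => rw [← hb]
        rw [smul_smul]
        congr 1
        refine Prod.ext ?_ ?_
        · simp
        · exact Subtype.ext (by simp)
      · rw [smul_smul]
        simp
    · obtain ⟨a, ha⟩ := mem_im.1 (h (m⁻¹ * n).2)
      rw [← hy] at ha
      obtain ⟨_, haL, ha⟩ := mem_stabS.1 ha
      refine ⟨(j, l * ⟨a, haL⟩⁻¹), ?_⟩
      rw [smul_compMk, compMk_eq]
      refine ⟨m, ?_, ?_⟩
      · rw [smul_smul]
        simp
      · rw [smul_smul]
        conv_rhs => rw [← ha]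
        rw [smul_smul]
        congr 1
        refine Prod.ext ?_ ?_
        · exact Subtype.ext (by simp)
        · simp)
  rw [stabS_comp, hx, hy] at key
  exact key

theorem comp_bquot_mem {J M L : Subgroup S} {Γ Δ : Subgroup (S × S)} (h1 : im Γ ≤ J)
    (h2 : dom Γ ≤ M) (h3 : im Δ ≤ M) (h4 : dom Δ ≤ L) :
    (bquot J M Γ).comp (bquot M L Δ) ∈ AddSubmonoid.closure
      {y | ∃ j ∈ J, ∃ m ∈ M, ∃ n ∈ M, ∃ l ∈ L,
        y = bquot J L (rcomp (cj j m Γ) (cj n l Δ))} := by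
  refine AddSubmonoid.closure_mono ?_ (mk_mem_closure (Biset.comp (tquot J M Γ) (tquot M L Δ)))
  rintro _ ⟨z, rfl⟩
  obtain ⟨x, y, rfl⟩ := exists_compMk z
  obtain ⟨⟨j, m⟩, rfl⟩ := exists_smul_basePt _ x
  obtain ⟨⟨n, l⟩, rfl⟩ := exists_smul_basePt _ y
  refine ⟨j, j.2, m, m.2, n, n.2, l, l.2, ?_⟩
  rw [stabS_comp, stabS_smul, stabS_smul, stabS_basePt h1 h2, stabS_basePt h3 h4]

/-- The sum over the orbits of a biset of the values of `f` at the stabilizers. -/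
noncomputable def orbitSum {G : Type*} [AddCommMonoid G] {J L : Subgroup S}
    (f : Subgroup (S × S) → G) (hf : ∀ Γ, im Γ ≤ J → dom Γ ≤ L → ∀ j ∈ J, ∀ l ∈ L,
      f (cj j l Γ) = f Γ) (X : Biset J L) : G :=
  ∑ᶠ o : MulAction.orbitRel.Quotient (J × L) X.carrier,
    Quotient.lift (s := MulAction.orbitRel (J × L) X.carrier) (fun x => f (stabS X x)) (by
      rintro _ y ⟨⟨j, l⟩, rfl⟩
      change f (stabS X (((j, l) : J × L) • y)) = _
      rw [stabS_smul]
      exact hf _ (im_stabS_le X y) (dom_stabS_le X y) j j.2 l l.2) o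

section

variable {G : Type*} [AddCommMonoid G] {J L : Subgroup S} (f : Subgroup (S × S) → G)
  (hf : ∀ Γ, im Γ ≤ J → dom Γ ≤ L → ∀ j ∈ J, ∀ l ∈ L, f (cj j l Γ) = f Γ)

theorem orbitSum_iso {X Y : Biset J L} (h : Biset.Iso X Y) :
    orbitSum f hf X = orbitSum f hf Y := by
  obtain ⟨e, he⟩ := h
  refine finsum_eq_of_bijective (Quotient.map' (s₁ := MulAction.orbitRel (J × L) X.carrier)
    (s₂ := MulAction.orbitRel (J × L) Y.carrier) e ?_) ⟨?_, ?_⟩ ?_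
  · rintro _ b ⟨g, rfl⟩
    exact ⟨g, (he g b).symm⟩
  · rintro ⟨a⟩ ⟨b⟩ h
    obtain ⟨g, h⟩ := Quotient.exact h
    refine Quotient.sound ⟨g, e.injective ?_⟩
    rw [← h]
    exact he g b
  · rintro ⟨y⟩
    obtain ⟨x, rfl⟩ := e.surjective y
    exact ⟨Quotient.mk _ x, rfl⟩
  · rintro ⟨x⟩
    exact congrArg f (stabS_eq_of_equivariant e e.injective he x).symm

theorem orbitSum_disjUnion (X Y : Biset J L) :
    orbitSum f hf (Biset.disjUnion X Y) = orbitSum f hf X + orbitSum f hf Y := by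
  let e : MulAction.orbitRel.Quotient (J × L) X.carrier ⊕
      MulAction.orbitRel.Quotient (J × L) Y.carrier →
      MulAction.orbitRel.Quotient (J × L) (Biset.disjUnion X Y).carrier :=
    Sum.elim
      (Quotient.map' (s₁ := MulAction.orbitRel (J × L) X.carrier)
        (s₂ := MulAction.orbitRel (J × L) (Biset.disjUnion X Y).carrier) Sum.inl (by
          rintro _ b ⟨g, rfl⟩
          exact ⟨g, rfl⟩))
      (Quotient.map' (s₁ := MulAction.orbitRel (J × L) Y.carrier)
        (s₂ := MulAction.orbitRel (J × L) (Biset.disjUnion X Y).carrier) Sum.inr (by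
          rintro _ b ⟨g, rfl⟩
          exact ⟨g, rfl⟩))
  have hex : ∀ a b : (Biset.disjUnion X Y).carrier,
      (Quotient.mk (MulAction.orbitRel (J × L) (Biset.disjUnion X Y).carrier) a = Quotient.mk _ b) →
      ∃ g : J × L, g • b = a := fun a b h => Quotient.exact h
  have he : Function.Bijective e := by
    constructor
    · rintro (a | a) (b | b) h <;> obtain ⟨a, rfl⟩ := Quotient.exists_rep a <;>
        obtain ⟨b, rfl⟩ := Quotient.exists_rep b
      · obtain ⟨g, h⟩ := hex (Sum.inl a) (Sum.inl b) h
        exact congrArg Sum.inl (Quotient.sound ⟨g, Sum.inl_injective h⟩)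
      · obtain ⟨g, h⟩ := hex (Sum.inl a) (Sum.inr b) h
        cases h
      · obtain ⟨g, h⟩ := hex (Sum.inr a) (Sum.inl b) h
        cases h
      · obtain ⟨g, h⟩ := hex (Sum.inr a) (Sum.inr b) h
        exact congrArg Sum.inr (Quotient.sound ⟨g, Sum.inr_injective h⟩)
    · rintro ⟨x | y⟩
      · exact ⟨Sum.inl (Quotient.mk _ x), rfl⟩
      · exact ⟨Sum.inr (Quotient.mk _ y), rfl⟩
  have := Fintype.ofFinite (MulAction.orbitRel.Quotient (J × L) X.carrier)
  have := Fintype.ofFinite (MulAction.orbitRel.Quotient (J × L) Y.carrier)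
  have h1 := finsum_eq_of_bijective (f := fun o => Sum.elim
    (Quotient.lift (s := MulAction.orbitRel (J × L) X.carrier) (fun x => f (stabS X x)) (by
      rintro _ y ⟨⟨j, l⟩, rfl⟩
      change f (stabS X (((j, l) : J × L) • y)) = _
      rw [stabS_smul]
      exact hf _ (im_stabS_le X y) (dom_stabS_le X y) j j.2 l l.2))
    (Quotient.lift (s := MulAction.orbitRel (J × L) Y.carrier) (fun x => f (stabS Y x)) (by
      rintro _ y ⟨⟨j, l⟩, rfl⟩
      change f (stabS Y (((j, l) : J × L) • y)) = _
      rw [stabS_smul]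
      exact hf _ (im_stabS_le Y y) (dom_stabS_le Y y) j j.2 l l.2)) o)
    (g := fun o => Quotient.lift (s := MulAction.orbitRel (J × L) (Biset.disjUnion X Y).carrier)
      (fun x => f (stabS (Biset.disjUnion X Y) x)) (by
      rintro _ y ⟨⟨j, l⟩, rfl⟩
      change f (stabS (Biset.disjUnion X Y) (((j, l) : J × L) • y)) = _
      rw [stabS_smul]
      exact hf _ (im_stabS_le _ y) (dom_stabS_le _ y) j j.2 l l.2) o) e he (by
    rintro (o | o) <;> obtain ⟨a, rfl⟩ := Quotient.exists_rep o
    · exact congrArg f (stabS_eq_of_equivariant (Y := Biset.disjUnion X Y) Sum.inl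
        Sum.inl_injective (fun _ _ => rfl) a).symm
    · exact congrArg f (stabS_eq_of_equivariant (Y := Biset.disjUnion X Y) Sum.inr
        Sum.inr_injective (fun _ _ => rfl) a).symm)
  rw [finsum_eq_sum_of_fintype, Fintype.sum_sum_type, ← finsum_eq_sum_of_fintype,
    ← finsum_eq_sum_of_fintype] at h1
  exact h1.symm

theorem orbitSum_of_transitive (X : Biset J L) (x : X.carrier)
    (h : ∀ y, ∃ g : J × L, g • x = y) : orbitSum f hf X = f (stabS X x) := by
  have : Unique (MulAction.orbitRel.Quotient (J × L) X.carrier) :=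
    { default := Quotient.mk _ x
      uniq := by
        rintro ⟨y⟩
        obtain ⟨g, rfl⟩ := h y
        exact Quotient.sound ⟨g, rfl⟩ }
  unfold orbitSum
  rw [finsum_unique]
  have e : (default : MulAction.orbitRel.Quotient (J × L) X.carrier) =
    Quotient.mk (MulAction.orbitRel (J × L) X.carrier) x := Subsingleton.elim _ _
  rw [e]
  rfl

/-- `orbitSum` as an additive map on isomorphism classes. -/
noncomputable def orbitHom : BisetClass J L →+ G where
  toFun := Quotient.lift (orbitSum f hf) (fun _ _ h => orbitSum_iso f hf h)
  map_zero' := by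
    have : IsEmpty (MulAction.orbitRel.Quotient (J × L) (Biset.empty J L).carrier) :=
      ⟨by rintro ⟨x⟩; exact PEmpty.elim x⟩
    exact finsum_of_isEmpty _
  map_add' := by
    rintro ⟨X⟩ ⟨Y⟩
    exact orbitSum_disjUnion f hf X Y

theorem orbitHom_bquot {Γ : Subgroup (S × S)} (hi : im Γ ≤ J) (hd : dom Γ ≤ L) :
    orbitHom f hf (bquot J L Γ) = f Γ := by
  have := orbitSum_of_transitive f hf (tquot J L Γ) (basePt _) (exists_smul_basePt _)
  rw [stabS_basePt hi hd] at this
  exact this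

end

end Bisets

end CentricMackey

namespace CentricMackey

open BisetSemiring

section

attribute [local instance] Fintype.ofFinite

variable {S : Type u} [Group S] [Finite S]

theorem BisetSemiring.single_add (J L : Subgroup S) (x y : BisetClass J L) :
    single J L (x + y) = single J L x + single J L y := by
  classical
  unfold single
  rw [Pi.single_add, Pi.single_add]
  rfl

theorem BisetSemiring.single_zero (J L : Subgroup S) :
    single J L (0 : BisetClass J L) = 0 := by
  classical
  unfold single
  rw [Pi.single_zero, Pi.single_zero]
  rfl

/-- `single` as an additive map. -/
noncomputable def singleHom (J L : Subgroup S) : BisetClass J L →+ BisetSemiring S :=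
  ⟨⟨single J L, single_zero J L⟩, single_add J L⟩

theorem BisetSemiring.single_mul_single (J M L : Subgroup S) (x : BisetClass J M)
    (y : BisetClass M L) : single J M x * single M L y = single J L (x.comp y) := by
  funext B A
  rw [entry_mul, Finset.sum_eq_single M]
  · by_cases hB : B = J
    · subst hB
      by_cases hA : A = L
      · subst hA
        simp only [single_apply_self]
      · rw [single_apply_of_ne_right (A' := A) M M y hA,
          single_apply_of_ne_right (A' := A) B B _ hA, BisetClass.comp_zero]
    · rw [single_apply_of_ne_left _ _ x hB, single_apply_of_ne_left _ _ _ hB, BisetClass.zero_comp]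
  · intro C _ hC
    rw [single_apply_of_ne_left _ _ y hC, BisetClass.comp_zero]
  · intro h
    exact absurd (Finset.mem_univ M) h

theorem BisetSemiring.single_mul_single_of_ne {J M M' L : Subgroup S} (h : M ≠ M')
    (x : BisetClass J M) (y : BisetClass M' L) : single J M x * single M' L y = 0 := by
  funext B A
  rw [entry_mul]
  refine Finset.sum_eq_zero fun C _ => ?_
  by_cases hC : C = M'
  · subst hC
    rw [single_apply_of_ne_right J B x h.symm, BisetClass.zero_comp]
  · rw [single_apply_of_ne_left _ _ y hC, BisetClass.comp_zero]

/-- The transitive biset with stabilizer `Γ` as an element of the semiring. -/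
noncomputable def bs (J L : Subgroup S) (Γ : Subgroup (S × S)) : BisetSemiring S :=
  single J L (bquot J L Γ)

theorem bs_mul_bs {J M L : Subgroup S} {Γ Δ : Subgroup (S × S)} (h1 : im Γ ≤ J)
    (h2 : dom Γ ≤ M) (h3 : im Δ ≤ M) (h4 : dom Δ ≤ L) (h : M ≤ dom Γ ∨ M ≤ im Δ) :
    bs J M Γ * bs M L Δ = bs J L (rcomp Γ Δ) := by
  rw [bs, bs, single_mul_single, comp_bquot h1 h2 h3 h4 h, bs]

theorem bs_mul_bs_mem {J M L : Subgroup S} {Γ Δ : Subgroup (S × S)} (h1 : im Γ ≤ J)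
    (h2 : dom Γ ≤ M) (h3 : im Δ ≤ M) (h4 : dom Δ ≤ L) :
    bs J M Γ * bs M L Δ ∈ AddSubmonoid.closure
      {y | ∃ j ∈ J, ∃ m ∈ M, ∃ n ∈ M, ∃ l ∈ L, y = bs J L (rcomp (cj j m Γ) (cj n l Δ))} := by
  have h := AddSubmonoid.mem_map_of_mem (singleHom J L) (comp_bquot_mem h1 h2 h3 h4)
  rw [bs, bs, single_mul_single]
  rw [AddMonoidHom.map_mclosure] at h
  refine AddSubmonoid.closure_mono ?_ h
  rintro _ ⟨_, ⟨j, hj, m, hm, n, hn, l, hl, rfl⟩, rfl⟩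
  exact ⟨j, hj, m, hm, n, hn, l, hl, rfl⟩

theorem bs_cj {J L : Subgroup S} {Γ : Subgroup (S × S)} (hi : im Γ ≤ J) (hd : dom Γ ≤ L)
    {j l : S} (hj : j ∈ J) (hl : l ∈ L) : bs J L (cj j l Γ) = bs J L Γ := by
  rw [bs, bs, bquot_cj hi hd hj hl]

theorem res_eq_bs {H K : Subgroup S} (h : H ≤ K) : res h = bs H K (cgr 1 H) := by
  rw [res, bs, bquot]
  congr 3
  ext ⟨b, a⟩
  rw [Subgroup.mem_comap]
  change _ ↔ ((b : S), (a : S)) ∈ _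
  rw [mem_cgr]
  constructor
  · rintro ⟨x, hx⟩
    obtain ⟨rfl, rfl⟩ := Prod.mk.inj hx
    exact ⟨x.2, by simp⟩
  · rintro ⟨ha, hb⟩
    exact ⟨⟨a, ha⟩, Prod.ext (Subtype.ext (by simpa using hb.symm)) rfl⟩

theorem ind_eq_bs {H K : Subgroup S} (h : H ≤ K) : ind h = bs K H (cgr 1 H) := by
  rw [ind, bs, bquot]
  congr 3
  ext ⟨b, a⟩
  rw [Subgroup.mem_comap]
  change _ ↔ ((b : S), (a : S)) ∈ _
  rw [mem_cgr]
  constructor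
  · rintro ⟨x, hx⟩
    obtain ⟨rfl, rfl⟩ := Prod.mk.inj hx
    exact ⟨x.2, by simp⟩
  · rintro ⟨ha, hb⟩
    exact ⟨a, Prod.ext (Subtype.ext (by simpa using hb.symm)) rfl⟩

theorem conj_eq_bs {H K : Subgroup S} (e : H ≃* K) : conj e = bs K H (egr e) := by
  rw [conj, bs, bquot]
  congr 3
  ext ⟨b, a⟩
  rw [Subgroup.mem_comap]
  change _ ↔ ((b : S), (a : S)) ∈ _
  rw [mem_egr]
  constructor
  · rintro ⟨x, hx⟩
    obtain ⟨rfl, rfl⟩ := Prod.mk.inj hx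
    exact ⟨x.2, rfl⟩
  · rintro ⟨ha, hb⟩
    exact ⟨a, Prod.ext (Subtype.ext hb) rfl⟩

variable {P Q : Subgroup S}

/-- `Γ` is the graph of an isomorphism of `E` from a subgroup of `L` to a subgroup of `J`. -/
structure IsBas (E : FusionSystem Q) (J L : Subgroup S) (Γ : Subgroup (S × S)) : Prop where
  left : J ≤ Q
  right : L ≤ Q
  gr : E.Gr Γ
  im_le : im Γ ≤ J
  dom_le : dom Γ ≤ L

namespace IsBas

variable {E : FusionSystem Q} {J M L : Subgroup S} {Γ Δ : Subgroup (S × S)}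

theorem rcomp (h : IsBas E J M Γ) (h' : IsBas E M L Δ) : IsBas E J L (rcomp Γ Δ) :=
  ⟨h.left, h'.right, h.gr.rcomp h'.gr, (im_rcomp_le _ _).trans h.im_le,
    (dom_rcomp_le _ _).trans h'.dom_le⟩

theorem cj (h : IsBas E J L Γ) {j l : S} (hj : j ∈ J) (hl : l ∈ L) : IsBas E J L (cj j l Γ) := by
  refine ⟨h.left, h.right, h.gr.cj (h.left hj) (h.right hl), ?_, ?_⟩
  · rw [im_cj]
    rintro _ ⟨a, ha, rfl⟩
    exact J.mul_mem (J.mul_mem hj (h.im_le ha)) (J.inv_mem hj)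
  · rw [dom_cj]
    rintro _ ⟨a, ha, rfl⟩
    exact L.mul_mem (L.mul_mem hl (h.dom_le ha)) (L.inv_mem hl)

theorem of_isSubsystem {F : FusionSystem P} (hQP : Q ≤ P) (hEF : E.IsSubsystem F)
    (h : IsBas E J L Γ) : IsBas F J L Γ :=
  ⟨h.left.trans hQP, h.right.trans hQP, h.gr.of_isSubsystem hEF, h.im_le, h.dom_le⟩

theorem graph (h : E.Gr Γ) : IsBas E (im Γ) (dom Γ) Γ := ⟨h.im_le, h.dom_le, h, le_rfl, le_rfl⟩

theorem one (hJ : J ≤ L) (hL : L ≤ Q) : IsBas E J L (cgr 1 J) :=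
  ⟨hJ.trans hL, hL, FusionSystem.gr_cgr (one_mem _) (hJ.trans hL), (im_cgr_one J).le,
    (dom_cgr 1 J).le.trans hJ⟩

theorem one' (hJ : J ≤ L) (hL : L ≤ Q) : IsBas E L J (cgr 1 J) :=
  ⟨hL, hJ.trans hL, FusionSystem.gr_cgr (one_mem _) (hJ.trans hL), (im_cgr_one J).le.trans hJ,
    (dom_cgr 1 J).le⟩

end IsBas

variable {E : FusionSystem Q}

theorem bs_mem_mackeySubsemiring {J L : Subgroup S} {Γ : Subgroup (S × S)}
    (h : IsBas E J L Γ) : bs J L Γ ∈ mackeySubsemiring E := by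
  obtain ⟨e, he, heΓ⟩ := h.gr.exists_equiv_of_eq rfl rfl
  have h1 : ind h.im_le * (conj e * res h.dom_le) = bs J L Γ := by
    rw [ind_eq_bs, conj_eq_bs, res_eq_bs, heΓ, bs_mul_bs le_rfl le_rfl (im_cgr_one _).le
      ((dom_cgr 1 _).le.trans h.dom_le) (Or.inl le_rfl), rcomp_one_right le_rfl,
      bs_mul_bs ((im_cgr_one _).le.trans h.im_le) (dom_cgr 1 _).le le_rfl h.dom_le
      (Or.inr le_rfl), rcomp_one_left le_rfl]
  rw [← h1]
  exact mul_mem (NonUnitalSubsemiring.subset_closure (.ind _ h.left))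
    (mul_mem (NonUnitalSubsemiring.subset_closure (.conj e he))
      (NonUnitalSubsemiring.subset_closure (.res _ h.right)))

theorem mem_closure_bs {x : BisetSemiring S} (hx : x ∈ mackeySubsemiring E) :
    x ∈ AddSubmonoid.closure {y | ∃ J L Γ, IsBas E J L Γ ∧ y = bs J L Γ} := by
  induction hx using NonUnitalSubsemiring.closure_induction with
  | mem x hx =>
    refine AddSubmonoid.subset_closure ?_
    cases hx with
    | ind h hK => exact ⟨_, _, _, .one' h hK, ind_eq_bs h⟩
    | res h hK => exact ⟨_, _, _, .one h hK, res_eq_bs h⟩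
    | conj φ hφ =>
      refine ⟨_, _, _, ⟨(E.le_of_mem hφ).2, (E.le_of_mem hφ).1, FusionSystem.gr_egr hφ,
        (im_egr φ).le, (dom_egr φ).le⟩, conj_eq_bs φ⟩
  | zero => exact zero_mem _
  | add x y _ _ hx hy => exact add_mem hx hy
  | mul x y hx' hy' hx hy =>
    clear hx' hy'
    induction hx using AddSubmonoid.closure_induction with
    | zero => rw [zero_mul]; exact zero_mem _
    | add a b _ _ ha hb => rw [add_mul]; exact add_mem ha hb
    | mem a ha =>
      induction hy using AddSubmonoid.closure_induction with
      | zero => rw [mul_zero]; exact zero_mem _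
      | add b c _ _ hb hc => rw [mul_add]; exact add_mem hb hc
      | mem b hb =>
        obtain ⟨J, M, Γ, hΓ, rfl⟩ := ha
        obtain ⟨M', L, Δ, hΔ, rfl⟩ := hb
        by_cases hM : M = M'
        · subst hM
          refine AddSubmonoid.closure_mono ?_ (bs_mul_bs_mem hΓ.im_le hΓ.dom_le hΔ.im_le hΔ.dom_le)
          rintro _ ⟨j, hj, m, hm, n, hn, l, hl, rfl⟩
          exact ⟨J, L, _, (hΓ.cj hj hm).rcomp (hΔ.cj hn hl), rfl⟩
        · rw [bs, bs, single_mul_single_of_ne hM]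
          exact zero_mem _

/-- An element of the Mackey semiring. -/
def mkS {x : BisetSemiring S} (hx : x ∈ mackeySubsemiring E) : MackeySemiring E := ⟨x, hx⟩

theorem mkS_mul {x y : BisetSemiring S} (hx : x ∈ mackeySubsemiring E)
    (hy : y ∈ mackeySubsemiring E) : mkS hx * mkS hy = mkS (mul_mem hx hy) := rfl

theorem mkS_add {x y : BisetSemiring S} (hx : x ∈ mackeySubsemiring E)
    (hy : y ∈ mackeySubsemiring E) : mkS hx + mkS hy = mkS (add_mem hx hy) := rfl

theorem mkS_zero : (mkS (zero_mem _) : MackeySemiring E) = 0 := rfl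

theorem mkS_congr {x y : BisetSemiring S} (h : x = y) (hx : x ∈ mackeySubsemiring E)
    (hy : y ∈ mackeySubsemiring E) : mkS hx = mkS hy := Subtype.ext h

variable (R : Type v) [CommRing R]

/-- The canonical map from the Mackey semiring to the Mackey algebra. -/
noncomputable def mackeyHom (E : FusionSystem Q) : MackeySemiring E →+ MackeyAlgebra R E :=
  AddMonoidHom.comp (TensorProduct.mk ℤ R (GrothendieckRing (MackeySemiring E)) 1).toAddMonoidHom
    GrothendieckRing.of

theorem mackeyHom_mul (x y : MackeySemiring E) :
    mackeyHom R E (x * y) = mackeyHom R E x * mackeyHom R E y := by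
  change (1 : R) ⊗ₜ[ℤ] GrothendieckRing.of (x * y) =
    ((1 : R) ⊗ₜ[ℤ] GrothendieckRing.of x : R ⊗[ℤ] GrothendieckRing (MackeySemiring E)) *
      ((1 : R) ⊗ₜ[ℤ] GrothendieckRing.of y : R ⊗[ℤ] GrothendieckRing (MackeySemiring E))
  rw [Algebra.TensorProduct.tmul_mul_tmul, GrothendieckRing.of_mul_of, one_mul]

theorem smul_mackeyHom (r : R) (x : MackeySemiring E) :
    r • mackeyHom R E x = (r ⊗ₜ[ℤ] GrothendieckRing.of x : R ⊗[ℤ] _) := by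
  change r • ((1 : R) ⊗ₜ[ℤ] GrothendieckRing.of x : R ⊗[ℤ] GrothendieckRing (MackeySemiring E)) = _
  rw [TensorProduct.smul_tmul', smul_eq_mul, mul_one]

open Classical in
/-- The basis element of the Mackey algebra given by the transitive `(J, L)`-biset with
stabilizer `Γ`. -/
noncomputable def bas (E : FusionSystem Q) (J L : Subgroup S) (Γ : Subgroup (S × S)) : MackeyAlgebra R E :=
  if h : bs J L Γ ∈ mackeySubsemiring E then mackeyHom R E (mkS h) else 0

theorem bas_eq {J L : Subgroup S} {Γ : Subgroup (S × S)} (h : bs J L Γ ∈ mackeySubsemiring E) :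
    bas R E J L Γ = mackeyHom R E (mkS h) := dif_pos h

theorem bas_cj {J L : Subgroup S} {Γ : Subgroup (S × S)} (h : IsBas E J L Γ) {j l : S}
    (hj : j ∈ J) (hl : l ∈ L) : bas R E J L (cj j l Γ) = bas R E J L Γ := by
  rw [bas_eq R (bs_mem_mackeySubsemiring (h.cj hj hl)), bas_eq R (bs_mem_mackeySubsemiring h),
    mkS_congr (bs_cj h.im_le h.dom_le hj hl)]

theorem bas_mul {J M L : Subgroup S} {Γ Δ : Subgroup (S × S)} (h : IsBas E J M Γ)
    (h' : IsBas E M L Δ) (hM : M ≤ dom Γ ∨ M ≤ im Δ) :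
    bas R E J M Γ * bas R E M L Δ = bas R E J L (rcomp Γ Δ) := by
  rw [bas_eq R (bs_mem_mackeySubsemiring h), bas_eq R (bs_mem_mackeySubsemiring h'),
    bas_eq R (bs_mem_mackeySubsemiring (h.rcomp h')), ← mackeyHom_mul, mkS_mul, mkS_congr (bs_mul_bs h.im_le h.dom_le h'.im_le h'.dom_le hM)]

theorem bas_mul_of_ne {J M M' L : Subgroup S} {Γ Δ : Subgroup (S × S)} (hM : M ≠ M') :
    bas R E J M Γ * bas R E M' L Δ = 0 := by
  by_cases h : bs J M Γ ∈ mackeySubsemiring E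
  · by_cases h' : bs M' L Δ ∈ mackeySubsemiring E
    · rw [bas_eq R h, bas_eq R h', ← mackeyHom_mul, mkS_mul, ← (mackeyHom R E).map_zero,
        ← mkS_zero]
      exact congrArg _ (mkS_congr (single_mul_single_of_ne hM _ _) _ _)
    · rw [bas, bas, dif_neg h', mul_zero]
  · rw [bas, dif_neg h, zero_mul]

theorem bas_mul_mem {J M L : Subgroup S} {Γ Δ : Subgroup (S × S)} (h : IsBas E J M Γ)
    (h' : IsBas E M L Δ) : bas R E J M Γ * bas R E M L Δ ∈ AddSubmonoid.closure
      {y | ∃ j ∈ J, ∃ m ∈ M, ∃ n ∈ M, ∃ l ∈ L,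
        y = bas R E J L (rcomp (cj j m Γ) (cj n l Δ))} := by
  rw [bas_eq R (bs_mem_mackeySubsemiring h), bas_eq R (bs_mem_mackeySubsemiring h'),
    ← mackeyHom_mul, mkS_mul]
  have key := bs_mul_bs_mem h.im_le h.dom_le h'.im_le h'.dom_le
  have aux : ∀ x, ∀ (_ : x ∈ AddSubmonoid.closure {y | ∃ j ∈ J, ∃ m ∈ M, ∃ n ∈ M, ∃ l ∈ L,
      y = bs J L (rcomp (cj j m Γ) (cj n l Δ))}), ∃ hx : x ∈ mackeySubsemiring E,
      mackeyHom R E (mkS hx) ∈ AddSubmonoid.closure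
      {y | ∃ j ∈ J, ∃ m ∈ M, ∃ n ∈ M, ∃ l ∈ L,
        y = bas R E J L (rcomp (cj j m Γ) (cj n l Δ))} := by
    intro x hx
    induction hx using AddSubmonoid.closure_induction with
    | zero => exact ⟨zero_mem _, by
        rw [mkS_zero, map_zero]
        exact zero_mem _⟩
    | add x y _ _ hx hy =>
      obtain ⟨hx, hx'⟩ := hx
      obtain ⟨hy, hy'⟩ := hy
      refine ⟨add_mem hx hy, ?_⟩
      have := add_mem hx' hy'
      rw [← map_add, mkS_add] at this
      exact this
    | mem x hx =>
      obtain ⟨j, hj, m, hm, n, hn, l, hl, rfl⟩ := hx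
      have hm := bs_mem_mackeySubsemiring ((h.cj hj hm).rcomp (h'.cj hn hl))
      refine ⟨hm, AddSubmonoid.subset_closure ⟨j, hj, m, ‹_›, n, hn, l, hl, ?_⟩⟩
      rw [bas_eq R hm]
  obtain ⟨hx, h⟩ := aux _ key
  exact h

/-- The multiples of the basis elements generate the Mackey algebra additively. -/
theorem closure_bas : AddSubmonoid.closure
    {y | ∃ J L Γ, IsBas E J L Γ ∧ ∃ r : R, y = r • bas R E J L Γ} = ⊤ := by
  set C := AddSubmonoid.closure {y | ∃ J L Γ, IsBas E J L Γ ∧ ∃ r : R, y = r • bas R E J L Γ}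
  have h1 : ∀ (r : R) (x : BisetSemiring S), x ∈ AddSubmonoid.closure
      {y | ∃ J L Γ, IsBas E J L Γ ∧ y = bs J L Γ} →
      ∃ hx : x ∈ mackeySubsemiring E, r • mackeyHom R E (mkS hx) ∈ C := by
    intro r x hx
    induction hx using AddSubmonoid.closure_induction with
    | zero =>
      refine ⟨zero_mem _, ?_⟩
      rw [mkS_zero, map_zero, smul_zero]
      exact zero_mem C
    | add x y _ _ hx hy =>
      obtain ⟨hx, hx'⟩ := hx
      obtain ⟨hy, hy'⟩ := hy
      refine ⟨add_mem hx hy, ?_⟩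
      have := add_mem hx' hy'
      rw [← smul_add, ← map_add, mkS_add] at this
      exact this
    | mem x hx =>
      obtain ⟨J, L, Γ, h, rfl⟩ := hx
      refine ⟨bs_mem_mackeySubsemiring h, AddSubmonoid.subset_closure ⟨J, L, Γ, h, r, ?_⟩⟩
      rw [bas_eq R (bs_mem_mackeySubsemiring h)]
  have h2 : ∀ (r : R) (x : MackeySemiring E),
      (r ⊗ₜ[ℤ] GrothendieckRing.of x : R ⊗[ℤ] GrothendieckRing (MackeySemiring E)) ∈ C := by
    intro r x
    have := (h1 r x.1 (mem_closure_bs x.2)).2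
    rw [smul_mackeyHom] at this
    exact this
  refine top_unique fun x _ => ?_
  change R ⊗[ℤ] GrothendieckRing (MackeySemiring E) at x
  induction x using TensorProduct.induction_on with
  | zero => exact zero_mem C
  | add x y hx hy => exact add_mem (hx trivial) (hy trivial)
  | tmul r t =>
    obtain ⟨a, b, rfl⟩ := GrothendieckRing.exists_eq_sub t
    have := add_mem (h2 r a) (h2 (-r) b)
    rw [TensorProduct.tmul_sub, sub_eq_add_neg, ← TensorProduct.neg_tmul]
    exact this

theorem mackey_induction {C : MackeyAlgebra R E → Prop} (zero : C 0)
    (add : ∀ x y, C x → C y → C (x + y))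
    (smul_bas : ∀ (r : R) J L Γ, IsBas E J L Γ → C (r • bas R E J L Γ)) (x : MackeyAlgebra R E) :
    C x := by
  have hx : x ∈ AddSubmonoid.closure
      {y | ∃ J L Γ, IsBas E J L Γ ∧ ∃ r : R, y = r • bas R E J L Γ} := by
    rw [closure_bas]
    trivial
  induction hx using AddSubmonoid.closure_induction with
  | zero => exact zero
  | add x y _ _ hx hy => exact add x y hx hy
  | mem x hx =>
    obtain ⟨J, L, Γ, h, r, rfl⟩ := hx
    exact smul_bas r J L Γ h

instance : Module.Finite R (MackeyAlgebra R E) := by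
  refine ⟨⟨(Set.toFinite (Set.range fun t : Subgroup S × Subgroup S × Subgroup (S × S) =>
    bas R E t.1 t.2.1 t.2.2)).toFinset, ?_⟩⟩
  rw [Set.Finite.coe_toFinset]
  refine top_unique fun x _ => ?_
  induction x using mackey_induction R with
  | zero => exact zero_mem _
  | add x y hx hy => exact add_mem (hx trivial) (hy trivial)
  | smul_bas r J L Γ h => exact Submodule.smul_mem _ _ (Submodule.subset_span ⟨(J, L, Γ), rfl⟩)

theorem idem_eq_bas {K : Subgroup S} (hK : K ≤ Q) : idem R E K hK = bas R E K K (cgr 1 K) := by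
  rw [bas_eq R (bs_mem_mackeySubsemiring (.one le_rfl hK))]
  exact congrArg (mackeyHom R E) (mkS_congr (ind_eq_bs (le_refl K)) _ _)

theorem one_eq_sum : (1 : MackeyAlgebra R E) =
    ∑ᶠ K : {K : Subgroup S // K ≤ Q}, bas R E K K (cgr 1 K) := by
  classical
  rw [finsum_eq_sum_of_fintype]
  have h1 : (1 : MackeyAlgebra R E) = mackeyHom R E 1 := rfl
  have h2 : (1 : MackeySemiring E) = ∑ K : {K : Subgroup S // K ≤ Q},
      (⟨bs K K (cgr 1 K), bs_mem_mackeySubsemiring (.one le_rfl K.2)⟩ : mackeySubsemiring E) := by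
    refine Subtype.ext ?_
    change BisetSemiring.unit Q = (NonUnitalSubsemiringClass.subtype (mackeySubsemiring E)) _
    rw [map_sum, BisetSemiring.unit, ← Finset.sum_filter]
    simp only [ind_eq_bs]
    refine (Finset.sum_subtype (F := Subtype.fintype _) (p := fun K => K ≤ Q) _ (by simp) (fun K => bs K K (cgr 1 K))).trans ?_
    rfl
  rw [h1, h2]
  refine (map_sum (mackeyHom R E) _ _).trans ?_
  exact Finset.sum_congr rfl fun K _ => (bas_eq R _).symm

theorem mackeyInclusion_mackeyHom {F : FusionSystem P} (hQP : Q ≤ P) (h : E.IsSubsystem F)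
    (x : MackeySemiring E) : mackeyInclusion R hQP h (mackeyHom R E x) =
      mackeyHom R F (mkS (mackeySubsemiring_mono hQP h x.2)) := by
  change (1 : R) ⊗ₜ[ℤ] (GrothendieckRing.map _ (GrothendieckRing.of x)) = _
  change (1 : R) ⊗ₜ[ℤ] (GrothendieckRing.lift _ (GrothendieckRing.of x)) = _
  rw [GrothendieckRing.lift_of]
  rfl

theorem mackeyInclusion_smul {F : FusionSystem P} (hQP : Q ≤ P) (h : E.IsSubsystem F) (r : R)
    (x : MackeyAlgebra R E) :
    mackeyInclusion R hQP h (r • x) = r • mackeyInclusion R hQP h x :=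
  LinearMap.map_smul (LinearMap.baseChange R (GrothendieckRing.map (T := MackeySemiring E)
      (T' := MackeySemiring F) (NonUnitalSubsemiring.inclusion
        (mackeySubsemiring_mono hQP h)) :
      GrothendieckRing (MackeySemiring E) →+ GrothendieckRing (MackeySemiring F)).toIntLinearMap)
    r (show R ⊗[ℤ] GrothendieckRing (MackeySemiring E) from x)

theorem mackeyInclusion_bas {F : FusionSystem P} (hQP : Q ≤ P) (h : E.IsSubsystem F)
    {J L : Subgroup S} {Γ : Subgroup (S × S)} (hΓ : IsBas E J L Γ) :
    mackeyInclusion R hQP h (bas R E J L Γ) = bas R F J L Γ := by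
  rw [bas_eq R (bs_mem_mackeySubsemiring hΓ), mackeyInclusion_mackeyHom,
    bas_eq R (bs_mem_mackeySubsemiring (hΓ.of_isSubsystem hQP h))]
  rfl

theorem FusionSystem.IsSubsystem.trans {Q' : Subgroup S} {D : FusionSystem Q'}
    {F : FusionSystem P} (h' : D.IsSubsystem E) (h : E.IsSubsystem F) : D.IsSubsystem F :=
  fun A B => (h' A B).trans (h A B)

theorem mackeyInclusion_comp {Q' : Subgroup S} {D : FusionSystem Q'} {F : FusionSystem P}
    (hQP : Q ≤ P) (h : E.IsSubsystem F) (hQ' : Q' ≤ Q) (h' : D.IsSubsystem E)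
    (x : MackeyAlgebra R D) :
    mackeyInclusion R hQP h (mackeyInclusion R hQ' h' x) =
      mackeyInclusion R (hQ'.trans hQP) (h'.trans h) x := by
  induction x using mackey_induction R with
  | zero => simp
  | add x y hx hy => simp only [map_add, hx, hy]
  | smul_bas r J L Γ hΓ =>
    simp only [mackeyInclusion_smul]
    rw [mackeyInclusion_bas R _ _ hΓ, mackeyInclusion_bas R _ _ (hΓ.of_isSubsystem hQ' h'),
      mackeyInclusion_bas R _ _ hΓ]

theorem mackeyInclusion_one {F : FusionSystem P} (hQP : Q ≤ P) (h : E.IsSubsystem F) :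
    mackeyInclusion R hQP h 1 = ∑ᶠ K : {K : Subgroup S // K ≤ Q}, bas R F K K (cgr 1 K) := by
  rw [one_eq_sum, finsum_eq_sum_of_fintype, finsum_eq_sum_of_fintype, map_sum]
  exact Finset.sum_congr rfl fun K _ => mackeyInclusion_bas R _ _ (.one le_rfl K.2)

theorem bas_mul_mackeyInclusion_one {F : FusionSystem P} (hQP : Q ≤ P) (h : E.IsSubsystem F)
    {J L : Subgroup S} {Γ : Subgroup (S × S)} (hΓ : IsBas F J L Γ) (hL : L ≤ Q) :
    bas R F J L Γ * mackeyInclusion R hQP h 1 = bas R F J L Γ := by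
  classical
  rw [mackeyInclusion_one, finsum_eq_sum_of_fintype, Finset.mul_sum,
    Finset.sum_eq_single (⟨L, hL⟩ : {K : Subgroup S // K ≤ Q})]
  · rw [bas_mul R hΓ (.one le_rfl hΓ.right) (Or.inr (im_cgr_one L).ge), rcomp_one_right hΓ.dom_le]
  · intro K _ hK
    exact bas_mul_of_ne R fun e => hK (Subtype.ext e.symm)
  · intro h
    exact absurd (Finset.mem_univ _) h

theorem bas_mul_mackeyInclusion_one_of_not_le {F : FusionSystem P} (hQP : Q ≤ P)
    (h : E.IsSubsystem F) {J L : Subgroup S} {Γ : Subgroup (S × S)} (hL : ¬ L ≤ Q) :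
    bas R F J L Γ * mackeyInclusion R hQP h 1 = 0 := by
  rw [mackeyInclusion_one, finsum_eq_sum_of_fintype, Finset.mul_sum]
  refine Finset.sum_eq_zero fun K _ => bas_mul_of_ne R ?_
  rintro rfl
  exact hL K.2

theorem mackeyInclusion_one_mul_bas {F : FusionSystem P} (hQP : Q ≤ P) (h : E.IsSubsystem F)
    {J L : Subgroup S} {Γ : Subgroup (S × S)} (hΓ : IsBas F J L Γ) (hJ : J ≤ Q) :
    mackeyInclusion R hQP h 1 * bas R F J L Γ = bas R F J L Γ := by
  classical
  rw [mackeyInclusion_one, finsum_eq_sum_of_fintype, Finset.sum_mul,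
    Finset.sum_eq_single (⟨J, hJ⟩ : {K : Subgroup S // K ≤ Q})]
  · rw [bas_mul R (.one le_rfl hΓ.left) hΓ (Or.inl (dom_cgr 1 J).ge), rcomp_one_left hΓ.im_le]
  · intro K _ hK
    exact bas_mul_of_ne R fun e => hK (Subtype.ext e)
  · intro h
    exact absurd (Finset.mem_univ _) h

theorem mackeyInclusion_one_mul_bas_of_not_le {F : FusionSystem P} (hQP : Q ≤ P)
    (h : E.IsSubsystem F) {J L : Subgroup S} {Γ : Subgroup (S × S)} (hJ : ¬ J ≤ Q) :
    mackeyInclusion R hQP h 1 * bas R F J L Γ = 0 := by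
  rw [mackeyInclusion_one, finsum_eq_sum_of_fintype, Finset.sum_mul]
  refine Finset.sum_eq_zero fun K _ => bas_mul_of_ne R ?_
  rintro rfl
  exact hJ K.2

/-- The linear map on the Mackey algebra with prescribed conjugation invariant values at the
basis elements. -/
theorem exists_orbitLift {G : Type w} [AddCommGroup G] [Module R G]
    (f : Subgroup S → Subgroup S → Subgroup (S × S) → G)
    (hf : ∀ J L Γ, IsBas E J L Γ → ∀ j ∈ J, ∀ l ∈ L, f J L (cj j l Γ) = f J L Γ) :
    ∃ Φ : MackeyAlgebra R E →+ G, (∀ (r : R) x, Φ (r • x) = r • Φ x) ∧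
      ∀ J L Γ, IsBas E J L Γ → Φ (bas R E J L Γ) = f J L Γ := by
  classical
  let f' : Subgroup S → Subgroup S → Subgroup (S × S) → G :=
    fun J L Γ => if IsBas E J L Γ then f J L Γ else 0
  have hf' : ∀ J L Γ, im Γ ≤ J → dom Γ ≤ L → ∀ j ∈ J, ∀ l ∈ L, f' J L (cj j l Γ) = f' J L Γ := by
    intro J L Γ _ _ j hj l hl
    have h1 : IsBas E J L (cj j l Γ) ↔ IsBas E J L Γ := by
      refine ⟨fun h => ?_, fun h => h.cj hj hl⟩
      have := h.cj (J.inv_mem hj) (L.inv_mem hl)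
      rwa [cj_cj, inv_mul_cancel, inv_mul_cancel, cj_one] at this
    by_cases h : IsBas E J L Γ
    · simp only [f', h1, h, if_true]
      exact hf J L Γ h j hj l hl
    · simp only [f', h1, h, if_false]
  let φ : BisetSemiring S →+ G := ∑ J : Subgroup S, ∑ L : Subgroup S,
    (orbitHom (f' J L) (hf' J L)).comp
      (⟨⟨fun x => x J L, rfl⟩, fun _ _ => rfl⟩ : BisetSemiring S →+ BisetClass J L)
  have hφ : ∀ J L Γ, IsBas E J L Γ → φ (bs J L Γ) = f J L Γ := by
    intro J L Γ h
    simp only [φ, AddMonoidHom.finsetSum_apply, AddMonoidHom.comp_apply]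
    rw [Finset.sum_eq_single J, Finset.sum_eq_single L]
    · change orbitHom (f' J L) (hf' J L) (single J L (bquot J L Γ) J L) = _
      rw [single_apply_self, orbitHom_bquot _ _ h.im_le h.dom_le]
      exact if_pos h
    · intro L' _ hL
      change orbitHom (f' J L') (hf' J L') (single J L (bquot J L Γ) J L') = _
      rw [single_apply_of_ne_right J J _ hL, map_zero]
    · intro h
      exact absurd (Finset.mem_univ _) h
    · intro J' _ hJ
      refine Finset.sum_eq_zero fun L' _ => ?_
      change orbitHom (f' J' L') (hf' J' L') (single J L (bquot J L Γ) J' L') = _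
      rw [single_apply_of_ne_left _ _ _ hJ, map_zero]
    · intro h
      exact absurd (Finset.mem_univ _) h
  let ψ : GrothendieckRing (MackeySemiring E) →+ G :=
    GrothendieckRing.lift (φ.comp (NonUnitalSubsemiringClass.subtype (mackeySubsemiring E) :
      mackeySubsemiring E →+ BisetSemiring S))
  let Φ : R ⊗[ℤ] GrothendieckRing (MackeySemiring E) →ₗ[R] G :=
    TensorProduct.AlgebraTensorModule.lift
      (LinearMap.toSpanSingleton R _ ψ.toIntLinearMap)
  refine ⟨Φ.toAddMonoidHom, fun r x => Φ.map_smul r x, fun J L Γ h => ?_⟩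
  rw [bas_eq R (bs_mem_mackeySubsemiring h), ← hφ J L Γ h]
  change Φ (1 ⊗ₜ[ℤ] GrothendieckRing.of _) = _
  have : Φ (1 ⊗ₜ[ℤ] GrothendieckRing.of (T := MackeySemiring E)
      ⟨bs J L Γ, bs_mem_mackeySubsemiring h⟩) =
    (1 : R) • ψ (GrothendieckRing.of (T := MackeySemiring E)
      ⟨bs J L Γ, bs_mem_mackeySubsemiring h⟩) := rfl
  refine this.trans ?_
  rw [one_smul]
  exact GrothendieckRing.lift_of _ _

end

end CentricMackey

namespace CentricMackey

section

variable {A B : Type*} [Ring A] [Ring B] (ι : A →ₙ+* B)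

namespace Res

variable {M M' M'' : Type*} [AddCommGroup M] [Module B M] [AddCommGroup M'] [Module B M']
  [AddCommGroup M''] [Module B M'']

/-- The map `M → 1_A M`. -/
def proj : M →+ Res ι M :=
  (DistribSMul.toAddMonoidHom M (ι 1)).rangeRestrict

theorem val_proj (m : M) : val (proj ι m) = ι 1 • m := rfl

variable {ι}

theorem proj_val (x : Res ι M) : proj ι (val x) = x :=
  val_injective (by rw [val_proj, one_smul_val])

theorem smul_proj (a : A) (m : M) : a • proj ι m = proj ι (ι a • m) :=
  val_injective (by
    rw [val_smul, val_proj, val_proj, smul_smul, smul_smul, ← map_mul, ← map_mul, mul_one, one_mul])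

variable (ι)

/-- Restriction of homomorphisms. -/
def map (f : M →ₗ[B] M') : Res ι M →ₗ[A] Res ι M' where
  toFun x := proj ι (f (val x))
  map_add' x y := by rw [map_add, map_add, map_add]
  map_smul' a x := by
    rw [RingHom.id_apply, smul_proj, val_smul, f.map_smul]

theorem val_map (f : M →ₗ[B] M') (x : Res ι M) : val (map ι f x) = f (val x) := by
  change ι 1 • f (val x) = _
  rw [← f.map_smul, one_smul_val]

theorem map_id : map ι (LinearMap.id : M →ₗ[B] M) = LinearMap.id := by
  ext x
  exact val_injective (val_map ι _ x)

theorem map_comp (g : M' →ₗ[B] M'') (f : M →ₗ[B] M') :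
    map ι (g ∘ₗ f) = map ι g ∘ₗ map ι f := by
  ext x
  refine val_injective ?_
  rw [LinearMap.comp_apply, val_map, val_map, val_map, LinearMap.comp_apply]

theorem map_add_apply (f g : M →ₗ[B] M') : map ι (f + g) = map ι f + map ι g := by
  ext x
  refine val_injective ?_
  rw [LinearMap.add_apply, map_add val, val_map, val_map, val_map, LinearMap.add_apply]

theorem map_zero_apply : map ι (0 : M →ₗ[B] M') = 0 := by
  ext x
  refine val_injective ?_
  rw [val_map, LinearMap.zero_apply, LinearMap.zero_apply, map_zero]

end Res

section Induction

variable {N N' N'' : Type*} [AddCommGroup N] [Module A N] [AddCommGroup N'] [Module A N']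
  [AddCommGroup N''] [Module A N'']

/-- The element `b ⊗ n` of the induced module. -/
def ind (b : B) (n : N) : Ind ι N :=
  Submodule.Quotient.mk (p := indRelations ι N)
    ((⟨b * ι 1, Submodule.mem_span_singleton.2 ⟨b, rfl⟩⟩ : leftIdeal ι) ⊗ₜ[ℤ] n)

theorem ind_add_left (b b' : B) (n : N) : ind ι (b + b') n = ind ι b n + ind ι b' n := by
  have : (⟨(b + b') * ι 1, Submodule.mem_span_singleton.2 ⟨b + b', rfl⟩⟩ : leftIdeal ι) =
      ⟨b * ι 1, Submodule.mem_span_singleton.2 ⟨b, rfl⟩⟩ +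
      ⟨b' * ι 1, Submodule.mem_span_singleton.2 ⟨b', rfl⟩⟩ := Subtype.ext (add_mul b b' (ι 1))
  unfold ind
  rw [this, TensorProduct.add_tmul]
  rfl

theorem ind_add_right (b : B) (n n' : N) : ind ι b (n + n') = ind ι b n + ind ι b n' := by
  unfold ind
  rw [TensorProduct.tmul_add]
  rfl

/-- `ind` as a biadditive map. -/
def indHom : B →+ N →+ Ind ι N :=
  AddMonoidHom.mk' (fun b => AddMonoidHom.mk' (ind ι b) (ind_add_right ι b)) (fun b b' => by
    ext n
    exact ind_add_left ι b b' n)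

theorem indHom_apply (b : B) (n : N) : indHom ι b n = ind ι b n := rfl

theorem ind_zero_left (n : N) : ind ι 0 n = 0 := by
  rw [← indHom_apply, map_zero]
  rfl

theorem ind_zero_right (b : B) : ind ι b (0 : N) = 0 := (indHom ι b).map_zero

theorem smul_ind (b b' : B) (n : N) : b • ind ι b' n = ind ι (b * b') n := by
  have : (⟨b * b' * ι 1, Submodule.mem_span_singleton.2 ⟨b * b', rfl⟩⟩ : leftIdeal ι) =
      b • ⟨b' * ι 1, Submodule.mem_span_singleton.2 ⟨b', rfl⟩⟩ :=
    Subtype.ext (mul_assoc b b' (ι 1))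
  unfold ind
  rw [this]
  rfl

theorem ind_eq_smul (b : B) (n : N) : ind ι b n = b • ind ι 1 n := by
  rw [smul_ind, mul_one]

theorem ind_mul (b : B) (a : A) (n : N) : ind ι (b * ι a) n = ind ι b (a • n) := by
  have h : (Submodule.Quotient.mk (p := indRelations ι N)
      (rightMul ι (⟨b * ι 1, Submodule.mem_span_singleton.2 ⟨b, rfl⟩⟩ : leftIdeal ι) a ⊗ₜ[ℤ] n)) =
      Submodule.Quotient.mk (p := indRelations ι N)
      ((⟨b * ι 1, Submodule.mem_span_singleton.2 ⟨b, rfl⟩⟩ : leftIdeal ι) ⊗ₜ[ℤ] (a • n)) :=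
    (Submodule.Quotient.eq _).2 (Submodule.subset_span ⟨_, a, n, rfl⟩)
  have e : rightMul ι (⟨b * ι 1, Submodule.mem_span_singleton.2 ⟨b, rfl⟩⟩ : leftIdeal ι) a =
      ⟨b * ι a * ι 1, Submodule.mem_span_singleton.2 ⟨b * ι a, rfl⟩⟩ := by
    refine Subtype.ext ?_
    change b * ι 1 * ι a = b * ι a * ι 1
    rw [mul_assoc, mul_assoc, ← map_mul, ← map_mul, one_mul, mul_one]
  rw [e] at h
  exact h

theorem ind_mul_one (b : B) (n : N) : ind ι (b * ι 1) n = ind ι b n := by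
  rw [ind_mul, one_smul]

variable {ι}

theorem Ind.induction {C : Ind ι N → Prop} (zero : C 0) (add : ∀ x y, C x → C y → C (x + y))
    (ind : ∀ b n, C (ind ι b n)) (x : Ind ι N) : C x := by
  obtain ⟨t, rfl⟩ := Submodule.Quotient.mk_surjective (indRelations ι N) x
  induction t using TensorProduct.induction_on with
  | zero => exact zero
  | add x y hx hy => exact add _ _ hx hy
  | tmul y n =>
    obtain ⟨y, hy⟩ := y
    obtain ⟨b, rfl⟩ := Submodule.mem_span_singleton.1 hy
    exact ind b n

theorem Ind.hom_ext {M : Type*} [AddCommGroup M] [Module B M] {f g : Ind ι N →ₗ[B] M}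
    (h : ∀ n, f (ind ι 1 n) = g (ind ι 1 n)) : f = g := by
  ext x
  induction x using Ind.induction with
  | zero => rw [map_zero, map_zero]
  | add x y hx hy => rw [map_add, map_add, hx, hy]
  | ind b n => rw [ind_eq_smul, map_smul, map_smul, h]

/-- The additive map on the induced module given by a balanced biadditive map. -/
theorem Ind.exists_liftAdd {G : Type*} [AddCommGroup G] (g : B →+ N →+ G)
    (hg : ∀ b a n, g (b * ι a) n = g b (a • n)) :
    ∃ Φ : Ind ι N →+ G, ∀ b n, Φ (ind ι b n) = g b n := by
  let g' : (leftIdeal ι) ⊗[ℤ] N →+ G := TensorProduct.liftAddHom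
    (g.comp (leftIdeal ι).subtype.toAddMonoidHom) (fun z y n => by
      change g ((z • y : leftIdeal ι) : B) n = g (y : B) (z • n)
      rw [Submodule.coe_smul_of_tower, map_zsmul, map_zsmul]
      rfl)
  have hg' : ∀ t ∈ indRelations ι N, g' t = 0 := by
    intro t ht
    have key : ∀ (b : B) (t : (leftIdeal ι) ⊗[ℤ] N), (∃ (y : leftIdeal ι) (a : A) (n : N),
        t = rightMul ι y a ⊗ₜ[ℤ] n - y ⊗ₜ[ℤ] (a • n)) → g' (b • t) = 0 := by
      rintro b _ ⟨y, a, n, rfl⟩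
      rw [smul_sub, TensorProduct.smul_tmul', TensorProduct.smul_tmul', map_sub]
      change g (b * (y * ι a)) n - g (b * y) (a • n) = 0
      rw [← mul_assoc, hg, sub_self]
    suffices h : ∀ b : B, g' (b • t) = 0 by
      have := h 1
      rwa [one_smul] at this
    refine Submodule.span_induction (p := fun t _ => ∀ b : B, g' (b • t) = 0) ?_ ?_ ?_ ?_ ht
    · intro t ht b
      exact key b t ht
    · intro b
      rw [smul_zero, map_zero]
    · intro x y _ _ hx hy b
      rw [smul_add, map_add, hx, hy, add_zero]
    · intro c x _ hx b
      rw [smul_smul, hx]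
  refine ⟨QuotientAddGroup.lift (indRelations ι N).toAddSubgroup g' hg', fun b n => ?_⟩
  change g (b * ι 1) n = _
  rw [hg, one_smul]

theorem Ind.exists_lift {M : Type*} [AddCommGroup M] [Module B M] (g : N →+ M)
    (hg : ∀ a n, ι a • g n = g (a • n)) :
    ∃ Φ : Ind ι N →ₗ[B] M, ∀ b n, Φ (ind ι b n) = b • g n := by
  obtain ⟨Φ, hΦ⟩ := Ind.exists_liftAdd (ι := ι) (G := M)
    (AddMonoidHom.mk' (fun b => (DistribSMul.toAddMonoidHom M b).comp g) (fun b b' => by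
      ext n
      exact add_smul b b' (g n))) (fun b a n => by
      change (b * ι a) • g n = b • g (a • n)
      rw [mul_smul, hg])
  refine ⟨{ Φ with map_smul' := fun b x => ?_ }, hΦ⟩
  change Φ (b • x) = b • Φ x
  induction x using Ind.induction with
  | zero => rw [smul_zero, map_zero, smul_zero]
  | add x y hx hy => rw [smul_add, map_add, map_add, hx, hy, smul_add]
  | ind c n =>
    rw [smul_ind, hΦ, hΦ]
    exact mul_smul b c (g n)

variable (ι)

theorem Ind.exists_map (f : N →ₗ[A] N') :
    ∃ Φ : Ind ι N →ₗ[B] Ind ι N', ∀ b n, Φ (ind ι b n) = ind ι b (f n) := by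
  obtain ⟨Φ, hΦ⟩ := Ind.exists_lift (ι := ι) ((indHom ι (1 : B)).comp f.toAddMonoidHom)
    (fun a n => by
      change ι a • ind ι 1 (f n) = ind ι 1 (f (a • n))
      rw [smul_ind, mul_one, map_smul, ← ind_mul, one_mul])
  exact ⟨Φ, fun b n => (hΦ b n).trans (ind_eq_smul ι b (f n)).symm⟩

/-- Induction of homomorphisms. -/
noncomputable def Ind.map (f : N →ₗ[A] N') : Ind ι N →ₗ[B] Ind ι N' := (Ind.exists_map ι f).choose

theorem Ind.map_ind (f : N →ₗ[A] N') (b : B) (n : N) : Ind.map ι f (ind ι b n) = ind ι b (f n) :=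
  (Ind.exists_map ι f).choose_spec b n

theorem Ind.map_zero_apply : Ind.map ι (0 : N →ₗ[A] N') = 0 :=
  Ind.hom_ext fun n => by
    rw [Ind.map_ind, LinearMap.zero_apply, LinearMap.zero_apply, ind_zero_right]

theorem Ind.map_id : Ind.map ι (LinearMap.id : N →ₗ[A] N) = LinearMap.id :=
  Ind.hom_ext fun n => Ind.map_ind ι _ 1 n

theorem Ind.map_comp (g : N' →ₗ[A] N'') (f : N →ₗ[A] N') :
    Ind.map ι (g ∘ₗ f) = Ind.map ι g ∘ₗ Ind.map ι f :=
  Ind.hom_ext fun n => by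
    rw [LinearMap.comp_apply, Ind.map_ind, Ind.map_ind, Ind.map_ind, LinearMap.comp_apply]

theorem Ind.map_add_apply (f g : N →ₗ[A] N') : Ind.map ι (f + g) = Ind.map ι f + Ind.map ι g :=
  Ind.hom_ext fun n => by
    rw [LinearMap.add_apply, Ind.map_ind, Ind.map_ind, Ind.map_ind, LinearMap.add_apply,
      ind_add_right]

/-- The unit of the adjunction between induction and restriction. -/
def etaMap : N →ₗ[A] Res ι (Ind ι N) where
  toFun n := Res.proj ι (ind ι 1 n)
  map_add' n n' := by rw [ind_add_right, map_add]
  map_smul' a n := by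
    rw [RingHom.id_apply, Res.smul_proj, smul_ind, mul_one, ← ind_mul, one_mul]

theorem val_etaMap (n : N) : Res.val (etaMap ι n) = ind ι (ι 1) n := by
  change ι 1 • ind ι 1 n = _
  rw [smul_ind, mul_one]

end Induction

section Trace

variable {M M' M'' : Type*} [AddCommGroup M] [Module B M] [AddCommGroup M'] [Module B M']
  [AddCommGroup M''] [Module B M'']

theorem theta_ind (b : B) (x : Res ι M) : theta ι M (ind ι b x) = b • Res.val x := by
  change (b * ι 1) • Res.val x = _
  rw [mul_smul, Res.one_smul_val]

variable (M M') in
/-- The homomorphisms `M → M'` that factor through the counit `θ` at `M'`. -/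
def Tr : AddSubgroup (M →ₗ[B] M') where
  carrier := {f | ∃ g : M →ₗ[B] Ind ι (Res ι M'), f = theta ι M' ∘ₗ g}
  zero_mem' := ⟨0, by rw [LinearMap.comp_zero]⟩
  add_mem' := by
    rintro _ _ ⟨g, rfl⟩ ⟨g', rfl⟩
    exact ⟨g + g', by rw [LinearMap.comp_add]⟩
  neg_mem' := by
    rintro _ ⟨g, rfl⟩
    exact ⟨-g, by rw [LinearMap.comp_neg]⟩

variable {ι}

/-- Everything that factors through an induced module belongs to `Tr`. -/
theorem comp_mem_Tr {Z : Type*} [AddCommGroup Z] [Module A Z] (g : M →ₗ[B] Ind ι Z)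
    (h : Ind ι Z →ₗ[B] M') : h ∘ₗ g ∈ Tr ι M M' := by
  refine ⟨Ind.map ι (Res.map ι h ∘ₗ etaMap ι) ∘ₗ g, ?_⟩
  rw [← LinearMap.comp_assoc]
  congr 1
  refine Ind.hom_ext fun z => ?_
  rw [LinearMap.comp_apply, Ind.map_ind, theta_ind, one_smul, LinearMap.comp_apply, Res.val_map,
    val_etaMap, ← one_mul (ι 1), ind_mul_one]

theorem Tr.comp_right {f : M' →ₗ[B] M''} (hf : f ∈ Tr ι M' M'') (g : M →ₗ[B] M') :
    f ∘ₗ g ∈ Tr ι M M'' := by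
  obtain ⟨k, rfl⟩ := hf
  exact ⟨k ∘ₗ g, LinearMap.comp_assoc _ _ _⟩

theorem Tr.comp_left {f : M →ₗ[B] M'} (hf : f ∈ Tr ι M M') (g : M' →ₗ[B] M'') :
    g ∘ₗ f ∈ Tr ι M M'' := by
  obtain ⟨k, rfl⟩ := hf
  rw [← LinearMap.comp_assoc]
  exact comp_mem_Tr k (g ∘ₗ theta ι M')

end Trace

section Transitivity

variable {A' : Type*} [Ring A'] {κ : A' →ₙ+* A} {l : A' →ₙ+* B} {ι}
  {Z : Type*} [AddCommGroup Z] [Module A' Z]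

theorem exists_indInd (hl : ∀ a, l a = ι (κ a)) :
    ∃ (f : Ind l Z →ₗ[B] Ind ι (Ind κ Z)) (g : Ind ι (Ind κ Z) →ₗ[B] Ind l Z),
      (∀ z, f (ind l 1 z) = ind ι 1 (ind κ 1 z)) ∧
      f ∘ₗ g = LinearMap.id ∧ g ∘ₗ f = LinearMap.id := by
  obtain ⟨f, hf⟩ := Ind.exists_lift (ι := l) (N := Z) (M := Ind ι (Ind κ Z))
    ((indHom ι (1 : B)).comp (indHom κ (1 : A))) (fun a z => by
      change l a • ind ι 1 (ind κ 1 z) = ind ι 1 (ind κ 1 (a • z))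
      rw [hl, smul_ind, mul_one, ← one_mul (ι (κ a)), ind_mul, smul_ind, mul_one,
        ← one_mul (κ a), ind_mul])
  obtain ⟨g₁, hg₁⟩ := Ind.exists_liftAdd (ι := κ) (N := Z) (G := Ind l Z)
    (AddMonoidHom.mk' (fun a => indHom l (ι a)) (fun a a' => by
      rw [map_add, map_add])) (fun b a z => by
      change ind l (ι (b * κ a)) z = ind l (ι b) (a • z)
      rw [map_mul, ← hl, ind_mul])
  obtain ⟨g, hg⟩ := Ind.exists_lift (ι := ι) (N := Ind κ Z) (M := Ind l Z) g₁ (fun a x => by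
    induction x using Ind.induction with
    | zero => rw [map_zero, smul_zero, smul_zero, map_zero]
    | add x y hx hy => rw [map_add, smul_add, smul_add, hx, hy, map_add]
    | ind a' z =>
      rw [hg₁, smul_ind, hg₁]
      change ι a • ind l (ι a') z = ind l (ι (a * a')) z
      rw [smul_ind, map_mul])
  refine ⟨f, g, fun z => ?_, ?_, ?_⟩
  · rw [hf, one_smul]
    rfl
  · refine Ind.hom_ext fun x => ?_
    rw [LinearMap.comp_apply, LinearMap.id_apply, hg, one_smul]
    induction x using Ind.induction with
    | zero => rw [map_zero, ind_zero_right, map_zero]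
    | add x y hx hy => rw [map_add, map_add, hx, hy, ind_add_right]
    | ind a z =>
      rw [hg₁]
      change f (ind l (ι a) z) = _
      rw [hf]
      change ι a • ind ι 1 (ind κ 1 z) = _
      rw [smul_ind, mul_one, ← one_mul (ι a), ind_mul, smul_ind, mul_one]
  · refine Ind.hom_ext fun z => ?_
    rw [LinearMap.comp_apply, LinearMap.id_apply, hf, one_smul]
    change g (ind ι 1 (ind κ 1 z)) = _
    rw [hg, one_smul, hg₁]
    change ind l (ι 1) z = _
    rw [← ind_mul_one l (ι 1), hl, ← map_mul, one_mul, ← hl, ← one_mul (l 1), ind_mul_one]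

theorem ind_mem_Tr (hl : ∀ a, l a = ι (κ a)) {N N' : Type*} [AddCommGroup N] [Module A N]
    [AddCommGroup N'] [Module A N'] {f : N →ₗ[A] N'} (hf : f ∈ Tr κ N N') :
    Ind.map ι f ∈ Tr l (Ind ι N) (Ind ι N') := by
  obtain ⟨g, rfl⟩ := hf
  obtain ⟨u, v, -, h, -⟩ := exists_indInd (Z := Res κ N') hl
  have : Ind.map ι (theta κ N' ∘ₗ g) = (Ind.map ι (theta κ N') ∘ₗ u) ∘ₗ (v ∘ₗ Ind.map ι g) := by
    rw [LinearMap.comp_assoc, ← LinearMap.comp_assoc (Ind.map ι g) v u, h, LinearMap.id_comp,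
      Ind.map_comp]
  rw [this]
  exact comp_mem_Tr _ _

theorem exists_comp_of_mem_Tr (hl : ∀ a, l a = ι (κ a)) {M M' : Type*} [AddCommGroup M]
    [Module B M] [AddCommGroup M'] [Module B M'] {f : M →ₗ[B] M'} (hf : f ∈ Tr l M M') :
    ∃ g : M →ₗ[B] Ind ι (Ind κ (Res κ (Res ι M'))),
      f = theta ι M' ∘ₗ Ind.map ι (theta κ (Res ι M')) ∘ₗ g := by
  obtain ⟨g, rfl⟩ := hf
  obtain ⟨u, v, hu, -, -⟩ := exists_indInd (Z := Res l M') hl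
  have hl1 : ι 1 * l 1 = l 1 := by rw [hl, ← map_mul, one_mul]
  let c : Res l M' →ₗ[A'] Res κ (Res ι M') :=
    { toFun := fun x => Res.proj κ (Res.proj ι (Res.val x))
      map_add' := fun x y => by simp only [map_add]
      map_smul' := fun a x => by
        rw [RingHom.id_apply, Res.smul_proj, Res.smul_proj, Res.val_smul, hl] }
  have hc : ∀ x, Res.val (Res.val (c x)) = Res.val x := fun x => by
    change ι (κ 1) • ι 1 • Res.val x = _
    rw [smul_smul, ← map_mul, mul_one, ← hl, Res.one_smul_val]
  refine ⟨Ind.map ι (Ind.map κ c) ∘ₗ u ∘ₗ g, ?_⟩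
  rw [← LinearMap.comp_assoc, ← LinearMap.comp_assoc, ← LinearMap.comp_assoc]
  congr 1
  refine Ind.hom_ext fun x => ?_
  simp only [LinearMap.comp_apply]
  rw [hu, Ind.map_ind, Ind.map_ind, Ind.map_ind, theta_ind, theta_ind, theta_ind, one_smul,
    one_smul, one_smul, hc]

theorem Tr_le_of_comp (hl : ∀ a, l a = ι (κ a)) (M M' : Type*) [AddCommGroup M]
    [Module B M] [AddCommGroup M'] [Module B M'] : Tr l M M' ≤ Tr ι M M' := by
  intro f hf
  obtain ⟨g, rfl⟩ := exists_comp_of_mem_Tr hl hf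
  exact comp_mem_Tr _ _

end Transitivity

/-- Induction along two homomorphisms that are conjugate in the target. -/
theorem Tr_le_of_conj {A' : Type*} [Ring A'] {ι : A →ₙ+* B} {ι' : A' →ₙ+* B} {c d : B}
    (hdc : d * c = ι 1) (hcd : c * d = ι' 1) (h : ∀ a, ∃ a', c * ι a = ι' a' * c)
    (M M' : Type*) [AddCommGroup M] [Module B M] [AddCommGroup M'] [Module B M'] :
    Tr ι M M' ≤ Tr ι' M M' := by
  rintro _ ⟨g, rfl⟩
  have h' : ∀ a, ∃ a', c * ι a = ι' a' * c ∧ ι a * d = d * ι' a' := by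
    intro a
    obtain ⟨a', ha'⟩ := h a
    refine ⟨a', ha', ?_⟩
    calc ι a * d = d * (c * ι a) * d := by rw [← mul_assoc, hdc, ← map_mul, one_mul]
      _ = d * ι' a' * (c * d) := by rw [ha']; simp only [mul_assoc]
      _ = d * ι' a' := by rw [hcd, mul_assoc, ← map_mul, mul_one]
  let e : Res ι M' →+ Ind ι' (Res ι' M') :=
    AddMonoidHom.mk' (fun x => ind ι' d (Res.proj ι' (c • Res.val x))) (fun x y => by
      rw [map_add, smul_add, map_add, ind_add_right])
  obtain ⟨Φ, hΦ⟩ := Ind.exists_lift (ι := ι) e (fun a x => by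
    change ι a • ind ι' d (Res.proj ι' (c • Res.val x)) =
      ind ι' d (Res.proj ι' (c • Res.val (a • x)))
    obtain ⟨a', h1, h2⟩ := h' a
    rw [smul_ind, h2, ind_mul, Res.smul_proj, Res.val_smul, smul_smul, smul_smul, h1])
  have : theta ι M' = theta ι' M' ∘ₗ Φ := by
    refine Ind.hom_ext fun x => ?_
    rw [LinearMap.comp_apply, hΦ, one_smul, theta_ind, one_smul]
    change _ = theta ι' M' (ind ι' d (Res.proj ι' (c • Res.val x)))
    rw [theta_ind, Res.val_proj, smul_smul, smul_smul, ← hcd, ← mul_assoc, hdc, mul_assoc, hdc,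
      ← map_mul, mul_one, Res.one_smul_val]
  rw [this, LinearMap.comp_assoc]
  exact comp_mem_Tr _ _

section Finite

theorem finite_ind (ι : A →ₙ+* B) (N : Type*) [AddCommGroup N] [Module A N] [Module.Finite A N] :
    Module.Finite B (Ind ι N) := by
  obtain ⟨s, hs⟩ := Module.Finite.fg_top (R := A) (M := N)
  refine ⟨⟨(s.finite_toSet.image (ind ι 1)).toFinset, ?_⟩⟩
  rw [Set.Finite.coe_toFinset]
  have key : ∀ n : N, ∀ b, ind ι b n ∈ Submodule.span B (ind ι 1 '' (s : Set N)) := by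
    intro n
    have hn : n ∈ Submodule.span A (s : Set N) := by
      rw [hs]
      trivial
    induction hn using Submodule.span_induction with
    | mem n hn =>
      intro b
      rw [ind_eq_smul]
      exact Submodule.smul_mem _ _ (Submodule.subset_span ⟨n, hn, rfl⟩)
    | zero =>
      intro b
      rw [ind_zero_right]
      exact zero_mem _
    | add x y _ _ hx hy =>
      intro b
      rw [ind_add_right]
      exact add_mem (hx b) (hy b)
    | smul a x _ hx =>
      intro b
      rw [← ind_mul]
      exact hx _
  refine top_unique fun x _ => ?_
  induction x using Ind.induction with
  | zero => exact zero_mem _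
  | add x y hx hy => exact add_mem (hx trivial) (hy trivial)
  | ind b n => exact key n b

theorem finite_res {R : Type*} [CommRing R] [Algebra R A] [Algebra R B] [Module.Finite R B]
    (ι : A →ₙ+* B) (hι : ∀ (r : R) a, ι (r • a) = r • ι a) (M : Type*) [AddCommGroup M]
    [Module B M] [Module.Finite B M] : Module.Finite A (Res ι M) := by
  obtain ⟨s, hs⟩ := Module.Finite.fg_top (R := B) (M := M)
  obtain ⟨t, ht⟩ := Module.Finite.fg_top (R := R) (M := B)
  let T : Set (Res ι M) := (fun z : B × M => Res.proj ι (z.1 • z.2)) '' ((t : Set B) ×ˢ (s : Set M))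
  have hT : T.Finite := (t.finite_toSet.prod s.finite_toSet).image _
  refine ⟨⟨hT.toFinset, ?_⟩⟩
  rw [Set.Finite.coe_toFinset]
  have key1 : ∀ m ∈ s, ∀ b : B, Res.proj ι (b • m) ∈ Submodule.span A T := by
    intro m hm b
    have hb : b ∈ Submodule.span R (t : Set B) := by
      rw [ht]
      trivial
    induction hb using Submodule.span_induction with
    | mem b hb => exact Submodule.subset_span ⟨(b, m), ⟨hb, hm⟩, rfl⟩
    | zero =>
      rw [zero_smul, map_zero]
      exact zero_mem _
    | add x y _ _ hx hy =>
      rw [add_smul, map_add]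
      exact add_mem hx hy
    | smul r x _ hx =>
      have : Res.proj ι ((r • x) • m) = (r • (1 : A)) • Res.proj ι (x • m) := by
        refine Res.val_injective ?_
        rw [Res.val_smul, Res.val_proj, Res.val_proj, hι, smul_smul, smul_smul, smul_mul_assoc,
          ← map_mul, mul_one, smul_smul, mul_smul_comm, smul_mul_assoc]
      rw [this]
      exact Submodule.smul_mem _ _ hx
  refine top_unique fun x _ => ?_
  rw [← Res.proj_val x]
  have hx : Res.val x ∈ Submodule.span B (s : Set M) := by
    rw [hs]
    trivial
  have key2 : ∀ m : M, m ∈ Submodule.span B (s : Set M) → ∀ b : B,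
      Res.proj ι (b • m) ∈ Submodule.span A T := by
    intro m hm
    induction hm using Submodule.span_induction with
    | mem m hm => exact key1 m hm
    | zero =>
      intro b
      rw [smul_zero, map_zero]
      exact zero_mem _
    | add x y _ _ hx hy =>
      intro b
      rw [smul_add, map_add]
      exact add_mem (hx b) (hy b)
    | smul c m _ hm =>
      intro b
      rw [smul_smul]
      exact hm _
  have := key2 _ hx 1
  rwa [one_smul] at this

end Finite

end

end CentricMackey

namespace CentricMackey

section Twist

open FusionSystem

variable {S : Type u} [Group S]

/-- `Λ` is a restriction of `G ∘ c_k` for some `k ∈ K`. -/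
def IsTwist (K : Subgroup S) (G Λ : Subgroup (S × S)) : Prop :=
  ∃ k ∈ K, ∀ b a, (b, a) ∈ Λ ↔ a ∈ dom Λ ∧ (b, k * a * k⁻¹) ∈ G

/-- `Λ` is a restriction of `G ∘ c_k` for some `k ∈ K`, which agrees with `Γ` up to composition
with a morphism of `E₁`. -/
structure IsFactor {Q₁ : Subgroup S} (E₁ : FusionSystem Q₁) (K : Subgroup S)
    (G Γ Λ : Subgroup (S × S)) : Prop where
  twist : IsTwist K G Λ
  dom_eq : dom Λ = dom Γ
  gr : E₁.Gr (rcomp Γ (rinv Λ))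

variable {K : Subgroup S} {G Γ Λ : Subgroup (S × S)}

theorem IsTwist.im_le (h : IsTwist K G Λ) : im Λ ≤ im G := by
  obtain ⟨k, -, h⟩ := h
  intro b hb
  obtain ⟨a, hab⟩ := mem_im.1 hb
  exact mem_im_of ((h b a).1 hab).2

theorem IsTwist.dom_le (h : IsTwist K G Λ) (hG : dom G ≤ K) : dom Λ ≤ K := by
  obtain ⟨k, hk, h⟩ := h
  intro a ha
  obtain ⟨b, hab⟩ := mem_dom.1 ha
  have := K.mul_mem (K.mul_mem (K.inv_mem hk) (hG (mem_dom_of ((h b a).1 hab).2))) hk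
  simpa [mul_assoc] using this

theorem IsTwist.gr {Q : Subgroup S} {E : FusionSystem Q} (h : IsTwist K G Λ) (hG : E.Gr G)
    (hd : dom G ≤ K) (hK : K ≤ Q) : E.Gr Λ := by
  obtain ⟨k, hk, h'⟩ := id h
  refine (hG.rcomp (gr_cgr (hK hk) ((h.dom_le hd).trans hK))).mono (Δ := rcomp G (cgr k (dom Λ))) ?_
  rintro ⟨b, a⟩ hab
  obtain ⟨ha, h1⟩ := (h' b a).1 hab
  exact ⟨_, h1, mem_cgr.2 ⟨ha, rfl⟩⟩

theorem IsTwist.mono {Q : Subgroup S} {E : FusionSystem Q} (h : IsTwist K G Λ) (hΛ : E.Gr Λ)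
    {Λ' : Subgroup (S × S)} (hle : Λ' ≤ Λ) : IsTwist K G Λ' := by
  obtain ⟨k, hk, h⟩ := h
  refine ⟨k, hk, fun b a => ⟨fun hab => ⟨mem_dom_of hab, ((h b a).1 (hle hab)).2⟩, ?_⟩⟩
  rintro ⟨ha, hab⟩
  obtain ⟨b', hb'⟩ := mem_dom.1 ha
  have h1 : (b, a) ∈ Λ := (h b a).2 ⟨dom_mono hle ha, hab⟩
  rwa [hΛ.functional h1 (hle hb')]

theorem IsTwist.cj (h : IsTwist K G Λ) {l : S} (hl : l ∈ K) : IsTwist K G (cj 1 l Λ) := by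
  obtain ⟨k, hk, h⟩ := h
  refine ⟨k * l⁻¹, mul_mem hk (inv_mem hl), fun b a => ?_⟩
  rw [mem_cj, h, dom_cj]
  simp only [mul_inv_rev, inv_inv, inv_one, one_mul, mul_one, Subgroup.mem_map]
  refine and_congr ⟨fun ha => ⟨_, ha, by simp [mul_assoc]⟩, ?_⟩ (by simp [mul_assoc])
  rintro ⟨x, hx, rfl⟩
  simpa [mul_assoc] using hx

variable [Finite S] {p : ℕ} [Fact p.Prime] {F : FusionSystem (⊤ : Subgroup S)} {Q Q₁ : Subgroup S}
  {E : FusionSystem Q} {E₁ : FusionSystem Q₁}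

theorem IsFactor.via (h : IsFactor E₁ K G Γ Λ) :
    ∃ k ∈ K, (∀ b a, (b, a) ∈ Λ ↔ a ∈ dom Λ ∧ (b, k * a * k⁻¹) ∈ G) ∧
      Via (rinv (rcomp Γ (rinv Λ))) k Γ G := by
  obtain ⟨⟨k, hk, h1⟩, h2, h3⟩ := h
  refine ⟨k, hk, h1, fun b a hab => ?_⟩
  have ha : a ∈ dom Λ := by
    rw [h2]
    exact mem_dom_of hab
  obtain ⟨c, hc⟩ := mem_dom.1 ha
  exact ⟨c, ⟨a, hab, hc⟩, ((h1 c a).1 hc).2⟩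

theorem IsFactor.pairLE (h : IsFactor E₁ K G Γ Λ) : PairLE E₁ K Γ G := by
  obtain ⟨k, hk, -, hv⟩ := h.via
  exact ⟨k, hk, _, h.gr.rinv, hv⟩

theorem exists_isFactor (hG : E.Gr G) (h : PairLE E₁ K Γ G) : ∃ Λ, IsFactor E₁ K G Γ Λ := by
  obtain ⟨k, hk, τ, hτ, hv⟩ := h
  have hd : dom (rcomp G (cgr k (dom Γ))) = dom Γ := by
    rw [dom_rcomp, dom_cgr]
    intro c hc
    obtain ⟨a, ha⟩ := mem_im.1 hc
    obtain ⟨ha', rfl⟩ := mem_cgr.1 ha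
    exact hv.conj_dom_le ha'
  refine ⟨rcomp G (cgr k (dom Γ)), ⟨k, hk, fun b a => ?_⟩, hd, hτ.rinv.mono ?_⟩
  · rw [hd, mem_rcomp]
    constructor
    · rintro ⟨c, h1, h2⟩
      obtain ⟨ha, rfl⟩ := mem_cgr.1 h2
      exact ⟨ha, h1⟩
    · rintro ⟨ha, h1⟩
      exact ⟨_, h1, mem_cgr.2 ⟨ha, rfl⟩⟩
  · rintro ⟨b, c⟩ ⟨a, hab, d, h1, h2⟩
    obtain ⟨ha, rfl⟩ := mem_cgr.1 h2
    obtain ⟨c', h3, h4⟩ := hv b a hab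
    have hc : c = c' := hG.functional h1 h4
    subst hc
    exact h3

theorem IsFactor.cj (h : IsFactor E₁ K G Γ Λ) {j l : S} (hj : j ∈ Q₁) (hl : l ∈ K) :
    IsFactor E₁ K G (cj j l Γ) (cj 1 l Λ) := by
  refine ⟨h.twist.cj hl, ?_, (h.gr.cj hj (one_mem _)).mono ?_⟩
  · rw [dom_cj, dom_cj, h.dom_eq]
  · rintro ⟨b, c⟩ ⟨a, h1, h2⟩
    rw [mem_cj]
    refine ⟨l⁻¹ * a * l, mem_cj.1 h1, ?_⟩
    have h3 : (c, a) ∈ CentricMackey.cj 1 l Λ := h2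
    have h4 := mem_cj.1 h3
    have h5 : (1⁻¹ * c * 1, l⁻¹ * a * l) ∈ Λ := h4
    exact h5

/-- Two factors differ by conjugation with an element of the image of `G`. -/
theorem IsFactor.exists_conj (hs : MackeySetting p F E E₁ K) (hG : IsMaxPair F E E₁ K G)
    (hΓ : IsPair F E Q₁ K Γ) {Λ' : Subgroup (S × S)} (h : IsFactor E₁ K G Γ Λ)
    (h' : IsFactor E₁ K G Γ Λ') : ∃ d ∈ im G, Λ' = CentricMackey.cj d 1 Λ := by
  obtain ⟨k, hk, hΛ, hv⟩ := h.via
  obtain ⟨k', hk', hΛ', hv'⟩ := h'.via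
  have hd : k' * k⁻¹ ∈ dom G := by
    refine hG.mem_dom_of_via hs (hΓ.cj hs (one_mem _) hk) h.gr.rinv (k := k' * k⁻¹) ?_ h'.gr.rinv
      (mul_mem hk' (inv_mem hk)) ?_
    · intro b a hab
      obtain ⟨c, h1, h2⟩ := hv _ _ (mem_cj.1 hab)
      exact ⟨c, by simpa using h1, by simpa [mul_assoc] using h2⟩
    · intro b a hab
      obtain ⟨c, h1, h2⟩ := hv' _ _ (mem_cj.1 hab)
      exact ⟨c, by simpa using h1, by simpa [mul_assoc] using h2⟩
  obtain ⟨d, hd⟩ := mem_dom.1 hd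
  refine ⟨d, mem_im_of hd, ?_⟩
  ext ⟨b, a⟩
  rw [hΛ', mem_cj, hΛ, h.dom_eq, h'.dom_eq, inv_one, one_mul, mul_one]
  refine and_congr_right fun _ => ⟨fun h1 => ?_, fun h1 => ?_⟩
  · have := G.mul_mem (G.mul_mem (G.inv_mem hd) h1) hd
    have e : ((d⁻¹ * b * d, k * a * k⁻¹) : S × S) =
        (d, k' * k⁻¹)⁻¹ * (b, k' * a * k'⁻¹) * (d, k' * k⁻¹) := by
      ext <;> simp [mul_assoc]
    rwa [e]
  · have := G.mul_mem (G.mul_mem hd h1) (G.inv_mem hd)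
    have e : ((b, k' * a * k'⁻¹) : S × S) =
        (d, k' * k⁻¹) * (d⁻¹ * b * d, k * a * k⁻¹) * (d, k' * k⁻¹)⁻¹ := by
      ext <;> simp [mul_assoc]
    rwa [e]

theorem pairLE_rcomp_left {α : Subgroup (S × S)} (hα : E₁.Gr α) (hi : im Γ ≤ Q₁) {n l : S}
    (hn : n ∈ Q₁) (hl : l ∈ K) : PairLE E₁ K (rcomp α (cj n l Γ)) Γ := by
  refine ⟨l⁻¹, inv_mem hl, rcomp (rinv (cgr n (im Γ))) (rinv α),
    (gr_cgr hn hi).rinv.rcomp hα.rinv, ?_⟩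
  rintro b a ⟨c, h1, h2⟩
  have h3 := mem_cj.1 h2
  exact ⟨_, ⟨c, mem_cgr.2 ⟨mem_im_of h3, by simp [mul_assoc]⟩, h1⟩, by simpa using h3⟩

theorem pairLE_rcomp_right {β : Subgroup (S × S)} (hβ : (inner K).Gr β) (hi : im Γ ≤ Q₁)
    {j m : S} (hj : j ∈ Q₁) (hm : m ∈ K) : PairLE E₁ K (rcomp (cj j m Γ) β) Γ := by
  obtain ⟨-, k, hk, hβ⟩ := gr_inner_iff.1 hβ
  refine ⟨m⁻¹ * k, mul_mem (inv_mem hm) hk, rinv (cgr j (im Γ)), (gr_cgr hj hi).rinv, ?_⟩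
  rintro b a ⟨c, h1, h2⟩
  rw [hβ] at h2
  obtain ⟨-, rfl⟩ := mem_cgr.1 h2
  have h3 := mem_cj.1 h1
  exact ⟨_, mem_cgr.2 ⟨mem_im_of h3, by simp [mul_assoc]⟩, by simpa [mul_assoc] using h3⟩

theorem PairLE.centric {Γ' : Subgroup (S × S)} (h : PairLE E₁ K Γ Γ') (hc : F.Centric (dom Γ)) :
    F.Centric (dom Γ') := by
  obtain ⟨k, -, τ, -, hv⟩ := h
  have h1 : F.Centric (im (cgr k (dom Γ))) := by
    refine Gr.centric_im (gr_cgr (Subgroup.mem_top k) le_top) ?_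
    rwa [dom_cgr]
  refine h1.mono (fun c hc => ?_) le_top
  obtain ⟨a, ha⟩ := mem_im.1 hc
  obtain ⟨ha', rfl⟩ := mem_cgr.1 ha
  exact hv.conj_dom_le ha'

end Twist

section TensorElements

variable {A B C : Type*} [Ring A] [Ring B] [Ring C] (κ : C →ₙ+* A) (ι : A →ₙ+* B) {A' : Type*}
  [Ring A'] (ι' : A' →ₙ+* B) {X : Type*} [AddCommGroup X] [Module A' X]

/-- The image of `b ⊗ x` in the restriction to `C` of an induced module. -/
def tens : B →+ X →+ Res κ (Res ι (Ind ι' X)) :=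
  (AddMonoidHom.compHom ((Res.proj κ).comp (Res.proj ι))).comp (indHom ι')

theorem tens_apply (b : B) (x : X) :
    tens κ ι ι' b x = Res.proj κ (Res.proj ι (ind ι' b x)) := rfl

theorem smul_tens (c : C) (b : B) (x : X) : c • tens κ ι ι' b x = tens κ ι ι' (ι (κ c) * b) x := by
  rw [tens_apply, tens_apply, Res.smul_proj, Res.smul_proj, smul_ind]

theorem tens_mul (b : B) (a : A') (x : X) :
    tens κ ι ι' (b * ι' a) x = tens κ ι ι' b (a • x) := by
  rw [tens_apply, tens_apply, ind_mul]

end TensorElements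

section Balanced

variable {S : Type u} [Group S] [Finite S] {Q Q₁ K : Subgroup S}
  {E : FusionSystem Q} {E₁ : FusionSystem Q₁} (R : Type v) [CommRing R]

/-- A biadditive map on the Mackey algebra and a module with prescribed values. -/
theorem exists_biadditive {A : Type*} [Ring A] [Algebra R A] {W X : Type*} [AddCommGroup W]
    [Module A W] [AddCommGroup X] (f : X → Subgroup S → Subgroup S → Subgroup (S × S) → W)
    (hadd : ∀ x y J L Γ, IsBas E J L Γ → f (x + y) J L Γ = f x J L Γ + f y J L Γ)
    (hf : ∀ x J L Γ, IsBas E J L Γ → ∀ j ∈ J, ∀ l ∈ L, f x J L (cj j l Γ) = f x J L Γ) :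
    ∃ g : MackeyAlgebra R E →+ X →+ W,
      (∀ (r : R) b x, g (r • b) x = algebraMap R A r • g b x) ∧
      ∀ x J L Γ, IsBas E J L Γ → g (bas R E J L Γ) x = f x J L Γ := by
  let _ : Module R W := Module.compHom W (algebraMap R A)
  choose Φ h1 h2 using fun x => exists_orbitLift (E := E) R (f x) (hf x)
  refine ⟨AddMonoidHom.mk' (fun b => AddMonoidHom.mk' (fun x => Φ x b) fun x y => ?_) fun b b' => ?_,
    fun r b x => h1 x r b, h2⟩
  · induction b using mackey_induction R with
    | zero => simp
    | add b b' hb hb' =>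
      rw [map_add, map_add, map_add, hb, hb']
      abel
    | smul_bas r J L Γ h =>
      rw [h1, h1, h1, h2 _ _ _ _ h, h2 _ _ _ _ h, h2 _ _ _ _ h, hadd _ _ _ _ _ h, smul_add]
  · ext x
    exact map_add (Φ x) b b'

/-- A criterion for a biadditive map to be balanced and equivariant. -/
theorem exists_equivariant_lift (hQ : Q₁ ≤ Q) (hE : E₁.IsSubsystem E) (hK : K ≤ Q)
    {W X : Type*} [AddCommGroup W] [Module (MackeyAlgebra R E₁) W] [AddCommGroup X]
    [Module (MackeyAlgebra R (inner K)) X] (g : MackeyAlgebra R E →+ X →+ W)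
    (hr : ∀ (r : R) b x, g (r • b) x = algebraMap R (MackeyAlgebra R E₁) r • g b x)
    (P : Subgroup S → Subgroup S → Subgroup (S × S) → Prop)
    (hP : ∀ J L Γ, IsBas E J L Γ → P J L Γ → J ≤ Q₁)
    (h1 : ∀ J L Γ, IsBas E J L Γ → P J L Γ → ∀ a c x,
      g (mackeyInclusion R hQ hE a * bas R E J L Γ * innerInclusion R E hK c) x =
        a • g (bas R E J L Γ) (c • x))
    (h2 : ∀ J L Γ, IsBas E J L Γ → ¬ P J L Γ → ∀ x, g (bas R E J L Γ) x = 0)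
    (h3 : ∀ J' J L α Γ, IsBas E₁ J' J α → IsBas E J L Γ → ∀ n ∈ J, ∀ l ∈ L,
      P J' L (rcomp α (cj n l Γ)) → P J L Γ)
    (h4 : ∀ J L L' Γ β, IsBas E J L Γ → IsBas (inner K) L L' β → ∀ j ∈ J, ∀ m ∈ L,
      P J L' (rcomp (cj j m Γ) β) → P J L Γ) :
    ∃ Φ : Ind (innerInclusion R E hK) X →+ W,
      (∀ b x, Φ (ind (innerInclusion R E hK) b x) = g b x) ∧
      ∀ a y, Φ (mackeyInclusion R hQ hE a • y) = a • Φ y := by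
  have hz : ∀ J L Γ, IsBas E J L Γ → ¬ P J L Γ → ∀ x, g (bas R E J L Γ) x = 0 := h2
  have hzc : ∀ (s : Set (MackeyAlgebra R E)), (∀ b ∈ s, ∀ x, g b x = 0) →
      ∀ b ∈ AddSubmonoid.closure s, ∀ x, g b x = 0 := by
    intro s hs b hb x
    induction hb using AddSubmonoid.closure_induction with
    | zero => rw [map_zero, AddMonoidHom.zero_apply]
    | add b b' _ _ hb hb' => rw [map_add, AddMonoidHom.add_apply, hb, hb', add_zero]
    | mem b hb => exact hs b hb x
  have hone : ∀ J L Γ, IsBas E J L Γ → P J L Γ →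
      mackeyInclusion R hQ hE 1 * bas R E J L Γ = bas R E J L Γ := fun J L Γ h hp =>
    mackeyInclusion_one_mul_bas R hQ hE h (hP J L Γ h hp)
  have hbal : ∀ b c x, g (b * innerInclusion R E hK c) x = g b (c • x) := by
    intro b c x
    induction b using mackey_induction R with
    | zero => rw [zero_mul, map_zero, AddMonoidHom.zero_apply, AddMonoidHom.zero_apply]
    | add b b' hb hb' =>
      rw [add_mul, map_add, map_add, AddMonoidHom.add_apply, AddMonoidHom.add_apply, hb, hb']
    | smul_bas r J L Γ h =>
      rw [smul_mul_assoc, hr, hr]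
      congr 1
      by_cases hp : P J L Γ
      · have := h1 J L Γ h hp 1 c x
        rwa [hone J L Γ h hp, one_smul] at this
      · rw [hz J L Γ h hp]
        induction c using mackey_induction R with
        | zero => rw [map_zero, mul_zero, map_zero, AddMonoidHom.zero_apply]
        | add c c' hc hc' => rw [map_add, mul_add, map_add, AddMonoidHom.add_apply, hc, hc', add_zero]
        | smul_bas s L₁ L' β hβ =>
          rw [innerInclusion, mackeyInclusion_smul, mackeyInclusion_bas R _ _ hβ, mul_smul_comm, hr]
          convert smul_zero _
          by_cases hL : L = L₁
          · subst hL
            refine hzc _ ?_ _ (bas_mul_mem R h (hβ.of_isSubsystem hK (inner_isSubsystem E hK))) x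
            rintro _ ⟨j, hj, m, hm, n, hn, l, hl, rfl⟩ x
            refine hz _ _ _ ((h.cj hj hm).rcomp
              ((hβ.cj hn hl).of_isSubsystem hK (inner_isSubsystem E hK))) (fun hp' => hp ?_) x
            exact h4 _ _ _ _ _ h (hβ.cj hn hl) j hj m hm hp'
          · rw [bas_mul_of_ne R hL, map_zero, AddMonoidHom.zero_apply]
  have hlin : ∀ a b x, g (mackeyInclusion R hQ hE a * b) x = a • g b x := by
    intro a b x
    induction b using mackey_induction R with
    | zero => rw [mul_zero, map_zero, AddMonoidHom.zero_apply, smul_zero]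
    | add b b' hb hb' =>
      rw [mul_add, map_add, map_add, AddMonoidHom.add_apply, AddMonoidHom.add_apply, hb, hb',
        smul_add]
    | smul_bas r J L Γ h =>
      rw [mul_smul_comm, hr, hr, smul_smul, ← Algebra.commutes, mul_smul]
      congr 1
      by_cases hp : P J L Γ
      · by_cases hL : L ≤ K
        · have := h1 J L Γ h hp a 1 x
          rwa [mul_assoc, innerInclusion, bas_mul_mackeyInclusion_one R hK _ h hL, one_smul] at this
        · have h5 : ∀ b : MackeyAlgebra R E, g (b * bas R E J L Γ) x = 0 := fun b => by
            have := hbal (b * bas R E J L Γ) 1 x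
            rw [innerInclusion, mul_assoc, bas_mul_mackeyInclusion_one_of_not_le R hK _ hL,
              mul_zero, map_zero, one_smul, AddMonoidHom.zero_apply] at this
            exact this.symm
          have h6 := h5 1
          rw [one_mul] at h6
          rw [h5, h6, smul_zero]
      · rw [hz J L Γ h hp, smul_zero]
        induction a using mackey_induction R with
        | zero => rw [map_zero, zero_mul, map_zero, AddMonoidHom.zero_apply]
        | add c c' hc hc' => rw [map_add, add_mul, map_add, AddMonoidHom.add_apply, hc, hc', add_zero]
        | smul_bas s J' J₁ α hα =>
          rw [mackeyInclusion_smul, mackeyInclusion_bas R _ _ hα, smul_mul_assoc, hr]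
          convert smul_zero _
          by_cases hJ : J₁ = J
          · subst hJ
            refine hzc _ ?_ _ (bas_mul_mem R (hα.of_isSubsystem hQ hE) h) x
            rintro _ ⟨j, hj, m, hm, n, hn, l, hl, rfl⟩ x
            refine hz _ _ _ (((hα.cj hj hm).of_isSubsystem hQ hE).rcomp (h.cj hn hl))
              (fun hp' => hp ?_) x
            exact h3 _ _ _ _ _ (hα.cj hj hm) h n hn l hl hp'
          · rw [bas_mul_of_ne R hJ, map_zero, AddMonoidHom.zero_apply]
  obtain ⟨Φ, hΦ⟩ := Ind.exists_liftAdd g hbal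
  refine ⟨Φ, hΦ, fun a y => ?_⟩
  induction y using Ind.induction with
  | zero => rw [smul_zero, map_zero, smul_zero]
  | add x y hx hy => rw [smul_add, map_add, map_add, hx, hy, smul_add]
  | ind b x => rw [smul_ind, hΦ, hΦ, hlin]

end Balanced

end CentricMackey

namespace CentricMackey

open FusionSystem

section CentricModules

variable {S : Type u} [Group S] [Finite S] {P Q Q₁ : Subgroup S} {F : FusionSystem P}
  {E : FusionSystem Q} {E₁ : FusionSystem Q₁} (R : Type v) [CommRing R]

theorem bas_smul_eq_zero {X : Type*} [AddCommGroup X] [Module (MackeyAlgebra R E) X]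
    (hX : IsCentric R F E X) {J L : Subgroup S} {Γ : Subgroup (S × S)} (h : IsBas E J L Γ)
    (hc : ¬ F.Centric J) (x : X) : bas R E J L Γ • x = 0 := by
  have := hX J h.left hc (bas R E J L Γ • x)
  rwa [idem_eq_bas, smul_smul, bas_mul R (.one le_rfl h.left) h (Or.inl (dom_cgr 1 J).ge),
    rcomp_one_left h.im_le] at this

variable (hQ : Q₁ ≤ Q) (hE : E₁.IsSubsystem E) {X : Type*} [AddCommGroup X]
  [Module (MackeyAlgebra R E₁) X]

theorem ind_bas_eq_zero_of_not_le {J L : Subgroup S} {Γ : Subgroup (S × S)} (hL : ¬ L ≤ Q₁)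
    (x : X) : ind (mackeyInclusion R hQ hE) (bas R E J L Γ) x = 0 := by
  rw [← ind_mul_one, bas_mul_mackeyInclusion_one_of_not_le R hQ hE hL, ind_zero_left]

theorem ind_bas_eq_zero (hX : IsCentric R F E₁ X) {J L : Subgroup S} {Γ : Subgroup (S × S)}
    (h : IsBas E J L Γ) (hc : ¬ F.Centric (dom Γ)) (x : X) :
    ind (mackeyInclusion R hQ hE) (bas R E J L Γ) x = 0 := by
  by_cases hL : L ≤ Q₁
  · have h1 : IsBas E J (dom Γ) Γ := ⟨h.left, h.gr.dom_le, h.gr, h.im_le, le_rfl⟩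
    have h2 : IsBas E₁ (dom Γ) L (cgr 1 (dom Γ)) := .one h.dom_le hL
    have e : bas R E J L Γ = bas R E J (dom Γ) Γ * mackeyInclusion R hQ hE
        (bas R E₁ (dom Γ) L (cgr 1 (dom Γ))) := by
      rw [mackeyInclusion_bas R hQ hE h2, bas_mul R h1 (h2.of_isSubsystem hQ hE) (Or.inl le_rfl),
        rcomp_one_right le_rfl]
    rw [e, ind_mul, bas_smul_eq_zero R hX h2 hc, ind_zero_right]
  · exact ind_bas_eq_zero_of_not_le R hQ hE hL x

theorem not_centric_dom {Γ : Subgroup (S × S)} (hg : F.Gr Γ) {J : Subgroup S} (hJ : J ≤ P)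
    (h : im Γ ≤ J) (hc : ¬ F.Centric J) : ¬ F.Centric (dom Γ) :=
  fun h1 => hc ((hg.centric_im h1).mono h hJ)

theorem isCentric_ind (hQP : Q ≤ P) (hEF : E.IsSubsystem F) (hX : IsCentric R F E₁ X) :
    IsCentric R F E (Ind (mackeyInclusion R hQ hE) X) := by
  intro J hJ hc y
  induction y using Ind.induction with
  | zero => rw [smul_zero]
  | add x y hx hy => rw [smul_add, hx, hy, add_zero]
  | ind b x =>
    rw [idem_eq_bas]
    induction b using mackey_induction R with
    | zero => rw [ind_zero_left, smul_zero]
    | add b b' hb hb' => rw [ind_add_left, smul_add, hb, hb', add_zero]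
    | smul_bas r J' L Γ h =>
      have e : r • bas R E J' L Γ = algebraMap R _ r * bas R E J' L Γ := Algebra.smul_def _ _
      rw [e, smul_ind, ← mul_assoc, ← Algebra.commutes, mul_assoc, ← smul_ind]
      convert smul_zero _
      by_cases hJJ : J = J'
      · subst hJJ
        rw [bas_mul R (.one le_rfl hJ) h (Or.inl (dom_cgr 1 J).ge), rcomp_one_left h.im_le]
        exact ind_bas_eq_zero R hQ hE hX h
          (not_centric_dom (h.gr.of_isSubsystem hEF) (hJ.trans hQP) h.im_le hc) x
      · rw [bas_mul_of_ne R hJJ, ind_zero_left]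

theorem isCentric_res {M : Type*} [AddCommGroup M] [Module (MackeyAlgebra R E) M]
    (hM : IsCentric R F E M) : IsCentric R F E₁ (Res (mackeyInclusion R hQ hE) M) := by
  intro J hJ hc x
  refine Res.val_injective ?_
  rw [map_zero, Res.val_smul, idem_eq_bas, mackeyInclusion_bas R hQ hE (.one le_rfl hJ)]
  exact bas_smul_eq_zero R hM (.one le_rfl (hJ.trans hQ)) hc _

theorem algebraMap_smul_ind (r : R) (b : MackeyAlgebra R E) (x : X) :
    algebraMap R (MackeyAlgebra R E) r • ind (mackeyInclusion R hQ hE) b x =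
      ind (mackeyInclusion R hQ hE) b (algebraMap R (MackeyAlgebra R E₁) r • x) := by
  rw [smul_ind, ← ind_mul, ← ind_mul_one, ← Algebra.smul_def, Algebra.algebraMap_eq_smul_one,
    mackeyInclusion_smul, mul_smul_comm, smul_mul_assoc]

end CentricModules

end CentricMackey

namespace CentricMackey

open FusionSystem

section Component

variable {S : Type u} [Group S] [Finite S] {p : ℕ} [Fact p.Prime]
  {F : FusionSystem (⊤ : Subgroup S)} {Q Q₁ K : Subgroup S}
  {E : FusionSystem Q} {E₁ : FusionSystem Q₁} {G : Subgroup (S × S)} (R : Type v) [CommRing R]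
  (hs : MackeySetting p F E E₁ K) (hG : IsMaxPair F E E₁ K G)
  {X : Type*} [AddCommGroup X] [Module (MackeyAlgebra R (inner K)) X]

/-- The element `a ⊗ (b ⊗ x)` of the module induced to `E₁` from the image of `G`. -/
noncomputable def tri (a : MackeyAlgebra R E₁) (b : MackeyAlgebra R E) (x : X) :
    Ind (innerInclusion R E₁ hG.pair.im_le) (Res (innerInclusion R E₁ hG.pair.im_le)
      (Res (mackeyInclusion R hs.le hs.sub) (Ind (innerInclusion R E hs.le') X))) :=
  ind (innerInclusion R E₁ hG.pair.im_le) a (tens (innerInclusion R E₁ hG.pair.im_le)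
    (mackeyInclusion R hs.le hs.sub) (innerInclusion R E hs.le') b x)

theorem tri_add_left (a a' : MackeyAlgebra R E₁) (b : MackeyAlgebra R E) (x : X) :
    tri R hs hG (a + a') b x = tri R hs hG a b x + tri R hs hG a' b x := ind_add_left _ _ _ _

theorem tri_add_mid (a : MackeyAlgebra R E₁) (b b' : MackeyAlgebra R E) (x : X) :
    tri R hs hG a (b + b') x = tri R hs hG a b x + tri R hs hG a b' x := by
  rw [tri, map_add, AddMonoidHom.add_apply, ind_add_right]
  rfl

theorem tri_add_right (a : MackeyAlgebra R E₁) (b : MackeyAlgebra R E) (x x' : X) :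
    tri R hs hG a b (x + x') = tri R hs hG a b x + tri R hs hG a b x' := by
  rw [tri, map_add, ind_add_right]
  rfl

theorem tri_zero_left (b : MackeyAlgebra R E) (x : X) : tri R hs hG 0 b x = 0 := ind_zero_left _ _

theorem tri_zero_mid (a : MackeyAlgebra R E₁) (x : X) : tri R hs hG a 0 x = 0 := by
  rw [tri, map_zero, AddMonoidHom.zero_apply, ind_zero_right]

theorem smul_tri (c a : MackeyAlgebra R E₁) (b : MackeyAlgebra R E) (x : X) :
    c • tri R hs hG a b x = tri R hs hG (c * a) b x := smul_ind _ _ _ _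

theorem tri_mul_right (a : MackeyAlgebra R E₁) (b : MackeyAlgebra R E)
    (c : MackeyAlgebra R (inner K)) (x : X) :
    tri R hs hG a (b * innerInclusion R E hs.le' c) x = tri R hs hG a b (c • x) := by
  rw [tri, tens_mul]
  rfl

theorem tri_move {A B : Subgroup S} {β : Subgroup (S × S)} (hβ : IsBas (inner (im G)) A B β)
    (a : MackeyAlgebra R E₁) (b : MackeyAlgebra R E) (x : X) :
    tri R hs hG (a * bas R E₁ A B β) b x = tri R hs hG a (bas R E A B β * b) x := by
  have h1 : innerInclusion R E₁ hG.pair.im_le (bas R _ A B β) = bas R E₁ A B β :=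
    mackeyInclusion_bas R _ _ hβ
  rw [tri, ← h1, ind_mul, smul_tens, h1, mackeyInclusion_bas R hs.le hs.sub
    (hβ.of_isSubsystem hG.pair.im_le (inner_isSubsystem E₁ hG.pair.im_le))]
  rfl

theorem tri_smul (r : R) (a : MackeyAlgebra R E₁) (b : MackeyAlgebra R E) (x : X) :
    tri R hs hG a (r • b) x = algebraMap R (MackeyAlgebra R E₁) r • tri R hs hG a b x := by
  have h1 : ∀ c b, tri R hs hG a (mackeyInclusion R hs.le hs.sub
      (innerInclusion R E₁ hG.pair.im_le c) * b) x =
      tri R hs hG (a * innerInclusion R E₁ hG.pair.im_le c) b x := by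
    intro c b
    rw [tri, tri, ind_mul, smul_tens]
  have h2 := h1 1 (r • b)
  have h3 := h1 (r • 1) b
  rw [tri, tri, ind_mul_one] at h2
  rw [tri, ← h2, smul_tri, ← Algebra.smul_def]
  have h4 : innerInclusion R E₁ hG.pair.im_le (r • 1) =
      r • innerInclusion R E₁ hG.pair.im_le 1 := mackeyInclusion_smul R _ _ _ _
  rw [h4, mackeyInclusion_smul, smul_mul_assoc, mul_smul_comm, ← smul_mul_assoc] at h3
  rw [mul_smul_comm]
  change tri R hs hG a _ x = _
  rw [← smul_mul_assoc, h3, ← mul_smul_comm, tri, mul_smul_comm, ← smul_mul_assoc, ind_mul_one]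
  rfl

theorem tri_bas_eq_zero (hX : IsCentric R F (inner K) X) {J L : Subgroup S}
    {Γ : Subgroup (S × S)} (h : IsBas E J L Γ) (hc : ¬ F.Centric (dom Γ))
    (a : MackeyAlgebra R E₁) (x : X) : tri R hs hG a (bas R E J L Γ) x = 0 := by
  have h1 : ind (innerInclusion R E hs.le') (bas R E J L Γ) x = 0 :=
    ind_bas_eq_zero R hs.le' (inner_isSubsystem E hs.le') hX h hc x
  rw [tri, tens_apply, h1, map_zero, map_zero, ind_zero_right]

theorem tri_cj {J L : Subgroup S} {Γ Λ : Subgroup (S × S)} (hJ : J ≤ Q₁) (hΓ : IsBas E J L Γ)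
    (h : IsFactor E₁ K G Γ Λ) {d : S} (hd : d ∈ im G) (x : X) :
    tri R hs hG (bas R E₁ J (im (cj d 1 Λ)) (rcomp Γ (rinv (cj d 1 Λ))))
      (bas R E (im (cj d 1 Λ)) L (cj d 1 Λ)) x =
    tri R hs hG (bas R E₁ J (im Λ) (rcomp Γ (rinv Λ))) (bas R E (im Λ) L Λ) x := by
  have hi : im Λ ≤ im G := h.twist.im_le
  have hΛ : E.Gr Λ := h.twist.gr hG.pair.gr hG.pair.dom_le hs.le'
  have hi' : im (cgr d (im Λ)) ≤ im G := by
    intro c hc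
    obtain ⟨a, ha⟩ := mem_im.1 hc
    obtain ⟨ha', rfl⟩ := mem_cgr.1 ha
    exact (im G).mul_mem ((im G).mul_mem hd (hi ha')) ((im G).inv_mem hd)
  have h1 : cj d 1 Λ = rcomp (cgr d (im Λ)) Λ := by
    ext ⟨b, a⟩
    rw [mem_cj, mem_rcomp]
    constructor
    · intro h2
      exact ⟨_, mem_cgr.2 ⟨mem_im_of h2, by simp [mul_assoc]⟩, by simpa using h2⟩
    · rintro ⟨c, h2, h3⟩
      obtain ⟨-, rfl⟩ := mem_cgr.1 h2
      simpa [mul_assoc] using h3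
  have h2 : im (cj d 1 Λ) = im (cgr d (im Λ)) := by
    rw [h1, im_rcomp (dom_cgr _ _).le]
  have hβ : IsBas (inner (im G)) (im (cgr d (im Λ))) (im Λ) (cgr d (im Λ)) :=
    ⟨hi', hi, gr_cgr hd hi, le_rfl, (dom_cgr _ _).le⟩
  have hβ₁ := hβ.of_isSubsystem hG.pair.im_le (inner_isSubsystem E₁ hG.pair.im_le)
  have hβE := hβ₁.of_isSubsystem hs.le hs.sub
  have hd1 : dom Λ ≤ L := h.dom_eq.le.trans hΓ.dom_le
  rw [h2, h1, ← bas_mul R hβE ⟨hβE.right, hΓ.right, hΛ, le_rfl, hd1⟩ (Or.inr le_rfl),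
    ← tri_move R hs hG hβ, bas_mul R ?_ hβ₁ (Or.inl ?_)]
  · congr 2
    ext ⟨b, a⟩
    constructor
    · rintro ⟨c, ⟨e, h3, f, h4, h5⟩, h6⟩
      obtain ⟨-, rfl⟩ := mem_cgr.1 h6
      obtain ⟨-, h7⟩ := mem_cgr.1 h4
      have h8 : a = f := by simpa using h7
      subst h8
      exact ⟨e, h3, h5⟩
    · rintro ⟨e, h3, h4⟩
      have ha : a ∈ im Λ := mem_im_of h4
      exact ⟨d * a * d⁻¹, ⟨e, h3, a, mem_cgr.2 ⟨ha, rfl⟩, h4⟩, mem_cgr.2 ⟨ha, rfl⟩⟩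
  · refine ⟨hJ, hβ₁.left, ?_, (im_rcomp_le _ _).trans hΓ.im_le, ?_⟩
    · have h3 := h.gr.rcomp (hβ₁.gr.rinv)
      refine h3.mono ?_
      rintro ⟨b, a⟩ ⟨e, h3, f, h4, h5⟩
      exact ⟨f, ⟨e, h3, h5⟩, h4⟩
    · refine (dom_rcomp_le _ _).trans ?_
      rw [dom_rinv, ← h1, h2]
  · rw [dom_rcomp, dom_rinv, ← h1, h2]
    rw [im_rinv, ← h1, dom_cj]
    rintro _ ⟨a, ha, rfl⟩
    simpa [← h.dom_eq] using ha

/-- The predicate describing the support of the component at `G`. -/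
def IsGood (F : FusionSystem (⊤ : Subgroup S)) {Q₁ : Subgroup S} (E₁ : FusionSystem Q₁)
    (K : Subgroup S) (G : Subgroup (S × S)) (J L : Subgroup S) (Γ : Subgroup (S × S)) : Prop :=
  J ≤ Q₁ ∧ L ≤ K ∧ F.Centric (dom Γ) ∧ ∃ Λ, IsFactor E₁ K G Γ Λ

theorem IsGood.exists_factor {J L : Subgroup S} {Γ : Subgroup (S × S)}
    (h : IsGood F E₁ K G J L Γ) : ∃ Λ, IsFactor E₁ K G Γ Λ := h.2.2.2

theorem IsGood.isPair {J L : Subgroup S} {Γ : Subgroup (S × S)} (h : IsGood F E₁ K G J L Γ)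
    (hb : IsBas E J L Γ) : IsPair F E Q₁ K Γ :=
  ⟨hb.gr, h.2.2.1, hb.dom_le.trans h.2.1, hb.im_le.trans h.1⟩

include hs in
theorem IsGood.cj {J L : Subgroup S} {Γ : Subgroup (S × S)} (h : IsGood F E₁ K G J L Γ)
    (hb : IsBas E J L Γ) {j l : S} (hj : j ∈ J) (hl : l ∈ L) :
    IsGood F E₁ K G J L (cj j l Γ) := by
  obtain ⟨Λ, hΛ⟩ := h.2.2.2
  exact ⟨h.1, h.2.1, ((h.isPair hb).cj hs (h.1 hj) (h.2.1 hl)).centric, _,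
    hΛ.cj (h.1 hj) (h.2.1 hl)⟩

theorem tri_factor_cj {J L : Subgroup S} {Γ Λ : Subgroup (S × S)} (hJ : J ≤ Q₁)
    (hΓ : IsBas E J L Γ) (h : IsFactor E₁ K G Γ Λ) {j l : S} (hj : j ∈ J) (hl : l ∈ L) (x : X) :
    tri R hs hG (bas R E₁ J (im (cj 1 l Λ)) (rcomp (cj j l Γ) (rinv (cj 1 l Λ))))
      (bas R E (im (cj 1 l Λ)) L (cj 1 l Λ)) x =
    tri R hs hG (bas R E₁ J (im Λ) (rcomp Γ (rinv Λ))) (bas R E (im Λ) L Λ) x := by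
  have hi : im Λ ≤ im G := h.twist.im_le
  have hΛ : E.Gr Λ := h.twist.gr hG.pair.gr hG.pair.dom_le hs.le'
  have h1 : im (cj 1 l Λ) = im Λ := by
    rw [im_cj]
    ext b
    simp
  have hd1 : dom Λ ≤ L := h.dom_eq.le.trans hΓ.dom_le
  have h2 : IsBas E (im Λ) L Λ :=
    ⟨hi.trans (hG.pair.im_le.trans hs.le), hΓ.right, hΛ, le_rfl, hd1⟩
  rw [h1, bas_cj R h2 (one_mem _) hl]
  have h3 : rcomp (cj j l Γ) (rinv (cj 1 l Λ)) = cj j 1 (rcomp Γ (rinv Λ)) := by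
    ext ⟨b, a⟩
    rw [mem_cj, mem_rcomp, mem_rcomp]
    simp only [mem_rinv, mem_cj]
    constructor
    · rintro ⟨c, h4, h5⟩
      exact ⟨_, h4, h5⟩
    · rintro ⟨c, h4, h5⟩
      exact ⟨l * c * l⁻¹, by simpa [mul_assoc] using h4, by simpa [mul_assoc] using h5⟩
  rw [h3, bas_cj R ?_ hj (one_mem _)]
  exact ⟨hJ, hi.trans hG.pair.im_le, h.gr, (im_rcomp_le _ _).trans hΓ.im_le,
    (dom_rcomp_le _ _).trans (dom_rinv Λ).le⟩

open Classical in
/-- The biadditive map that defines the component at `G`. -/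
theorem exists_component_biadditive :
    ∃ g : MackeyAlgebra R E →+ X →+ Ind (innerInclusion R E₁ hG.pair.im_le)
        (Res (innerInclusion R E₁ hG.pair.im_le)
          (Res (mackeyInclusion R hs.le hs.sub) (Ind (innerInclusion R E hs.le') X))),
      (∀ (r : R) b x, g (r • b) x = algebraMap R (MackeyAlgebra R E₁) r • g b x) ∧
      (∀ J L Γ, IsBas E J L Γ → IsGood F E₁ K G J L Γ → ∀ Λ, IsFactor E₁ K G Γ Λ → ∀ x,
        g (bas R E J L Γ) x =
          tri R hs hG (bas R E₁ J (im Λ) (rcomp Γ (rinv Λ))) (bas R E (im Λ) L Λ) x) ∧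
      ∀ J L Γ, IsBas E J L Γ → ¬ IsGood F E₁ K G J L Γ → ∀ x, g (bas R E J L Γ) x = 0 := by
  have key : ∀ {J L Γ}, IsBas E J L Γ → IsGood F E₁ K G J L Γ → ∀ {Λ Λ'},
      IsFactor E₁ K G Γ Λ → IsFactor E₁ K G Γ Λ' → ∀ x : X,
      tri R hs hG (bas R E₁ J (im Λ) (rcomp Γ (rinv Λ))) (bas R E (im Λ) L Λ) x =
        tri R hs hG (bas R E₁ J (im Λ') (rcomp Γ (rinv Λ'))) (bas R E (im Λ') L Λ') x := by
    intro J L Γ hb hg Λ Λ' h h' x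
    obtain ⟨d, hd, rfl⟩ := h.exists_conj hs hG (hg.isPair hb) h'
    exact (tri_cj R hs hG hg.1 hb h hd x).symm
  obtain ⟨g, h1, h2⟩ := exists_biadditive (E := E) R (A := MackeyAlgebra R E₁)
    (W := Ind (innerInclusion R E₁ hG.pair.im_le)
        (Res (innerInclusion R E₁ hG.pair.im_le)
          (Res (mackeyInclusion R hs.le hs.sub) (Ind (innerInclusion R E hs.le') X)))) (X := X)
    (fun x J L Γ => if h : IsGood F E₁ K G J L Γ then
      tri R hs hG (bas R E₁ J (im h.exists_factor.choose) (rcomp Γ (rinv h.exists_factor.choose)))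
        (bas R E (im h.exists_factor.choose) L h.exists_factor.choose) x else 0) (fun x y J L Γ _ => by
      split_ifs
      · rw [tri_add_right]
      · rw [add_zero]) (fun x J L Γ hb j hj l hl => by
      by_cases h : IsGood F E₁ K G J L Γ
      · rw [dif_pos h, dif_pos (h.cj hs hb hj hl)]
        refine (key (hb.cj hj hl) (h.cj hs hb hj hl) (h.cj hs hb hj hl).exists_factor.choose_spec
          (h.exists_factor.choose_spec.cj (h.1 hj) (h.2.1 hl)) x).trans ?_
        exact tri_factor_cj R hs hG h.1 hb h.exists_factor.choose_spec hj hl x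
      · rw [dif_neg h, dif_neg fun h' => h ?_]
        have := h'.cj hs (hb.cj hj hl) (inv_mem hj) (inv_mem hl)
        rwa [cj_cj, inv_mul_cancel, inv_mul_cancel, cj_one] at this)
  refine ⟨g, h1, fun J L Γ hb hg Λ hΛ x => ?_, fun J L Γ hb hg x => ?_⟩
  · rw [h2 _ _ _ _ hb, dif_pos hg]
    exact key hb hg hg.exists_factor.choose_spec hΛ x
  · rw [h2 _ _ _ _ hb, dif_neg hg]

end Component

end CentricMackey

namespace CentricMackey

open FusionSystem

section Star

variable {S : Type u} [Group S] [Finite S] {p : ℕ} [Fact p.Prime]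
  {F : FusionSystem (⊤ : Subgroup S)} {Q Q₁ K : Subgroup S}
  {E : FusionSystem Q} {E₁ : FusionSystem Q₁} {G : Subgroup (S × S)} (R : Type v) [CommRing R]
  (hs : MackeySetting p F E E₁ K) (hG : IsMaxPair F E E₁ K G)
  {X : Type*} [AddCommGroup X] [Module (MackeyAlgebra R (inner K)) X]

include hs in
theorem IsMaxPair.pairLE_of_pairLE (hG : IsMaxPair F E E₁ K G) {Γ Γ' : Subgroup (S × S)}
    (hΓ : IsPair F E Q₁ K Γ) (hΓ' : IsPair F E Q₁ K Γ') (h : PairLE E₁ K Γ' Γ)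
    (h' : PairLE E₁ K Γ' G) : PairLE E₁ K Γ G := by
  obtain ⟨Z, hZ, h1, h2⟩ := pairLE_upper_bound hs hΓ' hΓ hG.pair h h'
  exact h1.trans (hG.pairLE_symm hs hZ h2)

theorem tri_eq_zero_of_ne {J J' I L : Subgroup S} {α Λ : Subgroup (S × S)} (h : J' ≠ I)
    (hI : I ≤ im G) (hΛ : IsBas E I L Λ) (x : X) :
    tri R hs hG (bas R E₁ J J' α) (bas R E I L Λ) x = 0 := by
  have h1 : IsBas (inner (im G)) I I (cgr 1 I) := .one le_rfl hI
  have h2 := tri_move R hs hG h1 (bas R E₁ J J' α) (bas R E I L Λ) x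
  rw [bas_mul_of_ne R h, tri_zero_left, bas_mul R (.one le_rfl hΛ.left) hΛ
    (Or.inl (dom_cgr 1 I).ge), rcomp_one_left hΛ.im_le] at h2
  exact h2.symm

/-- The component at `G` is left multiplicative on restrictions of `G ∘ c_k`. -/
theorem component_mul_of_im_eq {g : MackeyAlgebra R E →+ X →+ Ind (innerInclusion R E₁ hG.pair.im_le)
        (Res (innerInclusion R E₁ hG.pair.im_le)
          (Res (mackeyInclusion R hs.le hs.sub) (Ind (innerInclusion R E hs.le') X)))}
    (hX : IsCentric R F (inner K) X)
    (hr : ∀ (r : R) b x, g (r • b) x = algebraMap R (MackeyAlgebra R E₁) r • g b x)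
    (h1 : ∀ J L Γ, IsBas E J L Γ → IsGood F E₁ K G J L Γ → ∀ Λ, IsFactor E₁ K G Γ Λ → ∀ x,
        g (bas R E J L Γ) x =
          tri R hs hG (bas R E₁ J (im Λ) (rcomp Γ (rinv Λ))) (bas R E (im Λ) L Λ) x)
    (h2 : ∀ J L Γ, IsBas E J L Γ → ¬ IsGood F E₁ K G J L Γ → ∀ x, g (bas R E J L Γ) x = 0)
    {L : Subgroup S} {Λ : Subgroup (S × S)} (hL : L ≤ K) (hd : dom Λ ≤ L) (h : IsTwist K G Λ)
    (a : MackeyAlgebra R E₁) (x : X) :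
    g (mackeyInclusion R hs.le hs.sub a * bas R E (im Λ) L Λ) x =
      tri R hs hG a (bas R E (im Λ) L Λ) x := by
  have hΛ : E.Gr Λ := h.gr hG.pair.gr hG.pair.dom_le hs.le'
  have hb : IsBas E (im Λ) L Λ :=
    ⟨h.im_le.trans (hG.pair.im_le.trans hs.le), hL.trans hs.le', hΛ, le_rfl, hd⟩
  induction a using mackey_induction R with
  | zero => rw [map_zero, zero_mul, map_zero, AddMonoidHom.zero_apply, tri_zero_left]
  | add a b ha hb => rw [map_add, add_mul, map_add, AddMonoidHom.add_apply, ha, hb, tri_add_left]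
  | smul_bas r J J' α hα =>
    rw [mackeyInclusion_smul, mackeyInclusion_bas R _ _ hα, smul_mul_assoc, hr, Algebra.smul_def,
      ← smul_tri]
    congr 1
    by_cases hJ : J' = im Λ
    · subst hJ
      have hA : dom α ≤ im Λ := hα.dom_le
      set Λ₂ := rcomp (cgr 1 (dom α)) Λ with hΛ₂
      have e1 : im Λ₂ = dom α := by
        rw [im_rcomp (by rwa [dom_cgr]), im_cgr_one]
      have hle : Λ₂ ≤ Λ := by
        rintro ⟨b, a⟩ ⟨c, h3, h4⟩
        obtain ⟨-, rfl⟩ := mem_cgr.1 h3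
        simpa using h4
      have e2 : rcomp α Λ₂ = rcomp α Λ := by
        rw [hΛ₂, ← rcomp_assoc, rcomp_one_right le_rfl]
      have e3 : dom Λ₂ = dom (rcomp α Λ) := by
        rw [← e2, dom_rcomp e1.le]
      have e4 : rcomp (rcomp α Λ) (rinv Λ₂) = α := by
        rw [← e2, rcomp_assoc, (hΛ.mono hle).rcomp_rinv_self, e1, rcomp_one_right le_rfl]
      have hf : IsFactor E₁ K G (rcomp α Λ) Λ₂ := ⟨h.mono hΛ hle, e3, by rw [e4]; exact hα.gr⟩
      have hαE := hα.of_isSubsystem hs.le hs.sub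
      have hb2 : IsBas E (dom α) L Λ₂ := ⟨hA.trans hb.left, hb.right, hΛ.mono hle, e1.le,
        (dom_mono hle).trans hd⟩
      have hm : IsBas (inner (im G)) (dom α) (im Λ) (cgr 1 (dom α)) := .one hA h.im_le
      have hm₁ := hm.of_isSubsystem hG.pair.im_le (inner_isSubsystem E₁ hG.pair.im_le)
      have e5 : bas R E₁ J (im Λ) α = bas R E₁ J (dom α) α *
          bas R E₁ (dom α) (im Λ) (cgr 1 (dom α)) := by
        rw [bas_mul R ⟨hα.left, hm₁.left, hα.gr, hα.im_le, le_rfl⟩ hm₁ (Or.inl le_rfl),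
          rcomp_one_right le_rfl]
      have e6 : tri R hs hG (bas R E₁ J (im Λ) α) (bas R E (im Λ) L Λ) x =
          tri R hs hG (bas R E₁ J (dom α) α) (bas R E (dom α) L Λ₂) x := by
        rw [e5, tri_move R hs hG hm, bas_mul R (hm₁.of_isSubsystem hs.le hs.sub) hb
          (Or.inr le_rfl)]
      rw [bas_mul R hαE hb (Or.inr le_rfl), e6]
      by_cases hc : F.Centric (dom Λ₂)
      · have := h1 J L (rcomp α Λ) (hαE.rcomp hb) ⟨hα.left, hL, by rwa [← e3], _, hf⟩ Λ₂ hf x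
        rwa [e4, e1] at this
      · rw [tri_bas_eq_zero R hs hG hX hb2 hc, h2 J L _ (hαE.rcomp hb)]
        rintro ⟨-, -, h3, -⟩
        exact hc (by rwa [e3])
    · rw [bas_mul_of_ne R hJ, map_zero, AddMonoidHom.zero_apply,
        tri_eq_zero_of_ne R hs hG hJ h.im_le hb]

theorem component_mul {g : MackeyAlgebra R E →+ X →+ Ind (innerInclusion R E₁ hG.pair.im_le)
        (Res (innerInclusion R E₁ hG.pair.im_le)
          (Res (mackeyInclusion R hs.le hs.sub) (Ind (innerInclusion R E hs.le') X)))}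
    (hX : IsCentric R F (inner K) X)
    (hr : ∀ (r : R) b x, g (r • b) x = algebraMap R (MackeyAlgebra R E₁) r • g b x)
    (h1 : ∀ J L Γ, IsBas E J L Γ → IsGood F E₁ K G J L Γ → ∀ Λ, IsFactor E₁ K G Γ Λ → ∀ x,
        g (bas R E J L Γ) x =
          tri R hs hG (bas R E₁ J (im Λ) (rcomp Γ (rinv Λ))) (bas R E (im Λ) L Λ) x)
    (h2 : ∀ J L Γ, IsBas E J L Γ → ¬ IsGood F E₁ K G J L Γ → ∀ x, g (bas R E J L Γ) x = 0)
    {L : Subgroup S} {Λ : Subgroup (S × S)} (hL : L ≤ K) (hd : dom Λ ≤ L) (h : IsTwist K G Λ)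
    (a : MackeyAlgebra R E₁) (c : MackeyAlgebra R (inner K)) (x : X) :
    g (mackeyInclusion R hs.le hs.sub a * bas R E (im Λ) L Λ * innerInclusion R E hs.le' c) x =
      tri R hs hG a (bas R E (im Λ) L Λ) (c • x) := by
  have hΛ : E.Gr Λ := h.gr hG.pair.gr hG.pair.dom_le hs.le'
  obtain ⟨k, hk, hΛk⟩ := id h
  have hdK : dom Λ ≤ K := hd.trans hL
  set γ := cgr k (dom Λ) with hγ
  have hiγ : im γ ≤ K := by
    intro y hy
    obtain ⟨a, ha⟩ := mem_im.1 hy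
    obtain ⟨ha', rfl⟩ := mem_cgr.1 ha
    exact K.mul_mem (K.mul_mem hk (hdK ha')) (K.inv_mem hk)
  have hγb : IsBas (inner K) (im γ) L γ := ⟨hiγ, hL, gr_cgr hk hdK, le_rfl, (dom_cgr _ _).le.trans hd⟩
  set Λ₀ := rcomp Λ (rinv γ) with hΛ₀
  have e1 : dom (rinv γ) = im γ := dom_rinv _
  have e2 : im (rinv γ) = dom Λ := by rw [im_rinv, hγ, dom_cgr]
  have hI : im Λ ≤ Q := h.im_le.trans (hG.pair.im_le.trans hs.le)
  have hγE := hγb.gr.of_isSubsystem (inner_isSubsystem E hs.le')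
  have hΛ₀d : dom Λ₀ = im γ := by rw [hΛ₀, dom_rcomp e2.le, e1]
  have hΛ₀G : Λ₀ ≤ G := by
    rintro ⟨b, c⟩ ⟨a, h3, h4⟩
    have h5 : (c, a) ∈ γ := h4
    obtain ⟨-, rfl⟩ := mem_cgr.1 h5
    exact ((hΛk _ _).1 h3).2
  have hΛ₀b : IsBas E (im Λ) (im γ) Λ₀ := ⟨hI, hiγ.trans hs.le', hΛ.rcomp hγE.rinv,
    im_rcomp_le _ _, hΛ₀d.le⟩
  have e3 : bas R E (im Λ) L Λ = bas R E (im Λ) (im γ) Λ₀ *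
      innerInclusion R E hs.le' (bas R _ (im γ) L γ) := by
    have h3 : innerInclusion R E hs.le' (bas R _ (im γ) L γ) = bas R E (im γ) L γ :=
      mackeyInclusion_bas R _ _ hγb
    rw [h3, bas_mul R hΛ₀b (hγb.of_isSubsystem hs.le' (inner_isSubsystem E hs.le')) (Or.inr le_rfl),
      hΛ₀, rcomp_assoc, hγE.rinv_rcomp_self, rcomp_one_right (by rw [hγ, dom_cgr])]
  have key : ∀ c : MackeyAlgebra R (inner K),
      g (mackeyInclusion R hs.le hs.sub a * (bas R E (im Λ) (im γ) Λ₀ * innerInclusion R E hs.le' c)) x =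
      tri R hs hG a (bas R E (im Λ) (im γ) Λ₀ * innerInclusion R E hs.le' c) x := by
    intro c
    induction c using mackey_induction R with
    | zero => rw [map_zero, mul_zero, mul_zero, map_zero, tri_zero_mid]; rfl
    | add c c' h h' => rw [map_add, mul_add, mul_add, map_add, AddMonoidHom.add_apply, h, h', tri_add_mid]
    | smul_bas r M L' β hβ =>
      have h3 : innerInclusion R E hs.le' (r • bas R _ M L' β) = r • bas R E M L' β := by
        rw [innerInclusion, mackeyInclusion_smul, mackeyInclusion_bas R _ _ hβ]
      rw [h3, mul_smul_comm, mul_smul_comm, hr, tri_smul]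
      congr 1
      by_cases hM : M = im γ
      · subst hM
        have hβE := hβ.of_isSubsystem hs.le' (inner_isSubsystem E hs.le')
        rw [bas_mul R hΛ₀b hβE (Or.inl hΛ₀d.ge)]
        set Λ' := rcomp Λ₀ β with hΛ'
        have ht : IsTwist K G Λ' := by
          obtain ⟨-, m, hm, hβm⟩ := gr_inner_iff.1 hβ.gr
          refine ⟨m, hm, fun b a => ⟨?_, ?_⟩⟩
          · intro hab
            refine ⟨mem_dom_of hab, ?_⟩
            obtain ⟨e, h4, h5⟩ := hab
            rw [hβm] at h5
            obtain ⟨-, rfl⟩ := mem_cgr.1 h5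
            exact hΛ₀G h4
          · rintro ⟨h4, h5⟩
            obtain ⟨b', hb'⟩ := mem_dom.1 h4
            obtain ⟨e, h6, h7⟩ := id hb'
            rw [hβm] at h7
            obtain ⟨-, rfl⟩ := mem_cgr.1 h7
            rwa [hG.pair.gr.functional h5 (hΛ₀G h6)]
        have hi : im Λ' ≤ im Λ := (im_rcomp_le _ _).trans (im_rcomp_le _ _)
        have hm : IsBas (inner (im G)) (im Λ) (im Λ') (cgr 1 (im Λ')) := .one' hi h.im_le
        have hm₁ := hm.of_isSubsystem hG.pair.im_le (inner_isSubsystem E₁ hG.pair.im_le)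
        have hd' : dom Λ' ≤ L' := (dom_rcomp_le _ _).trans hβ.dom_le
        have hb' : IsBas E (im Λ') L' Λ' := ⟨hi.trans hI, hβE.right,
          hΛ₀b.gr.rcomp hβE.gr, le_rfl, hd'⟩
        have e4 : bas R E (im Λ) L' Λ' = bas R E (im Λ) (im Λ') (cgr 1 (im Λ')) *
            bas R E (im Λ') L' Λ' := by
          rw [bas_mul R (hm₁.of_isSubsystem hs.le hs.sub) hb' (Or.inr le_rfl), rcomp_one_left le_rfl]
        rw [e4, ← tri_move R hs hG hm, ← component_mul_of_im_eq R hs hG hX hr h1 h2 hβ.right hd' ht,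
          map_mul (mackeyInclusion R hs.le hs.sub), mackeyInclusion_bas R _ _ hm₁, mul_assoc]
      · rw [bas_mul_of_ne R (Ne.symm hM), mul_zero, tri_zero_mid, map_zero]
        rfl
  rw [mul_assoc, e3, mul_assoc, ← map_mul, key, map_mul (innerInclusion R E hs.le'), ← mul_assoc, tri_mul_right]

/-- The component at a maximal pair `G` of the restriction to `E₁` of a functor that is induced
from `K` to `E`. -/
theorem exists_mackey_component (hX : IsCentric R F (inner K) X) :
    ∃ Ψ : Res (mackeyInclusion R hs.le hs.sub) (Ind (innerInclusion R E hs.le') X)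
        →ₗ[MackeyAlgebra R E₁]
        Res (mackeyInclusion R hs.le hs.sub) (Ind (innerInclusion R E hs.le') X),
      Ψ ∈ Tr (innerInclusion R E₁ hG.pair.im_le) _ _ ∧
      ∀ J L Γ, IsBas E J L Γ → J ≤ Q₁ → L ≤ K → F.Centric (dom Γ) → ∀ x,
        (PairLE E₁ K Γ G →
          Ψ (Res.proj _ (ind (innerInclusion R E hs.le') (bas R E J L Γ) x)) =
            Res.proj _ (ind (innerInclusion R E hs.le') (bas R E J L Γ) x)) ∧
        (¬ PairLE E₁ K Γ G →
          Ψ (Res.proj _ (ind (innerInclusion R E hs.le') (bas R E J L Γ) x)) = 0) := by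
  obtain ⟨g, hr, h1, h2⟩ := exists_component_biadditive R hs hG (X := X)
  have fac : ∀ {J L Γ Λ}, IsBas E J L Γ → J ≤ Q₁ → IsFactor E₁ K G Γ Λ →
      IsBas E₁ J (im Λ) (rcomp Γ (rinv Λ)) ∧ bas R E J L Γ = mackeyInclusion R hs.le hs.sub
        (bas R E₁ J (im Λ) (rcomp Γ (rinv Λ))) * bas R E (im Λ) L Λ := by
    intro J L Γ Λ hb hJ hf
    have hi : im Λ ≤ Q₁ := hf.twist.im_le.trans hG.pair.im_le
    have hΛ : E.Gr Λ := hf.twist.gr hG.pair.gr hG.pair.dom_le hs.le'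
    have h3 : IsBas E₁ J (im Λ) (rcomp Γ (rinv Λ)) := ⟨hJ, hi, hf.gr,
      (im_rcomp_le _ _).trans hb.im_le, (dom_rcomp_le _ _).trans (dom_rinv Λ).le⟩
    refine ⟨h3, ?_⟩
    rw [mackeyInclusion_bas R _ _ h3, bas_mul R (h3.of_isSubsystem hs.le hs.sub)
      ⟨hi.trans hs.le, hb.right, hΛ, le_rfl, hf.dom_eq.le.trans hb.dom_le⟩ (Or.inr le_rfl),
      rcomp_assoc, hΛ.rinv_rcomp_self, rcomp_one_right hf.dom_eq.ge]
  have hgood : ∀ {J L Γ J' L' Γ'}, IsBas E J L Γ → IsBas E J' L' Γ' → J ≤ Q₁ → L ≤ K →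
      IsGood F E₁ K G J' L' Γ' → PairLE E₁ K Γ' Γ → IsGood F E₁ K G J L Γ := by
    intro J L Γ J' L' Γ' hb hb' hJ hL hg' hle
    have hp : IsPair F E Q₁ K Γ := ⟨hb.gr, hle.centric hg'.2.2.1, hb.dom_le.trans hL,
      hb.im_le.trans hJ⟩
    obtain ⟨Λ, hΛ⟩ := hg'.exists_factor
    exact ⟨hJ, hL, hp.centric, exists_isFactor hG.pair.gr
      (hG.pairLE_of_pairLE hs hp (hg'.isPair hb') hle hΛ.pairLE)⟩
  obtain ⟨Φ, hΦ, hΦ'⟩ := exists_equivariant_lift R hs.le hs.sub hs.le' g hr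
    (fun J L Γ => IsGood F E₁ K G J L Γ) (fun J L Γ _ h => h.1)
    (fun J L Γ hb hg a c x => by
      obtain ⟨Λ, hΛ⟩ := hg.exists_factor
      obtain ⟨h3, e⟩ := fac hb hg.1 hΛ
      rw [h1 J L Γ hb hg Λ hΛ, smul_tri, e, ← mul_assoc, ← map_mul,
        component_mul R hs hG hX hr h1 h2 hg.2.1 (hΛ.dom_eq.le.trans hb.dom_le) hΛ.twist])
    h2
    (fun J' J L α Γ hα hb n hn l hl hg => by
      have hJ : J ≤ Q₁ := hα.right
      refine hgood hb ((hα.of_isSubsystem hs.le hs.sub).rcomp (hb.cj hn hl)) hJ hg.2.1 hg ?_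
      exact pairLE_rcomp_left hα.gr (hb.im_le.trans hJ) (hJ hn) (hg.2.1 hl))
    (fun J L L' Γ β hb hβ j hj m hm hg => by
      refine hgood hb ((hb.cj hj hm).rcomp (hβ.of_isSubsystem hs.le' (inner_isSubsystem E hs.le')))
        hg.1 hβ.left hg ?_
      exact pairLE_rcomp_right hβ.gr (hb.im_le.trans hg.1) (hg.1 hj) (hβ.left hm))
  let Φ' : Res (mackeyInclusion R hs.le hs.sub) (Ind (innerInclusion R E hs.le') X)
        →ₗ[MackeyAlgebra R E₁] Ind (innerInclusion R E₁ hG.pair.im_le)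
        (Res (innerInclusion R E₁ hG.pair.im_le)
          (Res (mackeyInclusion R hs.le hs.sub) (Ind (innerInclusion R E hs.le') X))) :=
    { toFun := fun y => Φ (Res.val y)
      map_add' := fun y z => by rw [map_add, map_add]
      map_smul' := fun a y => by rw [Res.val_smul, hΦ', RingHom.id_apply] }
  have hval : ∀ b x, Φ' (Res.proj _ (ind (innerInclusion R E hs.le') b x)) = g b x := by
    intro b x
    change Φ (Res.val (Res.proj _ _)) = _
    rw [Res.val_proj, hΦ', hΦ, one_smul]
  refine ⟨theta _ _ ∘ₗ Φ', ⟨Φ', rfl⟩, fun J L Γ hb hJ hL hc x => ⟨fun h => ?_, fun h => ?_⟩⟩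
  · obtain ⟨Λ, hΛ⟩ := exists_isFactor hG.pair.gr h
    have hg : IsGood F E₁ K G J L Γ := ⟨hJ, hL, hc, Λ, hΛ⟩
    obtain ⟨h3, e⟩ := fac hb hJ hΛ
    have e2 : bas R E₁ J (im Λ) (rcomp Γ (rinv Λ)) * innerInclusion R E₁ hG.pair.im_le 1 =
        bas R E₁ J (im Λ) (rcomp Γ (rinv Λ)) :=
      bas_mul_mackeyInclusion_one R _ _ h3 hΛ.twist.im_le
    rw [LinearMap.comp_apply, hval, h1 J L Γ hb hg Λ hΛ, tri, theta_ind, tens_apply, Res.val_proj,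
      smul_smul, e2, Res.smul_proj, smul_ind, ← e]
  · rw [LinearMap.comp_apply, hval, h2 J L Γ hb, map_zero]
    rintro ⟨-, -, -, Λ, hΛ⟩
    exact h hΛ.pairLE

end Star

end CentricMackey

namespace CentricMackey

open FusionSystem

section TraceFamily

variable {S : Type u} [Group S] [Finite S] {Q : Subgroup S} (R : Type v) [CommRing R]
  (E : FusionSystem Q)

/-- The homomorphisms that factor through functors induced from members of `Z`. -/
noncomputable def TrF (Z : Set (Subgroup S)) (M M' : Type*) [AddCommGroup M]
    [Module (MackeyAlgebra R E) M] [AddCommGroup M'] [Module (MackeyAlgebra R E) M'] :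
    AddSubgroup (M →ₗ[MackeyAlgebra R E] M') :=
  ⨆ K : {K : Subgroup S // K ∈ Z ∧ K ≤ Q}, Tr (innerInclusion R E K.2.2) M M'

variable {R E} {Z Z' : Set (Subgroup S)}
  {M M' M'' : Type*} [AddCommGroup M] [Module (MackeyAlgebra R E) M] [AddCommGroup M']
  [Module (MackeyAlgebra R E) M'] [AddCommGroup M''] [Module (MackeyAlgebra R E) M'']

theorem tr_le_TrF {K : Subgroup S} (hK : K ∈ Z) (hKQ : K ≤ Q) :
    Tr (innerInclusion R E hKQ) M M' ≤ TrF R E Z M M' :=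
  le_iSup (fun K : {K : Subgroup S // K ∈ Z ∧ K ≤ Q} => Tr (innerInclusion R E K.2.2) M M')
    ⟨K, hK, hKQ⟩

theorem TrF_le {T : AddSubgroup (M →ₗ[MackeyAlgebra R E] M')}
    (h : ∀ K ∈ Z, ∀ hK : K ≤ Q, Tr (innerInclusion R E hK) M M' ≤ T) : TrF R E Z M M' ≤ T :=
  iSup_le fun K => h K.1 K.2.1 K.2.2

theorem TrF_mono (h : Z ⊆ Z') : TrF R E Z M M' ≤ TrF R E Z' M M' :=
  TrF_le fun _ hK hKQ => tr_le_TrF (h hK) hKQ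

theorem TrF.comp_right {f : M' →ₗ[MackeyAlgebra R E] M''} (hf : f ∈ TrF R E Z M' M'')
    (g : M →ₗ[MackeyAlgebra R E] M') : f ∘ₗ g ∈ TrF R E Z M M'' := by
  have : TrF R E Z M' M'' ≤ (TrF R E Z M M'').comap
      (AddMonoidHom.mk' (fun f : M' →ₗ[MackeyAlgebra R E] M'' => f ∘ₗ g)
        fun a b => LinearMap.add_comp g b a) :=
    TrF_le fun K hK hKQ f hf => tr_le_TrF hK hKQ (Tr.comp_right hf g)
  exact this hf

theorem TrF.comp_left {f : M →ₗ[MackeyAlgebra R E] M'} (hf : f ∈ TrF R E Z M M')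
    (g : M' →ₗ[MackeyAlgebra R E] M'') : g ∘ₗ f ∈ TrF R E Z M M'' := by
  have : TrF R E Z M M' ≤ (TrF R E Z M M'').comap
      (AddMonoidHom.mk' (fun f : M →ₗ[MackeyAlgebra R E] M' => g ∘ₗ f)
        fun a b => LinearMap.comp_add a b g) :=
    TrF_le fun K hK hKQ f hf => tr_le_TrF hK hKQ (Tr.comp_left hf g)
  exact this hf

open Classical in
theorem thetaFamily_comp_lof (K : {K : Subgroup S // K ∈ Z ∧ K ≤ Q}) :
    thetaFamily R E M Z ∘ₗ DirectSum.lof (MackeyAlgebra R E) _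
      (fun K : {K : Subgroup S // K ∈ Z ∧ K ≤ Q} => ResInd R E M K.2.2) K =
    theta (innerInclusion R E K.2.2) M := by
  unfold thetaFamily
  ext x
  rw [LinearMap.comp_apply, DirectSum.toModule_lof]

open Classical in
theorem isRelProjective_iff : IsRelProjective R E M Z ↔ LinearMap.id ∈ TrF R E Z M M := by
  constructor
  · rintro ⟨s, hs⟩
    have _ : Fintype {K : Subgroup S // K ∈ Z ∧ K ≤ Q} := Fintype.ofFinite _
    rw [← hs]
    have h : s = ∑ K, DirectSum.lof (MackeyAlgebra R E) _
        (fun K : {K : Subgroup S // K ∈ Z ∧ K ≤ Q} => ResInd R E M K.2.2) K ∘ₗ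
        DirectSum.component (MackeyAlgebra R E) _ _ K ∘ₗ s := by
      ext x : 1
      rw [LinearMap.sum_apply]
      refine DirectSum.ext_component (MackeyAlgebra R E) fun K => ?_
      rw [map_sum, Finset.sum_eq_single K]
      · rw [LinearMap.comp_apply, LinearMap.comp_apply, DirectSum.component.lof_self]
      · intro L _ hL
        rw [LinearMap.comp_apply, DirectSum.component.of, dif_neg hL]
      · intro h
        exact absurd (Finset.mem_univ _) h
    have h' : thetaFamily R E M Z ∘ₗ s = ∑ K, thetaFamily R E M Z ∘ₗ (DirectSum.lof
        (MackeyAlgebra R E) _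
        (fun K : {K : Subgroup S // K ∈ Z ∧ K ≤ Q} => ResInd R E M K.2.2) K ∘ₗ
        DirectSum.component (MackeyAlgebra R E) _ _ K ∘ₗ s) := by
      ext x
      rw [LinearMap.comp_apply, LinearMap.sum_apply]
      conv_lhs => rw [h]
      rw [LinearMap.sum_apply, map_sum]
      rfl
    rw [h']
    refine sum_mem fun K _ => ?_
    refine tr_le_TrF K.2.1 K.2.2 ⟨DirectSum.component (MackeyAlgebra R E) _ _ K ∘ₗ s, ?_⟩
    rw [← LinearMap.comp_assoc, thetaFamily_comp_lof]
  · intro h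
    have key : ∀ f ∈ TrF R E Z M M, ∃ s, thetaFamily R E M Z ∘ₗ s = f := by
      intro f hf
      induction hf using AddSubgroup.iSup_induction' with
      | hp K f hf =>
        obtain ⟨g, rfl⟩ := hf
        refine ⟨DirectSum.lof (MackeyAlgebra R E) _
          (fun K : {K : Subgroup S // K ∈ Z ∧ K ≤ Q} => ResInd R E M K.2.2) K ∘ₗ g, ?_⟩
        rw [← LinearMap.comp_assoc, thetaFamily_comp_lof]
      | h1 => exact ⟨0, LinearMap.comp_zero _⟩
      | hadd f g _ _ hf hg =>
        obtain ⟨s, rfl⟩ := hf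
        obtain ⟨t, rfl⟩ := hg
        exact ⟨s + t, LinearMap.comp_add _ _ _⟩
    exact key _ h

end TraceFamily

section MackeyFormula

variable {S : Type u} [Group S] [Finite S] {p : ℕ} [Fact p.Prime]
  {F : FusionSystem (⊤ : Subgroup S)} {Q Q₁ K : Subgroup S}
  {E : FusionSystem Q} {E₁ : FusionSystem Q₁} (R : Type v) [CommRing R]
  {X : Type*} [AddCommGroup X] [Module (MackeyAlgebra R (inner K)) X]

theorem res_ind_induction (hK : K ≤ Q) (hQ : Q₁ ≤ Q) (hE : E₁.IsSubsystem E)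
    (hX : IsCentric R F (inner K) X)
    {C : Res (mackeyInclusion R hQ hE) (Ind (innerInclusion R E hK) X) → Prop} (zero : C 0)
    (add : ∀ x y, C x → C y → C (x + y))
    (ind : ∀ J L Γ x, IsBas E J L Γ → J ≤ Q₁ → L ≤ K → F.Centric (dom Γ) →
      C (Res.proj _ (ind (innerInclusion R E hK) (bas R E J L Γ) x)))
    (y : Res (mackeyInclusion R hQ hE) (Ind (innerInclusion R E hK) X)) : C y := by
  rw [← Res.proj_val y]
  generalize Res.val y = z
  induction z using Ind.induction with
  | zero => rw [map_zero]; exact zero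
  | add x y hx hy => rw [map_add]; exact add _ _ hx hy
  | ind b x =>
    induction b using mackey_induction R generalizing x with
    | zero => rw [ind_zero_left, map_zero]; exact zero
    | add b b' hb hb' => rw [ind_add_left, map_add]; exact add _ _ (hb x) (hb' x)
    | smul_bas r J L Γ h =>
      have e : CentricMackey.ind (innerInclusion R E hK) (r • bas R E J L Γ) x =
          CentricMackey.ind (innerInclusion R E hK) (bas R E J L Γ)
            (algebraMap R (MackeyAlgebra R (inner K)) r • x) := by
        rw [Algebra.smul_def, ← smul_ind]
        exact algebraMap_smul_ind R hK (inner_isSubsystem E hK) r _ x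
      rw [e]
      by_cases hL : L ≤ K
      · by_cases hc : F.Centric (dom Γ)
        · by_cases hJ : J ≤ Q₁
          · exact ind J L Γ _ h hJ hL hc
          · convert zero using 1
            refine Res.val_injective ?_
            rw [Res.val_proj, smul_ind, mackeyInclusion_one_mul_bas_of_not_le R hQ hE hJ,
              ind_zero_left, map_zero]
        · convert zero using 1
          have := ind_bas_eq_zero R hK (inner_isSubsystem E hK) hX h hc
            (algebraMap R (MackeyAlgebra R (inner K)) r • x)
          rw [innerInclusion, this, map_zero]
      · convert zero using 1
        have := ind_bas_eq_zero_of_not_le (J := J) (Γ := Γ) R hK (inner_isSubsystem E hK) hL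
            (algebraMap R (MackeyAlgebra R (inner K)) r • x)
        rw [innerInclusion, this, map_zero]

theorem IsMaxPair.subconj {G : Subgroup (S × S)} (hG : IsMaxPair F E E₁ K G) (hK : K ≤ Q) :
    E.Subconj (im G) K :=
  ⟨hK, dom G, hG.pair.dom_le, hG.pair.gr.conj.symm⟩

theorem IsMaxPair.centric_im (hs : MackeySetting p F E E₁ K) {G : Subgroup (S × S)}
    (hG : IsMaxPair F E E₁ K G) : F.Centric (im G) :=
  (hG.pair.gr.of_isSubsystem hs.big.le).centric_im hG.pair.centric

/-- The Mackey formula: the restriction to `E₁` of a functor induced from `K` to `E` is projective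
relative to the images of the maximal pairs. -/
theorem id_mem_TrF_res_ind (hs : MackeySetting p F E E₁ K) (hX : IsCentric R F (inner K) X) :
    LinearMap.id ∈ TrF R E₁ {D | F.Centric D ∧ E.Subconj D K}
      (Res (mackeyInclusion R hs.le hs.sub) (Ind (innerInclusion R E hs.le') X))
      (Res (mackeyInclusion R hs.le hs.sub) (Ind (innerInclusion R E hs.le') X)) := by
  classical
  obtain ⟨T, hT, hTu⟩ := exists_transversal hs
  choose Ψ h1 h2 using fun G : T => exists_mackey_component R hs (hT G G.2) hX
  have _ : Fintype T := Fintype.ofFinite T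
  have hid : LinearMap.id = ∑ G : T, Ψ G := by
    ext y
    rw [LinearMap.id_apply, LinearMap.sum_apply]
    induction y using res_ind_induction R hs.le' hs.le hs.sub hX with
    | zero => simp only [map_zero, Finset.sum_const_zero]
    | add x y hx hy => simp only [map_add, Finset.sum_add_distrib, ← hx, ← hy]
    | ind J L Γ x h hJ hL hc =>
      obtain ⟨G, ⟨hG, hle⟩, hu⟩ := hTu Γ ⟨h.gr, hc, h.dom_le.trans hL, h.im_le.trans hJ⟩
      rw [Finset.sum_eq_single (⟨G, hG⟩ : T)]
      · exact ((h2 ⟨G, hG⟩ J L Γ h hJ hL hc x).1 hle).symm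
      · intro G' _ hne
        exact (h2 G' J L Γ h hJ hL hc x).2 fun h' => hne (Subtype.ext (hu _ ⟨G'.2, h'⟩))
      · intro h
        exact absurd (Finset.mem_univ _) h
  rw [hid]
  refine sum_mem fun G _ => ?_
  exact tr_le_TrF (Z := {D | F.Centric D ∧ E.Subconj D K})
    ⟨(hT G G.2).centric_im hs, (hT G G.2).subconj hs.le'⟩ (hT G G.2).pair.im_le (h1 G)

end MackeyFormula

end CentricMackey

namespace CentricMackey

open FusionSystem

section NormalizerSplitting

variable {S : Type u} [Group S] [Finite S] {p : ℕ} [Fact p.Prime]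
  {F : FusionSystem (⊤ : Subgroup S)} {Q Q₁ K : Subgroup S}
  {E : FusionSystem Q} {E₁ : FusionSystem Q₁} (R : Type v) [CommRing R]

/-- A functor that is induced from `K` to `E₁` is a direct summand of the restriction of the
functor induced to `E`. -/
theorem exists_retraction_res_ind (hs : MackeySetting p F E E₁ K) (hK : K ≤ Q₁) {X : Type*}
    [AddCommGroup X] [Module (MackeyAlgebra R (inner K)) X] (hX : IsCentric R F (inner K) X) :
    ∃ r : Res (mackeyInclusion R hs.le hs.sub) (Ind (innerInclusion R E hs.le') X)
        →ₗ[MackeyAlgebra R E₁] Ind (innerInclusion R E₁ hK) X,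
      ∀ J L Γ, IsBas E J L Γ → J ≤ Q₁ → L ≤ K → F.Centric (dom Γ) → ∀ x,
        (E₁.Gr Γ → r (Res.proj _ (ind (innerInclusion R E hs.le') (bas R E J L Γ) x)) =
            ind (innerInclusion R E₁ hK) (bas R E₁ J L Γ) x) ∧
        (¬ E₁.Gr Γ → r (Res.proj _ (ind (innerInclusion R E hs.le') (bas R E J L Γ) x)) = 0) := by
  classical
  let P : Subgroup S → Subgroup S → Subgroup (S × S) → Prop := fun J L Γ =>
    J ≤ Q₁ ∧ L ≤ K ∧ F.Centric (dom Γ) ∧ E₁.Gr Γ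
  have hPcj : ∀ {J L Γ j l}, P J L Γ → IsBas E J L Γ → j ∈ J → l ∈ L → P J L (cj j l Γ) := by
    intro J L Γ j l h hb hj hl
    have hg := h.2.2.2.cj (h.1 hj) (hK (h.2.1 hl))
    exact ⟨h.1, h.2.1, (IsPair.cj (K := K) hs ⟨hb.gr, h.2.2.1, hb.dom_le.trans h.2.1,
      hb.im_le.trans h.1⟩ (h.1 hj) (h.2.1 hl)).centric, hg⟩
  have hPcj' : ∀ {J L Γ j l}, P J L (cj j l Γ) → IsBas E J L Γ → j ∈ J → l ∈ L → P J L Γ := by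
    intro J L Γ j l h hb hj hl
    have := hPcj h (hb.cj hj hl) (inv_mem hj) (inv_mem hl)
    rwa [cj_cj, inv_mul_cancel, inv_mul_cancel, cj_one] at this
  obtain ⟨g, hr, hg⟩ := exists_biadditive (E := E) R (A := MackeyAlgebra R E₁)
    (W := Ind (innerInclusion R E₁ hK) X) (X := X)
    (fun x J L Γ => if P J L Γ then ind (innerInclusion R E₁ hK) (bas R E₁ J L Γ) x else 0)
    (fun x y J L Γ _ => by
      split_ifs
      · rw [ind_add_right]
      · rw [add_zero]) (fun x J L Γ hb j hj l hl => by
      by_cases h : P J L Γ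
      · rw [if_pos h, if_pos (hPcj h hb hj hl),
          bas_cj R ⟨h.1, h.2.1.trans hK, h.2.2.2, hb.im_le, hb.dom_le⟩ hj hl]
      · rw [if_neg h, if_neg fun h' => h (hPcj' h' hb hj hl)])
  have hg1 : ∀ b x, g (mackeyInclusion R hs.le hs.sub b) x = ind (innerInclusion R E₁ hK) b x := by
    intro b x
    induction b using mackey_induction R with
    | zero => rw [map_zero, map_zero, ind_zero_left]; rfl
    | add b b' hb hb' => rw [map_add, map_add, AddMonoidHom.add_apply, hb, hb', ind_add_left]
    | smul_bas r J L Γ h =>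
      rw [mackeyInclusion_smul, mackeyInclusion_bas R _ _ h, hr, Algebra.smul_def, ← smul_ind,
        hg _ _ _ _ (h.of_isSubsystem hs.le hs.sub)]
      congr 1
      by_cases hP : P J L Γ
      · rw [if_pos hP]
      · rw [if_neg hP]
        by_cases hL : L ≤ K
        · exact (ind_bas_eq_zero R hK (inner_isSubsystem E₁ hK) hX h
            (fun hc => hP ⟨h.left, hL, hc, h.gr⟩) x).symm
        · exact (ind_bas_eq_zero_of_not_le R hK (inner_isSubsystem E₁ hK) hL x).symm
  have h3 : ∀ J L Γ, IsBas E J L Γ → P J L Γ → IsBas E₁ J L Γ := fun J L Γ hb h =>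
    ⟨h.1, h.2.1.trans hK, h.2.2.2, hb.im_le, hb.dom_le⟩
  have hcomp : ∀ c, mackeyInclusion R hs.le hs.sub (innerInclusion R E₁ hK c) =
      innerInclusion R E hs.le' c := fun c => mackeyInclusion_comp R _ _ _ _ c
  obtain ⟨Φ, hΦ, hΦ'⟩ := exists_equivariant_lift R hs.le hs.sub hs.le' g hr P
    (fun J L Γ _ h => h.1)
    (fun J L Γ hb hp a c x => by
      rw [← mackeyInclusion_bas R hs.le hs.sub (h3 J L Γ hb hp), ← hcomp, ← map_mul, ← map_mul,
        hg1, hg1, smul_ind, ind_mul])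
    (fun J L Γ hb hp x => by rw [hg _ _ _ _ hb, if_neg hp])
    (fun J' J L α Γ hα hb n hn l hl hp => by
      have hJ : J ≤ Q₁ := hα.right
      have hb' := hb.cj hn hl
      obtain ⟨h4, h5, h6, h7⟩ := hp
      refine hPcj' (j := n) (l := l) ?_ hb hn hl
      have hF := hs.big.le
      have h8 : rcomp (rinv α) (rcomp α (cj n l Γ)) ≤ cj n l Γ := by
        rw [← rcomp_assoc, hα.gr.rinv_rcomp_self]
        rintro ⟨b, a⟩ ⟨c, h9, h10⟩
        obtain ⟨-, rfl⟩ := mem_cgr.1 h9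
        simpa using h10
      have h9 : dom (rcomp (rinv α) (rcomp α (cj n l Γ))) = dom (rcomp α (cj n l Γ)) :=
        dom_rcomp (by rw [dom_rinv]; exact im_rcomp_le _ _)
      refine ⟨hJ, h5, ?_, hs.small.full (hα.gr.rinv.rcomp h7) (by rwa [h9]) h8
        (hb'.gr.of_isSubsystem hF) ((hb'.dom_le.trans h5).trans hK) (hb'.im_le.trans hJ)⟩
      exact h6.mono (dom_rcomp_le _ _) le_top)
    (fun J L L' Γ β hb hβ j hj m hm hp => by
      have hb' := hb.cj hj hm
      obtain ⟨h4, h5, h6, h7⟩ := hp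
      refine hPcj' (j := j) (l := m) ?_ hb hj hm
      have hF := hs.big.le
      have hβ' : E₁.Gr β := hβ.gr.of_isSubsystem (inner_isSubsystem E₁ hK)
      have h8 : rcomp (rcomp (cj j m Γ) β) (rinv β) ≤ cj j m Γ := by
        rw [rcomp_assoc, hβ.gr.rcomp_rinv_self]
        rintro ⟨b, a⟩ ⟨c, h9, h10⟩
        obtain ⟨-, h11⟩ := mem_cgr.1 h10
        have h12 : c = a := by simpa using h11
        rwa [← h12]
      have h9 : im (rcomp (rcomp (cj j m Γ) β) (rinv β)) = im (rcomp (cj j m Γ) β) :=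
        im_rcomp (by rw [im_rinv]; exact dom_rcomp_le _ _)
      have h10 := h7.rcomp hβ'.rinv
      have h11 : F.Centric (dom (rcomp (rcomp (cj j m Γ) β) (rinv β))) := by
        refine Gr.centric_dom (h10.of_isSubsystem hs.small.le) ?_
        rw [h9]
        exact (h7.of_isSubsystem hs.small.le).centric_im h6
      refine ⟨h4, hβ.left, h11.mono (dom_mono h8) le_top, hs.small.full h10 h11 h8
        (hb'.gr.of_isSubsystem hF) ((hb'.dom_le.trans hβ.left).trans hK) (hb'.im_le.trans h4)⟩)
  refine ⟨{ toFun := fun y => Φ (Res.val y)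
            map_add' := fun y z => by rw [map_add, map_add]
            map_smul' := fun a y => by rw [Res.val_smul, hΦ', RingHom.id_apply] },
    fun J L Γ hb hJ hL hc x => ?_⟩
  have hval : ∀ b, Φ (Res.val (Res.proj (mackeyInclusion R hs.le hs.sub)
      (ind (innerInclusion R E hs.le') b x))) = g b x := by
    intro b
    rw [Res.val_proj, hΦ', hΦ, one_smul]
  refine ⟨fun h => ?_, fun h => ?_⟩
  · refine (hval _).trans ?_
    rw [hg _ _ _ _ hb, if_pos ⟨hJ, hL, hc, h⟩]
  · refine (hval _).trans ?_
    rw [hg _ _ _ _ hb, if_neg fun h' => h h'.2.2.2]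

/-- The canonical map from a functor induced from `K` to `E₁` to the restriction of the functor
induced to `E`. -/
theorem exists_unit_res_ind (hs : MackeySetting p F E E₁ K) (hK : K ≤ Q₁) (X : Type*)
    [AddCommGroup X] [Module (MackeyAlgebra R (inner K)) X] :
    ∃ η : Ind (innerInclusion R E₁ hK) X →ₗ[MackeyAlgebra R E₁]
        Res (mackeyInclusion R hs.le hs.sub) (Ind (innerInclusion R E hs.le') X),
      ∀ b x, η (ind _ b x) =
        Res.proj _ (ind (innerInclusion R E hs.le') (mackeyInclusion R hs.le hs.sub b) x) := by
  have hcomp : ∀ c, mackeyInclusion R hs.le hs.sub (innerInclusion R E₁ hK c) =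
      innerInclusion R E hs.le' c := fun c => mackeyInclusion_comp R _ _ _ _ c
  obtain ⟨η, hη⟩ := Ind.exists_lift (ι := innerInclusion R E₁ hK) (N := X)
    (M := Res (mackeyInclusion R hs.le hs.sub) (Ind (innerInclusion R E hs.le') X))
    ((Res.proj _).comp (indHom (innerInclusion R E hs.le') 1)) (fun a x => by
      change _ • Res.proj _ (ind _ 1 x) = Res.proj _ (ind _ 1 (a • x))
      rw [Res.smul_proj, smul_ind, hcomp, mul_one, ← ind_mul, one_mul])
  refine ⟨η, fun b x => ?_⟩
  rw [hη]
  change _ • Res.proj _ (ind _ 1 x) = _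
  rw [Res.smul_proj, smul_ind, mul_one]

variable {R} {H : Subgroup S}

theorem normalizerIn_le : normalizerIn ⊤ H ≤ ⊤ := le_top

theorem normalizerFusion_isSubsystem (F : FusionSystem (⊤ : Subgroup S)) (H : Subgroup S) :
    (normalizerFusion F H).IsSubsystem F :=
  normalizerSystem_isSubsystem F H le_top

theorem mackeySetting_normalizer (hS : IsPGroup p S) (hF : F.Saturated p)
    (hH : F.FullyNormalized H) : MackeySetting p F F (normalizerFusion F H) H :=
  ⟨hS, hF, isCentricallySaturated_self hS hF, isCentricallySaturated_normalizer hS hF hH,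
    normalizerFusion_isSubsystem F H, normalizerIn_le, le_top⟩

theorem le_normalizerIn : H ≤ normalizerIn ⊤ H := fun _ hx =>
  mem_normalizerIn_top.2 (Subgroup.le_normalizer hx)

theorem pairLE_cgr_one_iff {Γ : Subgroup (S × S)} (hd : dom Γ ≤ H) :
    PairLE (normalizerFusion F H) H Γ (cgr 1 H) ↔ (normalizerFusion F H).Gr Γ := by
  constructor
  · rintro ⟨k, hk, τ, hτ, hv⟩
    refine (hτ.rinv.rcomp (gr_cgr (le_normalizerIn hk) (hd.trans le_normalizerIn))).mono ?_
    rintro ⟨b, a⟩ hab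
    obtain ⟨c, h1, h2⟩ := hv b a hab
    obtain ⟨-, h3⟩ := mem_cgr.1 h2
    exact ⟨c, h1, mem_cgr.2 ⟨mem_dom_of hab, by simpa using h3⟩⟩
  · intro h
    exact ⟨1, one_mem _, rinv Γ, h.rinv, fun b a hab =>
      ⟨a, hab, mem_cgr.2 ⟨by simpa using hd (mem_dom_of hab), by simp⟩⟩⟩

/-- For a fully normalized centric subgroup `H`, the restriction to `N_F(H)` of a functor induced
from `H` to `F` is the functor induced to `N_F(H)` up to summands that are projective relative to
members of `𝒴`. -/
theorem exists_splitting_res_ind (hS : IsPGroup p S) (hF : F.Saturated p)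
    (hH : F.FullyNormalized H) (hHc : F.Centric H) {X : Type*}
    [AddCommGroup X] [Module (MackeyAlgebra R (inner H)) X] (hX : IsCentric R F (inner H) X)
    (η : Ind (innerInclusion R (normalizerFusion F H) le_normalizerIn) X
      →ₗ[MackeyAlgebra R (normalizerFusion F H)]
        Res (mackeyInclusion R normalizerIn_le (normalizerFusion_isSubsystem F H))
          (Ind (innerInclusion R F (K := H) le_top) X))
    (hη : ∀ b x, η (ind (innerInclusion R (normalizerFusion F H) le_normalizerIn) b x) =
      Res.proj _ (ind (innerInclusion R F (K := H) le_top)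
        (mackeyInclusion R normalizerIn_le (normalizerFusion_isSubsystem F H) b) x)) :
    ∃ r : Res (mackeyInclusion R normalizerIn_le (normalizerFusion_isSubsystem F H))
          (Ind (innerInclusion R F (K := H) le_top) X) →ₗ[MackeyAlgebra R (normalizerFusion F H)]
        Ind (innerInclusion R (normalizerFusion F H) le_normalizerIn) X,
      r ∘ₗ η = LinearMap.id ∧
      LinearMap.id - η ∘ₗ r ∈ TrF R (normalizerFusion F H) (greenY F H)
        (Res (mackeyInclusion R normalizerIn_le (normalizerFusion_isSubsystem F H))
          (Ind (innerInclusion R F (K := H) le_top) X))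
        (Res (mackeyInclusion R normalizerIn_le (normalizerFusion_isSubsystem F H))
          (Ind (innerInclusion R F (K := H) le_top) X)) := by
  classical
  have hs := mackeySetting_normalizer hS hF hH
  obtain ⟨r, hr⟩ := exists_retraction_res_ind R hs le_normalizerIn hX
  have hηb : ∀ J L Γ x, IsBas (normalizerFusion F H) J L Γ → η (ind _ (bas R _ J L Γ) x) =
      Res.proj _ (ind (innerInclusion R F (K := H) le_top) (bas R F J L Γ) x) := by
    intro J L Γ x h
    rw [hη, mackeyInclusion_bas R _ _ h]
  refine ⟨r, Ind.hom_ext fun x => ?_, ?_⟩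
  · rw [LinearMap.id_apply]
    generalize (1 : MackeyAlgebra R (normalizerFusion F H)) = b
    induction b using mackey_induction R generalizing x with
    | zero => rw [ind_zero_left, map_zero]
    | add b b' hb hb' => rw [ind_add_left, map_add, hb, hb']
    | smul_bas t J L Γ h =>
      rw [Algebra.smul_def, ← smul_ind, map_smul]
      congr 1
      by_cases hL : L ≤ H
      · by_cases hc : F.Centric (dom Γ)
        · rw [LinearMap.comp_apply, hηb _ _ _ _ h]
          exact (hr J L Γ (h.of_isSubsystem hs.le hs.sub) h.left hL hc x).1 h.gr
        · have := ind_bas_eq_zero R le_normalizerIn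
            (inner_isSubsystem (normalizerFusion F H) le_normalizerIn) hX h hc x
          exact (congrArg _ this).trans ((map_zero _).trans this.symm)
      · have := ind_bas_eq_zero_of_not_le (J := J) (Γ := Γ) R le_normalizerIn
          (inner_isSubsystem (normalizerFusion F H) le_normalizerIn) hL x
        exact (congrArg _ this).trans ((map_zero _).trans this.symm)
  · obtain ⟨T, hT, hTu⟩ := exists_transversal hs
    have _ : Fintype T := Fintype.ofFinite T
    have hH1 : IsPair F F (normalizerIn ⊤ H) H (cgr 1 H) :=
      ⟨gr_cgr (one_mem _) le_top, by rwa [dom_cgr], (dom_cgr 1 H).le,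
        (im_cgr_one H).le.trans le_normalizerIn⟩
    obtain ⟨G₀, ⟨hG₀, hle₀⟩, -⟩ := hTu _ hH1
    have hge₀ : PairLE (normalizerFusion F H) H G₀ (cgr 1 H) := by
      obtain ⟨k, hk, τ, hτ, hv⟩ := hle₀
      refine ⟨k⁻¹, inv_mem hk, rinv τ, hτ.rinv, hv.symm (hT G₀ hG₀).pair.gr ?_⟩
      rw [dom_cgr]
      exact Subgroup.card_le_of_le (hT G₀ hG₀).pair.dom_le
    have hN : ∀ Γ, IsPair F F (normalizerIn ⊤ H) H Γ →
        (PairLE (normalizerFusion F H) H Γ G₀ ↔ (normalizerFusion F H).Gr Γ) := by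
      intro Γ hΓ
      rw [← pairLE_cgr_one_iff hΓ.dom_le]
      exact ⟨fun h => h.trans hge₀, fun h => h.trans hle₀⟩
    choose Ψ h1 h2 using fun G : T => exists_mackey_component R hs (hT G G.2) hX
    have hid : LinearMap.id - η ∘ₗ r = ∑ G ∈ Finset.univ.erase (⟨G₀, hG₀⟩ : T), Ψ G := by
      ext y
      rw [LinearMap.sub_apply, LinearMap.id_apply, LinearMap.sum_apply, LinearMap.comp_apply]
      induction y using res_ind_induction R hs.le' hs.le hs.sub hX with
      | zero => simp only [map_zero, Finset.sum_const_zero, sub_zero]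
      | add x y hx hy => simp only [map_add, Finset.sum_add_distrib, ← hx, ← hy]; abel
      | ind J L Γ x h hJ hL hc =>
        have hp : IsPair F F (normalizerIn ⊤ H) H Γ :=
          ⟨h.gr, hc, h.dom_le.trans hL, h.im_le.trans hJ⟩
        obtain ⟨G, ⟨hG, hle⟩, hu⟩ := hTu Γ hp
        by_cases hΓ : (normalizerFusion F H).Gr Γ
        · have e1 := (hr J L Γ h hJ hL hc x).1 hΓ
          have e2 := hηb J L Γ x ⟨hJ, hL.trans le_normalizerIn, hΓ, h.im_le, h.dom_le⟩
          rw [Finset.sum_eq_zero]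
          · rw [sub_eq_zero]
            exact ((congrArg η e1).trans e2).symm
          · intro G' hG'
            refine (h2 G' J L Γ h hJ hL hc x).2 fun h' => (Finset.mem_erase.1 hG').1 ?_
            exact Subtype.ext ((hu _ ⟨G'.2, h'⟩).trans (hu _ ⟨hG₀, (hN Γ hp).2 hΓ⟩).symm)
        · have e1 := (hr J L Γ h hJ hL hc x).2 hΓ
          have hne : G ≠ G₀ := fun e => hΓ ((hN Γ hp).1 (by rwa [← e]))
          rw [Finset.sum_eq_single (⟨G, hG⟩ : T)]
          · rw [(h2 ⟨G, hG⟩ J L Γ h hJ hL hc x).1 hle, sub_eq_self]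
            exact (congrArg η e1).trans (map_zero η)
          · intro G' _ hne
            exact (h2 G' J L Γ h hJ hL hc x).2 fun h' => hne (Subtype.ext (hu _ ⟨G'.2, h'⟩))
          · intro h
            exact absurd (Finset.mem_erase.2 ⟨fun e => hne (congrArg Subtype.val e),
              Finset.mem_univ _⟩) h
    rw [hid]
    refine sum_mem fun G hG => ?_
    have hGm := hT G G.2
    refine tr_le_TrF (Z := greenY F H) ⟨hGm.centric_im hs, hGm.subconj le_top, hGm.pair.im_le,
      fun he => (Finset.mem_erase.1 hG).1 (Subtype.ext ?_)⟩ hGm.pair.im_le (h1 G)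
    have hd : dom G.1 = H := Subgroup.eq_of_le_of_card_ge hGm.pair.dom_le (by
      rw [hGm.pair.gr.card_eq, he])
    have hg : (normalizerFusion F H).Gr G.1 := by
      refine gr_normalizerSystem_iff.2 ⟨hd.le.trans le_normalizerIn, hGm.pair.im_le, G.1,
        hGm.pair.gr, le_rfl, hd.ge, fun b a hab _ => ?_⟩
      rw [← he]
      exact mem_im_of hab
    obtain ⟨G', -, hu⟩ := hTu _ hGm.pair
    exact (hu _ ⟨G.2, hGm.pair.pairLE_refl⟩).trans (hu _ ⟨hG₀, (hN _ hGm.pair).2 hg⟩).symm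

end NormalizerSplitting

end CentricMackey

namespace CentricMackey

open FusionSystem

section

variable {A B : Type*} [Ring A] [Ring B] (ι : A →ₙ+* B) {N N' : Type*} [AddCommGroup N]
  [Module A N] [AddCommGroup N'] [Module A N']

theorem etaMap_naturality (f : N →ₗ[A] N') :
    etaMap ι ∘ₗ f = Res.map ι (Ind.map ι f) ∘ₗ etaMap ι := by
  ext x
  refine Res.val_injective ?_
  rw [LinearMap.comp_apply, LinearMap.comp_apply, Res.val_map, val_etaMap, val_etaMap, Ind.map_ind]

end

section RelativeTraces

variable {S : Type u} [Group S] [Finite S] {p : ℕ} [Fact p.Prime]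
  {F : FusionSystem (⊤ : Subgroup S)} {Q Q₁ : Subgroup S}
  {E : FusionSystem Q} {E₁ : FusionSystem Q₁} {R : Type v} [CommRing R]

theorem TrF_induction {Z : Set (Subgroup S)} {M M' : Type*}
    [AddCommGroup M] [Module (MackeyAlgebra R E) M] [AddCommGroup M']
    [Module (MackeyAlgebra R E) M'] {C : (M →ₗ[MackeyAlgebra R E] M') → Prop} (zero : C 0)
    (add : ∀ f g, C f → C g → C (f + g))
    (tr : ∀ K ∈ Z, ∀ (hK : K ≤ Q), ∀ f ∈ Tr (innerInclusion R E hK) M M', C f)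
    {f : M →ₗ[MackeyAlgebra R E] M'} (hf : f ∈ TrF R E Z M M') : C f := by
  unfold TrF at hf
  induction hf using AddSubgroup.iSup_induction' with
  | hp K f hf => exact tr K.1 K.2.1 K.2.2 f hf
  | h1 => exact zero
  | hadd f g _ _ hf hg => exact add f g hf hg

theorem ind_mem_TrF (hQ : Q₁ ≤ Q) (hE : E₁.IsSubsystem E) {Z : Set (Subgroup S)} {N N' : Type*}
    [AddCommGroup N] [Module (MackeyAlgebra R E₁) N] [AddCommGroup N']
    [Module (MackeyAlgebra R E₁) N'] {f : N →ₗ[MackeyAlgebra R E₁] N'}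
    (hf : f ∈ TrF R E₁ Z N N') :
    Ind.map (mackeyInclusion R hQ hE) f ∈ TrF R E {D | D ∈ Z ∧ D ≤ Q₁}
      (Ind (mackeyInclusion R hQ hE) N) (Ind (mackeyInclusion R hQ hE) N') := by
  refine TrF_induction (C := fun f => Ind.map (mackeyInclusion R hQ hE) f ∈ TrF R E
    {D | D ∈ Z ∧ D ≤ Q₁} (Ind (mackeyInclusion R hQ hE) N) (Ind (mackeyInclusion R hQ hE) N'))
    ?_ ?_ ?_ hf
  · rw [Ind.map_zero_apply]
    exact zero_mem _
  · intro f g hf hg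
    rw [Ind.map_add_apply]
    exact add_mem hf hg
  · intro K hK hKQ f hf
    refine tr_le_TrF (Z := {D | D ∈ Z ∧ D ≤ Q₁}) ⟨hK, hKQ⟩ (hKQ.trans hQ) ?_
    refine ind_mem_Tr (fun a => ?_) hf
    exact (mackeyInclusion_comp R hQ hE hKQ (inner_isSubsystem E₁ hKQ) a).symm

theorem res_mem_TrF (hS : IsPGroup p S) (hF : F.Saturated p) (hEF : IsCentricallySaturated p F E)
    (hE₁F : IsCentricallySaturated p F E₁) (hQ : Q₁ ≤ Q) (hE : E₁.IsSubsystem E)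
    {Z : Set (Subgroup S)} {M M' : Type*} [AddCommGroup M] [Module (MackeyAlgebra R E) M]
    [AddCommGroup M'] [Module (MackeyAlgebra R E) M'] (hM' : IsCentric R F E M')
    {f : M →ₗ[MackeyAlgebra R E] M'} (hf : f ∈ TrF R E Z M M') :
    Res.map (mackeyInclusion R hQ hE) f ∈
      TrF R E₁ {D | F.Centric D ∧ ∃ K ∈ Z, E.Subconj D K} (Res (mackeyInclusion R hQ hE) M)
        (Res (mackeyInclusion R hQ hE) M') := by
  refine TrF_induction (C := fun f => Res.map (mackeyInclusion R hQ hE) f ∈ TrF R E₁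
    {D | F.Centric D ∧ ∃ K ∈ Z, E.Subconj D K} (Res (mackeyInclusion R hQ hE) M)
        (Res (mackeyInclusion R hQ hE) M')) ?_ ?_ ?_ hf
  · rw [Res.map_zero_apply]
    exact zero_mem _
  · intro f g hf hg
    rw [Res.map_add_apply]
    exact add_mem hf hg
  · rintro K hK hKQ _ ⟨g, rfl⟩
    have hs : MackeySetting p F E E₁ K := ⟨hS, hF, hEF, hE₁F, hE, hQ, hKQ⟩
    have h1 : IsCentric R F (inner K) (Res (innerInclusion R E hKQ) M') :=
      isCentric_res R hKQ (inner_isSubsystem E hKQ) hM'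
    have h2 := id_mem_TrF_res_ind R hs h1
    have h3 := TrF.comp_left (TrF.comp_right h2 (Res.map (mackeyInclusion R hQ hE) g))
      (Res.map (mackeyInclusion R hQ hE) (theta (innerInclusion R E hKQ) M'))
    rw [LinearMap.id_comp, ← Res.map_comp] at h3
    refine TrF_mono (Z := {D | F.Centric D ∧ E.Subconj D K})
      (Z' := {D | F.Centric D ∧ ∃ K ∈ Z, E.Subconj D K}) (fun D hD => ?_) h3
    exact ⟨hD.1, K, hK, hD.2⟩

theorem theta_eq_zero {M : Type*} [AddCommGroup M] [Module (MackeyAlgebra R E) M] {P : Subgroup S}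
    {F : FusionSystem P} (hQP : Q ≤ P)
    (hM : IsCentric R F E M) {K : Subgroup S} (hK : K ≤ Q) (hc : ¬ F.Centric K) :
    theta (innerInclusion R E hK) M = 0 := by
  refine Ind.hom_ext fun x => ?_
  have _ : Fintype {L : Subgroup S // L ≤ K} := Fintype.ofFinite _
  have h1 : innerInclusion R E hK 1 = _ := mackeyInclusion_one R hK (inner_isSubsystem E hK)
  rw [theta_ind, one_smul, LinearMap.zero_apply, ← Res.one_smul_val, h1, finsum_eq_sum_of_fintype, Finset.sum_smul]
  exact Finset.sum_eq_zero fun L _ => bas_smul_eq_zero R hM (.one le_rfl (L.2.trans hK))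
    (fun h => hc (h.mono L.2 (hK.trans hQP))) _

theorem Tr_le_of_le {D K : Subgroup S} (h : D ≤ K) (hK : K ≤ Q) (M M' : Type*) [AddCommGroup M]
    [Module (MackeyAlgebra R E) M] [AddCommGroup M'] [Module (MackeyAlgebra R E) M'] :
    Tr (innerInclusion R E (h.trans hK)) M M' ≤ Tr (innerInclusion R E hK) M M' :=
  Tr_le_of_comp (κ := innerInclusion R (inner K) h) (fun a =>
    (mackeyInclusion_comp R hK (inner_isSubsystem E hK) h (inner_isSubsystem (inner K) h) a).symm)
    M M'

theorem Tr_le_of_conj_gr {Γ : Subgroup (S × S)} (hΓ : E.Gr Γ) (M M' : Type*) [AddCommGroup M]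
    [Module (MackeyAlgebra R E) M] [AddCommGroup M'] [Module (MackeyAlgebra R E) M'] :
    Tr (innerInclusion R E hΓ.dom_le) M M' ≤ Tr (innerInclusion R E hΓ.im_le) M M' := by
  have _ : Fintype {L : Subgroup S // L ≤ dom Γ} := Fintype.ofFinite _
  have _ : Fintype {L : Subgroup S // L ≤ im Γ} := Fintype.ofFinite _
  have hr : ∀ L, E.Gr (rres Γ L) := fun L => hΓ.mono (rres_le _ _)
  have hd : ∀ {L}, L ≤ dom Γ → dom (rres Γ L) = L := fun h => dom_rres h
  have hi : ∀ L, im (rres Γ L) ≤ im Γ := fun L => im_mono (rres_le _ _)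
  have hb : ∀ {L}, L ≤ dom Γ → IsBas E (im (rres Γ L)) L (rres Γ L) := fun h =>
    ⟨(hi _).trans hΓ.im_le, h.trans hΓ.dom_le, hr _, le_rfl, (hd h).le⟩
  have hb' : ∀ {L}, L ≤ dom Γ → IsBas E L (im (rres Γ L)) (rinv (rres Γ L)) := fun h =>
    ⟨h.trans hΓ.dom_le, (hi _).trans hΓ.im_le, (hr _).rinv, by rw [im_rinv, hd h],
      by rw [dom_rinv]⟩
  have hinj : ∀ {L M : Subgroup S}, L ≤ dom Γ → M ≤ dom Γ → im (rres Γ L) = im (rres Γ M) →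
      L ≤ M := by
    intro L M hL hM h a ha
    obtain ⟨b, hb⟩ := mem_dom.1 (hL ha)
    have h1 : b ∈ im (rres Γ L) := mem_im.2 ⟨a, hb, ha⟩
    rw [h] at h1
    obtain ⟨a', h2, h3⟩ := mem_im.1 h1
    rwa [hΓ.injective hb h2]
  let c : MackeyAlgebra R E := ∑ L : {L : Subgroup S // L ≤ dom Γ},
    bas R E (im (rres Γ L)) L (rres Γ L)
  let d : MackeyAlgebra R E := ∑ L : {L : Subgroup S // L ≤ dom Γ},
    bas R E L (im (rres Γ L)) (rinv (rres Γ L))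
  have hc : ∀ {J L : Subgroup S} {α : Subgroup (S × S)} (hJ : J ≤ dom Γ), IsBas E J L α →
      c * bas R E J L α = bas R E (im (rres Γ J)) L (rcomp (rres Γ J) α) := by
    intro J L α hJ hα
    rw [Finset.sum_mul, Finset.sum_eq_single (⟨J, hJ⟩ : {L : Subgroup S // L ≤ dom Γ})]
    · exact bas_mul R (hb hJ) hα (Or.inl (hd hJ).ge)
    · intro M _ hM
      exact bas_mul_of_ne R fun h => hM (Subtype.ext h)
    · intro h
      exact absurd (Finset.mem_univ _) h
  have hc' : ∀ {J L : Subgroup S} {α : Subgroup (S × S)} (hL : L ≤ dom Γ),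
      IsBas E J (im (rres Γ L)) α →
      bas R E J (im (rres Γ L)) α * c = bas R E J L (rcomp α (rres Γ L)) := by
    intro J L α hL hα
    rw [Finset.mul_sum, Finset.sum_eq_single (⟨L, hL⟩ : {L : Subgroup S // L ≤ dom Γ})]
    · exact bas_mul R hα (hb hL) (Or.inr le_rfl)
    · intro M _ hM
      exact bas_mul_of_ne R fun h => hM (Subtype.ext
        (le_antisymm (hinj M.2 hL h.symm) (hinj hL M.2 h)))
    · intro h
      exact absurd (Finset.mem_univ _) h
  refine Tr_le_of_conj (c := c) (d := d) ?_ ?_ (fun a => ?_) M M'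
  · rw [innerInclusion, mackeyInclusion_one, finsum_eq_sum_of_fintype, Finset.sum_mul]
    refine Finset.sum_congr rfl fun L _ => ?_
    rw [hc' L.2 (hb' L.2), (hr _).rinv_rcomp_self, hd L.2]
  · rw [innerInclusion, mackeyInclusion_one, finsum_eq_sum_of_fintype, Finset.mul_sum]
    refine Fintype.sum_bijective (fun L => ⟨im (rres Γ L), hi _⟩) ⟨fun L M h => ?_, fun K => ?_⟩
      _ _ fun L => ?_
    · have := congrArg Subtype.val h
      exact Subtype.ext (le_antisymm (hinj L.2 M.2 this) (hinj M.2 L.2 this.symm))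
    · refine ⟨⟨im (rres (rinv Γ) K), (im_mono (rres_le _ _)).trans (im_rinv Γ).le⟩,
        Subtype.ext ?_⟩
      ext b
      constructor
      · intro h
        obtain ⟨a, h1, h2⟩ := mem_im.1 h
        obtain ⟨b', h3, h4⟩ := mem_im.1 h2
        have h5 : (b', a) ∈ Γ := h3
        rwa [hΓ.functional h1 h5]
      · intro h
        obtain ⟨a, h1⟩ := mem_im.1 (K.2 h)
        exact mem_im.2 ⟨a, h1, mem_im.2 ⟨b, h1, h⟩⟩
    · rw [hc L.2 (hb' L.2), (hr _).rcomp_rinv_self]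
  · induction a using mackey_induction R with
    | zero => exact ⟨0, by simp⟩
    | add a a' h h' =>
      obtain ⟨b, hb⟩ := h
      obtain ⟨b', hb'⟩ := h'
      exact ⟨b + b', by rw [map_add, mul_add, hb, hb', map_add, add_mul]⟩
    | smul_bas r J L α hα =>
      have hαE := hα.of_isSubsystem hΓ.dom_le (inner_isSubsystem E hΓ.dom_le)
      have hJ : J ≤ dom Γ := hα.left
      have hL : L ≤ dom Γ := hα.right
      obtain ⟨-, g, hg, hαg⟩ := gr_inner_iff.1 hα.gr
      obtain ⟨y, hy⟩ := mem_dom.1 hg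
      have h1 : IsBas (inner (im Γ)) (im (rres Γ J)) (im (rres Γ L))
          (rcomp (rcomp (rres Γ J) α) (rinv (rres Γ L))) := by
        refine ⟨hi _, hi _, ?_, (im_rcomp_le _ _).trans (im_rcomp_le _ _),
          (dom_rcomp_le _ _).trans (dom_rinv _).le⟩
        refine (gr_cgr (E := inner (im Γ)) (mem_im_of hy) (le_refl (im Γ))).mono ?_
        rintro ⟨b, a⟩ ⟨e, ⟨f, h2, h3⟩, h4⟩
        rw [hαg] at h3
        obtain ⟨-, rfl⟩ := mem_cgr.1 h3
        have h5 : (a, e) ∈ Γ := h4.1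
        refine mem_cgr.2 ⟨mem_im_of h5, hΓ.functional (h2.1 : (b, g * e * g⁻¹) ∈ Γ) ?_⟩
        exact Γ.mul_mem (Γ.mul_mem hy h5) (Γ.inv_mem hy)
      refine ⟨r • bas R _ (im (rres Γ J)) (im (rres Γ L))
        (rcomp (rcomp (rres Γ J) α) (rinv (rres Γ L))), ?_⟩
      rw [innerInclusion, innerInclusion, mackeyInclusion_smul, mackeyInclusion_smul,
        mackeyInclusion_bas R _ _ hα, mackeyInclusion_bas R _ _ h1, mul_smul_comm, smul_mul_assoc,
        hc hJ hαE, hc' hL (h1.of_isSubsystem hΓ.im_le (inner_isSubsystem E hΓ.im_le)),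
        rcomp_assoc, (hr L).rinv_rcomp_self, hd hL,
        rcomp_one_right ((dom_rcomp_le _ _).trans hα.dom_le)]

theorem Tr_le_of_subconj {D K : Subgroup S} (h : E.Subconj D K) (hD : D ≤ Q) (hK : K ≤ Q)
    (M M' : Type*) [AddCommGroup M]
    [Module (MackeyAlgebra R E) M] [AddCommGroup M'] [Module (MackeyAlgebra R E) M'] :
    Tr (innerInclusion R E hD) M M' ≤ Tr (innerInclusion R E hK) M M' := by
  obtain ⟨Γ, hΓ, rfl, hi⟩ := h.exists_gr
  exact (Tr_le_of_conj_gr hΓ M M').trans (Tr_le_of_le hi hK M M')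

variable {H : Subgroup S}

/-- For an `H`-projective functor `N` over `N_F(H)`, the unit `N → N↑↓` splits, and its cokernel is
projective relative to members of `𝒴`. -/
theorem exists_splitting_unit (hS : IsPGroup p S) (hF : F.Saturated p)
    (hH : F.FullyNormalized H) (hHc : F.Centric H) {N : Type*} [AddCommGroup N]
    [Module (MackeyAlgebra R (normalizerFusion F H)) N]
    (hN : IsCentric R F (normalizerFusion F H) N)
    (hNp : LinearMap.id ∈ Tr (innerInclusion R (normalizerFusion F H) le_normalizerIn) N N) :
    ∃ r : Res (mackeyInclusion R normalizerIn_le (normalizerFusion_isSubsystem F H))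
        (Ind (mackeyInclusion R normalizerIn_le (normalizerFusion_isSubsystem F H)) N)
        →ₗ[MackeyAlgebra R (normalizerFusion F H)] N,
      r ∘ₗ etaMap _ = LinearMap.id ∧
      LinearMap.id - etaMap _ ∘ₗ r ∈ TrF R (normalizerFusion F H) (greenY F H)
        (Res (mackeyInclusion R normalizerIn_le (normalizerFusion_isSubsystem F H))
          (Ind (mackeyInclusion R normalizerIn_le (normalizerFusion_isSubsystem F H)) N))
        (Res (mackeyInclusion R normalizerIn_le (normalizerFusion_isSubsystem F H))
          (Ind (mackeyInclusion R normalizerIn_le (normalizerFusion_isSubsystem F H)) N)) := by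
  set ι := mackeyInclusion R normalizerIn_le (normalizerFusion_isSubsystem F H) with hι
  set κ := innerInclusion R (normalizerFusion F H) le_normalizerIn with hκ
  set l := innerInclusion R F (K := H) le_top with hl
  have hlκ : ∀ a, l a = ι (κ a) := fun a => (mackeyInclusion_comp R _ _ _ _ a).symm
  obtain ⟨s, hs⟩ := hNp
  have hX : IsCentric R F (inner H) (Res κ N) :=
    isCentric_res R le_normalizerIn (inner_isSubsystem _ le_normalizerIn) hN
  have hms := mackeySetting_normalizer hS hF hH
  obtain ⟨η, hη⟩ := exists_unit_res_ind R hms le_normalizerIn (Res κ N)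
  obtain ⟨r, hr1, hr2⟩ := exists_splitting_res_ind hS hF hH hHc hX η hη
  obtain ⟨u, v, huv, h1, h2⟩ := exists_indInd (ι := ι) (κ := κ) (Z := Res κ N) hlκ
  -- the splitting for the induced functor
  have hηu : Res.map ι u ∘ₗ η = etaMap ι := by
    ext y
    induction y using Ind.induction with
    | zero => rw [map_zero, map_zero]
    | add x y hx hy => rw [map_add, map_add, hx, hy]
    | ind b x =>
      refine Res.val_injective ?_
      rw [LinearMap.comp_apply, Res.val_map, hη, Res.val_proj, val_etaMap, smul_ind, ind_eq_smul,
        map_smul, huv, smul_ind, mul_one, ← hι, ← map_mul, one_mul, ← one_mul (ι b), ind_mul,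
        smul_ind, mul_one, ← one_mul (ι 1), ind_mul_one]
  let r' := r ∘ₗ Res.map ι v
  have hr1' : r' ∘ₗ etaMap ι = LinearMap.id := by
    rw [← hηu, LinearMap.comp_assoc, ← LinearMap.comp_assoc η, ← Res.map_comp, h2, Res.map_id,
      LinearMap.id_comp, hr1]
  have hr2' : LinearMap.id - etaMap ι ∘ₗ r' = Res.map ι u ∘ₗ (LinearMap.id - η ∘ₗ r) ∘ₗ
      Res.map ι v := by
    rw [← hηu, LinearMap.sub_comp, LinearMap.comp_sub, LinearMap.id_comp, ← Res.map_comp, h1,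
      Res.map_id]
    rfl
  refine ⟨theta κ N ∘ₗ r' ∘ₗ Res.map ι (Ind.map ι s), ?_, ?_⟩
  · rw [LinearMap.comp_assoc, LinearMap.comp_assoc, ← etaMap_naturality,
      ← LinearMap.comp_assoc s, hr1', LinearMap.id_comp, ← hs]
  · have h3 : LinearMap.id - etaMap ι ∘ₗ (theta κ N ∘ₗ r' ∘ₗ Res.map ι (Ind.map ι s)) =
        Res.map ι (Ind.map ι (theta κ N)) ∘ₗ (Res.map ι u ∘ₗ (LinearMap.id - η ∘ₗ r) ∘ₗ
          Res.map ι v) ∘ₗ Res.map ι (Ind.map ι s) := by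
      rw [← hr2', LinearMap.sub_comp, LinearMap.comp_sub, LinearMap.id_comp, ← Res.map_comp,
        ← Ind.map_comp, ← hs, Ind.map_id, Res.map_id, ← LinearMap.comp_assoc, etaMap_naturality]
      rfl
    rw [h3]
    exact TrF.comp_left (TrF.comp_right (TrF.comp_left (TrF.comp_right hr2 _) _) _) _

end RelativeTraces

end CentricMackey

namespace CentricMackey

section LocalEndomorphisms

variable {B : Type*} [Ring B]

/-- The endomorphism ring of the nonzero module `M` is local. -/
def IsLocalModule (B : Type*) [Ring B] (M : Type*) [AddCommGroup M] [Module B M] : Prop :=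
  Nontrivial M ∧ ∀ f : M →ₗ[B] M, Function.Bijective f ∨
    Function.Bijective (LinearMap.id - f : M →ₗ[B] M)

variable {M N : Type*} [AddCommGroup M] [Module B M] [AddCommGroup N] [Module B N]

theorem IsLocalModule.bijective_of_add (hM : IsLocalModule B M) {f g : M →ₗ[B] M}
    (h : Function.Bijective (f + g : M →ₗ[B] M)) : Function.Bijective f ∨ Function.Bijective g := by
  let e := LinearEquiv.ofBijective (f + g) h
  have he : ∀ x, e x = f x + g x := fun x => rfl
  rcases hM.2 (e.symm.toLinearMap ∘ₗ f) with h1 | h1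
  · left
    have : (f : M → M) = e ∘ (e.symm.toLinearMap ∘ₗ f) := by
      ext x
      simp
    rw [this]
    exact e.bijective.comp h1
  · right
    have : (g : M → M) = e ∘ (LinearMap.id - e.symm.toLinearMap ∘ₗ f : M →ₗ[B] M) := by
      ext x
      change g x = e (x - e.symm (f x))
      rw [map_sub, e.apply_symm_apply, he]
      abel
    rw [this]
    exact e.bijective.comp h1

theorem IsLocalModule.not_bijective_zero (hM : IsLocalModule B M) :
    ¬ Function.Bijective (0 : M →ₗ[B] M) := fun h => by
  have := hM.1
  obtain ⟨x, hx⟩ := exists_ne (0 : M)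
  exact hx (h.1 rfl)

theorem IsLocalModule.exists_bijective_of_sum (hM : IsLocalModule B M) {ι : Type*} (s : Finset ι)
    (f : ι → M →ₗ[B] M) (h : Function.Bijective (∑ i ∈ s, f i : M →ₗ[B] M)) :
    ∃ i ∈ s, Function.Bijective (f i) := by
  classical
  induction s using Finset.induction_on with
  | empty =>
    rw [Finset.sum_empty] at h
    exact absurd h hM.not_bijective_zero
  | insert i s hi ih =>
    rw [Finset.sum_insert hi] at h
    rcases hM.bijective_of_add h with h1 | h1
    · exact ⟨i, Finset.mem_insert_self _ _, h1⟩
    · obtain ⟨j, hj, h2⟩ := ih h1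
      exact ⟨j, Finset.mem_insert_of_mem hj, h2⟩

/-- A nonzero module that is a retract of an indecomposable one is isomorphic to it. -/
theorem IsLocalModule.bijective_of_comp_bijective (hM : Nontrivial M) (hN : IsLocalModule B N)
    {a : M →ₗ[B] N} {b : N →ₗ[B] M} (h : Function.Bijective (b ∘ₗ a)) :
    Function.Bijective a ∧ Function.Bijective b := by
  let e := LinearEquiv.ofBijective (b ∘ₗ a) h
  have he : ∀ x, e x = b (a x) := fun x => rfl
  let f : N →ₗ[B] N := a ∘ₗ e.symm.toLinearMap ∘ₗ b
  have hf : ∀ x, f (f x) = f x := by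
    intro x
    change a (e.symm (b (a (e.symm (b x))))) = a (e.symm (b x))
    rw [← he, e.symm_apply_apply]
  have hb : ∀ x, b (f x) = b x := by
    intro x
    change b (a (e.symm (b x))) = b x
    rw [← he, e.apply_symm_apply]
  rcases hN.2 f with h1 | h1
  · have h2 : Function.Bijective a := by
      refine ⟨fun x y hxy => h.1 (congrArg b hxy), fun y => ?_⟩
      obtain ⟨x, rfl⟩ := h1.2 y
      exact ⟨_, rfl⟩
    refine ⟨h2, ?_⟩
    have : (b : N → M) = (b ∘ₗ a) ∘ (LinearEquiv.ofBijective a h2).symm := by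
      ext x
      obtain ⟨y, rfl⟩ := h2.2 x
      have : (LinearEquiv.ofBijective a h2).symm (a y) = y :=
        (LinearEquiv.ofBijective a h2).symm_apply_apply y
      simp [this]
    rw [this]
    exact h.comp (LinearEquiv.bijective _)
  · exfalso
    obtain ⟨x, hx⟩ := exists_ne (0 : M)
    obtain ⟨y, rfl⟩ := h.2 x
    have h2 : ∀ z, f z = 0 := by
      intro z
      refine h1.1 ?_
      rw [map_zero, LinearMap.sub_apply, LinearMap.id_apply, hf, sub_self]
    apply hx
    rw [LinearMap.comp_apply, ← hb, h2, map_zero]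

end LocalEndomorphisms

section Internal

variable {B : Type*} [Ring B] {M N : Type*} [AddCommGroup M] [Module B M] [AddCommGroup N]
  [Module B N] {ι : Type*} [Fintype ι] [DecidableEq ι]

theorem exists_proj_of_isInternal {D : ι → Submodule B M} (h : DirectSum.IsInternal D) :
    ∃ π : ∀ i, M →ₗ[B] D i, (∀ i (y : D i), π i y = y) ∧
      (∀ i j, i ≠ j → ∀ y : D j, π i y = 0) ∧ ∑ i, (D i).subtype ∘ₗ π i = LinearMap.id := by
  let e : (⨁ i, D i) ≃ₗ[B] M := LinearEquiv.ofBijective (DirectSum.coeLinearMap D) h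
  have he : ∀ i (y : D i), e.symm y = DirectSum.lof B ι (fun i => D i) i y := by
    intro i y
    rw [LinearEquiv.symm_apply_eq]
    exact (DirectSum.coeLinearMap_lof D i y).symm
  refine ⟨fun i => DirectSum.component B ι (fun i => D i) i ∘ₗ e.symm.toLinearMap, ?_, ?_, ?_⟩
  · intro i y
    rw [LinearMap.comp_apply, LinearEquiv.coe_coe, he, DirectSum.component.lof_self]
  · intro i j hij y
    rw [LinearMap.comp_apply, LinearEquiv.coe_coe, he, DirectSum.component.of,
      dif_neg (Ne.symm hij)]
  · ext x
    obtain ⟨z, rfl⟩ := e.surjective x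
    rw [LinearMap.sum_apply, LinearMap.id_apply]
    simp only [LinearMap.comp_apply, LinearEquiv.coe_coe, LinearEquiv.symm_apply_apply,
      Submodule.subtype_apply]
    induction z using DirectSum.induction_on with
    | zero => simp
    | add x y hx hy => simp only [map_add, Submodule.coe_add, Finset.sum_add_distrib, hx, hy]
    | of i y =>
      change ∑ j, ((DirectSum.component B ι (fun i => D i) j
        (DirectSum.lof B ι (fun i => D i) i y) : D j) : M) =
        DirectSum.coeLinearMap D (DirectSum.lof B ι (fun i => D i) i y)
      rw [DirectSum.coeLinearMap_lof, Finset.sum_eq_single i]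
      · rw [DirectSum.component.lof_self]
      · intro j _ hj
        rw [DirectSum.component.of, dif_neg (Ne.symm hj)]
        rfl
      · intro h
        exact absurd (Finset.mem_univ _) h

theorem isInternal_map (e : M ≃ₗ[B] N) {D : ι → Submodule B M} (h : DirectSum.IsInternal D) :
    DirectSum.IsInternal fun i => (D i).map e.toLinearMap := by
  rw [DirectSum.isInternal_submodule_iff_iSupIndep_and_iSup_eq_top] at h ⊢
  refine ⟨h.1.map_orderIso (Submodule.orderIsoMapComap e), ?_⟩
  have := (Submodule.orderIsoMapComap e).map_iSup D
  rw [h.2, OrderIso.map_top] at this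
  exact this.symm

/-- The exchange property of modules with local endomorphism ring. -/
theorem exists_exchange {κ : Type*} [Fintype κ] [DecidableEq κ] {D : ι → Submodule B M}
    {D' : κ → Submodule B M} (h : DirectSum.IsInternal D) (h' : DirectSum.IsInternal D')
    (hl : ∀ i, IsLocalModule B (D i)) (hl' : ∀ j, IsLocalModule B (D' j)) (i : ι) :
    ∃ j, (∀ i', i' ≠ i → D' j ≠ D i') ∧ Nonempty (D i ≃ₗ[B] D' j) ∧
      DirectSum.IsInternal (Function.update D i (D' j)) := by
  obtain ⟨π, hπ1, hπ2, -⟩ := exists_proj_of_isInternal h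
  obtain ⟨ρ, -, -, hρ⟩ := exists_proj_of_isInternal h'
  have h1 : ∑ j, (π i ∘ₗ (D' j).subtype ∘ₗ ρ j) ∘ₗ (D i).subtype = LinearMap.id := by
    ext x
    rw [LinearMap.sum_apply, LinearMap.id_apply]
    simp only [LinearMap.comp_apply]
    rw [← map_sum]
    have := LinearMap.congr_fun hρ x
    rw [LinearMap.sum_apply] at this
    simp only [LinearMap.comp_apply, LinearMap.id_apply] at this
    change ((π i (∑ j, (D' j).subtype (ρ j x)) : D i) : M) = x
    rw [this, hπ1]
  obtain ⟨j, -, hj⟩ := (hl i).exists_bijective_of_sum Finset.univ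
    (fun j => (π i ∘ₗ (D' j).subtype ∘ₗ ρ j) ∘ₗ (D i).subtype) (by rw [h1]; exact Function.bijective_id)
  obtain ⟨h2, h3⟩ := IsLocalModule.bijective_of_comp_bijective (hl i).1 (hl' j)
    (a := ρ j ∘ₗ (D i).subtype) (b := π i ∘ₗ (D' j).subtype) hj
  let β := (LinearEquiv.ofBijective _ h3).symm
  have hβ : ∀ x, π i (β x : M) = x := fun x => (LinearEquiv.ofBijective _ h3).apply_symm_apply x
  have hα : ∃ α : M ≃ₗ[B] M, ∀ x, α x = x - π i x + β (π i x) := by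
    refine ⟨LinearEquiv.ofLinearMap (LinearMap.id - (D i).subtype ∘ₗ π i +
      (D' j).subtype ∘ₗ β.toLinearMap ∘ₗ π i) (LinearMap.id + (D i).subtype ∘ₗ π i -
      (D' j).subtype ∘ₗ β.toLinearMap ∘ₗ π i) ?_ ?_, fun x => rfl⟩
    · ext x
      simp [hβ, hπ1]
      abel
    · ext x
      simp [hβ, hπ1]
      abel
  obtain ⟨α, hα⟩ := hα
  refine ⟨j, fun i' hi' he => ?_, ⟨LinearEquiv.ofBijective _ h2⟩, ?_⟩
  · refine (hl i).not_bijective_zero ?_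
    convert hj using 2
    ext x
    have h4 : ((ρ j x : D' j) : M) ∈ D i' := he ▸ (ρ j x).2
    have h5 := hπ2 i i' hi'.symm ⟨_, h4⟩
    simp only [LinearMap.zero_apply, LinearMap.comp_apply, Submodule.subtype_apply]
    rw [h5]
  · convert isInternal_map α h using 1
    ext k x
    by_cases hk : k = i
    · subst hk
      rw [Function.update_self]
      constructor
      · intro hx
        obtain ⟨y, hy⟩ := β.surjective ⟨x, hx⟩
        refine ⟨y, y.2, ?_⟩
        change α y = x
        rw [hα, hπ1, sub_self, zero_add, hy]
      · rintro ⟨y, hy, rfl⟩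
        change α y ∈ D' j
        have := hπ1 k ⟨y, hy⟩
        rw [hα, this, sub_self, zero_add]
        exact (β _).2
    · rw [Function.update_of_ne hk]
      have h4 : ∀ y ∈ D k, α y = y := fun y hy => by
        have := hπ2 i k (Ne.symm hk) ⟨y, hy⟩
        rw [hα, this]
        simp
      constructor
      · intro hx
        exact ⟨x, hx, h4 x hx⟩
      · rintro ⟨y, hy, rfl⟩
        change α y ∈ D k
        rwa [h4 y hy]

/-- The theorem of Krull, Schmidt and Azumaya. -/
theorem exists_equiv_of_isInternal {κ : Type*} [Fintype κ] [DecidableEq κ] {D : ι → Submodule B M}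
    {D' : κ → Submodule B M} (h : DirectSum.IsInternal D) (h' : DirectSum.IsInternal D')
    (hl : ∀ i, IsLocalModule B (D i)) (hl' : ∀ j, IsLocalModule B (D' j)) :
    ∃ σ : ι ≃ κ, ∀ i, Nonempty (D i ≃ₗ[B] D' (σ i)) := by
  classical
  have key : ∀ s : Finset ι, ∃ τ : ι → κ, (∀ i ∈ s, Nonempty (D i ≃ₗ[B] D' (τ i))) ∧
      DirectSum.IsInternal fun i => if i ∈ s then D' (τ i) else D i := by
    intro s
    induction s using Finset.induction_on with
    | empty =>
      by_cases hι : Nonempty ι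
      · obtain ⟨i⟩ := hι
        obtain ⟨j, -⟩ := exists_exchange h h' hl hl' i
        exact ⟨fun _ => j, by simp, by simpa using h⟩
      · have : IsEmpty ι := not_nonempty_iff.1 hι
        exact ⟨fun i => this.elim i, by simp, by simpa using h⟩
    | insert i s hi ih =>
      obtain ⟨τ, h1, h2⟩ := ih
      obtain ⟨j, -, hj2, hj3⟩ := exists_exchange h2 h' (fun k => by
        by_cases hk : k ∈ s
        · rw [if_pos hk]
          exact hl' _
        · rw [if_neg hk]
          exact hl k) hl' i
      rw [if_neg hi] at hj2
      refine ⟨Function.update τ i j, fun k hk => ?_, ?_⟩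
      · rcases eq_or_ne k i with rfl | hki
        · rwa [Function.update_self]
        · rw [Function.update_of_ne hki]
          exact h1 k ((Finset.mem_insert.1 hk).resolve_left hki)
      · convert hj3 using 1
        ext1 k
        rcases eq_or_ne k i with rfl | hki
        · simp
        · simp [hki]
  obtain ⟨τ, h1, h2⟩ := key Finset.univ
  simp only [Finset.mem_univ, if_true] at h2
  rw [DirectSum.isInternal_submodule_iff_iSupIndep_and_iSup_eq_top] at h2 h'
  have hne : ∀ j, D' j ≠ ⊥ := fun j => by
    have := (hl' j).1
    exact Submodule.nontrivial_iff_ne_bot.1 this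
  have hτ : Function.Bijective τ := by
    refine ⟨fun i k hik => ?_, fun j => ?_⟩
    · exact h2.1.injective (fun i => hne _) (congrArg D' hik)
    · by_contra hj
      push Not at hj
      have h3 := h'.1 j
      have h4 : (⊤ : Submodule B M) ≤ ⨆ k, ⨆ (_ : k ≠ j), D' k := by
        rw [← h2.2]
        exact iSup_le fun i => le_iSup₂_of_le (τ i) (hj i) le_rfl
      exact hne j (h3.eq_bot_of_le (le_top.trans h4))
  exact ⟨Equiv.ofBijective τ hτ, fun i => h1 i (Finset.mem_univ i)⟩

end Internal

section Existence

variable {B : Type*} [Ring B] {M : Type*} [AddCommGroup M] [Module B M]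

theorem exists_decomposition [IsNoetherian B M] :
    ∃ (n : ℕ) (D : Fin n → Submodule B M), IsDecomposition D := by
  classical
  have key : ∀ A N : Submodule B M, IsCompl A N → ∃ s : Finset (Submodule B M),
      s.SupIndep id ∧ s.sup id = N ∧ ∀ D ∈ s, IsIndecomposable B D := by
    intro A
    induction A using WellFoundedGT.induction with
    | ind A ih =>
    intro N hAN
    by_cases h0 : N = ⊥
    · exact ⟨∅, Finset.supIndep_empty _, by simp [h0], by simp⟩
    by_cases hN : IsIndecomposable B N
    · exact ⟨{N}, Finset.supIndep_singleton _ _, by simp, by simpa using hN⟩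
    have hnt : Nontrivial N := Submodule.nontrivial_iff_ne_bot.2 h0
    simp only [IsIndecomposable, hnt, true_and] at hN
    push Not at hN
    obtain ⟨p, q, hpq, hp, hq⟩ := hN
    have hinj : Function.Injective (Submodule.map N.subtype) :=
      Submodule.map_injective_of_injective N.injective_subtype
    set N₁ := p.map N.subtype with hN₁
    set N₂ := q.map N.subtype with hN₂
    have h1 : N₁ ≠ ⊥ := fun h => hp (hinj (by rw [← hN₁, h, Submodule.map_bot]))
    have h2 : N₂ ≠ ⊥ := fun h => hq (hinj (by rw [← hN₂, h, Submodule.map_bot]))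
    have hsup : N₁ ⊔ N₂ = N := by
      rw [hN₁, hN₂, ← Submodule.map_sup, hpq.sup_eq_top, Submodule.map_subtype_top]
    have hinf : N₁ ⊓ N₂ = ⊥ := by
      rw [hN₁, hN₂, ← Submodule.map_inf _ N.injective_subtype, hpq.inf_eq_bot, Submodule.map_bot]
    have aux : ∀ N₁ N₂ : Submodule B M, N₁ ≠ ⊥ → N₁ ⊔ N₂ = N → N₁ ⊓ N₂ = ⊥ →
        ∃ s : Finset (Submodule B M),
        s.SupIndep id ∧ s.sup id = N₂ ∧ ∀ D ∈ s, IsIndecomposable B D := by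
      intro N₁ N₂ h1 hsup hinf
      have hd1 : Disjoint A N := hAN.disjoint
      refine ih (A ⊔ N₁) (lt_of_le_of_ne le_sup_left fun h => h1 ?_) N₂ ⟨?_, ?_⟩
      · have h3 : N₁ ≤ A := by
          rw [h]
          exact le_sup_right
        have h4 : N₁ ≤ N := by
          rw [← hsup]
          exact le_sup_left
        exact le_bot_iff.1 (hd1 h3 h4)
      · refine Disjoint.disjoint_sup_left_of_disjoint_sup_right (disjoint_iff.2 hinf) ?_
        rwa [hsup]
      · rw [codisjoint_iff, sup_assoc, hsup, hAN.sup_eq_top]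
    obtain ⟨s, hs1, hs2, hs3⟩ := aux N₁ N₂ h1 hsup hinf
    obtain ⟨t, ht1, ht2, ht3⟩ := aux N₂ N₁ h2 (by rwa [sup_comm]) (by rwa [inf_comm])
    refine ⟨s ∪ t, hs1.union ht1 ?_, ?_, ?_⟩
    · rw [hs2, ht2, disjoint_iff, inf_comm, hinf]
    · rw [Finset.sup_union, hs2, ht2, sup_comm, hsup]
    · intro D hD
      rcases Finset.mem_union.1 hD with h | h
      · exact hs3 D h
      · exact ht3 D h
  obtain ⟨s, hs1, hs2, hs3⟩ := key ⊥ ⊤ isCompl_bot_top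
  refine ⟨s.card, fun i => s.equivFin.symm i, ?_, fun i => hs3 _ (s.equivFin.symm i).2⟩
  rw [DirectSum.isInternal_submodule_iff_iSupIndep_and_iSup_eq_top]
  refine ⟨?_, ?_⟩
  · have := iSupIndep_comp_coe_iff_supIndep.2 hs1
    exact this.comp s.equivFin.symm.injective
  · rw [← hs2, Finset.sup_eq_iSup]
    apply le_antisymm
    · exact iSup_le fun i => le_iSup₂_of_le (s.equivFin.symm i : Submodule B M)
        (s.equivFin.symm i).2 le_rfl
    · refine iSup₂_le fun D hD => ?_
      refine le_iSup_of_le (s.equivFin ⟨D, hD⟩) ?_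
      simp

end Existence

end CentricMackey

namespace CentricMackey

section CompleteLocal

open scoped IsMulCommutative

theorem isPrecomplete_of_finite {R : Type*} [CommRing R] (I : Ideal R) [IsPrecomplete I R]
    (M : Type*) [AddCommGroup M] [Module R M] [Module.Finite R M] : IsPrecomplete I M := by
  rw [← AdicCompletion.of_surjective_iff]
  intro y
  obtain ⟨z, rfl⟩ := AdicCompletion.ofTensorProduct_surjective_of_finite I M y
  induction z using TensorProduct.induction_on with
  | zero => exact ⟨0, by simp⟩
  | add a b ha hb =>
    obtain ⟨c, hc⟩ := ha
    obtain ⟨d, hd⟩ := hb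
    exact ⟨c + d, by rw [map_add, hc, hd, map_add]⟩
  | tmul r m =>
    obtain ⟨s, rfl⟩ := AdicCompletion.of_surjective I R r
    refine ⟨s • m, ?_⟩
    rw [AdicCompletion.ofTensorProduct_tmul]
    rw [map_smul]
    ext n
    simp only [AdicCompletion.val_smul_apply, AdicCompletion.of_apply]
    rfl

theorem exists_idempotent_of_finite (R : Type*) [CommRing R] [IsNoetherianRing R] [IsLocalRing R]
    [IsAdicComplete (IsLocalRing.maximalIdeal R) R] {C : Type*} [CommRing C] [Algebra R C]
    [Module.Finite R C] (x : C) :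
    ∃ e : C, IsIdempotentElem e ∧ (e = 1 → IsUnit x) ∧ (e = 0 → IsUnit (1 - x)) := by
  set m := IsLocalRing.maximalIdeal R
  have h1 : IsAdicComplete m C :=
    { toIsHausdorff := inferInstance
      toIsPrecomplete := isPrecomplete_of_finite m C }
  set J := m.map (algebraMap R C) with hJ
  have h2 : IsAdicComplete J C := (IsAdicComplete.map_algebraMap_iff _ _).2 h1
  have hens : HenselianRing C J := inferInstance
  let _ : Field (R ⧸ m) := Ideal.Quotient.field m
  have : Module.Finite (R ⧸ m) (C ⧸ J) := Module.Finite.of_restrictScalars_finite R _ _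
  have : IsArtinianRing (C ⧸ J) := IsArtinianRing.of_finite (R ⧸ m) (C ⧸ J)
  have hunit : ∀ z : C, IsUnit (Ideal.Quotient.mk J z) → IsUnit z := by
    intro z hz
    obtain ⟨w, hw⟩ := hz.exists_right_inv
    obtain ⟨w, rfl⟩ := Ideal.Quotient.mk_surjective w
    rw [← map_mul, ← map_one (Ideal.Quotient.mk J), Ideal.Quotient.eq] at hw
    have h3 := Ideal.mem_jacobson_bot.1 (hens.jac hw) 1
    rw [mul_one, sub_add_cancel] at h3
    exact isUnit_of_mul_isUnit_left h3
  obtain ⟨n, y, hy⟩ := IsArtinian.exists_pow_succ_smul_dvd (Ideal.Quotient.mk J x) (1 : C ⧸ J)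
  obtain ⟨y, rfl⟩ := Ideal.Quotient.mk_surjective y
  set q := Ideal.Quotient.mk J
  simp only [smul_eq_mul, mul_one, Nat.succ_eq_add_one] at hy
  have hk : ∀ k, q x ^ (n + k) * q y ^ k = q x ^ n := by
    intro k
    induction k with
    | zero => simp
    | succ k ih =>
      calc q x ^ (n + (k + 1)) * q y ^ (k + 1)
          = (q x ^ (n + 1) * q y) * q x ^ k * q y ^ k := by ring
        _ = q x ^ (n + k) * q y ^ k := by rw [hy]; ring
        _ = q x ^ n := ih
  set e₀ := x ^ (n + 1) * y ^ (n + 1) with he₀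
  have he : q e₀ * q e₀ = q e₀ := by
    simp only [he₀, map_mul, map_pow]
    calc q x ^ (n + 1) * q y ^ (n + 1) * (q x ^ (n + 1) * q y ^ (n + 1))
        = (q x ^ (n + (n + 1)) * q y ^ (n + 1)) * (q x * q y ^ (n + 1)) := by ring
      _ = q x ^ (n + 1) * q y ^ (n + 1) := by rw [hk]; ring
  obtain ⟨e, he1, he2⟩ := hens.is_henselian (Polynomial.X ^ 2 - Polynomial.X) (by monicity!) e₀
    (by
      rw [← Ideal.Quotient.eq_zero_iff_mem]
      simp only [Polynomial.eval_sub, Polynomial.eval_pow, Polynomial.eval_X]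
      change q _ = 0
      rw [map_sub, map_pow, pow_two, he, sub_self])
    (by
      refine IsUnit.of_mul_eq_one (q (2 * e₀ - 1)) ?_
      have : (Polynomial.X ^ 2 - Polynomial.X : Polynomial C).derivative.eval e₀ = 2 * e₀ - 1 := by
        simp
        ring
      rw [this]
      change q _ * q _ = 1
      rw [map_sub, map_mul, map_one, map_ofNat]
      linear_combination 4 * he)
  have hqe : q e = q e₀ := Ideal.Quotient.eq.2 he2
  refine ⟨e, ?_, ?_, ?_⟩
  · simp [Polynomial.IsRoot] at he1
    rw [IsIdempotentElem]
    linear_combination he1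
  · rintro rfl
    refine hunit _ (IsUnit.of_mul_eq_one (q (x ^ n * y ^ (n + 1))) ?_)
    rw [map_one] at hqe
    rw [hqe, he₀]
    simp only [map_mul, map_pow]
    ring
  · rintro rfl
    refine hunit _ ?_
    rw [map_sub, map_one]
    refine IsNilpotent.isUnit_one_sub ⟨n, ?_⟩
    rw [map_zero] at hqe
    rw [← hk (n + 1)]
    calc q x ^ (n + (n + 1)) * q y ^ (n + 1) = q x ^ n * q e₀ := by
          simp only [he₀, map_mul, map_pow]
          ring
      _ = 0 := by rw [← hqe, mul_zero]

variable (R : Type*) [CommRing R] {B : Type*} [Ring B] [Algebra R B] {M : Type*} [AddCommGroup M]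
  [Module B M] [Module R M] [IsScalarTower R B M] [Module.Finite R M]

theorem isIntegral_end (f : Module.End B M) : IsIntegral R f := by
  obtain ⟨q, hq, h⟩ := LinearMap.exists_monic_and_aeval_eq_zero R (f.restrictScalars R)
  refine ⟨q, hq, LinearMap.ext fun z => ?_⟩
  have key : ∀ q : Polynomial R, (Polynomial.aeval f q) z =
      (Polynomial.aeval (f.restrictScalars R : Module.End R M) q) z := by
    intro q
    induction q using Polynomial.induction_on' with
    | add q r hq hr => rw [map_add, map_add, LinearMap.add_apply, LinearMap.add_apply, hq, hr]
    | monomial n r =>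
      rw [Polynomial.aeval_monomial, Polynomial.aeval_monomial]
      change r • (f ^ n) z = r • ((f.restrictScalars R : Module.End R M) ^ n) z
      rw [Module.End.pow_apply, Module.End.pow_apply]
      rfl
  have := key q
  rw [h] at this
  exact this

theorem isLocalModule_of_isIndecomposable [IsNoetherianRing R] [IsLocalRing R]
    [IsAdicComplete (IsLocalRing.maximalIdeal R) R] (h : IsIndecomposable B M) :
    IsLocalModule B M := by
  refine ⟨h.1, fun f => ?_⟩
  let f' : Module.End B M := f
  let C := Algebra.adjoin R {f'}
  have : Module.Finite R C := Module.Finite.iff_fg.2 (isIntegral_end R f').fg_adjoin_singleton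
  let x : C := ⟨f', Algebra.self_mem_adjoin_singleton R f'⟩
  obtain ⟨e, he, h1, h2⟩ := exists_idempotent_of_finite R x
  have he' : IsIdempotentElem (e : Module.End B M) := congrArg Subtype.val he
  have key : ∀ z : C, IsUnit z → Function.Bijective ((z : Module.End B M) : M → M) := by
    intro z hz
    have := hz.map C.val
    exact (Module.End.isUnit_iff _).1 this
  rcases h.2 _ _ (LinearMap.IsIdempotentElem.isCompl he') with h3 | h3
  · right
    exact key (1 - x) (h2 (Subtype.ext (LinearMap.range_eq_bot.1 h3)))
  · left
    refine key x (h1 (Subtype.ext ?_))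
    have h4 : Function.Injective ((e : Module.End B M) : M → M) := LinearMap.ker_eq_bot.1 h3
    refine LinearMap.ext fun z => h4 ?_
    exact LinearMap.congr_fun he' z

end CompleteLocal

end CentricMackey

namespace CentricMackey

section KrullSchmidt

variable {S : Type u} [Group S] [Finite S] {Q : Subgroup S} (R : Type v) [CommRing R] [IsDomain R]
  [IsPrincipalIdealRing R] [IsLocalRing R] [IsAdicComplete (IsLocalRing.maximalIdeal R) R]
  (E : FusionSystem Q) (M : Type*) [AddCommGroup M] [Module (MackeyAlgebra R E) M]
  [Module.Finite (MackeyAlgebra R E) M]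

theorem isLocalModule_mackey (h : IsIndecomposable (MackeyAlgebra R E) M) :
    IsLocalModule (MackeyAlgebra R E) M := by
  let _ : Module R M := Module.compHom M (algebraMap R (MackeyAlgebra R E))
  have : IsScalarTower R (MackeyAlgebra R E) M := ⟨fun r a m => by
    rw [Algebra.smul_def, mul_smul]
    rfl⟩
  have : Module.Finite R M := Module.Finite.trans (MackeyAlgebra R E) M
  exact isLocalModule_of_isIndecomposable R h

theorem isNoetherian_mackey : IsNoetherian (MackeyAlgebra R E) M := by
  have : IsNoetherianRing (MackeyAlgebra R E) :=
    isNoetherian_of_tower R (isNoetherian_of_isNoetherianRing_of_finite R (MackeyAlgebra R E))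
  infer_instance

theorem finite_submodule_mackey (D : Submodule (MackeyAlgebra R E) M) :
    Module.Finite (MackeyAlgebra R E) D := by
  have := isNoetherian_mackey R E M
  infer_instance

theorem hasKrullSchmidtDecomposition_mackey :
    HasKrullSchmidtDecomposition (MackeyAlgebra R E) M := by
  have := isNoetherian_mackey R E M
  refine ⟨exists_decomposition, fun n m D D' hD hD' => ?_⟩
  exact exists_equiv_of_isInternal hD.1 hD'.1
    (fun i => isLocalModule_mackey R E _ (hD.2 i)) (fun i => isLocalModule_mackey R E _ (hD'.2 i))

end KrullSchmidt

section Vertices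

open FusionSystem

variable {S : Type u} [Group S] [Finite S] {p : ℕ} [Fact p.Prime]
  {F : FusionSystem (⊤ : Subgroup S)} {Q : Subgroup S} (R : Type v) [CommRing R]
  (E : FusionSystem Q)

/-- `M` is projective relative to the subgroup `K`. -/
def IsSubgroupProjective (M : Type*) [AddCommGroup M] [Module (MackeyAlgebra R E) M]
    (K : Subgroup S) : Prop :=
  ∃ hK : K ≤ Q, LinearMap.id ∈ Tr (innerInclusion R E hK) M M

variable {R E} {M M' : Type*} [AddCommGroup M] [Module (MackeyAlgebra R E) M] [AddCommGroup M']
  [Module (MackeyAlgebra R E) M'] {K L V : Subgroup S}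

theorem id_mem_TrF_of_retract {Z : Set (Subgroup S)} (h : LinearMap.id ∈ TrF R E Z M M)
    {a : M' →ₗ[MackeyAlgebra R E] M} {b : M →ₗ[MackeyAlgebra R E] M'}
    (hab : b ∘ₗ a = LinearMap.id) : LinearMap.id ∈ TrF R E Z M' M' := by
  rw [← hab, ← LinearMap.id_comp a]
  exact TrF.comp_left (TrF.comp_right h a) b

theorem IsSubgroupProjective.of_retract (h : IsSubgroupProjective R E M K)
    {a : M' →ₗ[MackeyAlgebra R E] M} {b : M →ₗ[MackeyAlgebra R E] M'}
    (hab : b ∘ₗ a = LinearMap.id) : IsSubgroupProjective R E M' K := by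
  refine ⟨h.1, ?_⟩
  rw [← hab, ← LinearMap.id_comp a]
  exact Tr.comp_left (Tr.comp_right h.2 a) b

theorem IsSubgroupProjective.mem_TrF {Z : Set (Subgroup S)} (h : IsSubgroupProjective R E M K)
    (hK : K ∈ Z) : LinearMap.id ∈ TrF R E Z M M :=
  tr_le_TrF hK h.1 h.2

theorem IsSubgroupProjective.of_subconj (h : IsSubgroupProjective R E M K) (hKL : E.Subconj K L) :
    IsSubgroupProjective R E M L :=
  ⟨hKL.1, Tr_le_of_subconj hKL h.1 hKL.1 _ _ h.2⟩

theorem IsCentric.of_injective {P : Subgroup S} {F : FusionSystem P} (h : IsCentric R F E M)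
    {a : M' →ₗ[MackeyAlgebra R E] M} (ha : Function.Injective a) : IsCentric R F E M' :=
  fun K hK hc m => ha (by rw [map_smul, h K hK hc, map_zero])

theorem IsSubgroupProjective.centric {P : Subgroup S} {F : FusionSystem P} (hQP : Q ≤ P)
    [Nontrivial M] (hM : IsCentric R F E M) (h : IsSubgroupProjective R E M K) : F.Centric K := by
  by_contra hc
  obtain ⟨hK, g, hg⟩ := h
  rw [theta_eq_zero hQP hM hK hc, LinearMap.zero_comp] at hg
  obtain ⟨x, hx⟩ := exists_ne (0 : M)
  exact hx (LinearMap.congr_fun hg x)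

theorem exists_bijective_of_mem_TrF (hM : IsLocalModule (MackeyAlgebra R E) M)
    {Z : Set (Subgroup S)} {f : M →ₗ[MackeyAlgebra R E] M} (hf : f ∈ TrF R E Z M M)
    (hb : Function.Bijective f) : ∃ K ∈ Z, IsSubgroupProjective R E M K := by
  revert hb
  refine TrF_induction (C := fun f => Function.Bijective f →
    ∃ K ∈ Z, IsSubgroupProjective R E M K) (fun hb => absurd hb hM.not_bijective_zero)
    (fun f g hf hg hb => (hM.bijective_of_add hb).elim hf hg) (fun K hK hKQ f hf hb => ?_) hf
  refine ⟨K, hK, hKQ, ?_⟩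
  have := Tr.comp_right hf (LinearEquiv.ofBijective f hb).symm.toLinearMap
  convert this using 1
  ext x
  exact ((LinearEquiv.ofBijective f hb).apply_symm_apply x).symm

theorem exists_isSubgroupProjective (hM : IsLocalModule (MackeyAlgebra R E) M)
    {Z : Set (Subgroup S)} (h : LinearMap.id ∈ TrF R E Z M M) :
    ∃ K ∈ Z, IsSubgroupProjective R E M K :=
  exists_bijective_of_mem_TrF hM h Function.bijective_id

theorem Centric.of_isSubsystem {F : FusionSystem (⊤ : Subgroup S)} (hEF : E.IsSubsystem F)
    (hV : F.Centric V) (hVQ : V ≤ Q) : E.Centric V :=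
  ⟨hVQ, fun K hK => (inf_le_inf_right _ le_top).trans (hV.2 K (hK.of_isSubsystem hEF))⟩

/-- A functor that is projective relative to `K` and `V` is projective relative to intersections of
`K` with conjugates of `V`. -/
theorem IsSubgroupProjective.inter (hS : IsPGroup p S) (hF : F.Saturated p)
    (hEF : IsCentricallySaturated p F E) (hM : IsCentric R F E M)
    (hK : IsSubgroupProjective R E M K) {Z : Set (Subgroup S)}
    (hV : LinearMap.id ∈ TrF R E Z M M) :
    LinearMap.id ∈ TrF R E {D | F.Centric D ∧ D ≤ K ∧ ∃ V ∈ Z, E.Subconj D V} M M := by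
  obtain ⟨hKQ, s, hs⟩ := hK
  have h1 := res_mem_TrF hS hF hEF (isCentricallySaturated_inner hS hF K) hKQ
    (inner_isSubsystem E hKQ) hM hV
  have h2 := ind_mem_TrF hKQ (inner_isSubsystem E hKQ) h1
  rw [Res.map_id, Ind.map_id] at h2
  rw [hs]
  refine TrF_mono ?_ (TrF.comp_left (TrF.comp_right h2 s) (theta (innerInclusion R E hKQ) M))
  rintro D ⟨⟨h3, h4⟩, h5⟩
  exact ⟨h3, h5, h4⟩

/-- Among the subgroups relative to which `M` is projective there is a smallest one up to
isomorphism in `E`. -/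
theorem exists_vertex (hS : IsPGroup p S) (hF : F.Saturated p)
    (hEF : IsCentricallySaturated p F E) (hM : IsCentric R F E M)
    (hl : IsLocalModule (MackeyAlgebra R E) M) (hK : IsSubgroupProjective R E M K) :
    ∃ V, E.FullyNormalized V ∧ IsSubgroupProjective R E M V ∧
      ∀ K, IsSubgroupProjective R E M K → E.Subconj V K := by
  obtain ⟨W, hW, hmin⟩ := Set.exists_min_image {W | IsSubgroupProjective R E M W}
    (fun W => Nat.card W) (Set.toFinite _) ⟨K, hK⟩
  obtain ⟨V, hVW, hV⟩ := exists_fullyNormalized (E := E) hW.1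
  have hVp : IsSubgroupProjective R E M V := hW.of_subconj hVW.subconj
  refine ⟨V, hV, hVp, fun K hK => ?_⟩
  obtain ⟨D, ⟨-, hDK, _, hV', hDV⟩, hD⟩ := exists_isSubgroupProjective hl
    (hK.inter hS hF hEF hM (hVp.mem_TrF (Set.mem_singleton V)))
  obtain rfl := Set.mem_singleton_iff.1 hV'
  have h1 : E.Conj D _ := hDV.conj_of_card_le (by
    rw [← hVW.card_eq]
    exact hmin D hD)
  exact h1.symm.subconj.trans (subconj_of_le hK.1 hDK)

theorem isProjectiveFamily_subconj (hEF : E.IsSubsystem F) [Nontrivial M]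
    (hM : IsCentric R F E M) (hV : IsSubgroupProjective R E M V) :
    IsProjectiveFamily R E M {L | E.Centric L ∧ E.Subconj L V} := by
  refine ⟨fun K hK => hK.1, fun K hK L hL hLK => ⟨hL, hLK.trans hK.2⟩, ?_⟩
  rw [isRelProjective_iff]
  exact hV.mem_TrF ⟨Centric.of_isSubsystem hEF (hV.centric le_top hM) hV.1,
    subconj_of_le hV.1 le_rfl⟩

/-- The vertices of an indecomposable functor are the smallest subgroups relative to which it is
projective. -/
theorem isVertex_iff (hS : IsPGroup p S) (hF : F.Saturated p)
    (hEF : IsCentricallySaturated p F E) (hM : IsCentric R F E M)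
    (hl : IsLocalModule (MackeyAlgebra R E) M) :
    IsVertex R E M V ↔ E.FullyNormalized V ∧ IsSubgroupProjective R E M V ∧
      ∀ K, IsSubgroupProjective R E M K → E.Subconj V K := by
  have := hl.1
  constructor
  · rintro ⟨X, hX, hVX, -, hV⟩
    obtain ⟨K, hKX, hK⟩ := exists_isSubgroupProjective hl (isRelProjective_iff.1 hX.1.2.2)
    obtain ⟨W, hW, hWp, hWm⟩ := exists_vertex hS hF hEF hM hl hK
    have hWc : E.Centric W :=
      Centric.of_isSubsystem hEF.le (hWp.centric le_top hM) hWp.1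
    have hWX : W ∈ X := hX.1.2.1 K hKX W hWc (hWm K hK)
    have hle : {L | E.Centric L ∧ E.Subconj L W} ⊆ X := fun L hL =>
      hX.1.2.1 W hWX L hL.1 hL.2
    have h1 : E.Subconj V W :=
      (hX.2 (isProjectiveFamily_subconj hEF.le hM hWp) hle hVX.1).2
    have h2 : E.Subconj W V := hVX.2 W hWX h1
    exact ⟨hV, hWp.of_subconj h2, fun K hK => h1.trans (hWm K hK)⟩
  · rintro ⟨hV, hVp, hVm⟩
    have hVc : E.Centric V := Centric.of_isSubsystem hEF.le (hVp.centric le_top hM) hVp.1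
    refine ⟨{L | E.Centric L ∧ E.Subconj L V},
      ⟨isProjectiveFamily_subconj hEF.le hM hVp, fun Y hY _ L hL => ?_⟩,
      ⟨⟨hVc, subconj_of_le hVp.1 le_rfl⟩, fun L hL _ => hL.2⟩, fun K hK => ?_, hV⟩
    · obtain ⟨K, hKY, hK⟩ := exists_isSubgroupProjective hl (isRelProjective_iff.1 hY.2.2)
      exact hY.2.1 K hKY L hL.1 (hL.2.trans (hVm K hK))
    · have h1 : E.Subconj V K := hK.2 V ⟨hVc, subconj_of_le hVp.1 le_rfl⟩ hK.1.2
      exact hK.1.2.conj_of_card_le h1.card_le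

end Vertices

end CentricMackey

namespace CentricMackey

section GreenFamilies

open FusionSystem

variable {S : Type u} [Group S] [Finite S] {p : ℕ} [Fact p.Prime]
  {F : FusionSystem (⊤ : Subgroup S)} {Q : Subgroup S} {R : Type v} [CommRing R]
  {E : FusionSystem Q} {H : Subgroup S} {Z : Set (Subgroup S)}

/-- `Z` contains the `F`-centric subgroups strictly below `H` or below another member of `Z`, but
none above `H`. -/
structure IsGreenFamily (F : FusionSystem (⊤ : Subgroup S)) {Q : Subgroup S} (E : FusionSystem Q)
    (H : Subgroup S) (Z : Set (Subgroup S)) : Prop where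
  fullyNormalized : E.FullyNormalized H
  not_subconj : ∀ K ∈ Z, ¬ E.Subconj H K
  mem_of_subconj : ∀ K ∈ Z, ∀ V, F.Centric V → E.Subconj V K → V ∈ Z
  mem_of_lt : ∀ V, F.Centric V → E.Subconj V H → ¬ E.Subconj H V → V ∈ Z

section

variable {M : Type*} [AddCommGroup M] [Module (MackeyAlgebra R E) M]

theorem IsGreenFamily.vertex_mem (hZ : IsGreenFamily F E H Z) (hS : IsPGroup p S)
    (hF : F.Saturated p) (hEF : IsCentricallySaturated p F E) (hM : IsCentric R F E M)
    (hl : IsLocalModule (MackeyAlgebra R E) M) (h : LinearMap.id ∈ TrF R E Z M M) :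
    (∃ V, IsVertex R E M V) ∧ ∀ V, IsVertex R E M V → V ∈ Z := by
  have := hl.1
  obtain ⟨K, hK, hKp⟩ := exists_isSubgroupProjective hl h
  obtain ⟨V, hV⟩ := exists_vertex hS hF hEF hM hl hKp
  refine ⟨⟨V, (isVertex_iff hS hF hEF hM hl).2 hV⟩, fun W hW => ?_⟩
  obtain ⟨-, hWp, hWm⟩ := (isVertex_iff hS hF hEF hM hl).1 hW
  exact hZ.mem_of_subconj K hK W (hWp.centric le_top hM) (hWm K hKp)

theorem IsGreenFamily.isVertex_iff (hZ : IsGreenFamily F E H Z) (hS : IsPGroup p S)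
    (hF : F.Saturated p) (hEF : IsCentricallySaturated p F E) (hM : IsCentric R F E M)
    (hl : IsLocalModule (MackeyAlgebra R E) M) :
    IsVertex R E M H ↔
      IsSubgroupProjective R E M H ∧ LinearMap.id ∉ TrF R E Z M M := by
  have := hl.1
  constructor
  · intro hH
    refine ⟨((CentricMackey.isVertex_iff hS hF hEF hM hl).1 hH).2.1, fun h => ?_⟩
    have h1 := (hZ.vertex_mem hS hF hEF hM hl h).2 H hH
    exact hZ.not_subconj H h1 (subconj_of_le hZ.fullyNormalized.1 le_rfl)
  · rintro ⟨hH, h⟩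
    obtain ⟨V, -, hVp, hVm⟩ := exists_vertex hS hF hEF hM hl hH
    refine (CentricMackey.isVertex_iff hS hF hEF hM hl).2
      ⟨hZ.fullyNormalized, hH, fun K hK => ?_⟩
    have h1 : E.Subconj H V := by
      by_contra h1
      exact h (hVp.mem_TrF (hZ.mem_of_lt V (hVp.centric le_top hM) (hVm H hH) h1))
    exact h1.trans (hVm K hK)

theorem IsGreenFamily.isSubgroupProjective_of_not_mem (hZ : IsGreenFamily F E H Z)
    (hl : IsLocalModule (MackeyAlgebra R E) M)
    (h : LinearMap.id ∈ TrF R E (insert H Z) M M) (h' : LinearMap.id ∉ TrF R E Z M M) :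
    IsSubgroupProjective R E M H := by
  obtain ⟨K, rfl | hK, hKp⟩ := exists_isSubgroupProjective hl h
  · exact hKp
  · exact absurd (hKp.mem_TrF hK) h'

end

section

variable {L : Type*} [AddCommGroup L] [Module (MackeyAlgebra R E) L]

theorem exists_retraction_of_isInternal {B : Type*} [Ring B] {M : Type*} [AddCommGroup M]
    [Module B M] {n : ℕ} {D : Fin n → Submodule B M} (h : DirectSum.IsInternal D) :
    ∃ π : ∀ i, M →ₗ[B] D i, (∀ i, π i ∘ₗ (D i).subtype = LinearMap.id) ∧
      (∀ i j, i ≠ j → π i ∘ₗ (D j).subtype = 0) ∧ ∑ i, (D i).subtype ∘ₗ π i = LinearMap.id := by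
  obtain ⟨π, h1, h2, h3⟩ := exists_proj_of_isInternal h
  exact ⟨π, fun i => LinearMap.ext fun x => h1 i x,
    fun i j hij => LinearMap.ext fun x => h2 i j hij x, h3⟩

theorem id_mem_TrF_of_isInternal {n : ℕ} {D : Fin n → Submodule (MackeyAlgebra R E) L}
    (hD : DirectSum.IsInternal D) (h : ∀ i, LinearMap.id ∈ TrF R E Z (D i) (D i)) :
    LinearMap.id ∈ TrF R E Z L L := by
  obtain ⟨π, -, -, hπ⟩ := exists_retraction_of_isInternal hD
  rw [← hπ]
  refine sum_mem fun i _ => ?_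
  rw [← LinearMap.id_comp (π i)]
  exact TrF.comp_left (TrF.comp_right (h i) _) _

variable [IsDomain R] [IsPrincipalIdealRing R] [IsLocalRing R]
  [IsAdicComplete (IsLocalRing.maximalIdeal R) R]

/-- A decomposition is a Green decomposition as soon as exactly one summand fails to be projective
relative to the smaller subgroups. -/
theorem IsGreenFamily.hasGreenDecomposition (hZ : IsGreenFamily F E H Z) (hS : IsPGroup p S)
    (hF : F.Saturated p) (hEF : IsCentricallySaturated p F E)
    (hfin : Module.Finite (MackeyAlgebra R E) L) (hL : IsCentric R F E L)
    (hp : LinearMap.id ∈ TrF R E (insert H Z) L L) (hnp : LinearMap.id ∉ TrF R E Z L L)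
    (huniq : ∀ (n : ℕ) (D : Fin n → Submodule (MackeyAlgebra R E) L), IsDecomposition D →
      ∀ i j, i ≠ j → LinearMap.id ∉ TrF R E Z (D i) (D i) →
        LinearMap.id ∈ TrF R E Z (D j) (D j)) :
    HasGreenDecomposition R E H Z L := by
  refine ⟨hfin, hasKrullSchmidtDecomposition_mackey R E L, fun n D hD => ?_⟩
  obtain ⟨π, hπ, -, -⟩ := exists_retraction_of_isInternal hD.1
  have hloc : ∀ i, IsLocalModule (MackeyAlgebra R E) (D i) := fun i => by
    have := finite_submodule_mackey R E L (D i)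
    exact isLocalModule_mackey R E _ (hD.2 i)
  have hc : ∀ i, IsCentric R F E (D i) := fun i => hL.of_injective (D i).injective_subtype
  have hv : ∀ i, IsVertex R E (D i) H ↔ LinearMap.id ∉ TrF R E Z (D i) (D i) := fun i => by
    rw [hZ.isVertex_iff hS hF hEF (hc i) (hloc i)]
    exact ⟨fun h => h.2, fun h => ⟨hZ.isSubgroupProjective_of_not_mem (hloc i)
      (id_mem_TrF_of_retract hp (hπ i)) h, h⟩⟩
  refine ⟨?_, fun j hj => ?_⟩
  · by_contra h
    by_cases hex : ∃ i, IsVertex R E (D i) H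
    · obtain ⟨i, hi⟩ := hex
      refine h ⟨i, hi, fun j hj => ?_⟩
      by_contra hji
      exact (hv j).1 hj (huniq n D hD i j (Ne.symm hji) ((hv i).1 hi))
    · push Not at hex
      refine hnp (id_mem_TrF_of_isInternal hD.1 fun i => ?_)
      by_contra hi
      exact hex i ((hv i).2 hi)
  · rw [hv, not_not] at hj
    exact hZ.vertex_mem hS hF hEF (hc j) (hloc j) hj

/-- A functor that is not `Z`-projective has an indecomposable summand that is not. -/
theorem exists_local_retract (hfin : Module.Finite (MackeyAlgebra R E) L)
    (h : LinearMap.id ∉ TrF R E Z L L) :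
    ∃ (U : Submodule (MackeyAlgebra R E) L) (b : L →ₗ[MackeyAlgebra R E] U),
      b ∘ₗ U.subtype = LinearMap.id ∧ IsLocalModule (MackeyAlgebra R E) U ∧
      LinearMap.id ∉ TrF R E Z U U := by
  obtain ⟨n, D, hD⟩ := (hasKrullSchmidtDecomposition_mackey R E L).1
  obtain ⟨π, hπ, -, -⟩ := exists_retraction_of_isInternal hD.1
  by_contra! hcon
  refine h (id_mem_TrF_of_isInternal hD.1 fun i => ?_)
  have := finite_submodule_mackey R E L (D i)
  exact hcon (D i) (π i) (hπ i) (isLocalModule_mackey R E _ (hD.2 i))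

end

section

variable {B : Type*} [Ring B]

/-- An indecomposable retract of a direct sum is isomorphic to one of the summands. -/
theorem exists_bijective_proj {M L : Type*} [AddCommGroup M] [Module B M] [AddCommGroup L]
    [Module B L] (hM : IsLocalModule B M) {n : ℕ} {D : Fin n → Submodule B L}
    {π : ∀ i, L →ₗ[B] D i} (hπ : ∑ i, (D i).subtype ∘ₗ π i = LinearMap.id)
    {a : M →ₗ[B] L} {b : L →ₗ[B] M} (hab : b ∘ₗ a = LinearMap.id) :
    ∃ i, Function.Bijective ((b ∘ₗ (D i).subtype) ∘ₗ (π i ∘ₗ a)) := by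
  have h : ∑ i, (b ∘ₗ (D i).subtype) ∘ₗ (π i ∘ₗ a) = LinearMap.id := by
    conv_rhs => rw [← hab, ← LinearMap.id_comp a, ← hπ]
    ext x
    simp
  obtain ⟨i, -, hi⟩ := hM.exists_bijective_of_sum Finset.univ
    (fun i => (b ∘ₗ (D i).subtype) ∘ₗ (π i ∘ₗ a)) (by rw [h]; exact Function.bijective_id)
  exact ⟨i, hi⟩

end

end GreenFamilies

end CentricMackey

namespace CentricMackey

section GreenCorrespondence

open FusionSystem

variable {S : Type u} [Group S] [Finite S] {p : ℕ} [Fact p.Prime]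
  {F : FusionSystem (⊤ : Subgroup S)} {H : Subgroup S}

theorem eq_of_conj_normalizer {K : Subgroup S} (h : (normalizerFusion F H).Conj H K) : K = H := by
  obtain ⟨Γ, hΓ, hd, rfl⟩ := conj_iff_gr.1 h
  obtain ⟨-, -, X, -, hle, -, hm⟩ := gr_normalizerSystem_iff.1 hΓ
  refine Subgroup.eq_of_le_of_card_ge (fun b hb => ?_) h.card_eq.le
  obtain ⟨a, hab⟩ := mem_im.1 hb
  exact hm b a (hle hab) (hd ▸ mem_dom_of hab)

theorem isGreenFamily_greenX (hH : F.FullyNormalized H) :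
    IsGreenFamily F F H (greenX F H) where
  fullyNormalized := hH
  not_subconj K hK h := hK.2.2 (hK.2.1.conj_of_card_le h.card_le)
  mem_of_subconj K hK V hV h := ⟨hV, h.trans hK.2.1, fun hc =>
    hK.2.2 (hK.2.1.conj_of_card_le (by rw [← hc.card_eq]; exact h.card_le))⟩
  mem_of_lt V hV h h' := ⟨hV, h, fun hc => h' hc.symm.subconj⟩

theorem not_subconj_of_mem_greenY {K : Subgroup S} (hK : K ∈ greenY F H) :
    ¬ (normalizerFusion F H).Subconj H K := fun h =>
  hK.2.2.2 (eq_of_conj_normalizer (h.conj_of_card_le hK.2.1.card_le))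

theorem Subconj.of_isSubsystem {P Q : Subgroup S} {F : FusionSystem P} {E : FusionSystem Q}
    (hEF : E.IsSubsystem F) (hQ : Q ≤ P) {A B : Subgroup S} (h : E.Subconj A B) : F.Subconj A B :=
  ⟨h.1.trans hQ, let ⟨J, hJ, hc⟩ := h.2; ⟨J, hJ, hc.of_isSubsystem hEF⟩⟩

theorem isGreenFamily_greenY : IsGreenFamily F (normalizerFusion F H) H (greenY F H) where
  fullyNormalized := ⟨le_normalizerIn, fun K hK => by rw [eq_of_conj_normalizer hK.symm]⟩
  not_subconj K hK := not_subconj_of_mem_greenY hK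
  mem_of_subconj K hK V hV h :=
    ⟨hV, (Subconj.of_isSubsystem (normalizerFusion_isSubsystem F H) le_top h).trans hK.2.1, h.le,
      fun hVH => not_subconj_of_mem_greenY hK (hVH ▸ h)⟩
  mem_of_lt V hV h h' :=
    ⟨hV, Subconj.of_isSubsystem (normalizerFusion_isSubsystem F H) le_top h, h.le,
      fun hVH => h' (hVH ▸ subconj_of_le le_normalizerIn le_rfl)⟩

variable (R : Type v) [CommRing R]

variable (F H) in
/-- The inclusion of the Mackey algebra of the normalizer of `H`. -/
noncomputable abbrev inclN :
    MackeyAlgebra R (normalizerFusion F H) →ₙ+* MackeyAlgebra R F :=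
  mackeyInclusion R normalizerIn_le (normalizerFusion_isSubsystem F H)

variable {R}

section

variable {M : Type*} [AddCommGroup M] [Module (MackeyAlgebra R F) M]

theorem res_insert_greenY (hS : IsPGroup p S) (hF : F.Saturated p) (hH : F.FullyNormalized H)
    (hM : IsCentric R F F M) (hMp : IsSubgroupProjective R F M H) :
    LinearMap.id ∈ TrF R (normalizerFusion F H) (insert H (greenY F H))
      (Res (inclN F H R) M) (Res (inclN F H R) M) := by
  have h := res_mem_TrF hS hF (isCentricallySaturated_self hS hF)
    (isCentricallySaturated_normalizer hS hF hH) normalizerIn_le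
    (normalizerFusion_isSubsystem F H) hM (hMp.mem_TrF (Set.mem_singleton H))
  rw [Res.map_id] at h
  refine TrF_le (fun K hK hKQ => ?_) h
  obtain ⟨hKc, L, hL, hKH⟩ := hK
  rw [Set.mem_singleton_iff.1 hL] at hKH
  refine tr_le_TrF ?_ hKQ
  by_cases hK : K = H
  · exact Or.inl hK
  · exact Or.inr ⟨hKc, hKH, hKQ, hK⟩

theorem res_greenY_of_greenX (hS : IsPGroup p S) (hF : F.Saturated p) (hH : F.FullyNormalized H)
    (hM : IsCentric R F F M) (hMp : LinearMap.id ∈ TrF R F (greenX F H) M M) :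
    LinearMap.id ∈ TrF R (normalizerFusion F H) (greenY F H)
      (Res (inclN F H R) M) (Res (inclN F H R) M) := by
  have h := res_mem_TrF hS hF (isCentricallySaturated_self hS hF)
    (isCentricallySaturated_normalizer hS hF hH) normalizerIn_le
    (normalizerFusion_isSubsystem F H) hM hMp
  rw [Res.map_id] at h
  refine TrF_le (fun K hK hKQ => ?_) h
  obtain ⟨hKc, L, hL, hKL⟩ := hK
  have hKY : K ≠ H → K ∈ greenY F H := fun hne => ⟨hKc, hKL.trans hL.2.1, hKQ, hne⟩
  refine tr_le_TrF (hKY ?_) hKQ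
  rintro rfl
  exact (isGreenFamily_greenX hH).not_subconj L hL hKL

theorem greenX_of_res_greenY (hS : IsPGroup p S) (hF : F.Saturated p) (hH : F.FullyNormalized H)
    (hM : IsCentric R F F M) (hMp : IsSubgroupProjective R F M H)
    (h : LinearMap.id ∈ TrF R (normalizerFusion F H) (greenY F H)
      (Res (inclN F H R) M) (Res (inclN F H R) M)) :
    LinearMap.id ∈ TrF R F (greenX F H) M M := by
  obtain ⟨g, hg⟩ := exists_comp_of_mem_Tr (M := M) (M' := M) (ι := inclN F H R)
    (κ := innerInclusion R (normalizerFusion F H) le_normalizerIn)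
    (fun a => (mackeyInclusion_comp R _ _ _ _ a).symm) hMp.2
  have h1 := res_mem_TrF hS hF (isCentricallySaturated_normalizer hS hF hH)
    (isCentricallySaturated_inner hS hF H) le_normalizerIn
    (inner_isSubsystem (normalizerFusion F H) le_normalizerIn)
    (isCentric_res R normalizerIn_le (normalizerFusion_isSubsystem F H) hM) h
  have h2 := ind_mem_TrF normalizerIn_le (normalizerFusion_isSubsystem F H)
    (ind_mem_TrF le_normalizerIn (inner_isSubsystem (normalizerFusion F H) le_normalizerIn) h1)
  rw [Res.map_id, Ind.map_id, Ind.map_id] at h2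
  rw [hg, ← LinearMap.comp_assoc]
  rw [← LinearMap.comp_id (_ ∘ₗ _), LinearMap.comp_assoc]
  refine TrF.comp_left (TrF.comp_right (TrF_mono ?_ h2) g) _
  rintro D ⟨⟨⟨hDc, K, hK, hDK⟩, hDH⟩, -⟩
  refine ⟨hDc, subconj_of_le le_top hDH, fun hc => ?_⟩
  have h3 : D = H := Subgroup.eq_of_le_of_card_ge hDH hc.card_eq.ge
  exact not_subconj_of_mem_greenY hK (h3 ▸ hDK)

end

section

variable {N : Type*} [AddCommGroup N] [Module (MackeyAlgebra R (normalizerFusion F H)) N]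

theorem isSubgroupProjective_ind (h : IsSubgroupProjective R (normalizerFusion F H) N H) :
    IsSubgroupProjective R F (Ind (inclN F H R) N) H := by
  refine ⟨le_top, ?_⟩
  have := ind_mem_Tr (ι := inclN F H R) (l := innerInclusion R F le_top)
    (fun a => (mackeyInclusion_comp R _ _ _ _ a).symm) h.2
  rwa [Ind.map_id] at this

/-- For indecomposable `N` over `N_F(H)` with vertex `H`, every indecomposable retract of `N↑↓` that
is not `𝒴`-projective is isomorphic to `N`, and there are no two independent ones. -/
theorem exists_equiv_of_retract (hS : IsPGroup p S) (hF : F.Saturated p)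
    (hH : F.FullyNormalized H) (hHc : F.Centric H)
    (hN : IsCentric R F (normalizerFusion F H) N)
    (hl : IsLocalModule (MackeyAlgebra R (normalizerFusion F H)) N)
    (hNp : IsSubgroupProjective R (normalizerFusion F H) N H)
    {U : Type*} [AddCommGroup U] [Module (MackeyAlgebra R (normalizerFusion F H)) U]
    (hU : IsLocalModule (MackeyAlgebra R (normalizerFusion F H)) U)
    (hUY : LinearMap.id ∉ TrF R (normalizerFusion F H) (greenY F H) U U)
    {a : U →ₗ[MackeyAlgebra R (normalizerFusion F H)] Res (inclN F H R) (Ind (inclN F H R) N)}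
    {b : Res (inclN F H R) (Ind (inclN F H R) N) →ₗ[MackeyAlgebra R (normalizerFusion F H)] U}
    (hab : b ∘ₗ a = LinearMap.id) :
    Nonempty (U ≃ₗ[MackeyAlgebra R (normalizerFusion F H)] N) ∧
    ∀ (V : Type w) [AddCommGroup V] [Module (MackeyAlgebra R (normalizerFusion F H)) V]
      (c : V →ₗ[MackeyAlgebra R (normalizerFusion F H)] Res (inclN F H R) (Ind (inclN F H R) N))
      (d : Res (inclN F H R) (Ind (inclN F H R) N) →ₗ[MackeyAlgebra R (normalizerFusion F H)] V),
      d ∘ₗ c = LinearMap.id → d ∘ₗ a = 0 →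
      LinearMap.id ∈ TrF R (normalizerFusion F H) (greenY F H) V V := by
  obtain ⟨r, -, hr⟩ := exists_splitting_unit hS hF hH hHc hN hNp.2
  set η := etaMap (N := N) (inclN F H R) with hη
  have h1 : b ∘ₗ (LinearMap.id - η ∘ₗ r) ∘ₗ a ∈
      TrF R (normalizerFusion F H) (greenY F H) U U := TrF.comp_left (TrF.comp_right hr a) b
  have h2 : (b ∘ₗ η) ∘ₗ (r ∘ₗ a) + b ∘ₗ (LinearMap.id - η ∘ₗ r) ∘ₗ a = LinearMap.id := by
    rw [← hab]
    ext x
    simp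
  have h3 : Function.Bijective ((b ∘ₗ η) ∘ₗ (r ∘ₗ a)) := by
    refine (hU.bijective_of_add (f := (b ∘ₗ η) ∘ₗ (r ∘ₗ a))
      (g := b ∘ₗ (LinearMap.id - η ∘ₗ r) ∘ₗ a)
      (by rw [h2]; exact Function.bijective_id)).resolve_right fun h => ?_
    obtain ⟨K, hK, hKp⟩ := exists_bijective_of_mem_TrF hU h1 h
    exact hUY (hKp.mem_TrF hK)
  have h4 := (IsLocalModule.bijective_of_comp_bijective hU.1 hl h3).1
  let e := LinearEquiv.ofBijective _ h4
  refine ⟨⟨e⟩, fun V _ _ c d hcd hda => ?_⟩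
  have h5 : d ∘ₗ (LinearMap.id - η ∘ₗ r) ∘ₗ a ∈
      TrF R (normalizerFusion F H) (greenY F H) U V := TrF.comp_left (TrF.comp_right hr a) d
  have h6 : d ∘ₗ η = -((d ∘ₗ (LinearMap.id - η ∘ₗ r) ∘ₗ a) ∘ₗ
      e.symm.toLinearMap) := by
    ext x
    obtain ⟨y, rfl⟩ := e.surjective x
    have h7 : d (a y) = 0 := LinearMap.congr_fun hda y
    change d (η (e y)) = -(d (a (e.symm (e y)) - η (r (a (e.symm (e y))))))
    rw [e.symm_apply_apply, map_sub, h7, zero_sub, neg_neg]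
    rfl
  have h7 : d ∘ₗ η ∈ TrF R (normalizerFusion F H) (greenY F H) N V := by
    rw [h6]
    exact neg_mem (TrF.comp_right h5 _)
  have h8 : LinearMap.id = (d ∘ₗ η) ∘ₗ (r ∘ₗ c) + d ∘ₗ (LinearMap.id - η ∘ₗ r) ∘ₗ c := by
    rw [← hcd]
    ext x
    simp
  rw [h8]
  exact add_mem (TrF.comp_right h7 _) (TrF.comp_left (TrF.comp_right hr c) d)

end

end GreenCorrespondence

end CentricMackey

namespace CentricMackey

section Green

open FusionSystem

variable {S : Type u} [Group S] [Finite S] {p : ℕ} [Fact p.Prime]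
  {F : FusionSystem (⊤ : Subgroup S)} {H : Subgroup S} {R : Type v} [CommRing R]

variable (R) in
theorem finite_res_mackey {Q Q₁ : Subgroup S} {E : FusionSystem Q} {E₁ : FusionSystem Q₁}
    (hQ : Q₁ ≤ Q) (hE : E₁.IsSubsystem E) (M : Type*) [AddCommGroup M]
    [Module (MackeyAlgebra R E) M] [Module.Finite (MackeyAlgebra R E) M] :
    Module.Finite (MackeyAlgebra R E₁) (Res (mackeyInclusion R hQ hE) M) :=
  finite_res (R := R) _ (fun r a => mackeyInclusion_smul R hQ hE r a) M

theorem Ind.map_sum {A B : Type*} [Ring A] [Ring B] (ι : A →ₙ+* B) {N N' : Type*}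
    [AddCommGroup N] [Module A N] [AddCommGroup N'] [Module A N'] {κ : Type*} (s : Finset κ)
    (f : κ → N →ₗ[A] N') : Ind.map ι (∑ i ∈ s, f i) = ∑ i ∈ s, Ind.map ι (f i) := by
  classical
  refine Ind.hom_ext fun x => ?_
  rw [Ind.map_ind, LinearMap.sum_apply, LinearMap.sum_apply]
  simp only [Ind.map_ind]
  exact _root_.map_sum (indHom ι 1) _ _

variable [IsDomain R] [IsPrincipalIdealRing R] [IsLocalRing R]
  [IsAdicComplete (IsLocalRing.maximalIdeal R) R]

theorem exists_retract_ind
    {M : Type w} [AddCommGroup M] [Module (MackeyAlgebra R F) M]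
    [Module.Finite (MackeyAlgebra R F) M] (hM : IsCentric R F F M)
    (hl : IsLocalModule (MackeyAlgebra R F) M) (hMp : IsSubgroupProjective R F M H) :
    ∃ (N : Type (max v (u + 1) w)) (_ : AddCommGroup N)
      (_ : Module (MackeyAlgebra R (normalizerFusion F H)) N)
      (a : M →ₗ[MackeyAlgebra R F] Ind (inclN F H R) N)
      (b : Ind (inclN F H R) N →ₗ[MackeyAlgebra R F] M),
      b ∘ₗ a = LinearMap.id ∧ IsCentric R F (normalizerFusion F H) N ∧
      IsLocalModule (MackeyAlgebra R (normalizerFusion F H)) N ∧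
      IsSubgroupProjective R (normalizerFusion F H) N H := by
  set κ := innerInclusion R (normalizerFusion F H) le_normalizerIn with hκ
  have hMp' := hMp.2
  obtain ⟨g, hg⟩ := exists_comp_of_mem_Tr (M := M) (M' := M) (ι := inclN F H R) (κ := κ)
    (fun a => (mackeyInclusion_comp R _ _ _ _ a).symm) hMp'
  have hf1 := finite_res_mackey R normalizerIn_le (normalizerFusion_isSubsystem F H) M
  have hf2 : Module.Finite (MackeyAlgebra R (inner H)) (Res κ (Res (inclN F H R) M)) :=
    finite_res_mackey R le_normalizerIn
    (inner_isSubsystem (normalizerFusion F H) le_normalizerIn) (Res (inclN F H R) M)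
  have hf3 := finite_ind κ (Res κ (Res (inclN F H R) M))
  have hc1 := isCentric_res R normalizerIn_le (normalizerFusion_isSubsystem F H) hM
  have hc2 := isCentric_res R le_normalizerIn
    (inner_isSubsystem (normalizerFusion F H) le_normalizerIn) hc1
  have hc3 := isCentric_ind R le_normalizerIn
    (inner_isSubsystem (normalizerFusion F H) le_normalizerIn) le_top
    (normalizerFusion_isSubsystem F H) hc2
  have hp : IsSubgroupProjective R (normalizerFusion F H) (Ind κ (Res κ (Res (inclN F H R) M))) H :=
    ⟨le_normalizerIn, comp_mem_Tr LinearMap.id LinearMap.id⟩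
  obtain ⟨n, D, hD⟩ := (hasKrullSchmidtDecomposition_mackey R (normalizerFusion F H)
    (Ind κ (Res κ (Res (inclN F H R) M)))).1
  obtain ⟨π, hπ, -, hπs⟩ := exists_retraction_of_isInternal hD.1
  set t := theta (inclN F H R) M ∘ₗ Ind.map (inclN F H R) (theta κ (Res (inclN F H R) M)) with ht
  have h1 : ∑ i, ((t ∘ₗ Ind.map (inclN F H R) (D i).subtype) ∘ₗ
      (Ind.map (inclN F H R) (π i) ∘ₗ g)) = LinearMap.id := by
    have h2 := Ind.map_sum (inclN F H R) Finset.univ fun i => (D i).subtype ∘ₗ π i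
    rw [hπs, Ind.map_id] at h2
    conv_rhs => rw [hg, ← LinearMap.comp_assoc, ← ht, ← LinearMap.id_comp g, h2]
    ext x
    simp [Ind.map_comp]
  obtain ⟨i, -, hi⟩ := hl.exists_bijective_of_sum Finset.univ
    (fun i => (t ∘ₗ Ind.map (inclN F H R) (D i).subtype) ∘ₗ
      (Ind.map (inclN F H R) (π i) ∘ₗ g)) (by rw [h1]; exact Function.bijective_id)
  let e := LinearEquiv.ofBijective _ hi
  have := finite_submodule_mackey R (normalizerFusion F H) _ (D i)
  refine ⟨D i, inferInstance, inferInstance, Ind.map (inclN F H R) (π i) ∘ₗ g,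
    e.symm.toLinearMap ∘ₗ t ∘ₗ Ind.map (inclN F H R) (D i).subtype, ?_,
    hc3.of_injective (D i).injective_subtype, isLocalModule_mackey R _ _ (hD.2 i),
    hp.of_retract (hπ i)⟩
  ext x
  exact e.symm_apply_apply x

/-- The Green decomposition of the restriction of a functor over `F` with vertex `H`. -/
theorem hasGreenDecomposition_res (hS : IsPGroup p S) (hF : F.Saturated p)
    (hH : F.FullyNormalized H) (hHc : F.Centric H)
    {M : Type w} [AddCommGroup M] [Module (MackeyAlgebra R F) M]
    [Module.Finite (MackeyAlgebra R F) M] (hM : IsCentric R F F M)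
    (hl : IsLocalModule (MackeyAlgebra R F) M) (hMv : IsVertex R F M H) :
    HasGreenDecomposition R (normalizerFusion F H) H (greenY F H) (Res (inclN F H R) M) ∧
    ∀ C : Submodule (MackeyAlgebra R (normalizerFusion F H)) (Res (inclN F H R) M),
      IsGreenCorrespondent R (normalizerFusion F H) H C →
      ∃ (a : M →ₗ[MackeyAlgebra R F] Ind (inclN F H R) C)
        (b : Ind (inclN F H R) C →ₗ[MackeyAlgebra R F] M), b ∘ₗ a = LinearMap.id := by
  have hself := isCentricallySaturated_self hS hF
  have hnor := isCentricallySaturated_normalizer hS hF hH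
  obtain ⟨hMp, hMX⟩ := ((isGreenFamily_greenX hH).isVertex_iff hS hF hself hM hl).1 hMv
  obtain ⟨N, _, _, a, b, hab, hNc, hNl, hNp⟩ := exists_retract_ind hM hl hMp
  have hfin := finite_res_mackey R normalizerIn_le (normalizerFusion_isSubsystem F H) M
  have hc := isCentric_res R normalizerIn_le (normalizerFusion_isSubsystem F H) hM
  have hab' : Res.map (inclN F H R) b ∘ₗ Res.map (inclN F H R) a = LinearMap.id := by
    rw [← Res.map_comp, hab, Res.map_id]
  have key : ∀ {U : Submodule (MackeyAlgebra R (normalizerFusion F H)) (Res (inclN F H R) M)}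
      {q : Res (inclN F H R) M →ₗ[MackeyAlgebra R (normalizerFusion F H)] U},
      q ∘ₗ U.subtype = LinearMap.id →
      (q ∘ₗ Res.map (inclN F H R) b) ∘ₗ (Res.map (inclN F H R) a ∘ₗ U.subtype) = LinearMap.id := by
    intro U q hq
    rw [LinearMap.comp_assoc, ← LinearMap.comp_assoc U.subtype, hab', LinearMap.id_comp, hq]
  refine ⟨isGreenFamily_greenY.hasGreenDecomposition hS hF hnor hfin hc
    (res_insert_greenY hS hF hH hM hMp)
    (fun h => hMX (greenX_of_res_greenY hS hF hH hM hMp h)) fun n D hD i j hij hi => ?_,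
    fun C hC => ?_⟩
  · obtain ⟨π, hπ1, hπ2, -⟩ := exists_retraction_of_isInternal hD.1
    have := finite_submodule_mackey R (normalizerFusion F H) _ (D i)
    refine (exists_equiv_of_retract hS hF hH hHc hNc hNl hNp
      (isLocalModule_mackey R _ _ (hD.2 i)) hi (key (hπ1 i))).2 (D j)
      (Res.map (inclN F H R) a ∘ₗ (D j).subtype) (π j ∘ₗ Res.map (inclN F H R) b)
      (key (hπ1 j)) ?_
    rw [LinearMap.comp_assoc, ← LinearMap.comp_assoc (D i).subtype, hab', LinearMap.id_comp,
      hπ2 j i hij.symm]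
  · obtain ⟨hCv, n, D, i, hD, rfl⟩ := hC
    obtain ⟨π, hπ1, -, -⟩ := exists_retraction_of_isInternal hD.1
    have := finite_submodule_mackey R (normalizerFusion F H) _ (D i)
    have hDl := isLocalModule_mackey R _ _ (hD.2 i)
    have hDY := ((isGreenFamily_greenY.isVertex_iff hS hF hnor
      (hc.of_injective (D i).injective_subtype) hDl).1 hCv).2
    obtain ⟨⟨e⟩, -⟩ := exists_equiv_of_retract.{u, v, 0} hS hF hH hHc hNc hNl hNp hDl hDY
      (key (hπ1 i))
    refine ⟨Ind.map (inclN F H R) e.symm.toLinearMap ∘ₗ a,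
      b ∘ₗ Ind.map (inclN F H R) e.toLinearMap, ?_⟩
    rw [LinearMap.comp_assoc, ← LinearMap.comp_assoc a, ← Ind.map_comp,
      LinearEquiv.comp_symm, Ind.map_id, LinearMap.id_comp, hab]

/-- The Green decomposition of the induction of a functor over `N_F(H)` with vertex `H`. -/
theorem hasGreenDecomposition_ind (hS : IsPGroup p S) (hF : F.Saturated p)
    (hH : F.FullyNormalized H) (hHc : F.Centric H)
    {N : Type w} [AddCommGroup N] [Module (MackeyAlgebra R (normalizerFusion F H)) N]
    [Module.Finite (MackeyAlgebra R (normalizerFusion F H)) N]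
    (hN : IsCentric R F (normalizerFusion F H) N)
    (hl : IsLocalModule (MackeyAlgebra R (normalizerFusion F H)) N)
    (hNv : IsVertex R (normalizerFusion F H) N H) :
    HasGreenDecomposition R F H (greenX F H) (Ind (inclN F H R) N) := by
  have hself := isCentricallySaturated_self hS hF
  have hnor := isCentricallySaturated_normalizer hS hF hH
  obtain ⟨hNp, hNY⟩ := (isGreenFamily_greenY.isVertex_iff hS hF hnor hN hl).1 hNv
  have hfin := finite_ind (inclN F H R) N
  have hc := isCentric_ind R normalizerIn_le (normalizerFusion_isSubsystem F H) le_rfl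
    (fun _ _ => subset_rfl) hN
  have hp := isSubgroupProjective_ind hNp
  obtain ⟨r, hr, -⟩ := exists_splitting_unit hS hF hH hHc hN hNp.2
  refine (isGreenFamily_greenX hH).hasGreenDecomposition hS hF hself hfin hc
    (hp.mem_TrF (Set.mem_insert _ _))
    (fun h => hNY (id_mem_TrF_of_retract (res_greenY_of_greenX hS hF hH hc h) hr))
    fun n D hD i j hij hi => ?_
  obtain ⟨π, hπ1, hπ2, -⟩ := exists_retraction_of_isInternal hD.1
  have hloc : ∀ k, LinearMap.id ∉ TrF R F (greenX F H) (D k) (D k) →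
      ∃ (U : Submodule (MackeyAlgebra R (normalizerFusion F H)) (Res (inclN F H R) (D k)))
        (b : Res (inclN F H R) (D k) →ₗ[MackeyAlgebra R (normalizerFusion F H)] U),
      b ∘ₗ U.subtype = LinearMap.id ∧ IsLocalModule (MackeyAlgebra R (normalizerFusion F H)) U ∧
      LinearMap.id ∉ TrF R (normalizerFusion F H) (greenY F H) U U := by
    intro k hk
    have := finite_submodule_mackey R F _ (D k)
    refine exists_local_retract
      (finite_res_mackey R normalizerIn_le (normalizerFusion_isSubsystem F H) (D k)) fun h => hk ?_
    exact greenX_of_res_greenY hS hF hH (hc.of_injective (D k).injective_subtype)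
      (hp.of_retract (hπ1 k)) h
  by_contra hj
  obtain ⟨U, b, hb, hUl, hUY⟩ := hloc i hi
  obtain ⟨V, d, hd, -, hVY⟩ := hloc j hj
  have key : ∀ {k} {U : Submodule (MackeyAlgebra R (normalizerFusion F H))
      (Res (inclN F H R) (D k))}
      {q : Res (inclN F H R) (D k) →ₗ[MackeyAlgebra R (normalizerFusion F H)] U},
      q ∘ₗ U.subtype = LinearMap.id → (q ∘ₗ Res.map (inclN F H R) (π k)) ∘ₗ
        (Res.map (inclN F H R) (D k).subtype ∘ₗ U.subtype) = LinearMap.id := by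
    intro k U q hq
    rw [LinearMap.comp_assoc, ← LinearMap.comp_assoc U.subtype, ← Res.map_comp, hπ1 k, Res.map_id,
      LinearMap.id_comp, hq]
  refine hVY ((exists_equiv_of_retract hS hF hH hHc hN hl hNp hUl hUY (key hb)).2 V _ _
    (key hd) ?_)
  rw [LinearMap.comp_assoc, ← LinearMap.comp_assoc U.subtype, ← Res.map_comp, hπ2 j i hij.symm,
    Res.map_zero_apply, LinearMap.zero_comp, LinearMap.comp_zero]

/-- A functor with vertex `H` that is a retract of `L` is isomorphic to the summand of `L` with
vertex `H`. -/
theorem equiv_of_isGreenCorrespondent (hS : IsPGroup p S) (hF : F.Saturated p)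
    {Q : Subgroup S} {E : FusionSystem Q} {Z : Set (Subgroup S)} (hZ : IsGreenFamily F E H Z)
    (hEF : IsCentricallySaturated p F E)
    {M : Type w} [AddCommGroup M] [Module (MackeyAlgebra R E) M]
    (hM : IsCentric R F E M) (hl : IsLocalModule (MackeyAlgebra R E) M)
    (hMv : IsVertex R E M H) {L : Type x} [AddCommGroup L] [Module (MackeyAlgebra R E) L]
    (hL : IsCentric R F E L) (hdec : HasGreenDecomposition R E H Z L)
    {a : M →ₗ[MackeyAlgebra R E] L} {b : L →ₗ[MackeyAlgebra R E] M} (hab : b ∘ₗ a = LinearMap.id)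
    {C : Submodule (MackeyAlgebra R E) L} (hC : IsGreenCorrespondent R E H C) :
    Nonempty (C ≃ₗ[MackeyAlgebra R E] M) := by
  obtain ⟨hfin, -, hdec⟩ := hdec
  obtain ⟨hCv, n, D, i, hD, rfl⟩ := hC
  obtain ⟨π, -, -, hπ⟩ := exists_retraction_of_isInternal hD.1
  obtain ⟨j, hj⟩ := exists_bijective_proj hl hπ hab
  have := finite_submodule_mackey R E L (D j)
  have hDl := isLocalModule_mackey R _ _ (hD.2 j)
  let e := LinearEquiv.ofBijective _ (IsLocalModule.bijective_of_comp_bijective hl.1 hDl hj).1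
  obtain ⟨hMp, hMZ⟩ := (hZ.isVertex_iff hS hF hEF hM hl).1 hMv
  have hDv : IsVertex R E (D j) H :=
    (hZ.isVertex_iff hS hF hEF (hL.of_injective (D j).injective_subtype) hDl).2
      ⟨hMp.of_retract (LinearEquiv.comp_symm e),
        fun h => hMZ (id_mem_TrF_of_retract h (LinearEquiv.symm_comp e))⟩
  obtain rfl := (hdec n D hD).1.unique hDv hCv
  exact ⟨e.symm⟩

theorem equiv_of_isGreenCorrespondent_res (hS : IsPGroup p S) (hF : F.Saturated p)
    (hH : F.FullyNormalized H) (hHc : F.Centric H)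
    {N : Type w} [AddCommGroup N] [Module (MackeyAlgebra R (normalizerFusion F H)) N]
    [Module.Finite (MackeyAlgebra R (normalizerFusion F H)) N]
    (hN : IsCentric R F (normalizerFusion F H) N)
    (hl : IsLocalModule (MackeyAlgebra R (normalizerFusion F H)) N)
    (hNv : IsVertex R (normalizerFusion F H) N H)
    {C : Submodule (MackeyAlgebra R F) (Ind (inclN F H R) N)}
    (hC : IsGreenCorrespondent R F H C)
    {C' : Submodule (MackeyAlgebra R (normalizerFusion F H)) (Res (inclN F H R) C)}
    (hC' : IsGreenCorrespondent R (normalizerFusion F H) H C') :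
    Nonempty (C' ≃ₗ[MackeyAlgebra R (normalizerFusion F H)] N) := by
  have hnor := isCentricallySaturated_normalizer hS hF hH
  have hNp := ((isGreenFamily_greenY.isVertex_iff hS hF hnor hN hl).1 hNv).1
  have hfin := finite_ind (inclN F H R) N
  have hc := isCentric_ind R normalizerIn_le (normalizerFusion_isSubsystem F H) le_rfl
    (fun _ _ => subset_rfl) hN
  obtain ⟨-, n, D, i, hD, rfl⟩ := hC
  obtain ⟨hCv, m, D', j, hD', rfl⟩ := hC'
  obtain ⟨π, hπ, -, -⟩ := exists_retraction_of_isInternal hD.1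
  obtain ⟨ρ, hρ, -, -⟩ := exists_retraction_of_isInternal hD'.1
  have := finite_submodule_mackey R F _ (D i)
  have := finite_res_mackey R normalizerIn_le (normalizerFusion_isSubsystem F H) (D i)
  have := finite_submodule_mackey R (normalizerFusion F H) _ (D' j)
  have hDc := isCentric_res R normalizerIn_le (normalizerFusion_isSubsystem F H)
    (hc.of_injective (D i).injective_subtype)
  have hDl := isLocalModule_mackey R _ _ (hD'.2 j)
  have hDY := ((isGreenFamily_greenY.isVertex_iff hS hF hnor
    (hDc.of_injective (D' j).injective_subtype) hDl).1 hCv).2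
  refine (exists_equiv_of_retract.{u, v, 0} hS hF hH hHc hN hl hNp hDl hDY
    (a := Res.map (inclN F H R) (D i).subtype ∘ₗ (D' j).subtype)
    (b := ρ j ∘ₗ Res.map (inclN F H R) (π i)) ?_).1
  rw [LinearMap.comp_assoc, ← LinearMap.comp_assoc (D' j).subtype, ← Res.map_comp, hπ i,
    Res.map_id, LinearMap.id_comp, hρ j]

end Green

end CentricMackey

theorem mainTheorem1 {p : ℕ} [Fact p.Prime] {S : Type u} [Group S] [Finite S] (hS : IsPGroup p S)
    (F : FusionSystem (⊤ : Subgroup S)) (hF : F.Saturated p)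
    (R : Type v) [CommRing R] [IsDomain R] [IsPrincipalIdealRing R] [IsLocalRing R]
    [IsAdicComplete (IsLocalRing.maximalIdeal R) R]
    (hR : ∀ q : ℕ, q.Prime → q ≠ p → IsUnit (q : R))
    (H : Subgroup S) (hH : F.FullyNormalized H) (hHc : F.Centric H) :
    (∀ (M : Type w) [AddCommGroup M] [Module (MackeyAlgebra R F) M],
      Module.Finite (MackeyAlgebra R F) M → IsCentric R F F M →
      IsIndecomposable (MackeyAlgebra R F) M → IsVertex R F M H →
      -- the restriction of `M` is an `F`-centric functor with the asserted decomposition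
      IsCentric R F (normalizerFusion F H) (ResNormalizer R F H M) ∧
      HasGreenDecomposition R (normalizerFusion F H) H (greenY F H) (ResNormalizer R F H M) ∧
      -- for the Green correspondent `C` of `M`, the Green correspondent `C'` of `C` is `M`
      ∀ C : Submodule (MackeyAlgebra R (normalizerFusion F H)) (ResNormalizer R F H M),
        IsGreenCorrespondent R (normalizerFusion F H) H C →
        HasGreenDecomposition R F H (greenX F H) (IndNormalizer R F H C) ∧
        ∀ C' : Submodule (MackeyAlgebra R F) (IndNormalizer R F H C),
          IsGreenCorrespondent R F H C' →
          Nonempty (C' ≃ₗ[MackeyAlgebra R F] M)) ∧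
    (∀ (N : Type x) [AddCommGroup N] [Module (MackeyAlgebra R (normalizerFusion F H)) N],
      Module.Finite (MackeyAlgebra R (normalizerFusion F H)) N →
      IsCentric R F (normalizerFusion F H) N →
      IsIndecomposable (MackeyAlgebra R (normalizerFusion F H)) N →
      IsVertex R (normalizerFusion F H) N H →
      -- the induction of `N` is an `F`-centric functor with the asserted decomposition
      IsCentric R F F (IndNormalizer R F H N) ∧
      HasGreenDecomposition R F H (greenX F H) (IndNormalizer R F H N) ∧
      -- for the Green correspondent `C` of `N`, the Green correspondent `C'` of `C` is `N`
      ∀ C : Submodule (MackeyAlgebra R F) (IndNormalizer R F H N), IsGreenCorrespondent R F H C →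
        HasGreenDecomposition R (normalizerFusion F H) H (greenY F H) (ResNormalizer R F H C) ∧
        ∀ C' : Submodule (MackeyAlgebra R (normalizerFusion F H)) (ResNormalizer R F H C),
          IsGreenCorrespondent R (normalizerFusion F H) H C' →
          Nonempty (C' ≃ₗ[MackeyAlgebra R (normalizerFusion F H)] N)) := by
  have hself := isCentricallySaturated_self hS hF
  refine ⟨fun M _ _ hfin hM hi hv => ?_, fun N _ _ hfin hN hi hv => ?_⟩
  · have hl := isLocalModule_mackey R F M hi
    obtain ⟨h1, h2⟩ := hasGreenDecomposition_res hS hF hH hHc hM hl hv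
    have hc := isCentric_res R normalizerIn_le (normalizerFusion_isSubsystem F H) hM
    refine ⟨hc, h1, fun C hC => ?_⟩
    obtain ⟨a, b, hab⟩ := h2 C hC
    obtain ⟨hCv, n, D, i, hD, rfl⟩ := hC
    have hfin : Module.Finite (MackeyAlgebra R (normalizerFusion F H)) (ResNormalizer R F H M) :=
      h1.1
    have hDfin := finite_submodule_mackey R (normalizerFusion F H) _ (D i)
    have hDc := hc.of_injective (D i).injective_subtype
    have h3 := hasGreenDecomposition_ind hS hF hH hHc hDc
      (isLocalModule_mackey R _ _ (hD.2 i)) hCv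
    exact ⟨h3, fun C' hC' => equiv_of_isGreenCorrespondent hS hF (isGreenFamily_greenX hH) hself
      hM hl hv (isCentric_ind R normalizerIn_le (normalizerFusion_isSubsystem F H) le_rfl
        (fun _ _ => subset_rfl) hDc) h3 hab hC'⟩
  · have hl := isLocalModule_mackey R (normalizerFusion F H) N hi
    have h1 := hasGreenDecomposition_ind hS hF hH hHc hN hl hv
    have hc := isCentric_ind R normalizerIn_le (normalizerFusion_isSubsystem F H) le_rfl
      (fun _ _ => subset_rfl) hN
    refine ⟨hc, h1, fun C hC => ⟨?_, fun C' hC' =>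
      equiv_of_isGreenCorrespondent_res hS hF hH hHc hN hl hv hC hC'⟩⟩
    obtain ⟨hCv, n, D, i, hD, rfl⟩ := hC
    have hfin : Module.Finite (MackeyAlgebra R F) (IndNormalizer R F H N) := h1.1
    have hDfin := finite_submodule_mackey R F _ (D i)
    exact (hasGreenDecomposition_res hS hF hH hHc (hc.of_injective (D i).injective_subtype)
      (isLocalModule_mackey R _ _ (hD.2 i)) hCv).1
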